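/- **Theorem 1.4 (Commutator Estimates, with their localized versions).** Let $n\ge 1$, $s\in(0,1)$ and $p_s:=\frac ns$. For $A\subset\mathbb R^n$ put $$[f]_{A}:=\Big(\int_A\int_A\frac{|f(x)-f(y)|^{p_s}}{|x-y|^{n+sp_s}}\,dx\,dy\Big)^{1/p_s}\in[0,\infty].$$ For $0<t<1$ let $(-\Delta)^{t/2}u(x)=c_t\int_{\mathbb R^n}\frac{u(y)-u(x)}{|x-y|^{n+t}}\,dy$ and $I_tu(x)=\tilde c_t\int_{\mathbb R^n}|x-z|^{t-n}u(z)\,dz$ with $c_t=\frac{2^t\,\Gamma((n+t)/2)}{\pi^{n/2}\,\Gamma(-t/2)}$, $\tilde c_t=\frac{\Gamma((n-t)/2)}{2^t\pi^{n/2}\,\Gamma(t/2)}$ (the constants for which these are the Fourier multipliers $|\xi|^{t}$ and $|\xi|^{-t}$). In what follows $B_r$ is the ball of radius $r$ around a fixed centre $x_0\in\mathbb R^n$. There is $t_0\in(0,s)$, depending only on $n,s$, such that for every $t\in(t_0,s)$ and every $N$ there are constants $C<\infty$ and $\sigma>0$, depending only on $n,s,t,N$, with the following properties. **(1)** Let $f,g:\mathbb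 R^n\to\mathbb R^N$ be measurable and, for $A\subset\mathbb R^n$, $$T_1^A(z):=\int_A\int_A\frac{|f(x)-f(y)|^{p_s-1}\,|g(x)+g(y)-2g(z)|\,\big||x-z|^{t-n}-|y-z|^{t-n}\big|}{|x-y|^{n+sp_s}}\,dx\,dy .$$ Then $$\|T_1^{\mathbb R^n}\|_{L^{\frac n{n-t}}(\mathbb R^n)}\le C\,[f]_{\mathbb R^n}^{p_s-1}\,[g]_{\mathbb R^n},$$ and for all $x_0\in\mathbb R^n$, $\rho>0$ and all integers $L\ge0$, $$\|T_1^{B_\rho}\|_{L^{\frac n{n-t}}(\mathbb R^n)}\le C\Big([f]_{B_{2^L\rho}}^{p_s-1}[g]_{B_{2^L\rho}}+\sum_{k=1}^\infty2^{-\sigma(L+k)}[f]_{B_{2^{L+k}\rho}}^{p_s-1}[g]_{B_{2^{L+k}\rho}}\Big).$$ **(2)** Let $f,h:\mathbb R^n\to\mathbb R^N$ and $g:\mathbb R^n\to\mathbb R$ be measurable with $[g]_{\mathbb R^n}<\infty$ and $[h]_{\mathbb R^n}<\infty$ (then $(-\Delta)^{t/2}g$ and $(-\Delta)^{t/2}h$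 are given by absolutely convergent integrals almost everywhere), and assume that the integral defining $I_t\big(g(-\Delta)^{t/2}h\big)(x)$ converges absolutely for almost every $x$; all this holds for Schwartz functions $g,h$. Put $$\Theta(x,y):=I_t\big(g(-\Delta)^{t/2}h\big)(x)-I_t\big(g(-\Delta)^{t/2}h\big)(y)-\tfrac12\big(h(x)-h(y)\big)\big(g(x)+g(y)\big),$$ $$T_2:=\int_{B_\rho}\int_{B_\rho}\frac{|f(x)-f(y)|^{p_s-1}\,|\Theta(x,y)|}{|x-y|^{n+sp_s}}\,dx\,dy .$$ Then for all $x_0\in\mathbb R^n$, $\rho>0$, $$T_2\le C\,\|(-\Delta)^{t/2}g\|_{L^{\frac nt}(\mathbb R^n)}\,[f]_{\mathbb R^n}^{p_s-1}\,[h]_{\mathbb R^n},$$ and for all integers $L\ge0$, $$T_2\le C\,\|(-\Delta)^{t/2}g\|_{L^{\frac nt}(\mathbb R^n)}\Big([f]_{B_{2^L\rho}}^{p_s-1}[h]_{B_{2^L\rho}}+\sum_{k=1}^\infty2^{-\sigma(L+k)}[f]_{B_{2^{L+k}\rho}}^{p_s-1}[h]_{B_{2^{L+k}\rho}}\Big).$$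 (Products in $[0,\infty]$ use $0\cdot\infty=0$.) -/

import Mathlib

open MeasureTheory
open scoped ENNReal NNReal

/-- The Gagliardo (Slobodeckij) seminorm over `A ⊆ ℝⁿ`, with values in `[0, ∞]`:
`[f]_{A,s,p} = (∫_A ∫_A |f(x) - f(y)|^p / |x - y|^{n + s p} dx dy)^{1/p}`. -/
noncomputable def gagliardoSeminorm {n : ℕ} {F : Type*} [NormedAddCommGroup F]
    (A : Set (EuclideanSpace ℝ (Fin n))) (s p : ℝ) (f : EuclideanSpace ℝ (Fin n) → F) : ℝ≥0∞ :=
  (∫⁻ x in A, ∫⁻ y in A,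
    ENNReal.ofReal (‖f x - f y‖ ^ p / ‖x - y‖ ^ ((n : ℝ) + s * p))) ^ (1 / p)

/-- The fractional Laplacian
`(-Δ)^{t/2} u (x) = c_t ∫ (u(y) - u(x)) / |x - y|^{n + t} dy`, `0 < t < 1`, where
`c_t = 2^t Γ((n + t)/2) / (π^{n/2} Γ(-t/2))` (a negative number) is the constant for which it is
the Fourier multiplier `|ξ|^t`. The integral converges absolutely, for every `x` if `u` is a
Schwartz function, and for almost every `x` if `u` has a finite seminorm `[u]_{ℝⁿ,s,n/s}` with
`0 < t < s < 1`. -/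
noncomputable def fracLaplacian {n : ℕ} {F : Type*} [NormedAddCommGroup F] [NormedSpace ℝ F]
    (t : ℝ) (u : EuclideanSpace ℝ (Fin n) → F) (x : EuclideanSpace ℝ (Fin n)) : F :=
  ((2 : ℝ) ^ t * Real.Gamma (((n : ℝ) + t) / 2) /
      (Real.pi ^ ((n : ℝ) / 2) * Real.Gamma (-t / 2))) •
    ∫ y, (‖x - y‖ ^ ((n : ℝ) + t))⁻¹ • (u y - u x)

/-- The Riesz potential `I_t u (x) = c̃_t ∫ |x - z|^{t - n} u(z) dz`, `0 < t < n`, where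
`c̃_t = Γ((n - t)/2) / (2^t π^{n/2} Γ(t/2))` is the constant for which it is the Fourier
multiplier `|ξ|^{-t}`, the inverse of `(-Δ)^{t/2}`. -/
noncomputable def rieszPotential {n : ℕ} {F : Type*} [NormedAddCommGroup F] [NormedSpace ℝ F]
    (t : ℝ) (u : EuclideanSpace ℝ (Fin n) → F) (x : EuclideanSpace ℝ (Fin n)) : F :=
  (Real.Gamma (((n : ℝ) - t) / 2) /
      ((2 : ℝ) ^ t * Real.pi ^ ((n : ℝ) / 2) * Real.Gamma (t / 2))) •
    ∫ z, ‖x - z‖ ^ (t - (n : ℝ)) • u z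

/-- `Γ(x,y,z) = |g(x) + g(y) - 2 g(z)| ||x - z|^{t - n} - |y - z|^{t - n}|`. -/
noncomputable def commGamma {n : ℕ} {F : Type*} [NormedAddCommGroup F] [NormedSpace ℝ F]
    (t : ℝ) (g : EuclideanSpace ℝ (Fin n) → F) (x y z : EuclideanSpace ℝ (Fin n)) : ℝ :=
  ‖g x + g y - (2 : ℝ) • g z‖ * |‖x - z‖ ^ (t - (n : ℝ)) - ‖y - z‖ ^ (t - (n : ℝ))|

/-- `Θ(x,y) = I_t(g (-Δ)^{t/2} h)(x) - I_t(g (-Δ)^{t/2} h)(y) - ½ (h(x) - h(y)) (g(x) + g(y))`. -/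
noncomputable def commTheta {n : ℕ} {F : Type*} [NormedAddCommGroup F] [NormedSpace ℝ F]
    (t : ℝ) (g : EuclideanSpace ℝ (Fin n) → ℝ) (h : EuclideanSpace ℝ (Fin n) → F)
    (x y : EuclideanSpace ℝ (Fin n)) : F :=
  rieszPotential t (fun z => g z • fracLaplacian t h z) x
    - rieszPotential t (fun z => g z • fracLaplacian t h z) y
    - ((1 / 2 : ℝ) * (g x + g y)) • (h x - h y)

/-- `T₁(z) = ∫_A ∫_A |f(x) - f(y)|^{p - 1} Γ(x,y,z) / |x - y|^{n + s p} dx dy` for `p = n/s`. -/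
noncomputable def commT₁ {n : ℕ} {F F' : Type*} [NormedAddCommGroup F]
    [NormedAddCommGroup F'] [NormedSpace ℝ F']
    (A : Set (EuclideanSpace ℝ (Fin n))) (s t : ℝ) (f : EuclideanSpace ℝ (Fin n) → F)
    (g : EuclideanSpace ℝ (Fin n) → F') (z : EuclideanSpace ℝ (Fin n)) : ℝ≥0∞ :=
  ∫⁻ x in A, ∫⁻ y in A,
    ENNReal.ofReal (‖f x - f y‖ ^ ((n : ℝ) / s - 1) * commGamma t g x y z
      / ‖x - y‖ ^ ((n : ℝ) + s * ((n : ℝ) / s)))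

/-- `T₂ = ∫_A ∫_A |f(x) - f(y)|^{p - 1} |Θ(x,y)| / |x - y|^{n + s p} dx dy` for `p = n/s`. -/
noncomputable def commT₂ {n : ℕ} {F F' : Type*} [NormedAddCommGroup F]
    [NormedAddCommGroup F'] [NormedSpace ℝ F']
    (A : Set (EuclideanSpace ℝ (Fin n))) (s t : ℝ) (f : EuclideanSpace ℝ (Fin n) → F)
    (g : EuclideanSpace ℝ (Fin n) → ℝ) (h : EuclideanSpace ℝ (Fin n) → F') : ℝ≥0∞ :=
  ∫⁻ x in A, ∫⁻ y in A,
    ENNReal.ofReal (‖f x - f y‖ ^ ((n : ℝ) / s - 1) * ‖commTheta t g h x y‖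
      / ‖x - y‖ ^ ((n : ℝ) + s * ((n : ℝ) / s)))

/-- The right-hand side of the localized estimates: with `B_r` the ball of radius `r` around `x₀`
and `p = n/s`,
`[f]_{B_{2^L ρ},s,p}^{p-1} [g]_{B_{2^L ρ},s,p}
  + ∑_{k ≥ 1} 2^{-σ(L+k)} [f]_{B_{2^{L+k} ρ},s,p}^{p-1} [g]_{B_{2^{L+k} ρ},s,p}`. -/
noncomputable def localizedBound {n : ℕ} {F F' : Type*} [NormedAddCommGroup F]
    [NormedAddCommGroup F'] (s σ : ℝ) (L : ℕ) (x₀ : EuclideanSpace ℝ (Fin n)) (ρ : ℝ)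
    (f : EuclideanSpace ℝ (Fin n) → F) (g : EuclideanSpace ℝ (Fin n) → F') : ℝ≥0∞ :=
  gagliardoSeminorm (Metric.ball x₀ (2 ^ L * ρ)) s (n / s) f ^ ((n : ℝ) / s - 1)
      * gagliardoSeminorm (Metric.ball x₀ (2 ^ L * ρ)) s (n / s) g
    + ∑' k : ℕ, ENNReal.ofReal ((2 : ℝ) ^ (-(σ * ((L : ℝ) + ((k : ℝ) + 1)))))
      * gagliardoSeminorm (Metric.ball x₀ (2 ^ (L + (k + 1)) * ρ)) s (n / s) f ^ ((n : ℝ) / s - 1)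
      * gagliardoSeminorm (Metric.ball x₀ (2 ^ (L + (k + 1)) * ρ)) s (n / s) g

/-!
Both commutators are bounded by multilinear forms with explicit kernels, and these forms are
estimated by Hölder's inequality with power weights. No Littlewood-Paley theory is needed: the
kernel is distributed between two factors so that each of them can be integrated in all variables
but the two in which `f`, or `g`, or `h`, is differenced.

The first commutator is tested with functions `φ ∈ L^{n/t}`. All that is used about `φ` is the
Morrey growth `∫_{B_r} φ ≤ A r^{n-t}` (`GrowthBound`). By the triangle inequality it suffices to
bound the trilinear form with integrand `|f(x)-f(y)|^{p-1} |g(x)-g(z)| ||x-z|^{t-n}-|y-z|^{t-n}|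
|x-y|^{-2n} φ(z)`, `p = n/s`. If `z` is far from `x` and `y`, the mean value theorem gains a factor
`|x-y|/|x-z|`, otherwise the two Riesz kernels are estimated separately. After Hölder's inequality
every factor is a Gagliardo energy, except for integrals of `|g(x)-g(z)|^p |x-z|^{κ-2n} φ(z)`. These
are controlled by the trace inequality `lintegral_trace_le`: the value of `g` at the point which
carries the weight `φ` is replaced by its values in a small ball around that point. The resulting
error is a small multiple of the integral itself and can be absorbed; in the main term, only the
growth of `φ` enters. In the far regime the points `z` of the `j`-th dyadic shell around the ball
gain a factor `2^{-(1-s)j}`. The resulting sum over all scales, `scaleSum`, is at most a constant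
times the right-hand side of the localized estimate for every `L`, since its terms up to the scale
`L` are controlled by the term of that scale (`scaleSum_le_localizedBound`), and it is also bounded
by the global seminorms (`scaleSum_le_univ`). This gives `eLpNorm_commT₁_le`.

For the second commutator, `(-Δ)^{t/2}` is inverted on differences: `h(x)-h(y) = c ∫
(|x-z|^{t-n}-|y-z|^{t-n}) (-Δ)^{t/2}h(z) dz` almost everywhere, if `[h]_{ℝⁿ} < ∞`
(`sub_eq_integral_smul_fracLaplacian`). Both kernels are written as superpositions of heat kernels,
the semigroup property reduces the identity to a double integral in two time variables, and that
integral is of Frullani's type. Hence `Θ(x,y)` is an integral of `(|x-z|^{t-n}-|y-z|^{t-n})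
(g(z)-(g(x)+g(y))/2) (-Δ)^{t/2}h(z)`. The same identity for `g` gives `|g(x)-g(z)| ≲ |x-z|^{t'}
(V(x)+V(z))` with the potential `V = I_{t-t'} |(-Δ)^{t/2}g|` (`exists_edist_le_potential`), for any
small `t'`, and `(-Δ)^{t/2}h(z)` is at most `∫ |h(z)-h(v)| |z-v|^{-n-t} dv`. Thus `exists_commT₂_le`
bounds `T₂` by a quadrilinear form in the points `x, y, z, v` with the weights `V(x)`, `V(y)`,
`V(z)`. It is estimated in three regions, according to whether `|z-v|`, `|x-z|` or `|x-y|` is the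
largest of these distances. As `t' > s - t`, there is room to integrate one factor over `(x, y)` and
the other one over `(z, v)`; for the weights only the growth of `V^{n/s}` and `V^{n/(n-s)}` is
needed, which follows from the membership of `(-Δ)^{t/2}g` in `L^{n/t}` when `t'` is small. In the
first two regions a pair `(z, v)` outside a large ball gains a power of the scale, and in the third
one such pairs do not occur (`lintegral_quadrilinear_le_scaleSum`, `commT₂_le`). The smallness of
`t'` against `t' > s - t` is what forces `t` to be close to `s`.
-/

section

open Set Filter Topology Metric
open ENNReal (ofReal rpow_add coe_mul mul_rpow_of_nonneg mul_ne_top rpow_mul coe_rpow_of_nonneg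
  rpow_one coe_toNNReal rpow_le_rpow ofReal_ne_top ofReal_mul ofReal_le_ofReal coe_ne_top
  rpow_ne_top_of_nonneg inv_ne_top rpow_natCast rpow_neg ofReal_ofNat rpow_ne_top_of_ne_zero
  rpow_zero mul_rpow_of_ne_top inv_rpow ofReal_pow one_rpow ofNat_ne_top mul_lt_top one_ne_top
  tsum_le_tsum zero_rpow_of_pos tsum_mul_left ofReal_toReal ofReal_add inv_ne_zero
  div_le_of_le_mul coe_ofNat coe_add add_ne_top rpow_lt_one rpow_add_of_nonneg)

variable {n : ℕ} {F G : Type*} [NormedAddCommGroup F] [NormedAddCommGroup G]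

local notation "E" => EuclideanSpace ℝ (Fin n)

/-! ### Powers in `[0, ∞]` and growth of measures on balls -/

/-- `ψ` has growth exponent `e` with constant `A`: its integral over a ball of radius `r` is at
most `A r ^ e`. With `e = n - d` this is the Morrey condition satisfied by functions in
`L^{n/d}`; it is the only information on the multiplier that the estimates use. -/
def GrowthBound (ψ : E → ℝ≥0∞) (A : ℝ≥0∞) (e : ℝ) : Prop :=
  ∀ (u : E) (r : ℝ), 0 < r → ∫⁻ z in ball u r, ψ z ≤ A * ofReal r ^ e

/-- Comparable quantities have comparable powers, whatever the sign of the exponent. -/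
lemma rpow_le_of_comparable {a b c : ℝ≥0∞} (hc0 : c ≠ 0) (hc : c ≠ ∞) (h1 : a ≤ c * b)
    (h2 : b ≤ c * a) (e : ℝ) : b ^ e ≤ c ^ |e| * a ^ e := by
  rcases le_or_gt 0 e with he | he
  · rw [abs_of_nonneg he, ← mul_rpow_of_nonneg _ _ he]
    exact rpow_le_rpow h2 he
  · rw [abs_of_neg he]
    have h3 : (c⁻¹ * a) ≤ b := by
      rw [mul_comm, ← div_eq_mul_inv]; exact ENNReal.div_le_of_le_mul' h1
    have h4 : b ^ e ≤ (c⁻¹ * a) ^ e := by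
      have := rpow_le_rpow h3 (by linarith : 0 ≤ -e)
      rw [rpow_neg, rpow_neg, ENNReal.inv_le_inv] at this
      exact this
    refine h4.trans (le_of_eq ?_)
    rw [ENNReal.mul_rpow_eq_ite, if_neg (by simp [hc0, hc]), inv_rpow, rpow_neg]

lemma ennreal_rpow_anti {a b : ℝ≥0∞} {e : ℝ} (he : e ≤ 0) (h : a ≤ b) : b ^ e ≤ a ^ e := by
  have := rpow_le_rpow h (by linarith : 0 ≤ -e)
  rwa [rpow_neg, rpow_neg, ENNReal.inv_le_inv] at this

/-- A bound `a ≤ c b` reverses under a nonpositive power. -/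
lemma rpow_le_mul_rpow_of_nonpos {a b c : ℝ≥0∞} (hc0 : c ≠ 0) (hc : c ≠ ∞) {e : ℝ} (he : e ≤ 0)
    (h : a ≤ c * b) : b ^ e ≤ c ^ (-e) * a ^ e := by
  have h4 : (c * b) ^ e ≤ a ^ e := ennreal_rpow_anti he h
  rw [ENNReal.mul_rpow_eq_ite, if_neg (by simp [hc0, hc])] at h4
  calc b ^ e = c ^ (-e) * (c ^ e * b ^ e) := by
        rw [← mul_assoc, ← rpow_add _ _ hc0 hc]; simp
    _ ≤ _ := by gcongr

lemma edist_le_ofReal_mul {x y z w : E} {c : ℝ} (hc : 0 ≤ c) (h : dist x y ≤ c * dist z w) :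
    edist x y ≤ ofReal c * edist z w := by
  rw [edist_dist, edist_dist, ← ofReal_mul hc]
  exact ofReal_le_ofReal h

lemma edist_le_two_mul {x y z w : E} (h : dist x y ≤ 2 * dist z w) :
    edist x y ≤ 2 * edist z w := by
  simpa only [ofReal_ofNat] using edist_le_ofReal_mul (by norm_num) h

lemma ofReal_le_two_mul {a b : ℝ} (h : a ≤ 2 * b) :
    ofReal a ≤ 2 * ofReal b := by
  rw [← ofReal_ofNat 2, ← ofReal_mul (by norm_num)]
  exact ofReal_le_ofReal h

lemma edist_rpow_ne_top {x y : E} (h : x ≠ y) (a : ℝ) : edist x y ^ a ≠ ∞ :=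
  rpow_ne_top_of_ne_zero (edist_pos.2 h).ne' (edist_ne_top x y)

/-- On a dyadic annulus the power of the distance is essentially constant. -/
lemma lintegral_annulus_le {ψ : E → ℝ≥0∞} {A : ℝ≥0∞} {e : ℝ} (h : GrowthBound ψ A e) (x : E)
    {ρ : ℝ} (hρ : 0 < ρ) (a : ℝ) :
    ∫⁻ z in {z | ρ / 2 ≤ dist z x ∧ dist z x < ρ}, edist x z ^ a * ψ z
      ≤ 2 ^ |a| * A * ofReal ρ ^ (a + e) := by
  have hρ0 : ofReal ρ ≠ 0 := by simpa using hρ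
  have hmeas : MeasurableSet {z : E | ρ / 2 ≤ dist z x ∧ dist z x < ρ} := by
    exact (measurableSet_le measurable_const (measurable_id.dist measurable_const)).inter
      (measurableSet_lt (measurable_id.dist measurable_const) measurable_const)
  calc ∫⁻ z in {z | ρ / 2 ≤ dist z x ∧ dist z x < ρ}, edist x z ^ a * ψ z
      ≤ ∫⁻ z in {z | ρ / 2 ≤ dist z x ∧ dist z x < ρ}, (2 ^ |a| * ofReal ρ ^ a) * ψ z := by
        refine setLIntegral_mono' hmeas fun z hz => ?_
        gcongr
        refine rpow_le_of_comparable (by simp) (by simp) ?_ ?_ a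
        · rw [edist_comm, edist_dist]
          exact ofReal_le_two_mul (by linarith [hz.1])
        · rw [edist_comm, edist_dist]
          refine (ofReal_le_ofReal hz.2.le).trans ?_
          exact le_mul_of_one_le_left (by simp) (by norm_num)
    _ = (2 ^ |a| * ofReal ρ ^ a) *
          ∫⁻ z in {z | ρ / 2 ≤ dist z x ∧ dist z x < ρ}, ψ z := by
        rw [lintegral_const_mul']
        exact mul_ne_top (by simp)
          (rpow_ne_top_of_ne_zero hρ0 ofReal_ne_top)
    _ ≤ (2 ^ |a| * ofReal ρ ^ a) * (A * ofReal ρ ^ e) := by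
        gcongr
        exact (lintegral_mono_set fun z hz => hz.2).trans (h x ρ hρ)
    _ = 2 ^ |a| * A * ofReal ρ ^ (a + e) := by
        rw [rpow_add _ _ hρ0 ofReal_ne_top]; ring

/-- Summation over a geometric sequence of annuli. -/
lemma lintegral_le_of_annuli {ψ : E → ℝ≥0∞} {A : ℝ≥0∞} {e : ℝ} (h : GrowthBound ψ A e)
    (x : E) {R : ℝ} (hR : 0 < R) (a : ℝ) {w : ℝ} (hw : 0 < w) (S : Set E)
    (hS : ∀ z ∈ S, ∃ k : ℕ, R * w ^ k / 2 ≤ dist z x ∧ dist z x < R * w ^ k) :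
    ∫⁻ z in S, edist x z ^ a * ψ z
      ≤ 2 ^ |a| * (1 - ofReal w ^ (a + e))⁻¹ * A * ofReal R ^ (a + e) := by
  have hsub : S ⊆ ⋃ k : ℕ, {z | R * w ^ k / 2 ≤ dist z x ∧ dist z x < R * w ^ k} := by
    intro z hz
    obtain ⟨k, hk⟩ := hS z hz
    exact mem_iUnion.2 ⟨k, hk⟩
  calc ∫⁻ z in S, edist x z ^ a * ψ z
      ≤ ∫⁻ z in ⋃ k : ℕ, {z | R * w ^ k / 2 ≤ dist z x ∧ dist z x < R * w ^ k},
          edist x z ^ a * ψ z := lintegral_mono_set hsub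
    _ ≤ ∑' k : ℕ, ∫⁻ z in {z | R * w ^ k / 2 ≤ dist z x ∧ dist z x < R * w ^ k},
          edist x z ^ a * ψ z := lintegral_iUnion_le _ _
    _ ≤ ∑' k : ℕ, 2 ^ |a| * A * ofReal (R * w ^ k) ^ (a + e) :=
        tsum_le_tsum fun k => lintegral_annulus_le h x (by positivity) a
    _ = ∑' k : ℕ, (2 ^ |a| * A * ofReal R ^ (a + e)) *
          (ofReal w ^ (a + e)) ^ k := by
        congr 1; ext k
        rw [ofReal_mul hR.le, ofReal_pow hw.le,
          mul_rpow_of_ne_top (by simp) (by simp), ← rpow_natCast,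
          ← rpow_natCast, ← rpow_mul, ← rpow_mul, mul_comm (k : ℝ)]
        ring
    _ = _ := by
        rw [tsum_mul_left, ENNReal.tsum_geometric]; ring

/-- A power of the distance integrates over a ball against a function of growth exponent `e`, as
long as the sum of the exponents is positive. -/
lemma lintegral_ball_edist_rpow_le {a e : ℝ} (hae : 0 < a + e) [NeZero n] : ∃ C : ℝ≥0,
    ∀ (ψ : E → ℝ≥0∞) (A : ℝ≥0∞), GrowthBound ψ A e → ∀ (x : E) (R : ℝ), 0 < R →
      ∫⁻ z in ball x R, edist x z ^ a * ψ z ≤ C * A * ofReal R ^ (a + e) := by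
  have hq : ofReal (1 / 2) ^ (a + e) < 1 :=
    rpow_lt_one (by rw [ENNReal.ofReal_lt_one]; norm_num) hae
  have hC : 2 ^ |a| * (1 - ofReal (1 / 2) ^ (a + e))⁻¹ ≠ ∞ :=
    mul_ne_top (by simp) (inv_ne_top.2 (tsub_pos_of_lt hq).ne')
  refine ⟨(2 ^ |a| * (1 - ofReal (1 / 2) ^ (a + e))⁻¹).toNNReal, fun ψ A h x R hR => ?_⟩
  rw [coe_toNNReal hC]
  have h1 := lintegral_le_of_annuli h x hR a (w := 1 / 2) (by norm_num)
    (ball x R \ {x}) (by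
      rintro z ⟨hz, hzx⟩
      have hpos : 0 < dist z x := dist_pos.2 hzx
      obtain ⟨k, hk1, hk2⟩ := exists_nat_pow_near_of_lt_one (x := dist z x / R) (y := 1 / 2)
        (by positivity) ((div_le_one hR).2 (mem_ball.1 hz).le) (by norm_num) (by norm_num)
      rw [div_le_iff₀ hR] at hk2
      rw [lt_div_iff₀ hR] at hk1
      rcases hk2.lt_or_eq with hk2 | hk2
      · exact ⟨k, by rw [pow_succ] at hk1; linarith, by linarith⟩
      · cases k with
        | zero => simp at hk2; rw [mem_ball] at hz; linarith
        | succ k => 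
          refine ⟨k, ?_, ?_⟩
          · rw [pow_succ] at hk2; linarith
          · rw [pow_succ] at hk2; have : 0 < R * (1/2)^k := by positivity
            linarith)
  have h2 : (ball x R \ {x} : Set E) =ᵐ[volume] ball x R :=
    sdiff_null_ae_eq_self (measure_singleton x)
  rwa [setLIntegral_congr h2] at h1

/-- A power of the distance integrates outside a ball against a function of growth exponent `e`,
as long as the sum of the exponents is negative. -/
lemma lintegral_compl_ball_edist_rpow_le {a e : ℝ} (hae : a + e < 0) : ∃ C : ℝ≥0,
    ∀ (ψ : E → ℝ≥0∞) (A : ℝ≥0∞), GrowthBound ψ A e → ∀ (x : E) (R : ℝ), 0 < R →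
      ∫⁻ z in (ball x R)ᶜ, edist x z ^ a * ψ z
        ≤ C * A * ofReal R ^ (a + e) := by
  have hq : ofReal 2 ^ (a + e) < 1 := by
    apply ENNReal.rpow_lt_one_of_one_lt_of_neg _ hae
    rw [ENNReal.one_lt_ofReal]; norm_num
  have hC : 2 ^ |a| * (1 - ofReal 2 ^ (a + e))⁻¹ * ofReal 2 ^ (a + e) ≠ ∞ :=
    mul_ne_top (mul_ne_top (by simp) (inv_ne_top.2 (tsub_pos_of_lt hq).ne'))
      (hq.trans_le le_top).ne
  refine ⟨(2 ^ |a| * (1 - ofReal 2 ^ (a + e))⁻¹ * ofReal 2 ^ (a + e)).toNNReal,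
    fun ψ A h x R hR => ?_⟩
  rw [coe_toNNReal hC]
  have h1 := lintegral_le_of_annuli h x (R := 2 * R) (by positivity) a (w := 2) (by norm_num)
    ((ball x R)ᶜ) (by
      intro z hz
      have hz : R ≤ dist z x := by simpa using hz
      obtain ⟨k, hk1, hk2⟩ := exists_nat_pow_near (x := dist z x / R) (y := 2)
        ((one_le_div hR).2 hz) (by norm_num)
      rw [le_div_iff₀ hR] at hk1
      rw [div_lt_iff₀ hR, pow_succ] at hk2
      exact ⟨k, by linarith, by linarith⟩)
  refine h1.trans (le_of_eq ?_)
  rw [ofReal_mul (by norm_num), mul_rpow_of_ne_top (by simp) (by simp)]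
  ring

/-- The basic integral: against a function of growth exponent `e`, a kernel which is the power `a`
of the distance up to scale `R` and the power `a + b` beyond integrates to the power of `R`
dictated by scaling, when it is integrable at both ends. -/
lemma lintegral_edist_rpow_max_le [NeZero n] {a b e : ℝ} (ha : 0 < a + e) (hb : a + b + e < 0) :
    ∃ C : ℝ≥0, ∀ (ψ : E → ℝ≥0∞) (A : ℝ≥0∞), GrowthBound ψ A e → ∀ (x : E) (R : ℝ≥0∞),
      R ≠ 0 → R ≠ ∞ →
      ∫⁻ z, edist x z ^ a * max R (edist x z) ^ b * ψ z ≤ C * A * R ^ (a + b + e) := by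
  obtain ⟨C₁, hC₁⟩ := lintegral_ball_edist_rpow_le (n := n) ha
  obtain ⟨C₂, hC₂⟩ := lintegral_compl_ball_edist_rpow_le (n := n) hb
  refine ⟨C₁ + C₂, fun ψ A h x R hR0 hR => ?_⟩
  have hRr : 0 < R.toReal := ENNReal.toReal_pos hR0 hR
  have hRb : R ^ b ≠ ∞ := rpow_ne_top_of_ne_zero hR0 hR
  rw [← lintegral_add_compl _ (measurableSet_ball (x := x) (ε := R.toReal))]
  have h1 : ∫⁻ z in ball x R.toReal, edist x z ^ a * max R (edist x z) ^ b * ψ z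
      ≤ C₁ * A * R ^ (a + b + e) := by
    calc ∫⁻ z in ball x R.toReal, edist x z ^ a * max R (edist x z) ^ b * ψ z
        = ∫⁻ z in ball x R.toReal, R ^ b * (edist x z ^ a * ψ z) := by
          refine setLIntegral_congr_fun measurableSet_ball fun z hz => ?_
          have : edist x z ≤ R := by
            rw [edist_comm, edist_dist]
            exact ENNReal.ofReal_le_of_le_toReal (mem_ball.1 hz).le
          simp only [max_eq_left this]; ring
      _ = R ^ b * ∫⁻ z in ball x R.toReal, edist x z ^ a * ψ z := lintegral_const_mul' _ _ hRb
      _ ≤ R ^ b * (C₁ * A * R ^ (a + e)) := by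
          gcongr
          have := hC₁ ψ A h x R.toReal hRr
          rwa [ofReal_toReal hR] at this
      _ = C₁ * A * R ^ (a + b + e) := by
          rw [show a + b + e = b + (a + e) by ring, rpow_add b _ hR0 hR]; ring
  have h2 : ∫⁻ z in (ball x R.toReal)ᶜ, edist x z ^ a * max R (edist x z) ^ b * ψ z
      ≤ C₂ * A * R ^ (a + b + e) := by
    calc ∫⁻ z in (ball x R.toReal)ᶜ, edist x z ^ a * max R (edist x z) ^ b * ψ z
        = ∫⁻ z in (ball x R.toReal)ᶜ, edist x z ^ (a + b) * ψ z := by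
          refine setLIntegral_congr_fun measurableSet_ball.compl fun z hz => ?_
          have hz : R.toReal ≤ dist z x := by simpa using hz
          have : R ≤ edist x z := by
            rw [edist_comm, edist_dist]
            exact (ENNReal.le_ofReal_iff_toReal_le hR dist_nonneg).2 hz
          simp only [max_eq_right this]
          rw [rpow_add _ _ (lt_of_lt_of_le (pos_iff_ne_zero.2 hR0) this).ne'
            (edist_ne_top _ _)]
      _ ≤ C₂ * A * R ^ (a + b + e) := by
          have := hC₂ ψ A h x R.toReal hRr
          rwa [ofReal_toReal hR] at this
  calc _ ≤ C₁ * A * R ^ (a + b + e) + C₂ * A * R ^ (a + b + e) := add_le_add h1 h2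
    _ = _ := by push_cast; ring

/-- The constant function `1` has growth exponent `n`. -/
lemma growthBound_one [NeZero n] :
    GrowthBound (fun _ : E => 1) (volume (ball (0 : E) 1)) n := by
  intro u r hr
  rw [lintegral_one, Measure.restrict_apply_univ, Measure.addHaar_ball _ _ hr.le,
    finrank_euclideanSpace_fin, ofReal_pow hr.le, rpow_natCast, mul_comm]

/-- `lintegral_edist_rpow_max_le` for Lebesgue measure. -/
lemma lintegral_edist_rpow_max_le_volume [NeZero n] {a b : ℝ} (ha : 0 < a + n)
    (hb : a + b + n < 0) : ∃ C : ℝ≥0, ∀ (x : E) (R : ℝ≥0∞), R ≠ 0 → R ≠ ∞ →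
      ∫⁻ z, edist x z ^ a * max R (edist x z) ^ b ≤ C * R ^ (a + b + n) := by
  obtain ⟨C, hC⟩ := lintegral_edist_rpow_max_le (n := n) ha hb
  refine ⟨C * (volume (ball (0 : E) 1)).toNNReal, fun x R hR0 hR => ?_⟩
  have := hC _ _ growthBound_one x R hR0 hR
  simp only [mul_one] at this
  rwa [coe_mul, coe_toNNReal measure_ball_lt_top.ne]

/-- The mean of `|x - w|^a` over a ball is comparable to the value of the kernel at the centre,
regularised at the scale of the ball, for `-n < a ≤ 0`. -/
lemma setLIntegral_ball_edist_rpow_le_max [NeZero n] {a : ℝ} (ha : 0 < a + n) (ha0 : a ≤ 0) :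
    ∃ C : ℝ≥0, ∀ (u w : E) (R : ℝ), 0 < R → ∫⁻ x in ball u R, edist x w ^ a
      ≤ C * ofReal R ^ (n : ℝ) * max (ofReal R) (edist u w) ^ a := by
  obtain ⟨C₁, hC₁⟩ := lintegral_ball_edist_rpow_le (n := n) ha
  set ω := volume (ball (0 : E) 1) with hω
  have hωt : ω ≠ ∞ := measure_ball_lt_top.ne
  refine ⟨C₁ * ω.toNNReal * 3 ^ (a + n) * 2 ^ (-a) + 2 ^ (-a) * ω.toNNReal, fun u w R hR => ?_⟩
  have hRE : ofReal R ≠ 0 := by simpa using hR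
  push_cast [coe_rpow_of_nonneg _ (show (0:ℝ) ≤ -a by linarith),
    coe_rpow_of_nonneg _ ha.le, coe_toNNReal hωt]
  rcases lt_or_ge (dist u w) (2 * R) with h | h
  · have hsub : ball u R ⊆ ball w (3 * R) := by
      intro x hx
      rw [mem_ball] at *
      linarith [dist_triangle x u w]
    have hmax : max (ofReal R) (edist u w) ≤ 2 * ofReal R := by
      refine max_le (le_mul_of_one_le_left (by simp) (by norm_num)) ?_
      rw [edist_dist]
      exact ofReal_le_two_mul h.le
    have hm := rpow_le_mul_rpow_of_nonpos (by simp) (by simp) ha0 hmax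
    calc ∫⁻ x in ball u R, edist x w ^ a
        ≤ ∫⁻ x in ball w (3 * R), edist w x ^ a * 1 := by
          refine (lintegral_mono_set hsub).trans (le_of_eq ?_)
          simp only [edist_comm, mul_one]
      _ ≤ C₁ * ω * ofReal (3 * R) ^ (a + n) := hC₁ _ _ growthBound_one w _ (by positivity)
      _ = C₁ * ω * 3 ^ (a + n) * ofReal R ^ (n : ℝ) * ofReal R ^ a := by
          rw [ofReal_mul (by norm_num), mul_rpow_of_ne_top (by simp) (by simp),
            rpow_add _ _ hRE (by simp)]
          simp only [ofReal_ofNat]; ring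
      _ ≤ C₁ * ω * 3 ^ (a + n) * ofReal R ^ (n : ℝ) *
            (2 ^ (-a) * max (ofReal R) (edist u w) ^ a) := by gcongr
      _ ≤ (C₁ * ω * 3 ^ (a + n) * 2 ^ (-a) + 2 ^ (-a) * ω) * ofReal R ^ (n : ℝ) *
            max (ofReal R) (edist u w) ^ a := by
          rw [add_mul, add_mul]
          refine le_trans (le_of_eq ?_) le_self_add
          ring
  · have hmax : max (ofReal R) (edist u w) = edist u w := by
      refine max_eq_right ?_
      rw [edist_dist]
      exact ofReal_le_ofReal (by linarith)
    rw [hmax]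
    calc ∫⁻ x in ball u R, edist x w ^ a
        ≤ ∫⁻ x in ball u R, 2 ^ (-a) * edist u w ^ a := by
          refine setLIntegral_mono' measurableSet_ball fun x hx => ?_
          refine rpow_le_mul_rpow_of_nonpos (by simp) (by simp) ha0 ?_
          refine edist_le_two_mul ?_
          rw [mem_ball] at hx
          linarith [dist_triangle u x w, dist_comm u x]
      _ = 2 ^ (-a) * edist u w ^ a * (ω * ofReal R ^ (n : ℝ)) := by
          rw [setLIntegral_const, Measure.addHaar_ball _ _ hR.le,
            finrank_euclideanSpace_fin, ofReal_pow hR.le, rpow_natCast, hω]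
          ring
      _ ≤ _ := by
          rw [add_mul, add_mul]
          refine le_trans (le_of_eq ?_) le_add_self
          ring

/-- The kernel of the Riesz potential of order `τ`, without normalisation, integrated against
`ψ ≥ 0`. -/
noncomputable def potential (τ : ℝ) (ψ : E → ℝ≥0∞) (x : E) : ℝ≥0∞ :=
  ∫⁻ w, edist x w ^ (τ - n) * ψ w

lemma measurable_potential {τ : ℝ} {ψ : E → ℝ≥0∞} (hψ : Measurable ψ) :
    Measurable (potential τ ψ) := by
  unfold potential
  apply Measurable.lintegral_prod_right' (f := fun q : E × E => edist q.1 q.2 ^ (τ - n) * ψ q.2)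
  fun_prop

/-- The potential of order `τ` raises the growth exponent by `τ`. -/
lemma growthBound_potential [NeZero n] {τ e : ℝ} (hτ : 0 < τ) (he : 0 < e)
    (hτe : τ + e < n) : ∃ C : ℝ≥0, ∀ (ψ : E → ℝ≥0∞) (A : ℝ≥0∞), Measurable ψ →
      GrowthBound ψ A e → GrowthBound (potential τ ψ) (C * A) (τ + e) := by
  obtain ⟨C₁, hC₁⟩ := setLIntegral_ball_edist_rpow_le_max (n := n) (a := τ - n) (by linarith)
    (by linarith)
  obtain ⟨C₂, hC₂⟩ := lintegral_edist_rpow_max_le (n := n) (a := 0) (b := τ - n) (e := e)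
    (by linarith) (by linarith)
  refine ⟨C₁ * C₂, fun ψ A hψ h u R hR => ?_⟩
  have hRE : ofReal R ≠ 0 := by simpa using hR
  unfold potential
  rw [lintegral_lintegral_swap (by apply Measurable.aemeasurable; unfold Function.uncurry; fun_prop)]
  calc ∫⁻ w, ∫⁻ x in ball u R, edist x w ^ (τ - n) * ψ w
      ≤ ∫⁻ w, C₁ * ofReal R ^ (n : ℝ) *
          (edist u w ^ (0 : ℝ) * max (ofReal R) (edist u w) ^ (τ - n) * ψ w) := by
        refine lintegral_mono fun w => ?_
        dsimp only
        rw [lintegral_mul_const _ (by fun_prop)]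
        calc _ ≤ (C₁ * ofReal R ^ (n : ℝ) * max (ofReal R) (edist u w) ^ (τ - n))
              * ψ w := by gcongr; exact hC₁ u w R hR
          _ = _ := by rw [rpow_zero]; ring
    _ = C₁ * ofReal R ^ (n : ℝ) *
          ∫⁻ w, (edist u w ^ (0 : ℝ) * max (ofReal R) (edist u w) ^ (τ - n) * ψ w) := by
        rw [lintegral_const_mul']
        exact mul_ne_top (by simp) (by simp)
    _ ≤ C₁ * ofReal R ^ (n : ℝ) * (C₂ * A * ofReal R ^ (0 + (τ - n) + e)) := by
        gcongr
        exact hC₂ ψ A h u _ hRE (by simp)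
    _ = _ := by
        rw [show τ + e = n + (0 + (τ - n) + e) by ring, rpow_add (n : ℝ) _ hRE (by simp)]
        push_cast; ring

/-- Interpolation of two powers of the same finite nonzero quantity. -/
lemma rpow_mul_rpow_interp {q : ℝ≥0∞} (h0 : q ≠ 0) (h : q ≠ ∞) {a b c θ : ℝ}
    (hc : c = a * θ + b * (1 - θ)) : q ^ c = (q ^ a) ^ θ * (q ^ b) ^ (1 - θ) := by
  rw [hc, rpow_add _ _ h0 h, rpow_mul, rpow_mul]

lemma eq_rpow_mul_rpow_one_sub (q : ℝ≥0∞) {θ : ℝ} (h0 : 0 ≤ θ) (h1 : θ ≤ 1) :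
    q = q ^ θ * q ^ (1 - θ) := by
  rw [← rpow_add_of_nonneg _ _ h0 (by linarith)]; simp

/-- Powers of Riesz potentials: if `ψ` has growth exponent `n - t`, then the `m`-th power of its
potential of order `t - t'` has growth exponent `n - m t'`, as long as `m t' < t`. The potential
is split by Hölder's inequality with respect to `ψ` into a factor integrable in `w`, uniformly in
`x`, and a factor integrable in `x`. -/
lemma growthBound_potential_rpow [NeZero n] {t t' m : ℝ} (ht' : 0 < t') (hm : 1 ≤ m)
    (hmt : m * t' < t) (htn : t < n) : ∃ C : ℝ≥0, ∀ (ψ : E → ℝ≥0∞) (A : ℝ≥0∞), Measurable ψ →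
      GrowthBound ψ A (n - t) →
      GrowthBound (fun x => potential (t - t') ψ x ^ m) (C * A ^ m) (n - m * t') := by
  have hm0 : 0 < m := by linarith
  obtain ⟨κ, hκ, hκ'⟩ : ∃ κ : ℝ, 0 < κ ∧ (m - 1) * κ < t - m * t' := by
    refine ⟨(t - m * t') / m, by apply div_pos <;> linarith, ?_⟩
    rw [mul_div_assoc', div_lt_iff₀ hm0]
    nlinarith
  set a₂ : ℝ := κ - (n - t) with ha₂
  set b₂ : ℝ := -(κ + t') with hb₂
  set a₁ : ℝ := -(n - t) - m * t' - (m - 1) * κ with ha₁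
  set b₁ : ℝ := (m - 1) * (κ + t') with hb₁
  obtain ⟨C₂, hC₂⟩ := lintegral_edist_rpow_max_le (n := n) (a := a₂) (b := b₂) (e := n - t)
    (by rw [ha₂]; linarith) (by rw [ha₂, hb₂]; linarith)
  obtain ⟨C₁, hC₁⟩ := setLIntegral_ball_edist_rpow_le_max (n := n) (a := a₁)
    (by rw [ha₁]; linarith) (by rw [ha₁]; nlinarith)
  obtain ⟨C₀, hC₀⟩ := lintegral_edist_rpow_max_le (n := n) (a := 0) (b := a₁ + b₁) (e := n - t)
    (by linarith) (by rw [ha₁, hb₁]; nlinarith)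
  refine ⟨2 ^ |b₁| * C₁ * C₀ * C₂ ^ (m - 1), fun ψ A hψ h u R hR => ?_⟩
  set ρ := ofReal R with hρ
  have hρ0 : ρ ≠ 0 := by simpa [hρ] using hR
  have hρt : ρ ≠ ∞ := by simp [hρ]
  set P : E → ℝ≥0∞ := fun x => ∫⁻ w, edist x w ^ a₁ * max ρ (edist x w) ^ b₁ * ψ w with hP
  have hmax0 : ∀ q : ℝ≥0∞, max ρ q ≠ 0 := fun q =>
    ((pos_iff_ne_zero.2 hρ0).trans_le (le_max_left _ _)).ne'
  have hV : ∀ x, potential (t - t') ψ x ^ m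
      ≤ P x * (C₂ * A * ρ ^ (a₂ + b₂ + (n - t))) ^ (m - 1) := by
    intro x
    have hθ0 : 0 ≤ 1 / m := by positivity
    have hθ1 : 0 ≤ 1 - 1 / m := by rw [sub_nonneg, div_le_one hm0]; exact hm
    have h1 : potential (t - t') ψ x ≤ P x ^ (1 / m) *
        (∫⁻ w, edist x w ^ a₂ * max ρ (edist x w) ^ b₂ * ψ w) ^ (1 - 1 / m) := by
      refine le_trans (le_of_eq ?_) (ENNReal.lintegral_mul_norm_pow_le
        (by fun_prop) (by fun_prop) hθ0 hθ1 (by ring))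
      refine lintegral_congr_ae ?_
      filter_upwards [Measure.ae_ne volume x] with w hw
      have hq0 : edist x w ≠ 0 := (edist_pos.2 hw.symm).ne'
      have hqt : edist x w ≠ ∞ := edist_ne_top _ _
      have e1 := rpow_mul_rpow_interp hq0 hqt (a := a₁) (b := a₂) (c := t - t' - n) (θ := 1 / m)
        (by rw [ha₁, ha₂]; field_simp; ring)
      have e2 := rpow_mul_rpow_interp (hmax0 (edist x w)) (max_lt hρt.lt_top hqt.lt_top).ne
        (a := b₁) (b := b₂) (c := 0) (θ := 1 / m) (by rw [hb₁, hb₂]; field_simp; ring)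
      have e3 := eq_rpow_mul_rpow_one_sub (ψ w) hθ0 (by linarith)
      rw [rpow_zero] at e2
      rw [mul_rpow_of_nonneg _ _ hθ0, mul_rpow_of_nonneg _ _ hθ0,
        mul_rpow_of_nonneg _ _ hθ1, mul_rpow_of_nonneg _ _ hθ1, e1]
      calc _ = (edist x w ^ a₁) ^ (1 / m) * (edist x w ^ a₂) ^ (1 - 1 / m) * 1 * ψ w := by
            rw [mul_one]
        _ = _ := by rw [e2]; nth_rewrite 1 [e3]; ring
    calc potential (t - t') ψ x ^ m
        ≤ (P x ^ (1 / m) * (C₂ * A * ρ ^ (a₂ + b₂ + (n - t))) ^ (1 - 1 / m)) ^ m := by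
          refine rpow_le_rpow (h1.trans ?_) hm0.le
          gcongr
          exact hC₂ ψ A h x ρ hρ0 hρt
      _ = _ := by
          rw [mul_rpow_of_nonneg _ _ hm0.le, ← rpow_mul, ← rpow_mul,
            one_div_mul_cancel hm0.ne', rpow_one,
            show (1 - 1 / m) * m = m - 1 by field_simp]
  have hPint : ∫⁻ x in ball u R, P x
      ≤ 2 ^ |b₁| * C₁ * ρ ^ (n : ℝ) * (C₀ * A * ρ ^ (0 + (a₁ + b₁) + (n - t))) := by
    rw [hP, lintegral_lintegral_swap
      (by apply Measurable.aemeasurable; unfold Function.uncurry; fun_prop)]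
    calc ∫⁻ w, ∫⁻ x in ball u R, edist x w ^ a₁ * max ρ (edist x w) ^ b₁ * ψ w
        ≤ ∫⁻ w, 2 ^ |b₁| * C₁ * ρ ^ (n : ℝ) *
            (edist u w ^ (0 : ℝ) * max ρ (edist u w) ^ (a₁ + b₁) * ψ w) := by
          refine lintegral_mono fun w => ?_
          dsimp only
          have hmt : max ρ (edist u w) ≠ ∞ := (max_lt hρt.lt_top (edist_lt_top _ _)).ne
          calc ∫⁻ x in ball u R, edist x w ^ a₁ * max ρ (edist x w) ^ b₁ * ψ w
              ≤ ∫⁻ x in ball u R,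
                  edist x w ^ a₁ * (2 ^ |b₁| * max ρ (edist u w) ^ b₁ * ψ w) := by
                refine setLIntegral_mono' measurableSet_ball fun x hx => ?_
                rw [mul_assoc]
                gcongr
                have hxu : edist x u ≤ ρ := by
                  rw [edist_dist]; exact ofReal_le_ofReal (mem_ball.1 hx).le
                refine rpow_le_of_comparable (by simp) (by simp) ?_ ?_ _
                · refine max_le ((le_max_left _ _).trans
                    (le_mul_of_one_le_left (by simp) (by norm_num))) ?_
                  rw [two_mul]
                  refine (edist_triangle u x w).trans ?_
                  rw [edist_comm u x]
                  exact add_le_add (hxu.trans (le_max_left _ _)) (le_max_right _ _)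
                · refine max_le ((le_max_left _ _).trans
                    (le_mul_of_one_le_left (by simp) (by norm_num))) ?_
                  rw [two_mul]
                  refine (edist_triangle x u w).trans ?_
                  exact add_le_add (hxu.trans (le_max_left _ _)) (le_max_right _ _)
            _ = (∫⁻ x in ball u R, edist x w ^ a₁) *
                  (2 ^ |b₁| * max ρ (edist u w) ^ b₁ * ψ w) := by
                rw [lintegral_mul_const _ (by fun_prop)]
            _ ≤ (C₁ * ρ ^ (n : ℝ) * max ρ (edist u w) ^ a₁) *
                  (2 ^ |b₁| * max ρ (edist u w) ^ b₁ * ψ w) := by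
                gcongr
                exact hC₁ u w R hR
            _ = _ := by
                rw [rpow_add _ _ (hmax0 _) hmt, rpow_zero]; ring
      _ = 2 ^ |b₁| * C₁ * ρ ^ (n : ℝ) *
            ∫⁻ w, (edist u w ^ (0 : ℝ) * max ρ (edist u w) ^ (a₁ + b₁) * ψ w) := by
          rw [lintegral_const_mul']
          exact mul_ne_top (mul_ne_top (by simp) (by simp))
            (rpow_ne_top_of_nonneg (by positivity) hρt)
      _ ≤ _ := by
          gcongr
          exact hC₀ ψ A h u ρ hρ0 hρt
  have hPm : Measurable P := by
    apply Measurable.lintegral_prod_right'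
      (f := fun q : E × E => edist q.1 q.2 ^ a₁ * max ρ (edist q.1 q.2) ^ b₁ * ψ q.2)
    fun_prop
  have hm1 : 0 ≤ m - 1 := by linarith
  calc ∫⁻ x in ball u R, potential (t - t') ψ x ^ m
      ≤ ∫⁻ x in ball u R, P x * (C₂ * A * ρ ^ (a₂ + b₂ + (n - t))) ^ (m - 1) :=
        lintegral_mono fun x => hV x
    _ = (∫⁻ x in ball u R, P x) * (C₂ * A * ρ ^ (a₂ + b₂ + (n - t))) ^ (m - 1) :=
        lintegral_mul_const _ hPm
    _ ≤ (2 ^ |b₁| * C₁ * ρ ^ (n : ℝ) * (C₀ * A * ρ ^ (0 + (a₁ + b₁) + (n - t)))) *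
          (C₂ * A * ρ ^ (a₂ + b₂ + (n - t))) ^ (m - 1) := by gcongr
    _ = (2 ^ |b₁| * C₁ * C₀ * (C₂ : ℝ≥0∞) ^ (m - 1)) * (A * A ^ (m - 1)) *
          (ρ ^ (n : ℝ) * ρ ^ (0 + (a₁ + b₁) + (n - t)) *
            ρ ^ ((a₂ + b₂ + (n - t)) * (m - 1))) := by
        rw [mul_rpow_of_nonneg _ _ hm1, mul_rpow_of_nonneg _ _ hm1,
          ← rpow_mul]
        generalize ρ ^ (n : ℝ) = x1
        generalize ρ ^ (0 + (a₁ + b₁) + (n - t)) = x2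
        generalize ρ ^ ((a₂ + b₂ + (n - t)) * (m - 1)) = x3
        ring
    _ = _ := by
        rw [← rpow_add _ _ hρ0 hρt, ← rpow_add _ _ hρ0 hρt,
          show (n : ℝ) + (0 + (a₁ + b₁) + (n - t)) + (a₂ + b₂ + (n - t)) * (m - 1) = n - m * t' by
            rw [ha₁, hb₁, ha₂, hb₂]; ring]
        have hA : A * A ^ (m - 1) = A ^ m := by
          calc A * A ^ (m - 1) = A ^ (1 : ℝ) * A ^ (m - 1) := by rw [rpow_one]
            _ = A ^ m := by rw [← rpow_add_of_nonneg _ _ (by norm_num) hm1]; simp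
        rw [hA]
        push_cast [coe_rpow_of_nonneg _ hm1, coe_rpow_of_nonneg _ (abs_nonneg b₁)]
        ring

/-! ### The trace inequality -/

/-- The `p`-th power of the Gagliardo seminorm at the critical exponents, where the kernel is
`|x - y| ^ (-2 n)`. -/
noncomputable def gagliardoEnergy (D : Set E) (p : ℝ) (f : E → F) : ℝ≥0∞ :=
  ∫⁻ x in D, ∫⁻ y in D, edist (f x) (f y) ^ p * edist x y ^ (-(2 * n : ℝ))

lemma measurable_edist_comp {f : E → F} (hf : StronglyMeasurable f) :
    Measurable fun q : E × E => edist (f q.1) (f q.2) :=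
  ((hf.comp_measurable measurable_fst).edist (hf.comp_measurable measurable_snd)).measurable

lemma measurable_edist_map {α : Type*} [MeasurableSpace α] {f : E → F} (hf : StronglyMeasurable f)
    {a b : α → E} (ha : Measurable a) (hb : Measurable b) :
    Measurable fun u => edist (f (a u)) (f (b u)) :=
  (measurable_edist_comp hf).comp (ha.prodMk hb)

/-- A ball centred in another ball, of at most twice its radius, meets it in a definite proportion
of its volume. -/
lemma volume_ball_inter_ball_ge [NeZero n] {x₀ x : E} {M r : ℝ} (hx : x ∈ ball x₀ M)
    (hr : 0 < r) (hrM : r ≤ 2 * M) :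
    ofReal (1 / 4) ^ n * volume (ball (0 : E) 1) * ofReal r ^ (n : ℝ)
      ≤ volume (ball x₀ M ∩ ball x r) := by
  have hM : 0 < M := by linarith
  set l := r / (4 * M) with hl
  have hl0 : 0 < l := by positivity
  have hl1 : l ≤ 1 / 2 := by rw [hl, div_le_iff₀ (by positivity)]; linarith
  have hlM : l * M = r / 4 := by rw [hl]; field_simp
  set x' := x + l • (x₀ - x) with hx'
  have hd : dist x x₀ < M := hx
  have h1 : dist x' x ≤ r / 4 := by
    rw [hx', dist_eq_norm, add_sub_cancel_left, norm_smul, Real.norm_of_nonneg hl0.le,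
      ← dist_eq_norm, dist_comm, ← hlM]
    gcongr
  have h2 : dist x' x₀ ≤ (1 - l) * dist x x₀ := by
    rw [hx', dist_eq_norm, dist_eq_norm, show x + l • (x₀ - x) - x₀ = (1 - l) • (x - x₀) by
      rw [sub_smul, one_smul, smul_sub, smul_sub]; abel, norm_smul,
      Real.norm_of_nonneg (by linarith)]
  have hsub : ball x' (r / 4) ⊆ ball x₀ M ∩ ball x r := by
    intro z hz
    rw [mem_ball] at hz
    constructor
    · rw [mem_ball]
      have := dist_triangle z x' x₀
      nlinarith
    · rw [mem_ball]
      linarith [dist_triangle z x' x]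
  refine le_trans (le_of_eq ?_) (measure_mono hsub)
  rw [Measure.addHaar_ball _ x' (by positivity : 0 ≤ r / 4), finrank_euclideanSpace_fin,
    ofReal_pow (by positivity), rpow_natCast,
    show r / 4 = 1 / 4 * r by ring, ofReal_mul (by norm_num), mul_pow]
  ring

lemma GrowthBound.ae_eq_zero {ψ : E → ℝ≥0∞} {e : ℝ} (hψ : Measurable ψ)
    (h : GrowthBound ψ 0 e) : ψ =ᵐ[volume] 0 := by
  have h1 : ∀ k : ℕ, ∀ᵐ z ∂volume, z ∈ ball (0 : E) (k + 1) → ψ z = 0 := by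
    intro k
    have := h 0 (k + 1) (by positivity)
    rw [zero_mul, nonpos_iff_eq_zero, lintegral_eq_zero_iff hψ] at this
    exact (ae_restrict_iff' measurableSet_ball).1 this
  filter_upwards [ae_all_iff.2 h1] with z hz
  obtain ⟨k, hk⟩ := exists_nat_gt (dist z 0)
  exact hz k (by rw [mem_ball]; linarith)

lemma gagliardoEnergy_mono {D D' : Set E} (h : D ⊆ D') (p : ℝ) (f : E → F) :
    gagliardoEnergy D p f ≤ gagliardoEnergy D' p f := by
  unfold gagliardoEnergy
  exact (lintegral_mono_set h).trans (lintegral_mono fun x => lintegral_mono_set h)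

/-- The indicator of `u` being closer to `x` than `y` is, by the factor `ϑ`. -/
noncomputable def closerIndicator (ϑ : ℝ) (x y u : E) : ℝ≥0∞ :=
  (ball x (ϑ * dist x y)).indicator (fun _ => 1) u

lemma measurable_closerIndicator (ϑ : ℝ) :
    Measurable fun q : E × E × E => closerIndicator ϑ q.1 q.2.1 q.2.2 := by
  have h : MeasurableSet {q : E × E × E | dist q.2.2 q.1 < ϑ * dist q.1 q.2.1} :=
    measurableSet_lt ((measurable_snd.comp measurable_snd).dist measurable_fst)
      ((measurable_fst.dist (measurable_fst.comp measurable_snd)).const_mul ϑ)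
  exact (measurable_const (a := (1 : ℝ≥0∞))).indicator h

/-- The difference of the values at `x` and `y` is compared with the values at the points `u` of
a ball around `x` which is smaller than `|x - y|` by the factor `ϑ`. -/
lemma edist_rpow_le_average [NeZero n] {p : ℝ} (hp : 1 ≤ p) : ∃ C : ℝ≥0, ∀ ϑ : ℝ, 0 < ϑ →
    ϑ ≤ 1 / 2 → ∀ f : E → F, ∀ (x₀ : E) (M : ℝ), ∀ x ∈ ball x₀ M, ∀ y ∈ ball x₀ M,
      x ≠ y → edist (f x) (f y) ^ p ≤ C * ofReal ϑ ^ (-(n : ℝ)) * edist x y ^ (-(n : ℝ)) *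
        ∫⁻ u in ball x₀ M, closerIndicator ϑ x y u *
          (edist (f x) (f u) ^ p + edist (f u) (f y) ^ p) := by
  set ω := volume (ball (0 : E) 1) with hω
  have hωt : ω ≠ ∞ := measure_ball_lt_top.ne
  have hω0 : ω ≠ 0 := (measure_ball_pos _ _ one_pos).ne'
  set c : ℝ≥0∞ := ofReal (1 / 4) ^ n * ω with hc
  have hc0 : c ≠ 0 := mul_ne_zero (pow_ne_zero _ (by norm_num)) hω0
  have hct : c ≠ ∞ := mul_ne_top (by simp) hωt
  have h2p : (2 : ℝ≥0∞) ^ (p - 1) ≠ ∞ := by simp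
  refine ⟨(c⁻¹ * 2 ^ (p - 1)).toNNReal, fun ϑ hϑ0 hϑ1 f x₀ M x hx y hy hxy => ?_⟩
  rw [coe_toNNReal (mul_ne_top (inv_ne_top.2 hc0) h2p)]
  set θ := ofReal ϑ with hθ
  have hθ0 : θ ≠ 0 := by simpa [hθ] using hϑ0
  have hθt : θ ≠ ∞ := by simp [hθ]
  set D := ball x₀ M with hD
  set r := edist x y with hr
  have hr0 : r ≠ 0 := (edist_pos.2 hxy).ne'
  have hrt : r ≠ ∞ := edist_ne_top _ _
  have hdpos : 0 < dist x y := dist_pos.2 hxy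
  have hdM : dist x y < 2 * M := by
    have := dist_triangle x x₀ y
    rw [hD, mem_ball] at hx hy
    rw [dist_comm x₀ y] at this
    linarith
  have hvol : c * (θ ^ (n : ℝ) * r ^ (n : ℝ)) ≤ ∫⁻ u in D, closerIndicator ϑ x y u := by
    have h1 := volume_ball_inter_ball_ge hx (r := ϑ * dist x y) (by positivity)
      (by nlinarith)
    rw [ofReal_mul hϑ0.le, ← edist_dist, mul_rpow_of_nonneg _ _ (by positivity)]
      at h1
    refine h1.trans (le_of_eq ?_)
    unfold closerIndicator
    rw [lintegral_indicator measurableSet_ball, setLIntegral_one,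
      Measure.restrict_apply measurableSet_ball, inter_comm]
  have h1 : c * (θ ^ (n : ℝ) * r ^ (n : ℝ)) * edist (f x) (f y) ^ p
      ≤ 2 ^ (p - 1) * ∫⁻ u in D, (closerIndicator ϑ x y u *
        (edist (f x) (f u) ^ p + edist (f u) (f y) ^ p)) := by
    have hSxy : Measurable fun u => closerIndicator ϑ x y u := by
      unfold closerIndicator
      exact measurable_const.indicator measurableSet_ball
    calc c * (θ ^ (n : ℝ) * r ^ (n : ℝ)) * edist (f x) (f y) ^ p
        ≤ (∫⁻ u in D, closerIndicator ϑ x y u) * edist (f x) (f y) ^ p := by gcongr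
      _ = ∫⁻ u in D, closerIndicator ϑ x y u * edist (f x) (f y) ^ p := by
          rw [lintegral_mul_const _ hSxy]
      _ ≤ ∫⁻ u in D, 2 ^ (p - 1) * (closerIndicator ϑ x y u *
            (edist (f x) (f u) ^ p + edist (f u) (f y) ^ p)) := by
          refine lintegral_mono fun u => ?_
          have : edist (f x) (f y) ^ p
              ≤ 2 ^ (p - 1) * (edist (f x) (f u) ^ p + edist (f u) (f y) ^ p) :=
            (rpow_le_rpow (edist_triangle _ (f u) _) (by linarith)).trans
              (ENNReal.rpow_add_le_mul_rpow_add_rpow _ _ hp)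
          calc _ ≤ closerIndicator ϑ x y u *
                (2 ^ (p - 1) * (edist (f x) (f u) ^ p + edist (f u) (f y) ^ p)) := by gcongr
            _ = _ := by ring
      _ = _ := lintegral_const_mul' _ _ h2p
  calc edist (f x) (f y) ^ p
      = (c⁻¹ * c) * (θ ^ (-(n : ℝ)) * θ ^ (n : ℝ)) * (r ^ (-(n : ℝ)) * r ^ (n : ℝ)) *
          edist (f x) (f y) ^ p := by
        rw [ENNReal.inv_mul_cancel hc0 hct, ← rpow_add _ _ hθ0 hθt,
          ← rpow_add _ _ hr0 hrt]
        simp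
    _ = c⁻¹ * θ ^ (-(n : ℝ)) * r ^ (-(n : ℝ)) *
          (c * (θ ^ (n : ℝ) * r ^ (n : ℝ)) * edist (f x) (f y) ^ p) := by ring
    _ ≤ c⁻¹ * θ ^ (-(n : ℝ)) * r ^ (-(n : ℝ)) * (2 ^ (p - 1) * ∫⁻ u in D,
          (closerIndicator ϑ x y u * (edist (f x) (f u) ^ p + edist (f u) (f y) ^ p))) := by
        gcongr
    _ = _ := by ring

/-- The part of the averaged integral which compares `x` with the nearby point `u`: integrating
out `y`, it is the original integral at smaller scales, with a gain of `ϑ ^ (2 n - κ)`. The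
weight `W` may grow at most like the power `κ` of the distance. -/
lemma lintegral_closer_left_le [NeZero n] {κ : ℝ} (hκ : 0 < κ) (hκn : κ < n) : ∃ C : ℝ≥0,
    ∀ ϑ : ℝ, 0 < ϑ → ϑ ≤ 1 / 2 → ∀ (W : E → E → ℝ≥0∞) (x u : E), u ≠ x →
    Measurable (W x) →
    (∀ y, y ≠ x → edist x u ≤ edist x y → W x y ≤ edist x y ^ κ * edist x u ^ (-κ) * W x u) →
    ∀ (D : Set E), ∫⁻ y in D, closerIndicator ϑ x y u * (edist x y ^ (-(3 * n : ℝ)) * W x y)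
      ≤ C * ofReal ϑ ^ (2 * n - κ) * (edist x u ^ (-(2 * n : ℝ)) * W x u) := by
  obtain ⟨C₁, hC₁⟩ := lintegral_compl_ball_edist_rpow_le (n := n) (a := κ - 3 * n) (e := n)
    (by linarith)
  set ω := volume (ball (0 : E) 1) with hω
  have hωt : ω ≠ ∞ := measure_ball_lt_top.ne
  refine ⟨C₁ * ω.toNNReal, fun ϑ hϑ0 hϑ1 W x u hu hWm hW D => ?_⟩
  rw [coe_mul, coe_toNNReal hωt]
  set θ := ofReal ϑ with hθ
  have hθ0 : θ ≠ 0 := by simpa [hθ] using hϑ0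
  have hθt : θ ≠ ∞ := by simp [hθ]
  set ρ := edist x u with hρ
  have hρ0 : ρ ≠ 0 := (edist_pos.2 (Ne.symm hu)).ne'
  have hρt : ρ ≠ ∞ := edist_ne_top _ _
  have hux : 0 < dist u x := dist_pos.2 hu
  have h1 : ∫⁻ y in D, closerIndicator ϑ x y u * (edist x y ^ (-(3 * n : ℝ)) * W x y)
      ≤ ρ ^ (-κ) * W x u * ∫⁻ y in (ball x (dist u x / ϑ))ᶜ,
        edist x y ^ (κ - 3 * n) * 1 := by
    rw [← lintegral_const_mul _ (by fun_prop), ← lintegral_indicator measurableSet_ball.compl]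
    refine (lintegral_mono' Measure.restrict_le_self le_rfl).trans (lintegral_mono fun y => ?_)
    unfold closerIndicator
    by_cases hy : u ∈ ball x (ϑ * dist x y)
    · rw [indicator_of_mem hy]
      rw [mem_ball] at hy
      have hxy : 0 < dist x y := by
        by_contra hcon
        have : dist x y = 0 := le_antisymm (not_lt.1 hcon) dist_nonneg
        rw [this, mul_zero] at hy
        linarith
      have hyn : y ∈ (ball x (dist u x / ϑ))ᶜ := by
        simp only [mem_compl_iff, mem_ball, not_lt]
        rw [div_le_iff₀ hϑ0, dist_comm y x]
        linarith
      rw [indicator_of_mem hyn, one_mul, mul_one]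
      set r := edist x y with hr
      have hr0 : r ≠ 0 := (edist_pos.2 (dist_pos.1 hxy)).ne'
      have hrt : r ≠ ∞ := edist_ne_top _ _
      have hρr : ρ ≤ r := by
        rw [hρ, hr, edist_dist, edist_dist]
        refine ofReal_le_ofReal ?_
        rw [dist_comm x u]
        nlinarith
      calc r ^ (-(3 * n : ℝ)) * W x y
          ≤ r ^ (-(3 * n : ℝ)) * (r ^ κ * ρ ^ (-κ) * W x u) := by
            gcongr
            exact hW y (dist_pos.1 hxy).symm hρr
        _ = ρ ^ (-κ) * W x u * r ^ (κ - 3 * n) := by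
            rw [show κ - 3 * n = -(3 * n : ℝ) + κ by ring, rpow_add _ κ hr0 hrt]
            ring
    · rw [indicator_of_notMem hy, zero_mul]
      exact zero_le
  calc _ ≤ ρ ^ (-κ) * W x u * (C₁ * ω * ofReal (dist u x / ϑ) ^ (κ - 3 * n + n)) := by
        refine h1.trans ?_
        gcongr
        exact hC₁ _ _ growthBound_one x _ (by positivity)
    _ = _ := by
        have e1 : ofReal (dist u x / ϑ) ^ (κ - 3 * n + n)
            = ρ ^ (κ - 2 * n) * θ ^ (2 * n - κ) := by
          rw [ENNReal.ofReal_div_of_pos hϑ0, ← edist_dist, edist_comm u x, ← hρ, ← hθ,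
            div_eq_mul_inv, mul_rpow_of_ne_top hρt (inv_ne_top.2 hθ0),
            inv_rpow, ← rpow_neg]
          congr 2 <;> ring
        have e2 : ρ ^ (-(2 * n : ℝ)) = ρ ^ (-κ) * ρ ^ (κ - 2 * n) := by
          rw [← rpow_add _ _ hρ0 hρt]; congr 1; ring
        rw [e1, e2]
        generalize θ ^ (2 * n - κ) = x1
        generalize ρ ^ (-κ) = x2
        generalize ρ ^ (κ - 2 * n) = x3
        ring

/-- In the part which compares the nearby point `u` with `y`, only the mean of the weight over
balls enters, after `x` has been integrated out. -/
lemma lintegral_closer_right_le {κ : ℝ} (hκ : 0 < κ) (hκn : κ < n) {ϑ : ℝ} (hϑ0 : 0 < ϑ)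
    (hϑ1 : ϑ ≤ 1 / 2) {ψ : E → ℝ≥0∞} {A : ℝ≥0∞} (hψ : Measurable ψ)
    (h : GrowthBound ψ A (n - κ)) (W : E → E → ℝ≥0∞) (hW : ∀ x y, W x y ≤ edist x y ^ κ * ψ x)
    {u y : E} (hyu : y ≠ u) (D : Set E) :
    ∫⁻ x in D, closerIndicator ϑ x y u * (edist x y ^ (-(3 * n : ℝ)) * W x y)
      ≤ 2 ^ (3 * n - κ) * A * edist u y ^ (-(2 * n : ℝ)) := by
  set r := edist u y with hr
  have hr0 : r ≠ 0 := (edist_pos.2 (Ne.symm hyu)).ne'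
  have hrt : r ≠ ∞ := edist_ne_top _ _
  have huy : 0 < dist u y := dist_pos.2 (Ne.symm hyu)
  have h1 : ∫⁻ x in D, closerIndicator ϑ x y u * (edist x y ^ (-(3 * n : ℝ)) * W x y)
      ≤ 2 ^ (3 * n - κ) * r ^ (κ - 3 * n) * ∫⁻ x in ball u (dist u y), ψ x := by
    rw [← lintegral_const_mul _ hψ, ← lintegral_indicator measurableSet_ball]
    refine (lintegral_mono' Measure.restrict_le_self le_rfl).trans (lintegral_mono fun x => ?_)
    unfold closerIndicator
    by_cases hx : u ∈ ball x (ϑ * dist x y)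
    · rw [indicator_of_mem hx]
      rw [mem_ball] at hx
      have hxy : x ≠ y := by
        rintro rfl
        rw [dist_self, mul_zero] at hx
        linarith [dist_nonneg (x := u) (y := x)]
      have hxy0 : edist x y ≠ 0 := (edist_pos.2 hxy).ne'
      have hxyd : 0 < dist x y := dist_pos.2 hxy
      have h3 : dist u y ≤ 2 * dist x y := by
        have := dist_triangle u x y
        nlinarith
      have hxm : x ∈ ball u (dist u y) := by
        have := dist_triangle x u y
        rw [dist_comm x u] at this
        rw [mem_ball, dist_comm]
        nlinarith
      rw [indicator_of_mem hxm, one_mul]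
      calc edist x y ^ (-(3 * n : ℝ)) * W x y
          ≤ edist x y ^ (-(3 * n : ℝ)) * (edist x y ^ κ * ψ x) := by
            gcongr
            exact hW x y
        _ = edist x y ^ (κ - 3 * n) * ψ x := by
            rw [show κ - 3 * n = -(3 * n : ℝ) + κ by ring,
              rpow_add _ κ hxy0 (edist_ne_top _ _)]
            ring
        _ ≤ 2 ^ (3 * n - κ) * r ^ (κ - 3 * n) * ψ x := by
            gcongr
            have := rpow_le_mul_rpow_of_nonpos (by simp) (by simp)
              (show κ - 3 * n ≤ 0 by nlinarith) (edist_le_two_mul h3)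
            rwa [neg_sub] at this
    · rw [indicator_of_notMem hx, zero_mul]
      exact zero_le
  calc _ ≤ 2 ^ (3 * n - κ) * r ^ (κ - 3 * n) * (A * ofReal (dist u y) ^ (n - κ)) := by
        refine h1.trans ?_
        gcongr
        exact h u _ huy
    _ = _ := by
        have e2 : r ^ (-(2 * n : ℝ)) = r ^ (κ - 3 * n) * r ^ (n - κ) := by
          rw [← rpow_add _ _ hr0 hrt]; congr 1; ring
        rw [← edist_dist, e2, ← hr]
        ring

/-- One absorption step for `lintegral_trace_le`: the integral with weight `W` is at most
`C ϑ^{n-κ}` times itself, plus a multiple of the energy. -/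
lemma trace_absorption_step [NeZero n] {p κ : ℝ} (hp : 1 ≤ p) (hκ : 0 < κ) (hκn : κ < n) :
    ∃ C : ℝ≥0, ∀ ϑ : ℝ, 0 < ϑ → ϑ ≤ 1 / 2 → ∀ f : E → F, StronglyMeasurable f →
    ∀ (ψ : E → ℝ≥0∞) (A : ℝ≥0∞), Measurable ψ → GrowthBound ψ A (n - κ) →
    ∀ W : E → E → ℝ≥0∞, (Measurable fun q : E × E => W q.1 q.2) →
    (∀ x y, W x y ≤ edist x y ^ κ * ψ x) →
    (∀ x y u, y ≠ x → u ≠ x → edist x u ≤ edist x y →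
      W x y ≤ edist x y ^ κ * edist x u ^ (-κ) * W x u) →
    ∀ (x₀ : E) (M : ℝ),
      ∫⁻ x in ball x₀ M, ∫⁻ y in ball x₀ M,
          edist (f x) (f y) ^ p * edist x y ^ (-(2 * n : ℝ)) * W x y
        ≤ C * ofReal ϑ ^ (n - κ) *
            (∫⁻ x in ball x₀ M, ∫⁻ y in ball x₀ M,
              edist (f x) (f y) ^ p * edist x y ^ (-(2 * n : ℝ)) * W x y)
          + C * ofReal ϑ ^ (-(n : ℝ)) * A * gagliardoEnergy (ball x₀ M) p f := by
  obtain ⟨C₀, hC₀⟩ := edist_rpow_le_average (n := n) (F := F) hp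
  obtain ⟨C₁, hC₁⟩ := lintegral_closer_left_le (n := n) hκ hκn
  have h2k : (2 : ℝ≥0∞) ^ (3 * n - κ) ≠ ∞ := by simp
  refine ⟨C₀ * C₁ + C₀ * ((2 : ℝ≥0∞) ^ (3 * n - κ)).toNNReal,
    fun ϑ hϑ0 hϑ1 f hf ψ A hψ h W hWm hWψ hWr x₀ M => ?_⟩
  push_cast [coe_toNNReal h2k]
  set D := ball x₀ M with hD
  set μ : Measure E := volume.restrict D with hμ
  set θ := ofReal ϑ with hθ
  have hθ0 : θ ≠ 0 := by simpa [hθ] using hϑ0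
  have hθt : θ ≠ ∞ := by simp [hθ]
  have hd := measurable_edist_comp hf
  have hSm := measurable_closerIndicator (n := n) ϑ
  have hm₀ : Measurable fun q : E × E × E => closerIndicator ϑ q.1 q.2.1 q.2.2 *
      (edist q.1 q.2.1 ^ (-(3 * n : ℝ)) * W q.1 q.2.1) :=
    hSm.mul (Measurable.mul (by fun_prop)
      (hWm.comp (measurable_fst.prodMk (measurable_fst.comp measurable_snd))))
  set G : E × E × E → ℝ≥0∞ := fun q => closerIndicator ϑ q.1 q.2.1 q.2.2 *
      (edist q.1 q.2.1 ^ (-(3 * n : ℝ)) * W q.1 q.2.1) with hG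
  have hm₁ : Measurable fun q : E × E × E => G q * edist (f q.1) (f q.2.2) ^ p :=
    hm₀.mul ((hd.comp (measurable_fst.prodMk
      (measurable_snd.comp measurable_snd))).pow_const _)
  have hm₂ : Measurable fun q : E × E × E => G q * edist (f q.2.2) (f q.2.1) ^ p :=
    hm₀.mul ((hd.comp ((measurable_snd.comp measurable_snd).prodMk
      (measurable_fst.comp measurable_snd))).pow_const _)
  set N := ∫⁻ x in D, ∫⁻ y in D, edist (f x) (f y) ^ p * edist x y ^ (-(2 * n : ℝ)) * W x y
    with hNdef
  set T₁ := ∫⁻ x, ∫⁻ y, ∫⁻ u, G (x, y, u) * edist (f x) (f u) ^ p ∂μ ∂μ ∂μ with hT₁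
  set T₂ := ∫⁻ x, ∫⁻ y, ∫⁻ u, G (x, y, u) * edist (f u) (f y) ^ p ∂μ ∂μ ∂μ with hT₂
  have hN : N ≤ C₀ * θ ^ (-(n : ℝ)) * (T₁ + T₂) := by
    have hk : C₀ * θ ^ (-(n : ℝ)) ≠ ∞ :=
      mul_ne_top (by simp) (rpow_ne_top_of_ne_zero hθ0 hθt)
    have hmx : ∀ x, Measurable fun q : E × E => G (x, q.1, q.2) * edist (f x) (f q.2) ^ p :=
      fun x => hm₁.comp measurable_prodMk_left
    have hmy : Measurable fun q : E × E => ∫⁻ u, G (q.1, q.2, u) * edist (f q.1) (f u) ^ p ∂μ :=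
      Measurable.lintegral_prod_right' (ν := μ)
        (f := fun q : (E × E) × E => G (q.1.1, q.1.2, q.2) * edist (f q.1.1) (f q.2) ^ p)
        (hm₁.comp MeasurableEquiv.prodAssoc.measurable)
    rw [hT₁, hT₂, ← lintegral_add_left hmy.lintegral_prod_right', ← lintegral_const_mul' _ _ hk]
    refine setLIntegral_mono' measurableSet_ball fun x hx => ?_
    rw [← lintegral_add_left (hmx x).lintegral_prod_right', ← lintegral_const_mul' _ _ hk]
    refine lintegral_mono_ae ?_
    filter_upwards [ae_restrict_mem measurableSet_ball,
      ae_restrict_of_ae (Measure.ae_ne volume x)] with y hy hyx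
    have hmxy : Measurable fun u => G (x, y, u) * edist (f x) (f u) ^ p :=
      hm₁.comp (measurable_const.prodMk measurable_prodMk_left)
    rw [← lintegral_add_left hmxy]
    have h1 := hC₀ ϑ hϑ0 hϑ1 f x₀ M x hx y hy (Ne.symm hyx)
    set r := edist x y with hr
    have hr0 : r ≠ 0 := (edist_pos.2 (Ne.symm hyx)).ne'
    have hrt : r ≠ ∞ := edist_ne_top _ _
    have hmu : Measurable fun u => closerIndicator ϑ x y u *
          (edist (f x) (f u) ^ p + edist (f u) (f y) ^ p) := by
      refine (hSm.comp (measurable_const.prodMk measurable_prodMk_left)).mul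
        (Measurable.add ?_ ?_)
      · exact (hd.comp measurable_prodMk_left).pow_const _
      · exact (hd.comp measurable_prodMk_right).pow_const _
    calc edist (f x) (f y) ^ p * r ^ (-(2 * n : ℝ)) * W x y
        ≤ (C₀ * θ ^ (-(n : ℝ)) * r ^ (-(n : ℝ)) * ∫⁻ u in D, closerIndicator ϑ x y u *
          (edist (f x) (f u) ^ p + edist (f u) (f y) ^ p)) * r ^ (-(2 * n : ℝ)) * W x y := by
          gcongr
      _ = C₀ * θ ^ (-(n : ℝ)) * ((r ^ (-(3 * n : ℝ)) * W x y) *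
            ∫⁻ u in D, closerIndicator ϑ x y u *
              (edist (f x) (f u) ^ p + edist (f u) (f y) ^ p)) := by
          rw [show -(3 * n : ℝ) = -n + -(2 * n) by ring, rpow_add _ (-(2 * n : ℝ)) hr0 hrt]
          generalize r ^ (-(2 * n : ℝ)) = x1
          ring
      _ = _ := by
          rw [← lintegral_const_mul _ hmu]
          congr 2
          ext u
          simp only [hG, ← hr]
          ring
  have hT₁le : T₁ ≤ C₁ * θ ^ (2 * n - κ) * N := by
    have hk : C₁ * θ ^ (2 * n - κ) ≠ ∞ :=
      mul_ne_top (by simp) (rpow_ne_top_of_ne_zero hθ0 hθt)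
    rw [hT₁, hNdef, ← lintegral_const_mul' _ _ hk]
    refine lintegral_mono fun x => ?_
    dsimp only
    have hmx : Measurable fun q : E × E => G (x, q.1, q.2) * edist (f x) (f q.2) ^ p :=
      hm₁.comp measurable_prodMk_left
    rw [lintegral_lintegral_swap (f := fun y u => G (x, y, u) * edist (f x) (f u) ^ p)
        hmx.aemeasurable,
      ← lintegral_const_mul' _ _ hk]
    refine lintegral_mono_ae ?_
    filter_upwards [ae_restrict_of_ae (Measure.ae_ne volume x)] with u hu
    have hmy : Measurable fun y => G (x, y, u) :=
      hm₀.comp (measurable_const.prodMk measurable_prodMk_right)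
    rw [lintegral_mul_const _ hmy]
    calc _ ≤ (C₁ * θ ^ (2 * n - κ) * (edist x u ^ (-(2 * n : ℝ)) * W x u)) *
          edist (f x) (f u) ^ p := by
          gcongr
          exact hC₁ ϑ hϑ0 hϑ1 W x u hu (hWm.comp measurable_prodMk_left)
            (fun y hy hle => hWr x y u hy hu hle) D
      _ = _ := by
          generalize θ ^ (2 * n - κ) = x1
          ring
  have hT₂le : T₂ ≤ 2 ^ (3 * n - κ) * A * gagliardoEnergy D p f := by
    have hsw : T₂ = ∫⁻ u, ∫⁻ y, ∫⁻ x, G (x, y, u) * edist (f u) (f y) ^ p ∂μ ∂μ ∂μ := by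
      rw [hT₂, lintegral_lintegral_swap]
      · calc _ = ∫⁻ y, ∫⁻ u, ∫⁻ x, G (x, y, u) * edist (f u) (f y) ^ p ∂μ ∂μ ∂μ := by
              refine lintegral_congr fun y => ?_
              rw [lintegral_lintegral_swap]
              exact (hm₂.comp (measurable_fst.prodMk
                (measurable_const.prodMk measurable_snd))).aemeasurable
          _ = _ := by
              rw [lintegral_lintegral_swap]
              refine Measurable.aemeasurable ?_
              exact Measurable.lintegral_prod_right' (ν := μ)
                (f := fun q : (E × E) × E => G (q.2, q.1.1, q.1.2) *
                  edist (f q.1.2) (f q.1.1) ^ p)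
                (hm₂.comp (measurable_snd.prodMk measurable_fst))
      · refine Measurable.aemeasurable ?_
        exact Measurable.lintegral_prod_right' (ν := μ)
          (f := fun q : (E × E) × E => G (q.1.1, q.1.2, q.2) * edist (f q.2) (f q.1.2) ^ p)
          (hm₂.comp MeasurableEquiv.prodAssoc.measurable)
    have hm : Measurable fun q : E × E =>
        edist (f q.1) (f q.2) ^ p * edist q.1 q.2 ^ (-(2 * n : ℝ)) := by fun_prop
    rw [hsw, gagliardoEnergy, ← lintegral_const_mul _ hm.lintegral_prod_right']
    refine lintegral_mono fun u => ?_
    have hmu : Measurable fun y => edist (f u) (f y) ^ p * edist u y ^ (-(2 * n : ℝ)) :=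
      hm.comp measurable_prodMk_left
    dsimp only
    rw [← lintegral_const_mul _ hmu]
    refine lintegral_mono_ae ?_
    filter_upwards [ae_restrict_of_ae (Measure.ae_ne volume u)] with y hy
    have hmx : Measurable fun x => G (x, y, u) := hm₀.comp measurable_prodMk_right
    rw [lintegral_mul_const _ hmx]
    calc _ ≤ (2 ^ (3 * n - κ) * A * edist u y ^ (-(2 * n : ℝ))) * edist (f u) (f y) ^ p := by
          gcongr
          exact lintegral_closer_right_le hκ hκn hϑ0 hϑ1 hψ h W hWψ hy D
      _ = _ := by ring
  calc N ≤ C₀ * θ ^ (-(n : ℝ)) * (T₁ + T₂) := hN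
    _ ≤ C₀ * θ ^ (-(n : ℝ)) * (C₁ * θ ^ (2 * n - κ) * N +
          2 ^ (3 * n - κ) * A * gagliardoEnergy D p f) := by gcongr
    _ = C₀ * C₁ * θ ^ (n - κ) * N +
          C₀ * 2 ^ (3 * n - κ) * θ ^ (-(n : ℝ)) * A * gagliardoEnergy D p f := by
        have e1 : θ ^ (n - κ) = θ ^ (-(n : ℝ)) * θ ^ (2 * n - κ) := by
          rw [← rpow_add _ _ hθ0 hθt]; congr 1; ring
        rw [e1]
        generalize θ ^ (-(n : ℝ)) = x1
        generalize θ ^ (2 * n - κ) = x2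
        generalize (2 : ℝ≥0∞) ^ (3 * n - κ) = x3
        ring
    _ ≤ _ := by
        gcongr
        · exact le_self_add
        · exact le_add_self

/-- **Trace inequality.** If `ψ` has growth exponent `n - κ`, then the critical energy with the
weaker kernel `|x - y|^{κ - 2n}` but the additional weight `ψ x` is controlled by the critical
energy on the same ball. This plays the role of Sobolev's inequality. Truncating the weight makes
the left side finite, and `trace_absorption_step` allows to absorb it. -/
lemma lintegral_trace_le [NeZero n] {p κ : ℝ} (hp : 1 ≤ p) (hκ : 0 < κ) (hκn : κ < n) :
    ∃ C : ℝ≥0, ∀ f : E → F, StronglyMeasurable f →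
    ∀ (ψ : E → ℝ≥0∞) (A : ℝ≥0∞), Measurable ψ → GrowthBound ψ A (n - κ) →
    ∀ (x₀ : E) (M : ℝ),
      ∫⁻ x in ball x₀ M, ∫⁻ y in ball x₀ M,
          edist (f x) (f y) ^ p * edist x y ^ (κ - 2 * n) * ψ x
        ≤ C * A * gagliardoEnergy (ball x₀ M) p f := by
  obtain ⟨C, hC⟩ := trace_absorption_step (n := n) (F := F) hp hκ hκn
  obtain ⟨ϑ, hϑ0, hϑ1, hϑC⟩ : ∃ ϑ : ℝ, 0 < ϑ ∧ ϑ ≤ 1 / 2 ∧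
      (C : ℝ≥0∞) * ofReal ϑ ^ (n - κ) ≤ 1 / 2 := by
    have hnk : 0 < (n : ℝ) - κ := by linarith
    set b : ℝ := (1 / (2 * (C + 1))) ^ (1 / (n - κ)) with hb
    have hb0 : 0 < b := by positivity
    refine ⟨min (1 / 2) b, by positivity, min_le_left _ _, ?_⟩
    have h1 : ofReal (min (1 / 2) b) ^ (n - κ) ≤ ofReal (1 / (2 * (C + 1))) := by
      rw [ENNReal.ofReal_rpow_of_pos (by positivity)]
      refine ofReal_le_ofReal ?_
      calc (min (1 / 2) b) ^ (n - κ) ≤ b ^ (n - κ) :=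
            Real.rpow_le_rpow (by positivity) (min_le_right _ _) hnk.le
        _ = 1 / (2 * (C + 1)) := by
            rw [hb, ← Real.rpow_mul (by positivity), one_div_mul_cancel hnk.ne', Real.rpow_one]
    calc (C : ℝ≥0∞) * ofReal (min (1 / 2) b) ^ (n - κ)
        ≤ C * ofReal (1 / (2 * (C + 1))) := by gcongr
      _ = ofReal (C * (1 / (2 * (C + 1)))) := by
          rw [ofReal_mul (by positivity), ENNReal.ofReal_coe_nnreal]
      _ ≤ ofReal (1 / 2) := by
          refine ofReal_le_ofReal ?_
          rw [mul_one_div, div_le_div_iff₀ (by positivity) (by positivity)]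
          linarith
      _ = 1 / 2 := by rw [ENNReal.ofReal_div_of_pos (by norm_num)]; simp
  set θ := ofReal ϑ with hθ
  have hθ0 : θ ≠ 0 := by simpa [hθ] using hϑ0
  have hθn : θ ^ (-(n : ℝ)) ≠ ∞ := rpow_ne_top_of_ne_zero hθ0 (by simp [hθ])
  set K : ℝ≥0∞ := 2 * (C * θ ^ (-(n : ℝ))) + 1 with hK
  have hKt : K ≠ ∞ := by
    simp only [hK, ne_eq, ENNReal.add_eq_top, one_ne_top, or_false]
    exact mul_ne_top (by simp) (mul_ne_top (by simp) hθn)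
  refine ⟨K.toNNReal, fun f hf ψ A hψ h x₀ M => ?_⟩
  rw [coe_toNNReal hKt]
  set D := ball x₀ M with hD
  have hd := measurable_edist_comp hf
  by_cases hA : A = 0
  · subst hA
    have h0 : ∫⁻ x in D, ∫⁻ y in D, edist (f x) (f y) ^ p * edist x y ^ (κ - 2 * n) * ψ x = 0 := by
      rw [lintegral_congr_ae (g := fun _ => 0), lintegral_zero]
      filter_upwards [ae_restrict_of_ae (h.ae_eq_zero hψ)] with x hx
      rw [hx]
      simp
    rw [h0]
    exact zero_le
  by_cases hE : gagliardoEnergy D p f = ∞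
  · rw [hE, ENNReal.mul_top]
    · exact le_top
    · exact mul_ne_zero (by simp [hK]) hA
  -- the truncated inequality
  have hj : ∀ j : ℕ, ∫⁻ x in D, ∫⁻ y in D, edist (f x) (f y) ^ p * edist x y ^ (-(2 * n : ℝ)) *
      min (edist x y ^ κ * ψ x) j ≤ K * A * gagliardoEnergy D p f := by
    intro j
    set N := ∫⁻ x in D, ∫⁻ y in D, edist (f x) (f y) ^ p * edist x y ^ (-(2 * n : ℝ)) *
      min (edist x y ^ κ * ψ x) j with hN
    have hNt : N ≠ ∞ := by
      refine ne_top_of_le_ne_top (mul_ne_top hE (ENNReal.natCast_ne_top j)) ?_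
      rw [gagliardoEnergy, ← lintegral_mul_const' _ _ (ENNReal.natCast_ne_top j)]
      refine lintegral_mono fun x => ?_
      rw [← lintegral_mul_const' _ _ (ENNReal.natCast_ne_top j)]
      refine lintegral_mono fun y => ?_
      gcongr
      exact min_le_right _ _
    have hone : ∀ x y u : E, u ≠ x → edist x u ≤ edist x y →
        1 ≤ edist x y ^ κ * edist x u ^ (-κ) := by
      intro x y u hu hle
      have hu0 : edist x u ≠ 0 := (edist_pos.2 (Ne.symm hu)).ne'
      calc (1 : ℝ≥0∞) = edist x u ^ κ * edist x u ^ (-κ) := by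
            rw [← rpow_add _ _ hu0 (edist_ne_top _ _)]; simp
        _ ≤ _ := by gcongr
    have h1 := hC ϑ hϑ0 hϑ1 f hf ψ A hψ h (fun x y => min (edist x y ^ κ * ψ x) j)
      ((show Measurable fun q : E × E => edist q.1 q.2 ^ κ * ψ q.1 by fun_prop).min
        measurable_const) (fun x y => min_le_left _ _) (fun x y u hy hu hle => by
        rw [mul_min]
        refine min_le_min (le_of_eq ?_) ?_
        · have hu0 : edist x u ≠ 0 := (edist_pos.2 (Ne.symm hu)).ne'
          calc edist x y ^ κ * ψ x
              = edist x y ^ κ * (edist x u ^ (-κ) * edist x u ^ κ) * ψ x := by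
                rw [← rpow_add _ _ hu0 (edist_ne_top _ _)]; simp
            _ = _ := by ring
        · exact le_mul_of_one_le_left zero_le (hone x y u hu hle)) x₀ M
    rw [← hD, ← hN, ← hθ] at h1
    set B := C * θ ^ (-(n : ℝ)) * A * gagliardoEnergy D p f with hB
    have h2 : N ≤ N / 2 + B := by
      refine h1.trans ?_
      gcongr
      calc C * θ ^ (n - κ) * N ≤ 1 / 2 * N := by gcongr
        _ = N / 2 := by rw [one_div, mul_comm, div_eq_mul_inv]
    have h3 : N / 2 ≤ B := by
      have h4 : N / 2 + N / 2 ≤ N / 2 + B := by rwa [ENNReal.add_halves]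
      exact (ENNReal.add_le_add_iff_left (ENNReal.div_ne_top hNt (by simp))).1 h4
    calc N = N / 2 + N / 2 := (ENNReal.add_halves N).symm
      _ ≤ B + B := add_le_add h3 h3
      _ = 2 * (C * θ ^ (-(n : ℝ))) * A * gagliardoEnergy D p f := by rw [hB]; ring
      _ ≤ K * A * gagliardoEnergy D p f := by
          gcongr
          exact le_self_add
  -- remove the truncation by monotone convergence
  have hmj : ∀ j : ℕ, Measurable fun q : E × E => edist (f q.1) (f q.2) ^ p *
      edist q.1 q.2 ^ (-(2 * n : ℝ)) * min (edist q.1 q.2 ^ κ * ψ q.1) (j : ℝ≥0∞) := by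
    intro j
    have : Measurable fun q : E × E => edist q.1 q.2 ^ κ * ψ q.1 := by fun_prop
    exact Measurable.mul (by fun_prop) (this.min measurable_const)
  have hsup : ∫⁻ x in D, ∫⁻ y in D, edist (f x) (f y) ^ p * edist x y ^ (κ - 2 * n) * ψ x
      = ⨆ j : ℕ, ∫⁻ x in D, ∫⁻ y in D, edist (f x) (f y) ^ p * edist x y ^ (-(2 * n : ℝ)) *
        min (edist x y ^ κ * ψ x) j := by
    have hmono : ∀ a b : ℝ≥0∞, Monotone fun j : ℕ => a * min b (j : ℝ≥0∞) := by
      intro a b i j hij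
      dsimp only
      gcongr
    rw [← lintegral_iSup]
    · refine lintegral_congr fun x => ?_
      rw [← lintegral_iSup]
      · refine lintegral_congr_ae ?_
        filter_upwards [ae_restrict_of_ae (Measure.ae_ne volume x)] with y hy
        rw [← ENNReal.mul_iSup, ← inf_iSup_eq, ENNReal.iSup_natCast, inf_top_eq,
          show κ - 2 * n = -(2 * n : ℝ) + κ by ring,
          rpow_add _ κ (edist_pos.2 (Ne.symm hy)).ne' (edist_ne_top _ _)]
        ring
      · exact fun j => (hmj j).comp measurable_prodMk_left
      · exact fun i j hij y => hmono _ _ hij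
    · exact fun j => (hmj j).lintegral_prod_right'
    · exact fun i j hij x => lintegral_mono fun y => hmono _ _ hij
  rw [hsup]
  exact iSup_le hj

/-! ### Hölder's inequality with power weights and differences of Riesz kernels -/

open Classical in
/-- The indicator of a proposition, as an element of `[0, ∞]`. -/
noncomputable def ind (P : Prop) : ℝ≥0∞ := if P then 1 else 0

lemma ind_of_true {P : Prop} (h : P) : ind P = 1 := if_pos h

lemma ind_of_false {P : Prop} (h : ¬P) : ind P = 0 := if_neg h

lemma ind_le_one (P : Prop) : ind P ≤ 1 := by
  by_cases h : P
  · rw [ind_of_true h]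
  · rw [ind_of_false h]; exact zero_le

lemma ind_mul_le_of_imp {P : Prop} {a b : ℝ≥0∞} (h : P → a ≤ b) : ind P * a ≤ b := by
  by_cases hP : P
  · rw [ind_of_true hP, one_mul]; exact h hP
  · rw [ind_of_false hP, zero_mul]; exact zero_le

lemma measurable_ind {α : Type*} [MeasurableSpace α] {P : α → Prop}
    (h : MeasurableSet {a | P a}) : Measurable fun a => ind (P a) := by
  classical
  exact Measurable.ite h measurable_const measurable_const

lemma measurable_ind_le {α : Type*} [MeasurableSpace α] {f g : α → ℝ≥0∞} (hf : Measurable f)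
    (hg : Measurable g) : Measurable fun a => ind (f a ≤ g a) :=
  measurable_ind (measurableSet_le hf hg)

/-- `lintegral_ball_edist_rpow_le` with an indicator in place of a ball. -/
lemma lintegral_ind_near_le [NeZero n] {a e : ℝ} (hae : 0 < a + e) : ∃ C : ℝ≥0,
    ∀ (ψ : E → ℝ≥0∞) (A : ℝ≥0∞), GrowthBound ψ A e → ∀ (x : E) (R : ℝ≥0∞), R ≠ 0 → R ≠ ∞ →
      ∫⁻ z, ind (edist x z ≤ R) * (edist x z ^ a * ψ z) ≤ C * A * R ^ (a + e) := by
  obtain ⟨C, hC⟩ := lintegral_ball_edist_rpow_le (n := n) hae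
  refine ⟨C * 2 ^ (a + e), fun ψ A h x R hR0 hRt => ?_⟩
  have hR : 0 < R.toReal := ENNReal.toReal_pos hR0 hRt
  calc ∫⁻ z, ind (edist x z ≤ R) * (edist x z ^ a * ψ z)
      ≤ ∫⁻ z in ball x (2 * R.toReal), edist x z ^ a * ψ z := by
        rw [← lintegral_indicator measurableSet_ball]
        refine lintegral_mono fun z => ind_mul_le_of_imp fun hz => ?_
        rw [indicator_of_mem]
        rw [edist_comm, edist_dist] at hz
        have := (ENNReal.ofReal_le_iff_le_toReal hRt).1 hz
        rw [mem_ball]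
        linarith
    _ ≤ C * A * ofReal (2 * R.toReal) ^ (a + e) := hC ψ A h x _ (by positivity)
    _ = _ := by
        rw [ofReal_mul (by norm_num), ofReal_toReal hRt,
          mul_rpow_of_nonneg _ _ hae.le, ofReal_ofNat, coe_mul,
          coe_rpow_of_nonneg _ hae.le]
        push_cast
        ring

/-- `lintegral_compl_ball_edist_rpow_le` with an indicator in place of a complement of a ball. -/
lemma lintegral_ind_far_le {a e : ℝ} (hae : a + e < 0) : ∃ C : ℝ≥0,
    ∀ (ψ : E → ℝ≥0∞) (A : ℝ≥0∞), GrowthBound ψ A e → ∀ (x : E) (R : ℝ≥0∞), R ≠ 0 → R ≠ ∞ →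
      ∫⁻ z, ind (R ≤ edist x z) * (edist x z ^ a * ψ z) ≤ C * A * R ^ (a + e) := by
  obtain ⟨C, hC⟩ := lintegral_compl_ball_edist_rpow_le (n := n) hae
  refine ⟨C, fun ψ A h x R hR0 hRt => ?_⟩
  have hR : 0 < R.toReal := ENNReal.toReal_pos hR0 hRt
  calc ∫⁻ z, ind (R ≤ edist x z) * (edist x z ^ a * ψ z)
      ≤ ∫⁻ z in (ball x R.toReal)ᶜ, edist x z ^ a * ψ z := by
        rw [← lintegral_indicator measurableSet_ball.compl]
        refine lintegral_mono fun z => ind_mul_le_of_imp fun hz => ?_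
        rw [indicator_of_mem]
        rw [edist_comm, edist_dist] at hz
        have := ENNReal.toReal_le_of_le_ofReal dist_nonneg hz
        simp only [mem_compl_iff, mem_ball, not_lt]
        exact this
    _ ≤ C * A * ofReal R.toReal ^ (a + e) := hC ψ A h x _ hR
    _ = _ := by rw [ofReal_toReal hRt]

lemma lintegral_ind_near_le_volume [NeZero n] {a : ℝ} (ha : 0 < a + n) : ∃ C : ℝ≥0,
    ∀ (x : E) (R : ℝ≥0∞), R ≠ 0 → R ≠ ∞ →
      ∫⁻ z, ind (edist x z ≤ R) * edist x z ^ a ≤ C * R ^ (a + n) := by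
  obtain ⟨C, hC⟩ := lintegral_ind_near_le (n := n) ha
  refine ⟨C * (volume (ball (0 : E) 1)).toNNReal, fun x R hR0 hR => ?_⟩
  have := hC _ _ growthBound_one x R hR0 hR
  simp only [mul_one] at this
  rwa [coe_mul, coe_toNNReal measure_ball_lt_top.ne]

lemma lintegral_ind_far_le_volume [NeZero n] {a : ℝ} (ha : a + n < 0) : ∃ C : ℝ≥0,
    ∀ (x : E) (R : ℝ≥0∞), R ≠ 0 → R ≠ ∞ →
      ∫⁻ z, ind (R ≤ edist x z) * edist x z ^ a ≤ C * R ^ (a + n) := by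
  obtain ⟨C, hC⟩ := lintegral_ind_far_le (n := n) ha
  refine ⟨C * (volume (ball (0 : E) 1)).toNNReal, fun x R hR0 hR => ?_⟩
  have := hC _ _ growthBound_one x R hR0 hR
  simp only [mul_one] at this
  rwa [coe_mul, coe_toNNReal measure_ball_lt_top.ne]

/-- Hölder's inequality for iterated integrals in three variables. -/
lemma lintegral_three_holder {α β γ : Type*} [MeasurableSpace α] [MeasurableSpace β]
    [MeasurableSpace γ] (μ₁ : Measure α) (μ₂ : Measure β) (μ₃ : Measure γ) [SFinite μ₁]
    [SFinite μ₂] [SFinite μ₃] {θ : ℝ} (h0 : 0 ≤ θ) (h1 : θ ≤ 1) {J U V : α → β → γ → ℝ≥0∞}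
    (hU : Measurable fun q : α × β × γ => U q.1 q.2.1 q.2.2)
    (hV : Measurable fun q : α × β × γ => V q.1 q.2.1 q.2.2)
    (hJ : ∀ x, ∀ᵐ y ∂μ₂, ∀ᵐ z ∂μ₃, J x y z ≤ U x y z ^ θ * V x y z ^ (1 - θ)) :
    ∫⁻ x, ∫⁻ y, ∫⁻ z, J x y z ∂μ₃ ∂μ₂ ∂μ₁ ≤ (∫⁻ x, ∫⁻ y, ∫⁻ z, U x y z ∂μ₃ ∂μ₂ ∂μ₁) ^ θ *
      (∫⁻ x, ∫⁻ y, ∫⁻ z, V x y z ∂μ₃ ∂μ₂ ∂μ₁) ^ (1 - θ) := by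
  have e : ∀ W : α → β → γ → ℝ≥0∞, (Measurable fun q : α × β × γ => W q.1 q.2.1 q.2.2) →
      ∫⁻ x, ∫⁻ y, ∫⁻ z, W x y z ∂μ₃ ∂μ₂ ∂μ₁
        = ∫⁻ q, W q.1 q.2.1 q.2.2 ∂(μ₁.prod (μ₂.prod μ₃)) := by
    intro W hW
    rw [lintegral_prod _ hW.aemeasurable]
    refine lintegral_congr fun x => ?_
    have : Measurable fun q : β × γ => W x q.1 q.2 := hW.comp measurable_prodMk_left
    rw [lintegral_prod _ this.aemeasurable]
  calc ∫⁻ x, ∫⁻ y, ∫⁻ z, J x y z ∂μ₃ ∂μ₂ ∂μ₁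
      ≤ ∫⁻ x, ∫⁻ y, ∫⁻ z, U x y z ^ θ * V x y z ^ (1 - θ) ∂μ₃ ∂μ₂ ∂μ₁ := by
        refine lintegral_mono fun x => lintegral_mono_ae ?_
        filter_upwards [hJ x] with y hy
        exact lintegral_mono_ae hy
    _ = ∫⁻ q, U q.1 q.2.1 q.2.2 ^ θ * V q.1 q.2.1 q.2.2 ^ (1 - θ) ∂(μ₁.prod (μ₂.prod μ₃)) :=
        e _ ((hU.pow_const _).mul (hV.pow_const _))
    _ ≤ _ := by
        rw [e U hU, e V hV]
        exact ENNReal.lintegral_mul_norm_pow_le hU.aemeasurable hV.aemeasurable h0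
          (by linarith) (by ring)

/-- Splitting a monomial in three distances and the differences `a`, `b` for Hölder's inequality
with exponents `p / (p - 1) = 1 / θ` and `p = 1 / (1 - θ)`. -/
lemma holder_split {p θ : ℝ} (hθ0 : 0 ≤ θ) (hθ1 : θ ≤ 1) (hp : p * θ = p - 1)
    {a b r q d w w₁ w₂ : ℝ≥0∞} (hr0 : r ≠ 0) (hr : r ≠ ∞) (hq0 : q ≠ 0) (hq : q ≠ ∞)
    (hd0 : d ≠ 0) (hd : d ≠ ∞) {er er₁ er₂ eq eq₁ eq₂ ed ed₁ ed₂ : ℝ}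
    (her : er = er₁ * θ + er₂ * (1 - θ)) (heq : eq = eq₁ * θ + eq₂ * (1 - θ))
    (hed : ed = ed₁ * θ + ed₂ * (1 - θ)) (hw : w = w₁ ^ θ * w₂ ^ (1 - θ)) :
    a ^ (p - 1) * b * (r ^ er * q ^ eq * d ^ ed * w)
      = (a ^ p * (r ^ er₁ * q ^ eq₁ * d ^ ed₁ * w₁)) ^ θ *
        (b ^ p * (r ^ er₂ * q ^ eq₂ * d ^ ed₂ * w₂)) ^ (1 - θ) := by
  have h1 : 0 ≤ 1 - θ := by linarith
  simp only [mul_rpow_of_nonneg _ _ hθ0, mul_rpow_of_nonneg _ _ h1]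
  rw [rpow_mul_rpow_interp hr0 hr her, rpow_mul_rpow_interp hq0 hq heq,
    rpow_mul_rpow_interp hd0 hd hed, hw, ← rpow_mul a, hp, ← rpow_mul b,
    show p * (1 - θ) = 1 by linarith, rpow_one]
  ring

/-- The difference of two negative powers, interpolated between the trivial bound and the bound by
the mean value theorem. -/
lemma abs_rpow_sub_rpow_le {α θ a b : ℝ} (hα : 0 ≤ α) (h0 : 0 ≤ θ) (h1 : θ ≤ 1) (ha : 0 < a)
    (hab : a ≤ b) : |a ^ (-α) - b ^ (-α)| ≤ max 1 α * ((b - a) ^ θ * a ^ (-α - θ)) := by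
  have hb : 0 < b := ha.trans_le hab
  have hle : b ^ (-α) ≤ a ^ (-α) := Real.rpow_le_rpow_of_nonpos ha hab (by linarith)
  rw [abs_of_nonneg (by linarith)]
  set δ := (b - a) / a with hδ
  have hδ0 : 0 ≤ δ := div_nonneg (by linarith) ha.le
  have hba : b / a = 1 + δ := by rw [hδ]; field_simp; ring
  have e1 : (b - a) ^ θ * a ^ (-α - θ) = a ^ (-α) * δ ^ θ := by
    rw [hδ, Real.div_rpow (by linarith) ha.le, Real.rpow_sub ha]
    ring
  have e2 : b ^ (-α) = a ^ (-α) * (1 + δ) ^ (-α) := by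
    rw [← hba, ← Real.mul_rpow ha.le (by positivity)]
    congr 1
    field_simp
  have hlow : 1 - α * δ ≤ (1 + δ) ^ (-α) := by
    rw [Real.rpow_def_of_pos (by linarith)]
    have h2 : Real.log (1 + δ) ≤ δ := by
      have := Real.log_le_sub_one_of_pos (show 0 < 1 + δ by linarith)
      linarith
    have h3 := Real.add_one_le_exp (Real.log (1 + δ) * -α)
    nlinarith
  have hpos : 0 ≤ (1 + δ) ^ (-α) := by positivity
  have hmain : 1 - (1 + δ) ^ (-α) ≤ max 1 α * δ ^ θ := by
    rcases le_total δ 1 with hd | hd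
    · have : δ ≤ δ ^ θ := by
        rcases hδ0.eq_or_lt with h | h
        · rw [← h]; positivity
        · simpa using Real.rpow_le_rpow_of_exponent_ge h hd h1
      calc 1 - (1 + δ) ^ (-α) ≤ α * δ := by linarith
        _ ≤ max 1 α * δ ^ θ := by gcongr; exact le_max_right _ _
    · have : 1 ≤ δ ^ θ := Real.one_le_rpow hd h0
      calc 1 - (1 + δ) ^ (-α) ≤ 1 * 1 := by linarith
        _ ≤ max 1 α * δ ^ θ := by gcongr; exact le_max_left _ _
  rw [e1, e2]
  have ha' : 0 < a ^ (-α) := Real.rpow_pos_of_pos ha _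
  calc a ^ (-α) - a ^ (-α) * (1 + δ) ^ (-α) = a ^ (-α) * (1 - (1 + δ) ^ (-α)) := by ring
    _ ≤ a ^ (-α) * (max 1 α * δ ^ θ) := by gcongr
    _ = _ := by ring

/-- The absolute value of the difference of two Riesz kernels with pole at `x` and at `y`. -/
noncomputable def rieszDiff (t : ℝ) (x y z : E) : ℝ≥0∞ :=
  ofReal |‖x - z‖ ^ (t - (n : ℝ)) - ‖y - z‖ ^ (t - (n : ℝ))|

lemma rieszDiff_comm (t : ℝ) (x y z : E) : rieszDiff t x y z = rieszDiff t y x z := by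
  unfold rieszDiff; rw [abs_sub_comm]

lemma measurable_rieszDiff (t : ℝ) :
    Measurable fun q : E × E × E => rieszDiff t q.1 q.2.1 q.2.2 := by
  unfold rieszDiff
  have h1 : Measurable fun q : E × E × E => ‖q.1 - q.2.2‖ ^ (t - (n : ℝ)) := by fun_prop
  have h2 : Measurable fun q : E × E × E => ‖q.2.1 - q.2.2‖ ^ (t - (n : ℝ)) := by fun_prop
  exact ENNReal.measurable_ofReal.comp (h1.sub h2).abs

lemma ofReal_dist_rpow {x y : E} (h : x ≠ y) (a : ℝ) :
    ofReal (dist x y ^ a) = edist x y ^ a := by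
  rw [edist_dist, ENNReal.ofReal_rpow_of_pos (dist_pos.2 h)]

lemma rieszDiff_le_aux {t θ : ℝ} (ht : t ≤ n) (h0 : 0 ≤ θ) (h1 : θ ≤ 1) {x y z : E}
    (hxz : x ≠ z) (hle : dist x z ≤ dist y z) :
    rieszDiff t x y z ≤ ofReal (max 1 (n - t)) *
      (edist x y ^ θ * edist x z ^ (t - n - θ)) := by
  have hd := dist_pos.2 hxz
  unfold rieszDiff
  rw [← dist_eq_norm, ← dist_eq_norm, show t - (n : ℝ) = -(n - t) by ring]
  have h := abs_rpow_sub_rpow_le (α := n - t) (by linarith) h0 h1 hd hle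
  have hm : 0 ≤ max 1 ((n : ℝ) - t) := zero_le_one.trans (le_max_left _ _)
  rw [← ofReal_dist_rpow hxz, edist_dist, ENNReal.ofReal_rpow_of_nonneg dist_nonneg h0,
    ← ofReal_mul (by positivity), ← ofReal_mul hm]
  refine ofReal_le_ofReal (h.trans ?_)
  gcongr
  linarith [dist_triangle y x z, dist_comm x y]

/-- The difference of two Riesz kernels gains any power `θ ∈ [0, 1]` of the distance of the
poles. -/
lemma rieszDiff_le {t θ : ℝ} (ht : t ≤ n) (h0 : 0 ≤ θ) (h1 : θ ≤ 1) {x y z : E}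
    (hxz : x ≠ z) (hyz : y ≠ z) :
    rieszDiff t x y z ≤ ofReal (max 1 (n - t)) *
      (edist x y ^ θ * (edist x z ^ (t - n - θ) + edist y z ^ (t - n - θ))) := by
  rcases le_total (dist x z) (dist y z) with h | h
  · refine (rieszDiff_le_aux ht h0 h1 hxz h).trans ?_
    gcongr
    exact le_self_add
  · rw [rieszDiff_comm]
    refine (rieszDiff_le_aux ht h0 h1 hyz h).trans ?_
    rw [edist_comm y x]
    gcongr
    exact le_add_self

/-- The difference of two Riesz kernels decays like the kernel differentiated once where the
distances to the poles are comparable; elsewhere these distances are controlled by the distance of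
the poles. -/
lemma rieszDiff_cases {t : ℝ} (ht : t ≤ n) {x y z : E} (hxz : x ≠ z) (hyz : y ≠ z) :
    (edist x y ≤ edist x z ∧ rieszDiff t x y z ≤
      ofReal (max 1 (n - t)) * (1 + 2 ^ (n + 1 - t)) *
        (edist x y * edist x z ^ (t - n - 1))) ∨
    (edist x z ≤ 2 * edist x y ∧ edist y z ≤ 2 * edist y x ∧
      rieszDiff t x y z ≤ ofReal (max 1 (n - t)) *
        (edist x z ^ (t - n) + edist y z ^ (t - n))) := by
  by_cases h : dist x y ≤ dist x z ∧ dist x z ≤ 2 * dist y z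
  · left
    have h0 : edist x y ≤ edist x z := by
      rw [edist_dist, edist_dist]; exact ofReal_le_ofReal h.1
    refine ⟨h0, (rieszDiff_le ht zero_le_one le_rfl hxz hyz).trans ?_⟩
    have h2 : edist x z ≤ 2 * edist y z := edist_le_two_mul h.2
    have h3 := rpow_le_mul_rpow_of_nonpos (by simp) (by simp) (show t - n - 1 ≤ 0 by linarith) h2
    rw [show -(t - n - 1) = n + 1 - t by ring] at h3
    calc ofReal (max 1 (n - t)) *
          (edist x y ^ (1 : ℝ) * (edist x z ^ (t - n - 1) + edist y z ^ (t - n - 1)))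
        ≤ ofReal (max 1 (n - t)) * (edist x y *
          (edist x z ^ (t - n - 1) + 2 ^ (n + 1 - t) * edist x z ^ (t - n - 1))) := by
          rw [rpow_one]; gcongr
      _ = _ := by ring
  · right
    have h4 := dist_triangle x y z
    have h5 := dist_triangle y x z
    rw [dist_comm y x] at h5
    have h6 : dist x z ≤ 2 * dist x y ∧ dist y z ≤ 2 * dist x y := by
      rw [not_and_or, not_le, not_le] at h
      rcases h with h | h <;> constructor <;> linarith
    refine ⟨edist_le_two_mul h6.1, edist_le_two_mul (by rw [dist_comm y x]; exact h6.2), ?_⟩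
    refine (rieszDiff_le ht le_rfl zero_le_one hxz hyz).trans ?_
    simp

/-! ### The trilinear form behind the first commutator -/

/-- Hölder's inequality for an integral with a monomial kernel in three distances. -/
lemma lintegral_holder_kernel {α β γ : Type*} [MeasurableSpace α] [MeasurableSpace β]
    [MeasurableSpace γ] (μ₁ : Measure α) (μ₂ : Measure β) (μ₃ : Measure γ) [SFinite μ₁]
    [SFinite μ₂] [SFinite μ₃] {p θ : ℝ} (hθ0 : 0 ≤ θ) (hθ1 : θ ≤ 1) (hp : p * θ = p - 1)
    {P : α → β → γ → Prop} {a b r q d w w₁ w₂ : α → β → γ → ℝ≥0∞}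
    (hP : Measurable fun u : α × β × γ => ind (P u.1 u.2.1 u.2.2))
    (ha : Measurable fun u : α × β × γ => a u.1 u.2.1 u.2.2)
    (hb : Measurable fun u : α × β × γ => b u.1 u.2.1 u.2.2)
    (hr : Measurable fun u : α × β × γ => r u.1 u.2.1 u.2.2)
    (hq : Measurable fun u : α × β × γ => q u.1 u.2.1 u.2.2)
    (hd : Measurable fun u : α × β × γ => d u.1 u.2.1 u.2.2)
    (hw₁ : Measurable fun u : α × β × γ => w₁ u.1 u.2.1 u.2.2)
    (hw₂ : Measurable fun u : α × β × γ => w₂ u.1 u.2.1 u.2.2)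
    (hpos : ∀ x, ∀ᵐ y ∂μ₂, ∀ᵐ z ∂μ₃, (r x y z ≠ 0 ∧ r x y z ≠ ∞) ∧ (q x y z ≠ 0 ∧ q x y z ≠ ∞) ∧
      (d x y z ≠ 0 ∧ d x y z ≠ ∞))
    {er er₁ er₂ eq eq₁ eq₂ ed ed₁ ed₂ : ℝ}
    (her : er = er₁ * θ + er₂ * (1 - θ)) (heq : eq = eq₁ * θ + eq₂ * (1 - θ))
    (hed : ed = ed₁ * θ + ed₂ * (1 - θ))
    (hw : ∀ x y z, w x y z = w₁ x y z ^ θ * w₂ x y z ^ (1 - θ)) :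
    ∫⁻ x, ∫⁻ y, ∫⁻ z, ind (P x y z) * (a x y z ^ (p - 1) * b x y z *
        (r x y z ^ er * q x y z ^ eq * d x y z ^ ed * w x y z)) ∂μ₃ ∂μ₂ ∂μ₁
      ≤ (∫⁻ x, ∫⁻ y, ∫⁻ z, ind (P x y z) * (a x y z ^ p *
          (r x y z ^ er₁ * q x y z ^ eq₁ * d x y z ^ ed₁ * w₁ x y z)) ∂μ₃ ∂μ₂ ∂μ₁) ^ θ *
        (∫⁻ x, ∫⁻ y, ∫⁻ z, ind (P x y z) * (b x y z ^ p *
          (r x y z ^ er₂ * q x y z ^ eq₂ * d x y z ^ ed₂ * w₂ x y z)) ∂μ₃ ∂μ₂ ∂μ₁) ^ (1 - θ) := by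
  apply lintegral_three_holder μ₁ μ₂ μ₃ hθ0 hθ1
  · exact hP.mul ((ha.pow_const _).mul ((((hr.pow_const _).mul (hq.pow_const _)).mul
      (hd.pow_const _)).mul hw₁))
  · exact hP.mul ((hb.pow_const _).mul ((((hr.pow_const _).mul (hq.pow_const _)).mul
      (hd.pow_const _)).mul hw₂))
  · intro x
    filter_upwards [hpos x] with y hy
    filter_upwards [hy] with z hz
    refine ind_mul_le_of_imp fun h => ?_
    rw [ind_of_true h, one_mul, one_mul]
    exact (holder_split hθ0 hθ1 hp hz.1.1 hz.1.2 hz.2.1.1 hz.2.1.2 hz.2.2.1 hz.2.2.2 her heq hed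
      (hw x y z)).le

lemma rpow_mul_rpow_le {θ : ℝ} (h0 : 0 ≤ θ) (h1 : θ ≤ 1) {I J X X₁ X₂ Y₁ Y₂ : ℝ≥0∞} {C₁ C₂ : ℝ≥0}
    (hI : I ≤ C₁ * (X₁ * Y₁)) (hJ : J ≤ C₂ * (X₂ * Y₂)) (hX : X₁ ^ θ * X₂ ^ (1 - θ) ≤ X) :
    I ^ θ * J ^ (1 - θ) ≤
      (C₁ ^ θ * C₂ ^ (1 - θ) : ℝ≥0) * (X * (Y₁ ^ θ * Y₂ ^ (1 - θ))) := by
  have h2 : 0 ≤ 1 - θ := by linarith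
  calc I ^ θ * J ^ (1 - θ) ≤ (C₁ * (X₁ * Y₁)) ^ θ * (C₂ * (X₂ * Y₂)) ^ (1 - θ) := by gcongr
    _ = C₁ ^ θ * C₂ ^ (1 - θ) * ((X₁ ^ θ * X₂ ^ (1 - θ)) * (Y₁ ^ θ * Y₂ ^ (1 - θ))) := by
        simp only [mul_rpow_of_nonneg _ _ h0, mul_rpow_of_nonneg _ _ h2]
        ring
    _ ≤ C₁ ^ θ * C₂ ^ (1 - θ) * (X * (Y₁ ^ θ * Y₂ ^ (1 - θ))) := by gcongr
    _ = _ := by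
        rw [coe_mul, coe_rpow_of_nonneg _ h0, coe_rpow_of_nonneg _ h2]

lemma ae_edist_ne [NeZero n] (x : E) (D : Set E) :
    ∀ᵐ y ∂(volume.restrict D), edist x y ≠ 0 ∧ edist x y ≠ ∞ := by
  filter_upwards [ae_restrict_of_ae (Measure.ae_ne volume x)] with y hy
  exact ⟨(edist_pos.2 hy.symm).ne', edist_ne_top x y⟩

lemma lintegral_le_mul_gagliardoEnergy [NeZero n] {p e e' : ℝ} (he : e + e' = -(2 * n : ℝ))
    {f : E → F} (hf : StronglyMeasurable f) (D : Set E) (K : ℝ≥0∞) {J : E → E → ℝ≥0∞}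
    (hJ : ∀ x y, x ≠ y →
      J x y ≤ edist (f x) (f y) ^ p * edist x y ^ e * (K * edist x y ^ e')) :
    ∫⁻ x in D, ∫⁻ y in D, J x y ≤ K * gagliardoEnergy D p f := by
  have hd := measurable_edist_comp hf
  have hm : Measurable fun q : E × E =>
      edist (f q.1) (f q.2) ^ p * edist q.1 q.2 ^ (-(2 * n : ℝ)) := by fun_prop
  unfold gagliardoEnergy
  rw [← lintegral_const_mul _ hm.lintegral_prod_right']
  refine lintegral_mono fun x => ?_
  have hm' : Measurable fun y => edist (f x) (f y) ^ p * edist x y ^ (-(2 * n : ℝ)) :=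
    hm.comp measurable_prodMk_left
  rw [← lintegral_const_mul _ hm']
  refine lintegral_mono_ae ?_
  filter_upwards [ae_restrict_of_ae (Measure.ae_ne volume x)] with y hy
  have hp := (edist_pos.2 hy.symm).ne'
  refine (hJ x y hy.symm).trans (le_of_eq ?_)
  rw [← he, rpow_add _ _ hp (edist_ne_top x y)]
  ring

/-- The trace inequality for a kernel in three points which is integrated in the middle point. -/
lemma lintegral_trace_middle_le [NeZero n] {p κ : ℝ} (hp : 1 ≤ p) (hκ : 0 < κ) (hκn : κ < n) :
    ∃ C : ℝ≥0, ∀ g : E → G, StronglyMeasurable g →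
    ∀ (φ : E → ℝ≥0∞) (A : ℝ≥0∞), Measurable φ → GrowthBound φ A (n - κ) →
    ∀ (x₀ : E) (M : ℝ) (B Z : Set E), B ⊆ ball x₀ M → Z ⊆ ball x₀ M →
    ∀ (K : ℝ≥0∞) (e e' : ℝ), e + e' = κ - 2 * n → ∀ H : E → E → E → ℝ≥0∞,
    (Measurable fun u : E × E × E => H u.1 u.2.1 u.2.2) →
    (∀ x z, x ≠ z → ∫⁻ y, H x y z ≤ K * edist x z ^ e') →
      ∫⁻ x in B, ∫⁻ y in B, ∫⁻ z in Z,
          H x y z * (edist (g x) (g z) ^ p * edist x z ^ e * φ z)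
        ≤ C * (K * A) * gagliardoEnergy (ball x₀ M) p g := by
  obtain ⟨C, hC⟩ := lintegral_trace_le (n := n) (F := G) hp hκ hκn
  refine ⟨C, fun g hg φ A hφ hA x₀ M B Z hB hZ K e e' he H hH hHK => ?_⟩
  have hd := measurable_edist_comp hg
  set D := ball x₀ M
  have hm₃ : Measurable fun u : E × E × E => H u.1 u.2.1 u.2.2 *
      (edist (g u.1) (g u.2.2) ^ p * edist u.1 u.2.2 ^ e * φ u.2.2) := by
    have h1 : Measurable fun u : E × E × E => edist (g u.1) (g u.2.2) :=
      hd.comp (measurable_fst.prodMk (measurable_snd.comp measurable_snd))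
    fun_prop
  have hm₂ : Measurable fun u : E × E =>
      edist (g u.1) (g u.2) ^ p * edist u.1 u.2 ^ (κ - 2 * n) * φ u.2 := by fun_prop
  calc ∫⁻ x in B, ∫⁻ y in B, ∫⁻ z in Z,
          H x y z * (edist (g x) (g z) ^ p * edist x z ^ e * φ z)
      ≤ ∫⁻ x in D, ∫⁻ z in D,
          K * (edist (g x) (g z) ^ p * edist x z ^ (κ - 2 * n) * φ z) := by
        refine (lintegral_mono_set hB).trans (lintegral_mono fun x => ?_)
        have hx : Measurable fun u : E × E => H x u.1 u.2 *
            (edist (g x) (g u.2) ^ p * edist x u.2 ^ e * φ u.2) :=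
          hm₃.comp measurable_prodMk_left
        rw [lintegral_lintegral_swap hx.aemeasurable]
        refine (lintegral_mono_set hZ).trans (lintegral_mono_ae ?_)
        filter_upwards [ae_restrict_of_ae (Measure.ae_ne volume x)] with z hz
        have hHm : Measurable fun y => H x y z :=
          hH.comp (measurable_const.prodMk measurable_prodMk_right)
        rw [lintegral_mul_const _ hHm]
        calc (∫⁻ y in B, H x y z) * (edist (g x) (g z) ^ p * edist x z ^ e * φ z)
            ≤ (K * edist x z ^ e') * (edist (g x) (g z) ^ p * edist x z ^ e * φ z) := by
              gcongr
              exact (setLIntegral_le_lintegral _ _).trans (hHK x z hz.symm)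
          _ = K * (edist (g x) (g z) ^ p * edist x z ^ (κ - 2 * n) * φ z) := by
              rw [← he, rpow_add _ _ (edist_pos.2 hz.symm).ne' (edist_ne_top x z)]
              ring
    _ = ∫⁻ z in D, ∫⁻ x in D,
          K * (edist (g z) (g x) ^ p * edist z x ^ (κ - 2 * n) * φ z) := by
        rw [lintegral_lintegral_swap (hm₂.const_mul K).aemeasurable]
        refine lintegral_congr fun z => lintegral_congr fun x => ?_
        rw [edist_comm x z, edist_comm (g x) (g z)]
    _ = K * ∫⁻ z in D, ∫⁻ x in D,
          edist (g z) (g x) ^ p * edist z x ^ (κ - 2 * n) * φ z := by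
        have hm₂' : Measurable fun u : E × E =>
          edist (g u.1) (g u.2) ^ p * edist u.1 u.2 ^ (κ - 2 * n) * φ u.1 := by fun_prop
        rw [← lintegral_const_mul _ hm₂'.lintegral_prod_right']
        refine lintegral_congr fun z => ?_
        have hz : Measurable fun x : E =>
          edist (g z) (g x) ^ p * edist z x ^ (κ - 2 * n) * φ z :=
          hm₂'.comp measurable_prodMk_left
        rw [lintegral_const_mul _ hz]
    _ ≤ K * (C * A * gagliardoEnergy D p g) := by
        gcongr
        exact hC g hg φ A hφ hA x₀ M
    _ = _ := by ring

/-- Hölder's inequality with exponents `n / (n - s)` and `n / s` for a trilinear form in the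
increments of `f` and a quantity `b`, where the kernel is split between the two factors. -/
lemma lintegral_trilinear_holder [NeZero n] {s : ℝ} (hs0 : 0 < s) (hs1 : s < 1) {f : E → F}
    (hf : StronglyMeasurable f) {φ : E → ℝ≥0∞} (hφ : Measurable φ) (B Z : Set E)
    {P : E → E → E → Prop} (hP : Measurable fun u : E × E × E => ind (P u.1 u.2.1 u.2.2))
    {b : E → E → E → ℝ≥0∞} (hb : Measurable fun u : E × E × E => b u.1 u.2.1 u.2.2)
    (er₁ er₂ eq₁ eq₂ : ℝ) {er eq : ℝ} (her : er = er₁ * (1 - s / n) + er₂ * (1 - (1 - s / n)))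
    (heq : eq = eq₁ * (1 - s / n) + eq₂ * (1 - (1 - s / n))) {C₁ C₂ : ℝ≥0} {X E₁ E₂ : ℝ≥0∞}
    (hU : ∫⁻ x in B, ∫⁻ y in B, ∫⁻ z in Z, ind (P x y z) * (edist (f x) (f y) ^ (n / s) *
      (edist x y ^ er₁ * edist x z ^ eq₁ * φ z)) ≤ C₁ * (X * E₁))
    (hV : ∫⁻ x in B, ∫⁻ y in B, ∫⁻ z in Z, ind (P x y z) * (b x y z ^ (n / s) *
      (edist x y ^ er₂ * edist x z ^ eq₂ * φ z)) ≤ C₂ * (X * E₂)) :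
    ∫⁻ x in B, ∫⁻ y in B, ∫⁻ z in Z, ind (P x y z) * (edist (f x) (f y) ^ (n / s - 1) * b x y z *
        (edist x y ^ er * edist x z ^ eq * φ z))
      ≤ (C₁ ^ (1 - s / n) * C₂ ^ (1 - (1 - s / n)) : ℝ≥0) *
        (X * (E₁ ^ (1 - s / n) * E₂ ^ (s / n))) := by
  have hn : (1 : ℝ) ≤ n := mod_cast NeZero.one_le
  have hn0 : (n : ℝ) ≠ 0 := by positivity
  have hθ : s / n ≤ 1 := by rw [div_le_one (by linarith)]; linarith
  have hθ0 : 0 ≤ s / n := by positivity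
  have ha : Measurable fun u : E × E × E => edist (f u.1) (f u.2.1) :=
    measurable_edist_map hf (by fun_prop) (by fun_prop)
  have hol := lintegral_holder_kernel (volume.restrict B) (volume.restrict B) (volume.restrict Z)
    (p := n / s) (θ := 1 - s / n) (by linarith) (by linarith) (by field_simp)
    (P := P) (a := fun x y z => edist (f x) (f y)) (b := b) (r := fun x y z => edist x y)
    (q := fun x y z => edist x z) (d := fun _ _ _ => 1) (w := fun x y z => φ z)
    (w₁ := fun x y z => φ z) (w₂ := fun x y z => φ z) hP ha hb (by fun_prop) (by fun_prop)
    measurable_const (by fun_prop) (by fun_prop)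
    (fun x => by
      filter_upwards [ae_edist_ne x B] with y hy
      filter_upwards [ae_edist_ne x Z] with z hz
      exact ⟨hy, hz, by simp⟩)
    her heq (ed := 0) (ed₁ := 0) (ed₂ := 0) (by ring)
    (fun x y z => eq_rpow_mul_rpow_one_sub _ (by linarith) (by linarith))
  simp only [rpow_zero, mul_one] at hol
  have h := rpow_mul_rpow_le (by linarith) (by linarith) hU hV
    (eq_rpow_mul_rpow_one_sub X (by linarith) (by linarith : 1 - s / n ≤ 1)).ge
  exact hol.trans (h.trans_eq (by rw [sub_sub_cancel]))

/-- The part of the trilinear form where `x` and `y` are closer to each other than to `z`. -/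
lemma lintegral_trilinear_far_le [NeZero n] {s t : ℝ} (hs0 : 0 < s) (hs1 : s < 1) (ht0 : 0 < t)
    (hts : t < s) : ∃ C : ℝ≥0, ∀ (f : E → F) (g : E → G), StronglyMeasurable f →
    StronglyMeasurable g → ∀ (φ : E → ℝ≥0∞) (A : ℝ≥0∞), Measurable φ → GrowthBound φ A (n - t) →
    ∀ (x₀ : E) (M : ℝ) (B Z : Set E), B ⊆ ball x₀ M → Z ⊆ ball x₀ M →
    ∀ l : ℝ≥0∞, l ≠ 0 → l ≠ ∞ →
      ∫⁻ x in B, ∫⁻ y in B, ∫⁻ z in Z, ind (edist x y ≤ l * edist x z) *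
          (edist (f x) (f y) ^ (n / s - 1) * edist (g x) (g z) *
            (edist x y ^ (1 - 2 * n : ℝ) * edist x z ^ (t - n - 1) * φ z))
        ≤ C * (l ^ (1 - s) * A * (gagliardoEnergy B (n / s) f ^ (1 - s / n) *
          gagliardoEnergy (ball x₀ M) (n / s) g ^ (s / n))) := by
  have hn : (1 : ℝ) ≤ n := mod_cast NeZero.one_le
  have hn0 : (n : ℝ) ≠ 0 := by positivity
  have hp : 1 ≤ (n : ℝ) / s := by rw [le_div_iff₀ hs0]; linarith
  obtain ⟨C₁, hC₁⟩ := lintegral_ind_far_le (n := n) (a := t - n - (1 - s)) (e := n - t)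
    (by linarith)
  obtain ⟨C₂, hC₂⟩ := lintegral_ind_near_le_volume (n := n) (a := 1 - s - n) (by linarith)
  obtain ⟨C₃, hC₃⟩ := lintegral_trace_middle_le (n := n) (G := G) hp ht0 (by linarith)
  refine ⟨C₁ ^ (1 - s / n) * (C₃ * C₂) ^ (1 - (1 - s / n)),
    fun f g hf hg φ A hφ hA x₀ M B Z hB hZ l hl0 hl => ?_⟩
  have hind : Measurable fun u : E × E × E => ind (edist u.1 u.2.1 ≤ l * edist u.1 u.2.2) :=
    measurable_ind_le (by fun_prop) (by fun_prop)
  have hb : Measurable fun u : E × E × E => edist (g u.1) (g u.2.2) :=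
    measurable_edist_map hg (by fun_prop) (by fun_prop)
  have hU : ∫⁻ x in B, ∫⁻ y in B, ∫⁻ z in Z, ind (edist x y ≤ l * edist x z) *
      (edist (f x) (f y) ^ (n / s) *
        (edist x y ^ (-2 * n + (1 - s)) * edist x z ^ (t - n - (1 - s)) * φ z))
      ≤ C₁ * A * l ^ (1 - s) * gagliardoEnergy B (n / s) f := by
    refine lintegral_le_mul_gagliardoEnergy (e := -2 * n + (1 - s)) (e' := -(1 - s)) (by ring)
      hf B _ fun x y hxy => ?_
    calc ∫⁻ z in Z, ind (edist x y ≤ l * edist x z) * (edist (f x) (f y) ^ (n / s) *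
          (edist x y ^ (-2 * n + (1 - s)) * edist x z ^ (t - n - (1 - s)) * φ z))
        ≤ ∫⁻ z, edist (f x) (f y) ^ (n / s) * edist x y ^ (-2 * n + (1 - s)) *
            (ind (l⁻¹ * edist x y ≤ edist x z) * (edist x z ^ (t - n - (1 - s)) * φ z)) := by
          refine (setLIntegral_le_lintegral _ _).trans (lintegral_mono fun z => ?_)
          refine ind_mul_le_of_imp fun h => ?_
          rw [ind_of_true]
          · refine le_of_eq (by ring)
          · rw [mul_comm, ← div_eq_mul_inv]
            exact div_le_of_le_mul (by rwa [mul_comm])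
      _ = edist (f x) (f y) ^ (n / s) * edist x y ^ (-2 * n + (1 - s)) *
          ∫⁻ z, ind (l⁻¹ * edist x y ≤ edist x z) * (edist x z ^ (t - n - (1 - s)) * φ z) := by
          refine lintegral_const_mul _ (Measurable.mul ?_ (by fun_prop))
          exact measurable_ind_le (by fun_prop) (by fun_prop)
      _ ≤ _ := by
          gcongr
          refine (hC₁ φ A hA x (l⁻¹ * edist x y) ?_ ?_).trans (le_of_eq ?_)
          · exact mul_ne_zero (inv_ne_zero.2 hl) (edist_pos.2 hxy).ne'
          · exact mul_ne_top (inv_ne_top.2 hl0) (edist_ne_top x y)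
          · rw [show t - n - (1 - s) + (n - t) = -(1 - s) by ring,
              mul_rpow_of_ne_top (inv_ne_top.2 hl0) (edist_ne_top x y),
              inv_rpow, ← rpow_neg, neg_neg]
            ring
  have hV : ∫⁻ x in B, ∫⁻ y in B, ∫⁻ z in Z, ind (edist x y ≤ l * edist x z) *
      (edist (g x) (g z) ^ (n / s) *
        (edist x y ^ ((1 - s) - n) * edist x z ^ (t - 2 * n - (1 - s)) * φ z))
      ≤ C₃ * ((C₂ * l ^ (1 - s)) * A) * gagliardoEnergy (ball x₀ M) (n / s) g := by
    refine le_trans (le_of_eq ?_) (hC₃ g hg φ A hφ hA x₀ M B Z hB hZ _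
      (t - 2 * n - (1 - s)) (1 - s) (by ring)
      (fun x y z => ind (edist x y ≤ l * edist x z) * edist x y ^ ((1 - s) - n))
      (hind.mul (by fun_prop)) fun x z hxz => ?_)
    · refine lintegral_congr fun x => lintegral_congr fun y => lintegral_congr fun z => ?_
      ring
    · refine (hC₂ x (l * edist x z) (mul_ne_zero hl0 (edist_pos.2 hxz).ne')
        (mul_ne_top hl (edist_ne_top x z))).trans (le_of_eq ?_)
      rw [show (1 - s) - n + n = 1 - s by ring, mul_rpow_of_nonneg _ _ (by linarith)]
      ring
  refine lintegral_trilinear_holder hs0 hs1 hf hφ B Z hind hb (-2 * n + (1 - s)) ((1 - s) - n)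
    (t - n - (1 - s)) (t - 2 * n - (1 - s)) (by field_simp; ring)
    (by field_simp; ring) (hU.trans (le_of_eq ?_)) (hV.trans (le_of_eq ?_))
  · ring
  · rw [coe_mul]; ring

/-- The part of the trilinear form where `z` is close to `x` and `g` is differenced between `x`
and `z`. -/
lemma lintegral_trilinear_near_le [NeZero n] {s t : ℝ} (hs0 : 0 < s) (hs1 : s < 1) (ht0 : 0 < t)
    (hts : t < s) : ∃ C : ℝ≥0, ∀ (f : E → F) (g : E → G), StronglyMeasurable f →
    StronglyMeasurable g → ∀ (φ : E → ℝ≥0∞) (A : ℝ≥0∞), Measurable φ → GrowthBound φ A (n - t) →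
    ∀ (x₀ : E) (M : ℝ) (B Z : Set E), B ⊆ ball x₀ M → Z ⊆ ball x₀ M →
      ∫⁻ x in B, ∫⁻ y in B, ∫⁻ z in Z, ind (edist x z ≤ 2 * edist x y) *
          (edist (f x) (f y) ^ (n / s - 1) * edist (g x) (g z) *
            (edist x y ^ (-(2 * n) : ℝ) * edist x z ^ (t - n) * φ z))
        ≤ C * (A * (gagliardoEnergy B (n / s) f ^ (1 - s / n) *
          gagliardoEnergy (ball x₀ M) (n / s) g ^ (s / n))) := by
  have hn : (1 : ℝ) ≤ n := mod_cast NeZero.one_le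
  have hn0 : (n : ℝ) ≠ 0 := by positivity
  have hp : 1 ≤ (n : ℝ) / s := by rw [le_div_iff₀ hs0]; linarith
  obtain ⟨C₁, hC₁⟩ := lintegral_ind_near_le (n := n) (a := t - n + s) (e := n - t) (by linarith)
  obtain ⟨C₂, hC₂⟩ := lintegral_ind_far_le_volume (n := n) (a := -n - s) (by linarith)
  obtain ⟨C₃, hC₃⟩ := lintegral_trace_middle_le (n := n) (G := G) hp ht0 (by linarith)
  refine ⟨(C₁ * 2 ^ s) ^ (1 - s / n) * (C₃ * C₂ * 2 ^ s) ^ (1 - (1 - s / n)),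
    fun f g hf hg φ A hφ hA x₀ M B Z hB hZ => ?_⟩
  have hind : Measurable fun u : E × E × E => ind (edist u.1 u.2.2 ≤ 2 * edist u.1 u.2.1) :=
    measurable_ind_le (by fun_prop) (by fun_prop)
  have hb : Measurable fun u : E × E × E => edist (g u.1) (g u.2.2) :=
    measurable_edist_map hg (by fun_prop) (by fun_prop)
  have hU : ∫⁻ x in B, ∫⁻ y in B, ∫⁻ z in Z, ind (edist x z ≤ 2 * edist x y) *
      (edist (f x) (f y) ^ (n / s) *
        (edist x y ^ (-2 * n - s) * edist x z ^ (t - n + s) * φ z))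
      ≤ C₁ * A * 2 ^ s * gagliardoEnergy B (n / s) f := by
    refine lintegral_le_mul_gagliardoEnergy (e := -2 * n - s) (e' := s) (by ring)
      hf B _ fun x y hxy => ?_
    calc ∫⁻ z in Z, ind (edist x z ≤ 2 * edist x y) * (edist (f x) (f y) ^ (n / s) *
          (edist x y ^ (-2 * n - s) * edist x z ^ (t - n + s) * φ z))
        ≤ ∫⁻ z, edist (f x) (f y) ^ (n / s) * edist x y ^ (-2 * n - s) *
            (ind (edist x z ≤ 2 * edist x y) * (edist x z ^ (t - n + s) * φ z)) := by
          refine (setLIntegral_le_lintegral _ _).trans (lintegral_mono fun z => le_of_eq ?_)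
          ring
      _ = edist (f x) (f y) ^ (n / s) * edist x y ^ (-2 * n - s) *
          ∫⁻ z, ind (edist x z ≤ 2 * edist x y) * (edist x z ^ (t - n + s) * φ z) := by
          refine lintegral_const_mul _ (Measurable.mul ?_ (by fun_prop))
          exact measurable_ind_le (by fun_prop) (by fun_prop)
      _ ≤ _ := by
          gcongr
          refine (hC₁ φ A hA x (2 * edist x y) ?_ ?_).trans (le_of_eq ?_)
          · exact mul_ne_zero (by simp) (edist_pos.2 hxy).ne'
          · exact mul_ne_top (by simp) (edist_ne_top x y)
          · rw [show t - n + s + (n - t) = s by ring, mul_rpow_of_nonneg _ _ hs0.le]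
            ring
  have hV : ∫⁻ x in B, ∫⁻ y in B, ∫⁻ z in Z, ind (edist x z ≤ 2 * edist x y) *
      (edist (g x) (g z) ^ (n / s) *
        (edist x y ^ (-n - s) * edist x z ^ (t - 2 * n + s) * φ z))
      ≤ C₃ * ((C₂ * 2 ^ s) * A) * gagliardoEnergy (ball x₀ M) (n / s) g := by
    refine le_trans (le_of_eq ?_) (hC₃ g hg φ A hφ hA x₀ M B Z hB hZ _
      (t - 2 * n + s) (-s) (by ring)
      (fun x y z => ind (edist x z ≤ 2 * edist x y) * edist x y ^ (-n - s))
      (hind.mul (by fun_prop)) fun x z hxz => ?_)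
    · refine lintegral_congr fun x => lintegral_congr fun y => lintegral_congr fun z => ?_
      ring
    · calc ∫⁻ y, ind (edist x z ≤ 2 * edist x y) * edist x y ^ (-n - s)
          ≤ ∫⁻ y, ind (2⁻¹ * edist x z ≤ edist x y) * edist x y ^ (-n - s) := by
            refine lintegral_mono fun y => ind_mul_le_of_imp fun h => ?_
            rw [ind_of_true, one_mul]
            rw [mul_comm, ← div_eq_mul_inv]
            exact div_le_of_le_mul (by rwa [mul_comm])
        _ ≤ _ := by
            refine (hC₂ x (2⁻¹ * edist x z) (mul_ne_zero (by simp) (edist_pos.2 hxz).ne')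
              (mul_ne_top (by simp) (edist_ne_top x z))).trans (le_of_eq ?_)
            rw [show -n - s + n = -s by ring,
              mul_rpow_of_ne_top (by simp) (edist_ne_top x z),
              inv_rpow, ← rpow_neg, neg_neg]
            ring
  refine lintegral_trilinear_holder hs0 hs1 hf hφ B Z hind hb (-2 * n - s) (-n - s)
    (t - n + s) (t - 2 * n + s) (by field_simp; ring)
    (by field_simp; ring) (hU.trans (le_of_eq ?_)) (hV.trans (le_of_eq ?_))
  · rw [coe_mul, coe_rpow_of_nonneg _ hs0.le, coe_ofNat]; ring
  · rw [coe_mul, coe_mul, coe_rpow_of_nonneg _ hs0.le,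
      coe_ofNat]; ring

lemma lintegral_trace_near_le [NeZero n] {p t : ℝ} (hp : 1 ≤ p) (ht0 : 0 < t) (htn : t < n) :
    ∃ C : ℝ≥0, ∀ f : E → F, StronglyMeasurable f →
    ∀ (φ : E → ℝ≥0∞) (A : ℝ≥0∞), Measurable φ → GrowthBound φ A (n - t) →
    ∀ (x₀ : E) (M : ℝ) (Z : Set E),
      ∫⁻ x in ball x₀ M, ∫⁻ y in ball x₀ M, ∫⁻ z in Z,
          ind (edist x z ≤ 2 * edist x y) * (edist (f x) (f y) ^ p *
            (edist x y ^ (-(2 * n) : ℝ) * edist x z ^ (t - n) * φ z))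
        ≤ C * (A * gagliardoEnergy (ball x₀ M) p f) := by
  obtain ⟨C₁, hC₁⟩ := lintegral_trace_le (n := n) (F := F) hp (half_pos ht0) (by linarith)
  obtain ⟨C₂, hC₂⟩ := growthBound_potential (n := n) (τ := t / 2) (e := n - t) (by linarith)
    (by linarith) (by linarith)
  refine ⟨2 ^ (t / 2) * C₁ * C₂, fun f hf φ A hφ hA x₀ M Z => ?_⟩
  have hd := measurable_edist_comp hf
  have hΦ : Measurable (potential (t / 2) φ) := measurable_potential hφ
  have hg := hC₂ φ A hφ hA
  rw [show t / 2 + (n - t) = n - t / 2 by ring] at hg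
  have hm : Measurable fun u : E × E => edist (f u.1) (f u.2) ^ p *
      edist u.1 u.2 ^ (t / 2 - 2 * n) * potential (t / 2) φ u.1 := by fun_prop
  calc ∫⁻ x in ball x₀ M, ∫⁻ y in ball x₀ M, ∫⁻ z in Z,
          ind (edist x z ≤ 2 * edist x y) * (edist (f x) (f y) ^ p *
            (edist x y ^ (-(2 * n) : ℝ) * edist x z ^ (t - n) * φ z))
      ≤ ∫⁻ x in ball x₀ M, ∫⁻ y in ball x₀ M, 2 ^ (t / 2) *
          (edist (f x) (f y) ^ p * edist x y ^ (t / 2 - 2 * n) * potential (t / 2) φ x) := by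
        refine lintegral_mono fun x => lintegral_mono_ae ?_
        filter_upwards [ae_restrict_of_ae (Measure.ae_ne volume x)] with y hy
        have hr := (edist_pos.2 hy.symm).ne'
        unfold potential
        rw [← mul_assoc, ← lintegral_const_mul _ (by fun_prop)]
        refine (setLIntegral_le_lintegral _ _).trans (lintegral_mono_ae ?_)
        filter_upwards [Measure.ae_ne volume x] with z hz
        refine ind_mul_le_of_imp fun h => ?_
        have hq := (edist_pos.2 hz.symm).ne'
        have h1 : edist x z ^ (t - n) ≤
            2 ^ (t / 2) * edist x y ^ (t / 2) * edist x z ^ (t / 2 - n) := by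
          rw [show t - (n : ℝ) = t / 2 + (t / 2 - n) by ring,
            rpow_add _ _ hq (edist_ne_top x z),
            ← mul_rpow_of_nonneg _ _ (by linarith)]
          gcongr
        have h2 : edist x y ^ (t / 2 - 2 * n) =
            edist x y ^ (t / 2) * edist x y ^ (-(2 * n) : ℝ) := by
          rw [← rpow_add _ _ hr (edist_ne_top x y)]; congr 1
        calc _ ≤ edist (f x) (f y) ^ p * (edist x y ^ (-(2 * n) : ℝ) *
              (2 ^ (t / 2) * edist x y ^ (t / 2) * edist x z ^ (t / 2 - n)) * φ z) := by gcongr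
          _ = _ := by rw [h2]; ring
    _ = 2 ^ (t / 2) * ∫⁻ x in ball x₀ M, ∫⁻ y in ball x₀ M,
          edist (f x) (f y) ^ p * edist x y ^ (t / 2 - 2 * n) * potential (t / 2) φ x := by
        rw [← lintegral_const_mul _ hm.lintegral_prod_right']
        refine lintegral_congr fun x => ?_
        have hx : Measurable fun y : E =>
            edist (f x) (f y) ^ p * edist x y ^ (t / 2 - 2 * n) * potential (t / 2) φ x :=
          hm.comp measurable_prodMk_left
        rw [lintegral_const_mul _ hx]
    _ ≤ 2 ^ (t / 2) * (C₁ * (C₂ * A) * gagliardoEnergy (ball x₀ M) p f) := by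
        gcongr
        exact hC₁ f hf _ _ hΦ hg x₀ M
    _ = _ := by
        rw [coe_mul, coe_mul, coe_rpow_of_nonneg _ (by linarith),
          coe_ofNat]
        ring

/-- The part of the trilinear form where `z` is close to `x` and `g` is differenced between `x`
and `y`. -/
lemma lintegral_trilinear_diag_le [NeZero n] {s t : ℝ} (hs0 : 0 < s) (hs1 : s < 1) (ht0 : 0 < t)
    (hts : t < s) : ∃ C : ℝ≥0, ∀ (f : E → F) (g : E → G), StronglyMeasurable f →
    StronglyMeasurable g → ∀ (φ : E → ℝ≥0∞) (A : ℝ≥0∞), Measurable φ → GrowthBound φ A (n - t) →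
    ∀ (x₀ : E) (M : ℝ) (Z : Set E),
      ∫⁻ x in ball x₀ M, ∫⁻ y in ball x₀ M, ∫⁻ z in Z,
          ind (edist x z ≤ 2 * edist x y) *
          (edist (f x) (f y) ^ (n / s - 1) * edist (g x) (g y) *
            (edist x y ^ (-(2 * n) : ℝ) * edist x z ^ (t - n) * φ z))
        ≤ C * (A * (gagliardoEnergy (ball x₀ M) (n / s) f ^ (1 - s / n) *
          gagliardoEnergy (ball x₀ M) (n / s) g ^ (s / n))) := by
  have hn : (1 : ℝ) ≤ n := mod_cast NeZero.one_le
  have hp : 1 ≤ (n : ℝ) / s := by rw [le_div_iff₀ hs0]; linarith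
  obtain ⟨C₁, hC₁⟩ := lintegral_trace_near_le (n := n) (F := F) hp ht0 (by linarith)
  obtain ⟨C₂, hC₂⟩ := lintegral_trace_near_le (n := n) (F := G) hp ht0 (by linarith)
  refine ⟨C₁ ^ (1 - s / n) * C₂ ^ (1 - (1 - s / n)), fun f g hf hg φ A hφ hA x₀ M Z => ?_⟩
  have hind : Measurable fun u : E × E × E => ind (edist u.1 u.2.2 ≤ 2 * edist u.1 u.2.1) :=
    measurable_ind_le (by fun_prop) (by fun_prop)
  have hb : Measurable fun u : E × E × E => edist (g u.1) (g u.2.1) :=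
    measurable_edist_map hg (by fun_prop) (by fun_prop)
  exact lintegral_trilinear_holder hs0 hs1 hf hφ _ Z hind hb (-(2 * n)) (-(2 * n)) (t - n) (t - n)
    (by ring) (by ring) (hC₁ f hf φ A hφ hA x₀ M Z) (hC₂ g hg φ A hφ hA x₀ M Z)

/-! ### Summation over dyadic annuli -/

/-- The pieces of a dyadic decomposition of the space around a ball of radius `ρ`. -/
def dyadicShell (x₀ : E) (ρ : ℝ) : ℕ → Set E
  | 0 => ball x₀ (2 ^ 4 * ρ)
  | j + 1 => ball x₀ (2 ^ (j + 1 + 4) * ρ) \ ball x₀ (2 ^ (j + 4) * ρ)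

lemma dyadicShell_subset (x₀ : E) (ρ : ℝ) (j : ℕ) :
    dyadicShell x₀ ρ j ⊆ ball x₀ (2 ^ (j + 4) * ρ) := by
  cases j with
  | zero => exact le_of_eq (by simp [dyadicShell])
  | succ j => exact Set.sdiff_subset

lemma exists_mem_ball_dyadic (x₀ : E) {ρ : ℝ} (hρ : 0 < ρ) (z : E) :
    ∃ j : ℕ, z ∈ ball x₀ (2 ^ (j + 4) * ρ) := by
  obtain ⟨j, hj⟩ := pow_unbounded_of_one_lt (dist z x₀ / ρ) (one_lt_two (α := ℝ))
  refine ⟨j, ?_⟩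
  rw [mem_ball]
  rw [div_lt_iff₀ hρ] at hj
  refine hj.trans_le ?_
  gcongr
  · norm_num
  · omega

lemma iUnion_dyadicShell (x₀ : E) {ρ : ℝ} (hρ : 0 < ρ) :
    ⋃ j, dyadicShell x₀ ρ j = univ := by
  classical
  refine Set.eq_univ_of_forall fun z => mem_iUnion.2 ?_
  have h := exists_mem_ball_dyadic x₀ hρ z
  refine ⟨Nat.find h, ?_⟩
  rcases hj : Nat.find h with _ | j
  · have := Nat.find_spec h
    rw [hj] at this
    simpa [dyadicShell] using this
  · have h1 := Nat.find_spec h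
    rw [hj] at h1
    exact ⟨h1, Nat.find_min h (by omega)⟩

lemma lintegral_le_tsum_dyadicShell (x₀ : E) {ρ : ℝ} (hρ : 0 < ρ) (φ : E → ℝ≥0∞) :
    ∫⁻ z, φ z ≤ ∑' j, ∫⁻ z in dyadicShell x₀ ρ j, φ z := by
  rw [← setLIntegral_univ, ← iUnion_dyadicShell x₀ hρ]
  exact lintegral_iUnion_le _ _

/-- A point of a far shell is much farther from the points of the ball than these are from each
other. -/
lemma edist_le_of_mem_dyadicShell {x₀ : E} {ρ : ℝ} {j : ℕ} {x y z : E}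
    (hx : x ∈ ball x₀ ρ) (hy : y ∈ ball x₀ ρ) (hz : z ∈ dyadicShell x₀ ρ (j + 1)) :
    edist x y ≤ 2⁻¹ ^ (j + 1) * edist x z ∧ 2 * edist x y < edist x z := by
  have hz' : 2 ^ (j + 4) * ρ ≤ dist z x₀ := not_lt.1 hz.2
  rw [mem_ball] at hx hy
  have hxy : dist x y < 2 * ρ := by linarith [dist_triangle_right x y x₀]
  have hρ : 0 < ρ := dist_nonneg.trans_lt hx
  have h1 : 1 ≤ (2 : ℝ) ^ j := one_le_pow₀ one_le_two
  have hxz : 2 ^ (j + 4) * ρ - ρ < dist x z := by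
    linarith [dist_triangle z x x₀, dist_comm z x]
  have h3 : 2 ^ (j + 2) * ρ ≤ dist x z := by
    rw [pow_add] at hxz ⊢
    nlinarith
  have h4 : dist x y ≤ 2⁻¹ ^ (j + 1) * dist x z := by
    calc dist x y ≤ 2 * ρ := hxy.le
      _ = 2⁻¹ ^ (j + 1) * (2 ^ (j + 2) * ρ) := by
          rw [show j + 2 = (j + 1) + 1 by ring, pow_succ _ (j + 1), inv_pow]; field_simp
      _ ≤ _ := by gcongr
  constructor
  · have h5 := edist_le_ofReal_mul (by positivity) h4
    rwa [ofReal_pow (by norm_num), ENNReal.ofReal_inv_of_pos (by norm_num),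
      ofReal_ofNat] at h5
  · have h6 : 2 * dist x y < dist x z := by rw [pow_add] at h3; nlinarith
    have h7 : ofReal (2 * dist x y) = 2 * edist x y := by
      rw [ofReal_mul zero_le_two, ofReal_ofNat, edist_dist]
    rw [← h7, edist_dist x z]
    exact (ENNReal.ofReal_lt_ofReal_iff_of_nonneg (by positivity)).2 h6

lemma tsum_ind_lt_mul (c : ℕ → ℝ≥0∞) (L : ℕ) :
    ∑' i, ind (L < i) * c i = ∑' k, c (L + (k + 1)) := by
  have h := Summable.sum_add_tsum_nat_add' (f := fun i => ind (L < i) * c i) (k := L + 1)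
    ENNReal.summable
  rw [← h, Finset.sum_eq_zero, zero_add]
  · refine tsum_congr fun k => ?_
    rw [ind_of_true (by omega), one_mul, show k + (L + 1) = L + (k + 1) by ring]
  · intro i hi
    rw [ind_of_false, zero_mul]
    simpa using Nat.lt_succ_iff.1 (Finset.mem_range.1 hi)

/-- A geometrically weighted sum over all scales is controlled by its part above the scale `L` and
the contribution of that scale. -/
lemma tsum_geometric_le {w : ℝ≥0∞} (hw0 : w ≠ 0) (hw1 : w < 1) (m : ℕ) : ∃ C : ℝ≥0,
    ∀ b : ℕ → ℝ≥0∞, Monotone b → ∀ L : ℕ,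
      ∑' j, w ^ j * b (j + m) ≤ C * (b L + ∑' k, w ^ (L + (k + 1)) * b (L + (k + 1))) := by
  have hwt : w ≠ ∞ := (hw1.trans ENNReal.one_lt_top).ne
  have hm0 : w ^ m ≠ 0 := pow_ne_zero _ hw0
  have hmt : w ^ m ≠ ∞ := ENNReal.pow_ne_top hwt
  obtain ⟨c₁, hc₁⟩ : ∃ c : ℝ≥0, (c : ℝ≥0∞) = (1 - w)⁻¹ :=
    ⟨_, coe_toNNReal (inv_ne_top.2 (tsub_pos_of_lt hw1).ne')⟩
  obtain ⟨c₂, hc₂⟩ : ∃ c : ℝ≥0, (c : ℝ≥0∞) = (w ^ m)⁻¹ :=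
    ⟨_, coe_toNNReal (inv_ne_top.2 hm0)⟩
  refine ⟨c₁ + c₂, fun b hb L => ?_⟩
  have hterm : ∀ j, w ^ j * b (j + m) ≤
      w ^ j * b L + c₂ * (ind (L < j + m) * (w ^ (j + m) * b (j + m))) := by
    intro j
    by_cases h : L < j + m
    · refine le_add_left (le_of_eq ?_)
      rw [ind_of_true h, one_mul, pow_add, hc₂]
      calc w ^ j * b (j + m) = ((w ^ m)⁻¹ * w ^ m) * (w ^ j * b (j + m)) := by
            rw [ENNReal.inv_mul_cancel hm0 hmt, one_mul]
        _ = _ := by ring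
    · refine le_add_right ?_
      gcongr
      exact hb (not_lt.1 h)
  have hinj : ∑' j, ind (L < j + m) * (w ^ (j + m) * b (j + m)) ≤
      ∑' k, w ^ (L + (k + 1)) * b (L + (k + 1)) := by
    rw [← tsum_ind_lt_mul (fun i => w ^ i * b i) L]
    exact ENNReal.tsum_comp_le_tsum_of_injective (add_left_injective m)
      fun i => ind (L < i) * (w ^ i * b i)
  generalize ∑' k, w ^ (L + (k + 1)) * b (L + (k + 1)) = S at hinj ⊢
  calc ∑' j, w ^ j * b (j + m)
      ≤ ∑' j, (w ^ j * b L + c₂ * (ind (L < j + m) * (w ^ (j + m) * b (j + m)))) :=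
        tsum_le_tsum hterm
    _ = (∑' j, w ^ j) * b L + c₂ * ∑' j, ind (L < j + m) * (w ^ (j + m) * b (j + m)) := by
        rw [ENNReal.tsum_add, ENNReal.tsum_mul_right, tsum_mul_left]
    _ ≤ c₁ * b L + c₂ * S := by
        rw [ENNReal.tsum_geometric, hc₁]
        gcongr
    _ ≤ c₁ * (b L + S) + c₂ * (b L + S) := by
        gcongr
        · exact le_self_add
        · exact le_add_self
    _ = _ := by rw [coe_add]; ring

/-! ### The first commutator -/

/-- One half of the integrand of the trilinear form which tests the first commutator: `g` is only
differenced between `x` and `z`. -/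
noncomputable def trilinear (s t : ℝ) (f : E → F) (g : E → G) (φ : E → ℝ≥0∞)
    (x y z : E) : ℝ≥0∞ :=
  edist (f x) (f y) ^ (n / s - 1) * edist (g x) (g z) * rieszDiff t x y z *
    edist x y ^ (-(2 * n) : ℝ) * φ z

lemma measurable_trilinear {s t : ℝ} {f : E → F} {g : E → G} (hf : StronglyMeasurable f)
    (hg : StronglyMeasurable g) {φ : E → ℝ≥0∞} (hφ : Measurable φ) :
    Measurable fun u : E × E × E => trilinear s t f g φ u.1 u.2.1 u.2.2 := by
  have ha : Measurable fun u : E × E × E => edist (f u.1) (f u.2.1) :=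
    measurable_edist_map hf (by fun_prop) (by fun_prop)
  have hb : Measurable fun u : E × E × E => edist (g u.1) (g u.2.2) :=
    measurable_edist_map hg (by fun_prop) (by fun_prop)
  have hk := measurable_rieszDiff (n := n) t
  unfold trilinear
  fun_prop

/-- The integrals over the far shells only see the regime where `x` and `y` are close together. -/
lemma lintegral_trilinear_shell_succ_le [NeZero n] {s t : ℝ} (hs0 : 0 < s) (hs1 : s < 1)
    (ht0 : 0 < t) (hts : t < s) : ∃ C : ℝ≥0, ∀ (f : E → F) (g : E → G), StronglyMeasurable f →
    StronglyMeasurable g → ∀ (φ : E → ℝ≥0∞) (A : ℝ≥0∞), Measurable φ → GrowthBound φ A (n - t) →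
    ∀ (x₀ : E) (ρ : ℝ) (j : ℕ), 0 < ρ →
      ∫⁻ x in ball x₀ ρ, ∫⁻ y in ball x₀ ρ, ∫⁻ z in dyadicShell x₀ ρ (j + 1),
          trilinear s t f g φ x y z
        ≤ C * ((2⁻¹ ^ (1 - s)) ^ (j + 1) * A *
          (gagliardoEnergy (ball x₀ ρ) (n / s) f ^ (1 - s / n) *
          gagliardoEnergy (ball x₀ (2 ^ (j + 1 + 4) * ρ)) (n / s) g ^ (s / n))) := by
  have hn : (1 : ℝ) ≤ n := mod_cast NeZero.one_le
  obtain ⟨C, hC⟩ := lintegral_trilinear_far_le (n := n) (F := F) (G := G) hs0 hs1 ht0 hts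
  set c : ℝ≥0∞ := ofReal (max 1 (n - t)) * (1 + 2 ^ (n + 1 - t)) with hc
  have hct : c ≠ ∞ := mul_ne_top ofReal_ne_top
    (add_ne_top.2 ⟨by simp, rpow_ne_top_of_nonneg (by linarith) (by simp)⟩)
  refine ⟨c.toNNReal * C, fun f g hf hg φ A hφ hA x₀ ρ j hρ => ?_⟩
  have hl0 : (2⁻¹ : ℝ≥0∞) ^ (j + 1) ≠ 0 := pow_ne_zero _ (by simp)
  have hlt : (2⁻¹ : ℝ≥0∞) ^ (j + 1) ≠ ∞ := ENNReal.pow_ne_top (by simp)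
  have h := hC f g hf hg φ A hφ hA x₀ (2 ^ (j + 1 + 4) * ρ) (ball x₀ ρ)
    (dyadicShell x₀ ρ (j + 1)) (ball_subset_ball ?_) (dyadicShell_subset x₀ ρ (j + 1))
    _ hl0 hlt
  swap
  · exact le_mul_of_one_le_left hρ.le (one_le_pow₀ one_le_two)
  have e : ((2⁻¹ : ℝ≥0∞) ^ (j + 1)) ^ (1 - s) = (2⁻¹ ^ (1 - s)) ^ (j + 1) := by
    rw [← rpow_natCast, ← rpow_mul, ← rpow_natCast, ← rpow_mul,
      mul_comm]
  rw [e] at h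
  rw [coe_mul, coe_toNNReal hct, mul_assoc]
  refine le_trans ?_ (mul_le_mul_right h _)
  rw [← lintegral_const_mul' _ _ hct]
  refine setLIntegral_mono' measurableSet_ball fun x hx => ?_
  rw [← lintegral_const_mul' _ _ hct]
  refine lintegral_mono_ae ?_
  filter_upwards [ae_restrict_mem measurableSet_ball,
    ae_restrict_of_ae (Measure.ae_ne volume x)] with y hy hxy
  rw [← lintegral_const_mul' _ _ hct]
  have hshell : MeasurableSet (dyadicShell x₀ ρ (j + 1)) :=
    measurableSet_ball.diff measurableSet_ball
  refine lintegral_mono_ae ?_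
  filter_upwards [ae_restrict_mem hshell,
    ae_restrict_of_ae (Measure.ae_ne volume x),
    ae_restrict_of_ae (Measure.ae_ne volume y)] with z hz hxz hyz
  have hgeo := edist_le_of_mem_dyadicShell hx hy hz
  rcases rieszDiff_cases (t := t) (by linarith) hxz.symm hyz.symm with h1 | h1
  · rw [ind_of_true hgeo.1, one_mul]
    unfold trilinear
    calc _ ≤ edist (f x) (f y) ^ (n / s - 1) * edist (g x) (g z) *
          (c * (edist x y * edist x z ^ (t - n - 1))) * edist x y ^ (-(2 * n) : ℝ) * φ z := by
          gcongr
          exact h1.2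
      _ = _ := by
          rw [show (1 - 2 * n : ℝ) = 1 + -(2 * n) by ring,
            rpow_add _ _ (edist_pos.2 hxy.symm).ne' (edist_ne_top x y), rpow_one]
          ring
  · exact absurd h1.1 (not_le.2 hgeo.2)

/-- The integrand over the central shell, split into the regimes of the previous section. -/
lemma trilinear_le [NeZero n] {s t : ℝ} (htn : t ≤ n) (f : E → F) (g : E → G)
    (φ : E → ℝ≥0∞) {x y z : E} (hxy : x ≠ y) (hxz : x ≠ z) (hyz : y ≠ z) :
    trilinear s t f g φ x y z ≤ ofReal (max 1 (n - t)) * (1 + 2 ^ (n + 1 - t)) *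
      (ind (edist x y ≤ 1 * edist x z) * (edist (f x) (f y) ^ (n / s - 1) * edist (g x) (g z) *
          (edist x y ^ (1 - 2 * n : ℝ) * edist x z ^ (t - n - 1) * φ z))
        + ind (edist x z ≤ 2 * edist x y) * (edist (f x) (f y) ^ (n / s - 1) *
          edist (g x) (g z) * (edist x y ^ (-(2 * n) : ℝ) * edist x z ^ (t - n) * φ z))
        + (ind (edist y z ≤ 2 * edist y x) * (edist (f y) (f x) ^ (n / s - 1) *
          edist (g y) (g z) * (edist y x ^ (-(2 * n) : ℝ) * edist y z ^ (t - n) * φ z))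
        + ind (edist y z ≤ 2 * edist y x) * (edist (f y) (f x) ^ (n / s - 1) *
          edist (g y) (g x) * (edist y x ^ (-(2 * n) : ℝ) * edist y z ^ (t - n) * φ z)))) := by
  unfold trilinear
  rcases rieszDiff_cases htn hxz hyz with h | ⟨h1, h2, h3⟩
  · rw [ind_of_true (show edist x y ≤ 1 * edist x z by rw [one_mul]; exact h.1)]
    set c : ℝ≥0∞ := ofReal (max 1 (n - t)) * (1 + 2 ^ (n + 1 - t))
    calc _ ≤ edist (f x) (f y) ^ (n / s - 1) * edist (g x) (g z) *
          (c * (edist x y * edist x z ^ (t - n - 1))) * edist x y ^ (-(2 * n) : ℝ) * φ z := by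
          gcongr
          exact h.2
      _ = c * (1 * (edist (f x) (f y) ^ (n / s - 1) * edist (g x) (g z) *
          (edist x y ^ (1 - 2 * n : ℝ) * edist x z ^ (t - n - 1) * φ z))) := by
          rw [show (1 - 2 * n : ℝ) = 1 + -(2 * n) by ring,
            rpow_add _ _ (edist_pos.2 hxy).ne' (edist_ne_top x y), rpow_one]
          ring
      _ ≤ _ := by
          gcongr
          rw [add_assoc]
          exact le_self_add
  · rw [ind_of_true h1, ind_of_true h2]
    set c : ℝ≥0∞ := ofReal (max 1 (n - t))
    have ht := edist_triangle (g x) (g y) (g z)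
    rw [edist_comm y x, edist_comm (f y) (f x), edist_comm (g y) (g x)]
    calc _ ≤ edist (f x) (f y) ^ (n / s - 1) * edist (g x) (g z) *
          (c * (edist x z ^ (t - n) + edist y z ^ (t - n))) *
          edist x y ^ (-(2 * n) : ℝ) * φ z := by
          gcongr
      _ = c * (edist (f x) (f y) ^ (n / s - 1) * edist (g x) (g z) *
          (edist x y ^ (-(2 * n) : ℝ) * edist x z ^ (t - n) * φ z)
          + edist (f x) (f y) ^ (n / s - 1) * edist (g x) (g z) *
          (edist x y ^ (-(2 * n) : ℝ) * edist y z ^ (t - n) * φ z)) := by ring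
      _ ≤ c * (edist (f x) (f y) ^ (n / s - 1) * edist (g x) (g z) *
          (edist x y ^ (-(2 * n) : ℝ) * edist x z ^ (t - n) * φ z)
          + edist (f x) (f y) ^ (n / s - 1) * (edist (g x) (g y) + edist (g y) (g z)) *
          (edist x y ^ (-(2 * n) : ℝ) * edist y z ^ (t - n) * φ z)) := by gcongr
      _ = c * 1 * (0 + 1 * (edist (f x) (f y) ^ (n / s - 1) * edist (g x) (g z) *
          (edist x y ^ (-(2 * n) : ℝ) * edist x z ^ (t - n) * φ z))
          + (1 * (edist (f x) (f y) ^ (n / s - 1) * edist (g y) (g z) *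
          (edist x y ^ (-(2 * n) : ℝ) * edist y z ^ (t - n) * φ z))
          + 1 * (edist (f x) (f y) ^ (n / s - 1) * edist (g x) (g y) *
          (edist x y ^ (-(2 * n) : ℝ) * edist y z ^ (t - n) * φ z)))) := by ring
      _ ≤ _ := by
          gcongr
          · exact le_self_add
          · exact zero_le

lemma lintegral_swap_ball {J : E → E → E → ℝ≥0∞}
    (hJ : Measurable fun u : E × E × E => J u.1 u.2.1 u.2.2) (B Z : Set E) :
    ∫⁻ x in B, ∫⁻ y in B, ∫⁻ z in Z, J y x z = ∫⁻ x in B, ∫⁻ y in B, ∫⁻ z in Z, J x y z := by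
  have h1 : Measurable fun u : (E × E) × E => J u.1.2 u.1.1 u.2 :=
    hJ.comp ((measurable_snd.comp measurable_fst).prodMk
      ((measurable_fst.comp measurable_fst).prodMk measurable_snd))
  exact lintegral_lintegral_swap h1.lintegral_prod_right'.aemeasurable

lemma lintegral_iterated_mono_ae {α β γ : Type*} [MeasurableSpace α] [MeasurableSpace β]
    [MeasurableSpace γ] (μ₁ : Measure α) (μ₂ : Measure β) (μ₃ : Measure γ)
    {J K : α → β → γ → ℝ≥0∞} (h : ∀ x, ∀ᵐ y ∂μ₂, ∀ᵐ z ∂μ₃, J x y z ≤ K x y z) :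
    ∫⁻ x, ∫⁻ y, ∫⁻ z, J x y z ∂μ₃ ∂μ₂ ∂μ₁ ≤ ∫⁻ x, ∫⁻ y, ∫⁻ z, K x y z ∂μ₃ ∂μ₂ ∂μ₁ := by
  refine lintegral_mono fun x => lintegral_mono_ae ?_
  filter_upwards [h x] with y hy
  exact lintegral_mono_ae hy

lemma lintegral_iterated_add {α β γ : Type*} [MeasurableSpace α] [MeasurableSpace β]
    [MeasurableSpace γ] (μ₁ : Measure α) (μ₂ : Measure β) (μ₃ : Measure γ) [SFinite μ₂] [SFinite μ₃]
    {J K : α → β → γ → ℝ≥0∞}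
    (hJ : Measurable fun u : α × β × γ => J u.1 u.2.1 u.2.2) :
    ∫⁻ x, ∫⁻ y, ∫⁻ z, J x y z + K x y z ∂μ₃ ∂μ₂ ∂μ₁ =
      ∫⁻ x, ∫⁻ y, ∫⁻ z, J x y z ∂μ₃ ∂μ₂ ∂μ₁ + ∫⁻ x, ∫⁻ y, ∫⁻ z, K x y z ∂μ₃ ∂μ₂ ∂μ₁ := by
  have h3 : Measurable fun u : (α × β) × γ => J u.1.1 u.1.2 u.2 :=
    hJ.comp ((measurable_fst.comp measurable_fst).prodMk
      ((measurable_snd.comp measurable_fst).prodMk measurable_snd))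
  have h2 : Measurable fun u : α × β => ∫⁻ z, J u.1 u.2 z ∂μ₃ := h3.lintegral_prod_right'
  have h1 : Measurable fun x : α => ∫⁻ y, ∫⁻ z, J x y z ∂μ₃ ∂μ₂ := h2.lintegral_prod_right'
  rw [← lintegral_add_left h1]
  refine lintegral_congr fun x => ?_
  have h2' : Measurable fun y : β => ∫⁻ z, J x y z ∂μ₃ :=
    h2.comp measurable_prodMk_left
  rw [← lintegral_add_left h2']
  refine lintegral_congr fun y => ?_
  have h3' : Measurable fun z : γ => J x y z :=
    hJ.comp (measurable_const.prodMk measurable_prodMk_left)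
  rw [← lintegral_add_left h3']

lemma lintegral_trilinear_shell_zero_le [NeZero n] {s t : ℝ} (hs0 : 0 < s) (hs1 : s < 1)
    (ht0 : 0 < t) (hts : t < s) : ∃ C : ℝ≥0, ∀ (f : E → F) (g : E → G), StronglyMeasurable f →
    StronglyMeasurable g → ∀ (φ : E → ℝ≥0∞) (A : ℝ≥0∞), Measurable φ → GrowthBound φ A (n - t) →
    ∀ (x₀ : E) (ρ : ℝ), 0 < ρ →
      ∫⁻ x in ball x₀ ρ, ∫⁻ y in ball x₀ ρ, ∫⁻ z in dyadicShell x₀ ρ 0,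
          trilinear s t f g φ x y z
        ≤ C * (A * (gagliardoEnergy (ball x₀ ρ) (n / s) f ^ (1 - s / n) *
          gagliardoEnergy (ball x₀ (2 ^ 4 * ρ)) (n / s) g ^ (s / n))) := by
  have hn : (1 : ℝ) ≤ n := mod_cast NeZero.one_le
  have hθ0 : 0 ≤ s / n := by positivity
  obtain ⟨C₁, hC₁⟩ := lintegral_trilinear_far_le (n := n) (F := F) (G := G) hs0 hs1 ht0 hts
  obtain ⟨C₂, hC₂⟩ := lintegral_trilinear_near_le (n := n) (F := F) (G := G) hs0 hs1 ht0 hts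
  obtain ⟨C₃, hC₃⟩ := lintegral_trilinear_diag_le (n := n) (F := F) (G := G) hs0 hs1 ht0 hts
  set c : ℝ≥0∞ := ofReal (max 1 (n - t)) * (1 + 2 ^ (n + 1 - t)) with hc
  have hct : c ≠ ∞ := mul_ne_top ofReal_ne_top
    (add_ne_top.2 ⟨by simp, rpow_ne_top_of_nonneg (by linarith) (by simp)⟩)
  refine ⟨c.toNNReal * (C₁ + C₂ + (C₂ + C₃)), fun f g hf hg φ A hφ hA x₀ ρ hρ => ?_⟩
  have hBD : ball x₀ ρ ⊆ ball x₀ (2 ^ 4 * ρ) :=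
    ball_subset_ball (le_mul_of_one_le_left hρ.le (one_le_pow₀ one_le_two))
  have hZ : dyadicShell x₀ ρ 0 ⊆ ball x₀ (2 ^ 4 * ρ) := subset_rfl
  have h₁ := hC₁ f g hf hg φ A hφ hA x₀ _ _ _ hBD hZ 1 (by simp) (by simp)
  have h₂ := hC₂ f g hf hg φ A hφ hA x₀ _ _ _ hBD hZ
  have h₃ := hC₃ f g hf hg φ A hφ hA x₀ ρ (dyadicShell x₀ ρ 0)
  have hE : gagliardoEnergy (ball x₀ ρ) (n / s) g ^ (s / n) ≤
      gagliardoEnergy (ball x₀ (2 ^ 4 * ρ)) (n / s) g ^ (s / n) := by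
    gcongr
    exact gagliardoEnergy_mono hBD _ _
  have ha : Measurable fun u : E × E × E => edist (f u.1) (f u.2.1) :=
    measurable_edist_map hf (by fun_prop) (by fun_prop)
  have hb : Measurable fun u : E × E × E => edist (g u.1) (g u.2.2) :=
    measurable_edist_map hg (by fun_prop) (by fun_prop)
  have hb' : Measurable fun u : E × E × E => edist (g u.1) (g u.2.1) :=
    measurable_edist_map hg (by fun_prop) (by fun_prop)
  have hi₁ : Measurable fun u : E × E × E => ind (edist u.1 u.2.1 ≤ 1 * edist u.1 u.2.2) :=
    measurable_ind_le (by fun_prop) (by fun_prop)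
  have hi₂ : Measurable fun u : E × E × E => ind (edist u.1 u.2.2 ≤ 2 * edist u.1 u.2.1) :=
    measurable_ind_le (by fun_prop) (by fun_prop)
  have hm₁ : Measurable fun u : E × E × E => ind (edist u.1 u.2.1 ≤ 1 * edist u.1 u.2.2) *
      (edist (f u.1) (f u.2.1) ^ (n / s - 1) * edist (g u.1) (g u.2.2) *
        (edist u.1 u.2.1 ^ (1 - 2 * n : ℝ) * edist u.1 u.2.2 ^ (t - n - 1) * φ u.2.2)) := by
    fun_prop
  have hm₂ : Measurable fun u : E × E × E => ind (edist u.1 u.2.2 ≤ 2 * edist u.1 u.2.1) *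
      (edist (f u.1) (f u.2.1) ^ (n / s - 1) * edist (g u.1) (g u.2.2) *
        (edist u.1 u.2.1 ^ (-(2 * n) : ℝ) * edist u.1 u.2.2 ^ (t - n) * φ u.2.2)) := by
    fun_prop
  have hm₃ : Measurable fun u : E × E × E => ind (edist u.1 u.2.2 ≤ 2 * edist u.1 u.2.1) *
      (edist (f u.1) (f u.2.1) ^ (n / s - 1) * edist (g u.1) (g u.2.1) *
        (edist u.1 u.2.1 ^ (-(2 * n) : ℝ) * edist u.1 u.2.2 ^ (t - n) * φ u.2.2)) := by
    fun_prop
  have hsw : Measurable fun u : E × E × E => (u.2.1, u.1, u.2.2) := by fun_prop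
  refine (lintegral_iterated_mono_ae _ _ _ fun x =>
    (ae_restrict_of_ae (Measure.ae_ne volume x)).mono fun y hxy =>
    ((ae_restrict_of_ae (Measure.ae_ne volume x)).and
      (ae_restrict_of_ae (Measure.ae_ne volume y))).mono fun z hz =>
    trilinear_le (by linarith) f g φ hxy.symm hz.1.symm hz.2.symm).trans ?_
  rw [← hc]
  simp_rw [lintegral_const_mul' _ _ hct]
  have e₂ := lintegral_swap_ball (J := fun x y z => ind (edist x z ≤ 2 * edist x y) *
      (edist (f x) (f y) ^ (n / s - 1) * edist (g x) (g z) *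
        (edist x y ^ (-(2 * n) : ℝ) * edist x z ^ (t - n) * φ z))) hm₂ (ball x₀ ρ)
    (dyadicShell x₀ ρ 0)
  have e₃ := lintegral_swap_ball (J := fun x y z => ind (edist x z ≤ 2 * edist x y) *
      (edist (f x) (f y) ^ (n / s - 1) * edist (g x) (g y) *
        (edist x y ^ (-(2 * n) : ℝ) * edist x z ^ (t - n) * φ z))) hm₃ (ball x₀ ρ)
    (dyadicShell x₀ ρ 0)
  rw [lintegral_iterated_add _ _ _ (hm₁.add hm₂), lintegral_iterated_add _ _ _ hm₁,
    lintegral_iterated_add _ _ _ (hm₂.comp hsw), e₂, e₃]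
  rw [coe_mul, coe_toNNReal hct, mul_assoc c]
  push_cast
  refine mul_le_mul_right ?_ c
  rw [one_rpow, one_mul] at h₁
  have h₃' := h₃.trans (mul_le_mul_right (mul_le_mul_right (mul_le_mul_right hE _) _) _)
  refine (add_le_add (add_le_add h₁ h₂) (add_le_add h₂ h₃')).trans (le_of_eq ?_)
  ring

lemma lintegral_iterated_le_tsum_dyadicShell {J : E → E → E → ℝ≥0∞}
    (hJ : Measurable fun u : E × E × E => J u.1 u.2.1 u.2.2) (B : Set E) (x₀ : E) {ρ : ℝ}
    (hρ : 0 < ρ) :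
    ∫⁻ x in B, ∫⁻ y in B, ∫⁻ z, J x y z ≤
      ∑' j, ∫⁻ x in B, ∫⁻ y in B, ∫⁻ z in dyadicShell x₀ ρ j, J x y z := by
  have hm3 : Measurable fun u : (E × E) × E => J u.1.1 u.1.2 u.2 :=
    hJ.comp ((measurable_fst.comp measurable_fst).prodMk
      ((measurable_snd.comp measurable_fst).prodMk measurable_snd))
  have hm2 : ∀ j, Measurable fun u : E × E => ∫⁻ z in dyadicShell x₀ ρ j, J u.1 u.2 z :=
    fun j => hm3.lintegral_prod_right'
  have hm1 : ∀ j, Measurable fun x : E => ∫⁻ y in B, ∫⁻ z in dyadicShell x₀ ρ j, J x y z :=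
    fun j => (hm2 j).lintegral_prod_right'
  rw [← lintegral_tsum fun j => (hm1 j).aemeasurable]
  refine lintegral_mono fun x => ?_
  have hx : ∀ j, Measurable fun y : E => ∫⁻ z in dyadicShell x₀ ρ j, J x y z :=
    fun j => (hm2 j).comp measurable_prodMk_left
  rw [← lintegral_tsum fun j => (hx j).aemeasurable]
  exact lintegral_mono fun y => lintegral_le_tsum_dyadicShell x₀ hρ _

lemma lintegral_iterated_rotate {J : E → E → E → ℝ≥0∞}
    (hJ : Measurable fun u : E × E × E => J u.1 u.2.1 u.2.2) (B : Set E) :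
    ∫⁻ z, ∫⁻ x in B, ∫⁻ y in B, J x y z = ∫⁻ x in B, ∫⁻ y in B, ∫⁻ z, J x y z := by
  have h5 : Measurable fun u : (E × E) × E => J u.1.2 u.2 u.1.1 :=
    hJ.comp ((measurable_snd.comp measurable_fst).prodMk
      (measurable_snd.prodMk (measurable_fst.comp measurable_fst)))
  have h6 : Measurable fun u : E × E => ∫⁻ y in B, J u.2 y u.1 := h5.lintegral_prod_right'
  rw [lintegral_lintegral_swap h6.aemeasurable]
  refine lintegral_congr fun x => ?_
  have h7 : Measurable fun u : E × E => J x u.2 u.1 :=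
    hJ.comp (measurable_const.prodMk (measurable_snd.prodMk measurable_fst))
  rw [lintegral_lintegral_swap h7.aemeasurable]

lemma measurable_lintegral_iterated {J : E → E → E → ℝ≥0∞}
    (hJ : Measurable fun u : E × E × E => J u.1 u.2.1 u.2.2) (B : Set E) :
    Measurable fun z => ∫⁻ x in B, ∫⁻ y in B, J x y z := by
  have hm3 : Measurable fun u : (E × E) × E => J u.1.2 u.2 u.1.1 :=
    hJ.comp ((measurable_snd.comp measurable_fst).prodMk
      (measurable_snd.prodMk (measurable_fst.comp measurable_fst)))
  have h2 : Measurable fun u : E × E => ∫⁻ y in B, J u.2 y u.1 := hm3.lintegral_prod_right'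
  exact h2.lintegral_prod_right'

lemma lintegral_iterated_mul_const {J : E → E → ℝ≥0∞}
    (hJ : Measurable fun u : E × E => J u.1 u.2) (B : Set E) (c : ℝ≥0∞) :
    (∫⁻ x in B, ∫⁻ y in B, J x y) * c = ∫⁻ x in B, ∫⁻ y in B, J x y * c := by
  rw [← lintegral_mul_const _ (hJ.lintegral_prod_right' (ν := volume.restrict B))]
  refine lintegral_congr fun x => ?_
  have h4 : Measurable fun y => J x y := hJ.comp measurable_prodMk_left
  rw [← lintegral_mul_const _ h4]

/-- The sum over all scales which bounds the trilinear forms over a ball. -/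
noncomputable def scaleSum (w : ℝ≥0∞) (s : ℝ) (x₀ : E) (ρ : ℝ) (f : E → F) (g : E → G) : ℝ≥0∞ :=
  ∑' j : ℕ, w ^ j * (gagliardoEnergy (ball x₀ ρ) (n / s) f ^ (1 - s / n) *
    gagliardoEnergy (ball x₀ (2 ^ (j + 4) * ρ)) (n / s) g ^ (s / n))

lemma lintegral_trilinear_le [NeZero n] {s t : ℝ} (hs0 : 0 < s) (hs1 : s < 1)
    (ht0 : 0 < t) (hts : t < s) : ∃ C : ℝ≥0, ∀ (f : E → F) (g : E → G), StronglyMeasurable f →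
    StronglyMeasurable g → ∀ (φ : E → ℝ≥0∞) (A : ℝ≥0∞), Measurable φ → GrowthBound φ A (n - t) →
    ∀ (x₀ : E) (ρ : ℝ), 0 < ρ →
      ∫⁻ x in ball x₀ ρ, ∫⁻ y in ball x₀ ρ, ∫⁻ z, trilinear s t f g φ x y z
        ≤ C * A * scaleSum (2⁻¹ ^ (1 - s)) s x₀ ρ f g := by
  obtain ⟨C₁, hC₁⟩ := lintegral_trilinear_shell_zero_le (n := n) (F := F) (G := G) hs0 hs1 ht0 hts
  obtain ⟨C₂, hC₂⟩ := lintegral_trilinear_shell_succ_le (n := n) (F := F) (G := G) hs0 hs1 ht0 hts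
  refine ⟨C₁ + C₂, fun f g hf hg φ A hφ hA x₀ ρ hρ => ?_⟩
  have hm := measurable_trilinear (s := s) (t := t) hf hg hφ
  refine (lintegral_iterated_le_tsum_dyadicShell hm _ x₀ hρ).trans ?_
  unfold scaleSum
  rw [← tsum_mul_left]
  refine tsum_le_tsum fun j => ?_
  have hC : ((C₁ + C₂ : ℝ≥0) : ℝ≥0∞) = C₁ + C₂ := coe_add _ _
  rw [hC, mul_assoc]
  cases j with
  | zero =>
    refine (hC₁ f g hf hg φ A hφ hA x₀ ρ hρ).trans ?_
    rw [pow_zero, one_mul, zero_add]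
    exact mul_le_mul_left le_self_add _
  | succ j =>
    refine (hC₂ f g hf hg φ A hφ hA x₀ ρ j hρ).trans ?_
    rw [← mul_assoc A, mul_comm A]
    exact mul_le_mul_left le_add_self _

/-- The majorant of the first commutator which arises from the triangle inequality for `g`. -/
noncomputable def commMajorant (B : Set E) (s t : ℝ) (f : E → F) (g : E → G) (z : E) : ℝ≥0∞ :=
  ∫⁻ x in B, ∫⁻ y in B, trilinear s t f g (fun _ => 1) x y z

lemma measurable_commMajorant {s t : ℝ} {f : E → F} {g : E → G} (hf : StronglyMeasurable f)
    (hg : StronglyMeasurable g) (B : Set E) : Measurable (commMajorant B s t f g) :=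
  measurable_lintegral_iterated (measurable_trilinear hf hg measurable_const) B

lemma trilinear_one_mul {s t : ℝ} (f : E → F) (g : E → G) (φ : E → ℝ≥0∞) (x y z : E) :
    trilinear s t f g (fun _ => 1) x y z * φ z = trilinear s t f g φ x y z := by
  unfold trilinear
  rw [mul_one]

lemma commMajorant_mul {s t : ℝ} {f : E → F} {g : E → G} (hf : StronglyMeasurable f)
    (hg : StronglyMeasurable g) (φ : E → ℝ≥0∞) (B : Set E) (z : E) :
    commMajorant B s t f g z * φ z = ∫⁻ x in B, ∫⁻ y in B, trilinear s t f g φ x y z := by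
  have hm : Measurable fun u : E × E × E => trilinear s t f g (fun _ => 1) u.1 u.2.1 u.2.2 :=
    measurable_trilinear hf hg measurable_const
  have h1 : Measurable fun u : E × E => (u.1, u.2, z) := by fun_prop
  refine (lintegral_iterated_mul_const (hm.comp h1) B (φ z)).trans ?_
  refine lintegral_congr fun x => lintegral_congr fun y => ?_
  exact trilinear_one_mul f g φ x y z

lemma lintegral_commMajorant_mul {s t : ℝ} {f : E → F} {g : E → G} (hf : StronglyMeasurable f)
    (hg : StronglyMeasurable g) {φ : E → ℝ≥0∞} (hφ : Measurable φ) (B : Set E) :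
    ∫⁻ z, commMajorant B s t f g z * φ z =
      ∫⁻ x in B, ∫⁻ y in B, ∫⁻ z, trilinear s t f g φ x y z := by
  simp_rw [commMajorant_mul hf hg]
  exact lintegral_iterated_rotate (measurable_trilinear hf hg hφ) B

/-- A function in `L^(n/t)` has growth exponent `n - t`. -/
lemma growthBound_of_lintegral_rpow [NeZero n] {t : ℝ} (ht0 : 0 < t) (htn : t < n) :
    ∃ C : ℝ≥0, ∀ φ : E → ℝ≥0∞, AEMeasurable φ →
      GrowthBound φ (C * (∫⁻ z, φ z ^ ((n : ℝ) / t)) ^ (t / n)) (n - t) := by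
  have hn : (0 : ℝ) < n := by linarith
  have h1 : 0 ≤ 1 - t / n := by rw [sub_nonneg, div_le_one hn]; exact htn.le
  refine ⟨(volume (ball (0 : E) 1)).toNNReal ^ (1 - t / n), fun φ hφ u r hr => ?_⟩
  have hv := growthBound_one (n := n) u r hr
  rw [coe_rpow_of_nonneg _ h1, coe_toNNReal measure_ball_lt_top.ne]
  have hol := ENNReal.lintegral_mul_norm_pow_le (μ := volume.restrict (ball u r))
    (f := fun z => φ z ^ ((n : ℝ) / t)) (g := fun _ => 1) (p := t / n) (q := 1 - t / n)
    ((hφ.pow_const _).restrict) aemeasurable_const (by positivity) h1 (by ring)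
  calc ∫⁻ z in ball u r, φ z
      = ∫⁻ z in ball u r, (φ z ^ ((n : ℝ) / t)) ^ (t / n) * 1 ^ (1 - t / n) := by
        refine lintegral_congr fun z => ?_
        rw [one_rpow, mul_one, ← rpow_mul,
          show (n : ℝ) / t * (t / n) = 1 by field_simp, rpow_one]
    _ ≤ _ := hol
    _ ≤ (∫⁻ z, φ z ^ ((n : ℝ) / t)) ^ (t / n) *
        (volume (ball (0 : E) 1) * ofReal r ^ (n : ℝ)) ^ (1 - t / n) := by
        gcongr
        exact Measure.restrict_le_self
    _ = _ := by
        rw [mul_rpow_of_nonneg _ _ h1, ← rpow_mul,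
          show (n : ℝ) * (1 - t / n) = n - t by field_simp]
        ring

/-- The converse of Hölder's inequality, by testing with truncated powers of the function. -/
lemma lintegral_rpow_le_of_forall_lintegral_mul_le {S : E → ℝ≥0∞} (hS : Measurable S) {q q' : ℝ}
    (hq : q.HolderConjugate q') {K : ℝ≥0∞}
    (h : ∀ φ : E → ℝ≥0∞, Measurable φ →
      ∫⁻ z, S z * φ z ≤ K * (∫⁻ z, φ z ^ q') ^ (1 / q')) :
    (∫⁻ z, S z ^ q) ^ (1 / q) ≤ K := by
  have hq0 := hq.pos
  have hq'0 := hq.symm.pos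
  have hq1 := hq.lt
  -- truncations of `S`, integrable to every power
  obtain ⟨T, hT⟩ : ∃ T : ℕ → E → ℝ≥0∞,
      T = fun k : ℕ => (ball (0 : E) (k : ℝ)).indicator fun z => min (S z) (k : ℝ≥0∞) := ⟨_, rfl⟩
  have hTm : ∀ k, Measurable (T k) := fun k => by
    rw [hT]
    exact (hS.min measurable_const).indicator measurableSet_ball
  have hTS : ∀ k z, T k z ≤ S z := fun k z => by
    rw [hT]
    exact (indicator_le_self _ _ z).trans (min_le_left _ _)
  have hTmono : Monotone T := by
    intro i j hij z
    rw [hT]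
    have hij' : (i : ℝ) ≤ j := mod_cast hij
    refine (indicator_le_indicator_of_subset (ball_subset_ball hij')
      (fun _ => zero_le) z).trans (indicator_le_indicator ?_)
    gcongr
  have hTsup : ∀ z, ⨆ k, T k z = S z := by
    intro z
    refine le_antisymm (iSup_le fun k => hTS k z) ?_
    refine le_of_forall_lt fun a ha => ?_
    obtain ⟨b, hab, hb⟩ := exists_between ha
    obtain ⟨k₁, hk₁⟩ := ENNReal.exists_nat_gt (hb.trans_le le_top).ne
    obtain ⟨k₂, hk₂⟩ := exists_nat_gt (dist z 0)
    refine hab.trans_le (le_trans ?_ (le_iSup _ (max k₁ k₂)))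
    rw [hT]
    have hz : z ∈ ball (0 : E) (max k₁ k₂ : ℕ) :=
      hk₂.trans_le (mod_cast le_max_right _ _)
    simp only
    rw [indicator_of_mem hz]
    exact le_min hb.le (hk₁.le.trans (mod_cast le_max_left _ _))
  have key : ∀ k, (∫⁻ z, T k z ^ q) ^ (1 / q) ≤ K := by
    intro k
    have hfin : ∫⁻ z, T k z ^ q ≠ ∞ := by
      have : ∫⁻ z, T k z ^ q ≤ ∫⁻ z in ball (0 : E) k, (k : ℝ≥0∞) ^ q := by
        rw [← lintegral_indicator measurableSet_ball]
        refine lintegral_mono fun z => ?_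
        rw [hT]
        by_cases hz : z ∈ ball (0 : E) k
        · simp only [indicator_of_mem hz]
          gcongr
          exact min_le_right _ _
        · simp only [indicator_of_notMem hz]
          rw [zero_rpow_of_pos hq0]
      refine (this.trans_lt ?_).ne
      rw [setLIntegral_const]
      exact mul_lt_top (ENNReal.rpow_lt_top_of_nonneg hq0.le (by simp))
        measure_ball_lt_top
    have h1 := h (fun z => T k z ^ (q - 1)) ((hTm k).pow_const _)
    have h2 : ∫⁻ z, T k z ^ q ≤ K * (∫⁻ z, T k z ^ q) ^ (1 / q') := by
      calc ∫⁻ z, T k z ^ q ≤ ∫⁻ z, S z * T k z ^ (q - 1) := by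
            refine lintegral_mono fun z => ?_
            calc T k z ^ q = T k z ^ (1 + (q - 1)) := by congr 1; ring
              _ = T k z * T k z ^ (q - 1) := by
                  rw [rpow_add_of_nonneg _ _ zero_le_one (by linarith), rpow_one]
              _ ≤ _ := by gcongr; exact hTS k z
        _ ≤ _ := h1
        _ = _ := by
            congr 2
            refine lintegral_congr fun z => ?_
            rw [← rpow_mul, hq.sub_one_mul_conj]
    generalize ∫⁻ z, T k z ^ q = I at h2 hfin
    by_cases hI : I = 0
    · rw [hI, zero_rpow_of_pos (by positivity)]
      exact zero_le
    · have hI' : I ^ (1 / q') ≠ 0 := by simp [hI, hfin]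
      have hI'' : I ^ (1 / q') ≠ ∞ := rpow_ne_top_of_nonneg (by positivity) hfin
      have e : I = I ^ (1 / q) * I ^ (1 / q') := by
        rw [← rpow_add _ _ hI hfin, one_div, one_div, hq.inv_add_inv_eq_one,
          rpow_one]
      nth_rewrite 1 [e] at h2
      exact (ENNReal.mul_le_mul_iff_left hI' hI'').1 h2
  have hsup : ∫⁻ z, S z ^ q = ⨆ k, ∫⁻ z, T k z ^ q := by
    rw [← lintegral_iSup (fun k => (hTm k).pow_const _)
      (fun i j hij z => rpow_le_rpow (hTmono hij z) hq0.le)]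
    refine lintegral_congr fun z => ?_
    rw [← hTsup z]
    exact (ENNReal.orderIsoRpow q hq0).map_iSup _
  rw [hsup]
  have := (ENNReal.orderIsoRpow (1 / q) (by positivity)).map_iSup fun k => ∫⁻ z, T k z ^ q
  simp only [ENNReal.orderIsoRpow_apply] at this
  rw [this]
  exact iSup_le key

lemma gagliardoSeminorm_eq {s : ℝ} (hs0 : 0 < s) (hn : 0 < (n : ℝ)) (f : E → F) (D : Set E) :
    gagliardoSeminorm D s (n / s) f = gagliardoEnergy D (n / s) f ^ (s / n) := by
  have hp : 0 < (n : ℝ) / s := by positivity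
  unfold gagliardoSeminorm gagliardoEnergy
  rw [one_div_div]
  congr 1
  refine lintegral_congr fun x => lintegral_congr fun y => ?_
  rw [show (n : ℝ) + s * (n / s) = 2 * n by field_simp; ring]
  rcases eq_or_ne x y with rfl | h
  · simp [Real.zero_rpow hp.ne', zero_rpow_of_pos hp]
  · have hd := dist_pos.2 h
    rw [← dist_eq_norm, ← dist_eq_norm, div_eq_mul_inv, ← Real.rpow_neg hd.le,
      ofReal_mul (by positivity), ofReal_dist_rpow h, edist_dist (f x),
      ENNReal.ofReal_rpow_of_nonneg dist_nonneg hp.le]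

lemma gagliardoSeminorm_rpow {s : ℝ} (hs0 : 0 < s) (hn : 0 < (n : ℝ)) (f : E → F) (D : Set E) :
    gagliardoSeminorm D s (n / s) f ^ ((n : ℝ) / s - 1) =
      gagliardoEnergy D (n / s) f ^ (1 - s / n) := by
  rw [gagliardoSeminorm_eq hs0 hn, ← rpow_mul]
  congr 1
  field_simp

/-- The sum over all scales is controlled by the right-hand side of the localized estimates, from
whatever scale `L` on. -/
lemma scaleSum_le_localizedBound {s σ : ℝ} (hs0 : 0 < s) (hs1 : s ≤ n) (hσ : 0 < σ) :
    ∃ C : ℝ≥0, ∀ (L : ℕ) (x₀ : E) (ρ : ℝ) (f : E → F) (g : E → G), 0 < ρ →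
      scaleSum (2⁻¹ ^ σ) s x₀ ρ f g ≤ C * localizedBound s σ L x₀ ρ f g := by
  have hn : 0 < (n : ℝ) := by linarith
  have hθ : 0 ≤ 1 - s / n := by rw [sub_nonneg, div_le_one hn]; exact hs1
  have hw0 : (2⁻¹ : ℝ≥0∞) ^ σ ≠ 0 := by simp
  have hw1 : (2⁻¹ : ℝ≥0∞) ^ σ < 1 := rpow_lt_one (by simp) hσ
  obtain ⟨C, hC⟩ := tsum_geometric_le hw0 hw1 4
  refine ⟨C, fun L x₀ ρ f g hρ => ?_⟩
  have hmono : ∀ {i j : ℕ}, i ≤ j →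
      ball x₀ (2 ^ i * ρ) ⊆ ball x₀ (2 ^ j * ρ) := fun h =>
    ball_subset_ball (mul_le_mul_of_nonneg_right (pow_le_pow_right₀ one_le_two h) hρ.le)
  have hb : Monotone fun m : ℕ =>
      gagliardoEnergy (ball x₀ (2 ^ m * ρ)) (n / s) f ^ (1 - s / n) *
        gagliardoEnergy (ball x₀ (2 ^ m * ρ)) (n / s) g ^ (s / n) := fun i j hij =>
    mul_le_mul' (rpow_le_rpow (gagliardoEnergy_mono (hmono hij) _ _) hθ)
      (rpow_le_rpow (gagliardoEnergy_mono (hmono hij) _ _) (by positivity))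
  have hloc : localizedBound s σ L x₀ ρ f g =
      gagliardoEnergy (ball x₀ (2 ^ L * ρ)) (n / s) f ^ (1 - s / n) *
        gagliardoEnergy (ball x₀ (2 ^ L * ρ)) (n / s) g ^ (s / n) +
      ∑' k : ℕ, (2⁻¹ ^ σ) ^ (L + (k + 1)) *
        (gagliardoEnergy (ball x₀ (2 ^ (L + (k + 1)) * ρ)) (n / s) f ^ (1 - s / n) *
        gagliardoEnergy (ball x₀ (2 ^ (L + (k + 1)) * ρ)) (n / s) g ^ (s / n)) := by
    unfold localizedBound
    simp only [gagliardoSeminorm_rpow hs0 hn]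
    simp only [gagliardoSeminorm_eq hs0 hn]
    congr 1
    refine tsum_congr fun k => ?_
    rw [mul_assoc]
    congr 1
    rw [← ENNReal.ofReal_rpow_of_pos two_pos, ofReal_ofNat, inv_rpow,
      ← rpow_neg, ← rpow_natCast, ← rpow_mul]
    congr 1
    push_cast
    ring
  rw [hloc]
  refine le_trans ?_ (hC _ hb L)
  unfold scaleSum
  refine tsum_le_tsum fun j => ?_
  refine mul_le_mul_right (mul_le_mul_left (rpow_le_rpow ?_ hθ) _) _
  exact gagliardoEnergy_mono (ball_subset_ball
    (le_mul_of_one_le_left hρ.le (one_le_pow₀ one_le_two))) _ _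

lemma scaleSum_le_univ {s σ : ℝ} (hs0 : 0 < s) (hs1 : s ≤ n) (hσ : 0 < σ) :
    ∃ C : ℝ≥0, ∀ (x₀ : E) (ρ : ℝ) (f : E → F) (g : E → G),
      scaleSum (2⁻¹ ^ σ) s x₀ ρ f g ≤ C * (gagliardoEnergy univ (n / s) f ^ (1 - s / n) *
        gagliardoEnergy univ (n / s) g ^ (s / n)) := by
  have hn : 0 < (n : ℝ) := by linarith
  have hθ : 0 ≤ 1 - s / n := by rw [sub_nonneg, div_le_one hn]; exact hs1
  have hw1 : (2⁻¹ : ℝ≥0∞) ^ σ < 1 := rpow_lt_one (by simp) hσ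
  refine ⟨(1 - (2⁻¹ : ℝ≥0∞) ^ σ)⁻¹.toNNReal, fun x₀ ρ f g => ?_⟩
  rw [coe_toNNReal (inv_ne_top.2 (tsub_pos_of_lt hw1).ne'),
    ← ENNReal.tsum_geometric, ← ENNReal.tsum_mul_right]
  unfold scaleSum
  refine tsum_le_tsum fun j => mul_le_mul_right (mul_le_mul' ?_ ?_) _
  · exact rpow_le_rpow (gagliardoEnergy_mono (Set.subset_univ _) _ _) hθ
  · exact rpow_le_rpow (gagliardoEnergy_mono (Set.subset_univ _) _ _) (by positivity)

/-- A bound on all balls is a bound on the whole space. -/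
lemma lintegral_lintegral_le_of_balls {Φ : E → E → ℝ≥0∞}
    (hΦ : Measurable fun u : E × E => Φ u.1 u.2) {K : ℝ≥0∞}
    (h : ∀ ρ : ℝ, 0 < ρ →
      ∫⁻ x in ball (0 : E) ρ, ∫⁻ y in ball (0 : E) ρ, Φ x y ≤ K) :
    ∫⁻ x, ∫⁻ y, Φ x y ≤ K := by
  have hU : (⋃ k : ℕ, ball (0 : E) (k + 1) ×ˢ ball (0 : E) (k + 1)) = univ := by
    refine Set.eq_univ_of_forall fun u => mem_iUnion.2 ?_
    obtain ⟨k, hk⟩ := exists_nat_gt (max (dist u.1 0) (dist u.2 0))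
    refine ⟨k, ?_, ?_⟩
    · exact (le_max_left _ _).trans_lt (hk.trans (lt_add_one _))
    · exact (le_max_right _ _).trans_lt (hk.trans (lt_add_one _))
  have hdir : Directed (· ⊆ ·)
      fun k : ℕ => ball (0 : E) (k + 1) ×ˢ ball (0 : E) (k + 1) := by
    refine Monotone.directed_le fun i j hij => ?_
    have : (i : ℝ) + 1 ≤ j + 1 := mod_cast Nat.succ_le_succ hij
    exact Set.prod_mono (ball_subset_ball this) (ball_subset_ball this)
  rw [← lintegral_prod (fun u : E × E => Φ u.1 u.2) hΦ.aemeasurable, ← setLIntegral_univ, ← hU,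
    setLIntegral_iUnion_of_directed _ hdir]
  refine iSup_le fun k => ?_
  rw [← Measure.prod_restrict, lintegral_prod _ hΦ.aemeasurable]
  exact h _ (by positivity)

lemma lintegral_iterated_le_of_balls {J : E → E → E → ℝ≥0∞}
    (hJ : Measurable fun u : E × E × E => J u.1 u.2.1 u.2.2) {K : ℝ≥0∞}
    (h : ∀ ρ : ℝ, 0 < ρ →
      ∫⁻ x in ball (0 : E) ρ, ∫⁻ y in ball (0 : E) ρ, ∫⁻ z, J x y z ≤ K) :
    ∫⁻ x, ∫⁻ y, ∫⁻ z, J x y z ≤ K := by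
  have hm3 : Measurable fun u : (E × E) × E => J u.1.1 u.1.2 u.2 :=
    hJ.comp (show Measurable fun u : (E × E) × E => (u.1.1, u.1.2, u.2) by fun_prop)
  exact lintegral_lintegral_le_of_balls hm3.lintegral_prod_right' h

/-- The bound of the majorant of the first commutator in `L^(n/(n-t))`, over balls and over the
whole space. -/
lemma lintegral_commMajorant_rpow_le [NeZero n] {s t : ℝ} (hs0 : 0 < s) (hs1 : s < 1)
    (ht0 : 0 < t) (hts : t < s) : ∃ C : ℝ≥0, ∀ (f : E → F) (g : E → G), StronglyMeasurable f →
    StronglyMeasurable g →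
    (∀ (x₀ : E) (ρ : ℝ), 0 < ρ →
      (∫⁻ z, commMajorant (ball x₀ ρ) s t f g z ^ ((n : ℝ) / (n - t))) ^
        (1 / ((n : ℝ) / (n - t))) ≤ C * scaleSum (2⁻¹ ^ (1 - s)) s x₀ ρ f g) ∧
    (∫⁻ z, commMajorant univ s t f g z ^ ((n : ℝ) / (n - t))) ^
        (1 / ((n : ℝ) / (n - t))) ≤ C * (gagliardoEnergy univ (n / s) f ^ (1 - s / n) *
        gagliardoEnergy univ (n / s) g ^ (s / n)) := by
  have hn : (1 : ℝ) ≤ n := mod_cast NeZero.one_le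
  have hnt : 0 < (n : ℝ) - t := by linarith
  have hq : ((n : ℝ) / (n - t)).HolderConjugate (n / t) := by
    rw [Real.holderConjugate_iff]
    constructor
    · rw [lt_div_iff₀ hnt]; linarith
    · field_simp; ring
  obtain ⟨C₁, hC₁⟩ := growthBound_of_lintegral_rpow (n := n) ht0 (by linarith)
  obtain ⟨C₂, hC₂⟩ := lintegral_trilinear_le (n := n) (F := F) (G := G) hs0 hs1 ht0 hts
  obtain ⟨C₃, hC₃⟩ := scaleSum_le_univ (n := n) (F := F) (G := G) (σ := 1 - s) hs0 (by linarith)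
    (by linarith)
  refine ⟨C₂ * C₁ * (1 + C₃), fun f g hf hg => ⟨fun x₀ ρ hρ => ?_, ?_⟩⟩
  · refine lintegral_rpow_le_of_forall_lintegral_mul_le (measurable_commMajorant hf hg _) hq
      fun φ hφ => ?_
    rw [lintegral_commMajorant_mul hf hg hφ]
    refine (hC₂ f g hf hg φ _ hφ (hC₁ φ hφ.aemeasurable) x₀ ρ hρ).trans ?_
    rw [one_div_div]
    generalize (∫⁻ z, φ z ^ ((n : ℝ) / t)) ^ (t / n) = N
    generalize scaleSum (2⁻¹ ^ (1 - s)) s x₀ ρ f g = S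
    calc C₂ * (C₁ * N) * S = (C₂ * C₁ * 1 : ℝ≥0) * S * N := by push_cast; ring
      _ ≤ _ := by
        gcongr
        exact le_self_add
  · refine lintegral_rpow_le_of_forall_lintegral_mul_le (measurable_commMajorant hf hg _) hq
      fun φ hφ => ?_
    rw [lintegral_commMajorant_mul hf hg hφ]
    simp only [Measure.restrict_univ]
    have hm := measurable_trilinear (s := s) (t := t) hf hg hφ
    refine lintegral_iterated_le_of_balls hm fun ρ hρ => ?_
    refine (hC₂ f g hf hg φ _ hφ (hC₁ φ hφ.aemeasurable) 0 ρ hρ).trans ?_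
    refine (mul_le_mul_right (hC₃ 0 ρ f g) _).trans ?_
    rw [one_div_div]
    generalize (∫⁻ z, φ z ^ ((n : ℝ) / t)) ^ (t / n) = N
    generalize gagliardoEnergy univ (n / s) f ^ (1 - s / n) *
        gagliardoEnergy univ (n / s) g ^ (s / n) = S
    calc C₂ * (C₁ * N) * (C₃ * S) = (C₂ * C₁ * C₃ : ℝ≥0) * S * N := by push_cast; ring
      _ ≤ _ := by
        gcongr
        exact le_add_self

lemma lintegral_iterated_add_swap {J : E → E → E → ℝ≥0∞}
    (hJ : Measurable fun u : E × E × E => J u.1 u.2.1 u.2.2) (B : Set E) (z : E) :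
    ∫⁻ x in B, ∫⁻ y in B, (J x y z + J y x z) = 2 * ∫⁻ x in B, ∫⁻ y in B, J x y z := by
  have h2 : Measurable fun u : E × E => J u.1 u.2 z :=
    hJ.comp (show Measurable fun u : E × E => (u.1, u.2, z) by fun_prop)
  have h3 : Measurable fun u : E × E => J u.2 u.1 z := h2.comp measurable_swap
  have e : ∀ x, ∫⁻ y in B, (J x y z + J y x z) =
      (∫⁻ y in B, J x y z) + ∫⁻ y in B, J y x z :=
    fun x => by
      have hx : Measurable fun y => J x y z :=
        h2.comp measurable_prodMk_left
      rw [lintegral_add_left hx]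
  simp_rw [e]
  rw [lintegral_add_left h2.lintegral_prod_right', two_mul]
  congr 1
  exact lintegral_lintegral_swap h3.aemeasurable

lemma gagliardoEnergy_congr_ae {p : ℝ} {f f' : E → F} (hf : f =ᵐ[volume] f') (B : Set E) :
    gagliardoEnergy B p f = gagliardoEnergy B p f' := by
  refine lintegral_congr_ae ?_
  filter_upwards [ae_restrict_of_ae hf] with x hfx
  refine lintegral_congr_ae ?_
  filter_upwards [ae_restrict_of_ae hf] with y hfy
  simp only [hfx, hfy]

lemma scaleSum_congr_ae {w : ℝ≥0∞} {s : ℝ} {f f' : E → F} {g g' : E → G} (hf : f =ᵐ[volume] f')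
    (hg : g =ᵐ[volume] g') (x₀ : E) (ρ : ℝ) : scaleSum w s x₀ ρ f g = scaleSum w s x₀ ρ f' g' := by
  unfold scaleSum
  simp only [gagliardoEnergy_congr_ae hf, gagliardoEnergy_congr_ae hg]

section FirstCommutatorEstimate

variable [NormedSpace ℝ G]

lemma ofReal_commGamma_le {t : ℝ} (g : E → G) (x y z : E) :
    ofReal (commGamma t g x y z) ≤
      (edist (g x) (g z) + edist (g y) (g z)) * rieszDiff t x y z := by
  unfold commGamma rieszDiff
  rw [ofReal_mul (norm_nonneg _)]
  gcongr
  rw [edist_dist, edist_dist, ← ofReal_add dist_nonneg dist_nonneg, dist_eq_norm,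
    dist_eq_norm]
  refine ofReal_le_ofReal ?_
  calc ‖g x + g y - (2 : ℝ) • g z‖ = ‖(g x - g z) + (g y - g z)‖ := by rw [two_smul]; congr 1; abel
    _ ≤ _ := norm_add_le _ _

/-- The integrands of the two commutators in terms of extended distances. -/
lemma ofReal_integrand_le {s : ℝ} (hs0 : 0 < s) (hs1 : s ≤ n) (f : E → F) {x y : E} (hxy : x ≠ y)
    (c : ℝ) :
    ofReal (‖f x - f y‖ ^ ((n : ℝ) / s - 1) * c / ‖x - y‖ ^ ((n : ℝ) + s * (n / s))) =
      edist (f x) (f y) ^ ((n : ℝ) / s - 1) * ofReal c * edist x y ^ (-(2 * n) : ℝ) := by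
  have hp : 0 ≤ (n : ℝ) / s - 1 := by rw [sub_nonneg, le_div_iff₀ hs0]; linarith
  rw [show (n : ℝ) + s * (n / s) = 2 * n by field_simp; ring]
  have hd := dist_pos.2 hxy
  rw [← dist_eq_norm, ← dist_eq_norm, div_eq_mul_inv, ← Real.rpow_neg hd.le,
    ENNReal.ofReal_mul' (by positivity), ofReal_dist_rpow hxy, edist_dist (f x),
    ofReal_mul (by positivity), ENNReal.ofReal_rpow_of_nonneg dist_nonneg hp]

lemma commT₁_le_commMajorant [NeZero n] {s t : ℝ} (hs0 : 0 < s) (hs1 : s < 1) {f : E → F}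
    {g : E → G} (hf : StronglyMeasurable f) (hg : StronglyMeasurable g) (B : Set E) (z : E) :
    commT₁ B s t f g z ≤ 2 * commMajorant B s t f g z := by
  have hn : (1 : ℝ) ≤ n := mod_cast NeZero.one_le
  have hsum : commT₁ B s t f g z ≤ ∫⁻ x in B, ∫⁻ y in B,
      (trilinear s t f g (fun _ => 1) x y z + trilinear s t f g (fun _ => 1) y x z) := by
    refine lintegral_mono fun x => lintegral_mono_ae ?_
    filter_upwards [ae_restrict_of_ae (Measure.ae_ne volume x)] with y hy
    rw [ofReal_integrand_le hs0 (by linarith) f hy.symm]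
    have h := ofReal_commGamma_le (t := t) g x y z
    calc _ ≤ edist (f x) (f y) ^ ((n : ℝ) / s - 1) *
          ((edist (g x) (g z) + edist (g y) (g z)) * rieszDiff t x y z) *
          edist x y ^ (-(2 * n) : ℝ) := by gcongr
      _ = _ := by
          unfold trilinear
          rw [edist_comm (f y), edist_comm y x, rieszDiff_comm t y x]
          ring
  exact hsum.trans
    (lintegral_iterated_add_swap (measurable_trilinear hf hg measurable_const) B z).le

/-- Changing the functions on a null set does not change the first commutator almost
everywhere. -/
lemma commT₁_congr_ae {s t : ℝ} {f f' : E → F} {g g' : E → G} (hf : f =ᵐ[volume] f')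
    (hg : g =ᵐ[volume] g') (B : Set E) : commT₁ B s t f g =ᵐ[volume] commT₁ B s t f' g' := by
  filter_upwards [hg] with z hz
  refine lintegral_congr_ae ?_
  filter_upwards [ae_restrict_of_ae hf, ae_restrict_of_ae hg] with x hfx hgx
  refine lintegral_congr_ae ?_
  filter_upwards [ae_restrict_of_ae hf, ae_restrict_of_ae hg] with y hfy hgy
  simp only [commGamma, hz, hfx, hgx, hfy, hgy]

/-- The estimates of the first commutator. -/
theorem eLpNorm_commT₁_le [NeZero n] {s t : ℝ} (hs0 : 0 < s) (hs1 : s < 1) (ht0 : 0 < t)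
    (hts : t < s) : ∃ C : ℝ≥0, ∀ (f : E → F) (g : E → G), AEStronglyMeasurable f volume →
    AEStronglyMeasurable g volume →
    eLpNorm (commT₁ univ s t f g) (ofReal ((n : ℝ) / ((n : ℝ) - t))) volume ≤
      C * gagliardoSeminorm univ s (n / s) f ^ ((n : ℝ) / s - 1) *
        gagliardoSeminorm univ s (n / s) g ∧
    ∀ (x₀ : E) (ρ : ℝ), 0 < ρ → ∀ L : ℕ,
      eLpNorm (commT₁ (ball x₀ ρ) s t f g) (ofReal ((n : ℝ) / ((n : ℝ) - t))) volume
        ≤ C * localizedBound s (1 - s) L x₀ ρ f g := by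
  have hn : (1 : ℝ) ≤ n := mod_cast NeZero.one_le
  have hnt : 0 < (n : ℝ) - t := by linarith
  have hq : 0 < (n : ℝ) / (n - t) := by positivity
  obtain ⟨C₁, hC₁⟩ := lintegral_commMajorant_rpow_le (n := n) (F := F) (G := G) hs0 hs1 ht0 hts
  obtain ⟨C₂, hC₂⟩ := scaleSum_le_localizedBound (n := n) (F := F) (G := G) (σ := 1 - s) hs0
    (by linarith) (by linarith)
  refine ⟨2 * C₁ * (1 + C₂), fun f g hf hg => ?_⟩
  obtain ⟨f', hf', hff'⟩ := hf
  obtain ⟨g', hg', hgg'⟩ := hg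
  have hnorm : ∀ B : Set E, eLpNorm (commT₁ B s t f g) (ofReal ((n : ℝ) / (n - t))) volume ≤
      2 * (∫⁻ z, commMajorant B s t f' g' z ^ ((n : ℝ) / (n - t))) ^ (1 / ((n : ℝ) / (n - t))) := by
    intro B
    rw [eLpNorm_congr_ae (commT₁_congr_ae hff' hgg' B), eLpNorm_eq_lintegral_rpow_enorm_toReal
      (by simpa using hq) ofReal_ne_top, ENNReal.toReal_ofReal hq.le]
    simp only [enorm_eq_self]
    calc (∫⁻ z, commT₁ B s t f' g' z ^ ((n : ℝ) / (n - t))) ^ (1 / ((n : ℝ) / (n - t)))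
        ≤ (∫⁻ z, (2 * commMajorant B s t f' g' z) ^ ((n : ℝ) / (n - t))) ^
          (1 / ((n : ℝ) / (n - t))) := by
          gcongr with z
          exact commT₁_le_commMajorant hs0 hs1 hf' hg' B z
      _ = _ := by
          simp only [mul_rpow_of_nonneg _ _ hq.le]
          rw [lintegral_const_mul' _ _ (rpow_ne_top_of_nonneg hq.le (by simp)),
            mul_rpow_of_nonneg _ _ (by positivity), ← rpow_mul,
            mul_one_div_cancel hq.ne', rpow_one]
  obtain ⟨hloc, huniv⟩ := hC₁ f' g' hf' hg'
  have hC : ((2 * C₁ * (1 + C₂) : ℝ≥0) : ℝ≥0∞) = 2 * C₁ * (1 + C₂) := by push_cast; ring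
  rw [hC]
  refine ⟨(hnorm _).trans ?_, fun x₀ ρ hρ L => (hnorm _).trans ?_⟩
  · refine (mul_le_mul_right huniv _).trans ?_
    rw [gagliardoSeminorm_rpow hs0 (by linarith), gagliardoSeminorm_eq hs0 (by linarith),
      gagliardoEnergy_congr_ae hff', gagliardoEnergy_congr_ae hgg', ← mul_assoc, mul_assoc (_ * _)]
    refine mul_le_mul_left ?_ _
    exact le_mul_of_one_le_right zero_le le_self_add
  · refine (mul_le_mul_right (hloc x₀ ρ hρ) _).trans ?_
    rw [← scaleSum_congr_ae hff' hgg', ← mul_assoc, mul_assoc (_ * _)]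
    refine mul_le_mul_right ((hC₂ L x₀ ρ f g hρ).trans ?_) _
    exact mul_le_mul_left le_add_self _

end FirstCommutatorEstimate

/-! ### Inverting fractional integrals in the time variable -/

section TimeIntegrals

variable {X : Type*} [NormedAddCommGroup X] [NormedSpace ℝ X]

/-- Composition of the fractional integral of order `α` with the Marchaud derivative of order `α`,
evaluated at the origin; the value is found by homogeneity and Frullani's integral. -/
lemma integral_rpow_smul_sub [CompleteSpace X] {α : ℝ} {Q : ℝ → X} {L R : X}
    (hQ : StronglyMeasurable Q) {M : ℝ} (hM : ∀ σ, 0 < σ → ‖Q σ‖ ≤ M)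
    (hL : Tendsto Q (𝓝[>] 0) (𝓝 L)) (hR : Tendsto Q atTop (𝓝 R))
    (hint : Integrable (fun u : ℝ × ℝ => (u.1 ^ (α - 1) * u.2 ^ (-1 - α)) • (Q (u.1 + u.2) - Q u.1))
      ((volume.restrict (Ioi 0)).prod (volume.restrict (Ioi 0)))) :
    ∫ u : ℝ × ℝ, (u.1 ^ (α - 1) * u.2 ^ (-1 - α)) • (Q (u.1 + u.2) - Q u.1)
        ∂((volume.restrict (Ioi 0)).prod (volume.restrict (Ioi 0)))
      = (∫ r in Ioi (0 : ℝ), r ^ (-1 - α) * Real.log (1 + r)) • (R - L) := by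
  have hloc : LocallyIntegrableOn Q (Ioi 0) := by
    rw [locallyIntegrableOn_iff isOpen_Ioi.isLocallyClosed]
    intro K hK hKc
    refine Measure.integrableOn_of_bounded (M := M) hKc.measure_lt_top.ne
      hQ.aestronglyMeasurable ?_
    filter_upwards [ae_restrict_mem hKc.measurableSet] with σ hσ
    exact hM σ (hK hσ)
  obtain ⟨G, hG⟩ : ∃ G : ℝ → ℝ → X,
      G = fun σ τ => (σ ^ (α - 1) * τ ^ (-1 - α)) • (Q (σ + τ) - Q σ) := ⟨_, rfl⟩
  have hint' : Integrable (fun u : ℝ × ℝ => G u.1 u.2)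
      ((volume.restrict (Ioi 0)).prod (volume.restrict (Ioi 0))) := by rw [hG]; exact hint
  have hGm : StronglyMeasurable fun u : ℝ × ℝ => G u.1 u.2 := by
    rw [hG]
    refine StronglyMeasurable.smul (Measurable.stronglyMeasurable (by fun_prop)) ?_
    exact (hQ.comp_measurable (by fun_prop)).sub (hQ.comp_measurable measurable_fst)
  have hscale : ∀ σ r : ℝ, 0 < σ → 0 < r →
      σ • G σ (σ * r) = r ^ (-1 - α) • (σ⁻¹ • (Q ((1 + r) * σ) - Q (1 * σ))) := by
    intro σ r hσ hr
    rw [hG]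
    simp only
    rw [smul_smul, smul_smul, one_mul, show σ + σ * r = (1 + r) * σ by ring]
    congr 1
    rw [Real.mul_rpow hσ.le hr.le, Real.rpow_sub hσ, Real.rpow_sub hσ, Real.rpow_neg hσ.le,
      Real.rpow_one]
    have : σ ^ α ≠ 0 := (Real.rpow_pos_of_pos hσ α).ne'
    field_simp
  have hintS : Integrable (fun u : ℝ × ℝ => u.1 • G u.1 (u.1 * u.2))
      ((volume.restrict (Ioi 0)).prod (volume.restrict (Ioi 0))) := by
    have hm : StronglyMeasurable fun u : ℝ × ℝ => u.1 • G u.1 (u.1 * u.2) :=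
      StronglyMeasurable.smul measurable_fst.stronglyMeasurable
        (hGm.comp_measurable (show Measurable fun u : ℝ × ℝ => (u.1, u.1 * u.2) by fun_prop))
    rw [integrable_prod_iff hm.aestronglyMeasurable]
    rw [integrable_prod_iff hGm.aestronglyMeasurable] at hint'
    constructor
    · filter_upwards [hint'.1, ae_restrict_mem measurableSet_Ioi] with σ h hσ
      refine Integrable.smul σ ?_
      have := (integrableOn_Ioi_comp_mul_left_iff (fun r => G σ r) 0 (mem_Ioi.1 hσ)).2
      rw [mul_zero] at this
      exact this h
    · refine hint'.2.congr ?_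
      filter_upwards [ae_restrict_mem measurableSet_Ioi] with σ hσ
      have := integral_comp_mul_left_Ioi' (fun r => ‖G σ r‖) 0 (mem_Ioi.1 hσ)
      rw [mul_zero] at this
      rw [← this, ← integral_smul]
      refine integral_congr_ae (Eventually.of_forall fun r => ?_)
      simp only [norm_smul, Real.norm_of_nonneg (mem_Ioi.1 hσ).le, smul_eq_mul]
  have h1 : ∫ u : ℝ × ℝ, G u.1 u.2 ∂((volume.restrict (Ioi 0)).prod (volume.restrict (Ioi 0)))
      = ∫ r in Ioi (0 : ℝ), ∫ σ in Ioi (0 : ℝ), σ • G σ (σ * r) := by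
    rw [integral_prod _ hint', ←
      integral_integral_swap (f := fun σ r => σ • G σ (σ * r)) hintS]
    refine setIntegral_congr_fun measurableSet_Ioi fun σ hσ => ?_
    have := integral_comp_mul_left_Ioi' (fun r => G σ r) 0 (mem_Ioi.1 hσ)
    rw [mul_zero] at this
    simp only
    rw [← this, integral_smul]
  have h2 : ∫ u : ℝ × ℝ, (u.1 ^ (α - 1) * u.2 ^ (-1 - α)) • (Q (u.1 + u.2) - Q u.1)
      ∂((volume.restrict (Ioi 0)).prod (volume.restrict (Ioi 0))) =
      ∫ u : ℝ × ℝ, G u.1 u.2 ∂((volume.restrict (Ioi 0)).prod (volume.restrict (Ioi 0))) := by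
    rw [hG]
  rw [h2, h1, ← integral_smul_const]
  refine integral_congr_ae ?_
  filter_upwards [hintS.prod_left_ae, ae_restrict_mem measurableSet_Ioi] with r hr hr0
  have hr1 : (0 : ℝ) < r := hr0
  have hr' : IntegrableOn (fun σ => r ^ (-1 - α) • (σ⁻¹ • (Q ((1 + r) * σ) - Q (1 * σ)))) (Ioi 0) := by
    refine (integrableOn_congr_fun (fun σ hσ => ?_) measurableSet_Ioi).1 hr
    exact hscale σ r hσ hr1
  have hr'' : IntegrableOn (fun σ => σ⁻¹ • (Q ((1 + r) * σ) - Q (1 * σ))) (Ioi 0) := by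
    have := hr'.smul (r ^ (-1 - α))⁻¹
    refine this.congr (Eventually.of_forall fun σ => ?_)
    have hne : r ^ (-1 - α) ≠ 0 := (Real.rpow_pos_of_pos hr1 _).ne'
    simp only [Pi.smul_apply]
    rw [inv_smul_smul₀ hne]
  calc ∫ σ in Ioi (0 : ℝ), σ • G σ (σ * r)
      = ∫ σ in Ioi (0 : ℝ), r ^ (-1 - α) • (σ⁻¹ • (Q ((1 + r) * σ) - Q (1 * σ))) :=
        setIntegral_congr_fun measurableSet_Ioi fun σ hσ => hscale σ r hσ hr1
    _ = r ^ (-1 - α) • (Real.log (1 / (1 + r)) • (L - R)) := by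
        rw [integral_smul, Frullani.integral_Ioi_eq hloc (by linarith) one_pos hL hR hr'']
    _ = _ := by
        rw [one_div, Real.log_inv, neg_smul, ← smul_neg, neg_sub, smul_smul]

lemma integrableOn_rpow_mul_one_sub_exp {α : ℝ} (h0 : 0 < α) (h1 : α < 1) :
    IntegrableOn (fun τ : ℝ => τ ^ (-1 - α) * (1 - Real.exp (-τ))) (Ioi 0) := by
  rw [← Ioc_union_Ioi_eq_Ioi zero_le_one]
  have hm : Measurable fun τ : ℝ => τ ^ (-1 - α) * (1 - Real.exp (-τ)) := by fun_prop
  refine IntegrableOn.union ?_ ?_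
  · have hi : IntegrableOn (fun τ : ℝ => τ ^ (-α)) (Ioc 0 1) :=
      (intervalIntegrable_iff_integrableOn_Ioc_of_le zero_le_one).1
        (intervalIntegral.intervalIntegrable_rpow' (by linarith))
    refine hi.mono' hm.aestronglyMeasurable ?_
    filter_upwards [ae_restrict_mem measurableSet_Ioc] with τ hτ
    have h2 := Real.add_one_le_exp (-τ)
    have h3 : Real.exp (-τ) ≤ 1 := Real.exp_le_one_iff.2 (by linarith [hτ.1])
    have h4 : 0 ≤ τ ^ (-1 - α) := Real.rpow_nonneg hτ.1.le _
    rw [Real.norm_of_nonneg (mul_nonneg h4 (by linarith))]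
    calc τ ^ (-1 - α) * (1 - Real.exp (-τ)) ≤ τ ^ (-1 - α) * τ ^ (1 : ℝ) := by
          rw [Real.rpow_one]; gcongr; linarith
      _ = τ ^ (-α) := by rw [← Real.rpow_add hτ.1]; congr 1; ring
  · have hi : IntegrableOn (fun τ : ℝ => τ ^ (-1 - α)) (Ioi 1) :=
      integrableOn_Ioi_rpow_of_lt (by linarith) one_pos
    refine hi.mono' hm.aestronglyMeasurable ?_
    filter_upwards [ae_restrict_mem measurableSet_Ioi] with τ hτ
    have hτ0 : 0 < τ := one_pos.trans hτ
    have h3 : Real.exp (-τ) ≤ 1 := Real.exp_le_one_iff.2 (by linarith)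
    have h4 : 0 ≤ τ ^ (-1 - α) := Real.rpow_nonneg hτ0.le _
    rw [Real.norm_of_nonneg (mul_nonneg h4 (by linarith))]
    exact mul_le_of_le_one_right h4 (by linarith [Real.exp_pos (-τ)])

lemma integral_rpow_mul_one_sub_exp {α : ℝ} (h0 : 0 < α) (h1 : α < 1) :
    ∫ τ in Ioi (0 : ℝ), τ ^ (-1 - α) * (1 - Real.exp (-τ)) = -Real.Gamma (-α) := by
  have hΓ : IntegrableOn (fun σ : ℝ => Real.exp (-σ) * σ ^ (-α)) (Ioi 0) := by
    have := Real.GammaIntegral_convergent (s := 1 - α) (by linarith)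
    simpa using this
  have hΓ' : ∫ σ in Ioi (0 : ℝ), Real.exp (-σ) * σ ^ (-α) = -α * Real.Gamma (-α) := by
    rw [← Real.Gamma_add_one (by linarith : -α ≠ 0), Real.Gamma_eq_integral (by linarith)]
    simp
  have hu : ∀ τ ∈ Ioi (0 : ℝ), HasDerivAt (fun τ => 1 - Real.exp (-τ)) (Real.exp (-τ)) τ := by
    intro τ _
    have := ((hasDerivAt_neg τ).exp).const_sub 1
    simpa using this
  have hv : ∀ τ ∈ Ioi (0 : ℝ), HasDerivAt (fun τ => -(τ ^ (-α) / α)) (τ ^ (-1 - α)) τ := by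
    intro τ hτ
    have := ((Real.hasDerivAt_rpow_const (p := -α) (Or.inl (mem_Ioi.1 hτ).ne')).div_const α).neg
    refine this.congr_deriv ?_
    rw [show -α - 1 = -1 - α by ring]
    field_simp
  have hlim0 : Tendsto ((fun τ : ℝ => 1 - Real.exp (-τ)) * fun τ => -(τ ^ (-α) / α))
      (𝓝[>] 0) (𝓝 0) := by
    have h : Tendsto (fun τ : ℝ => τ ^ (1 - α) / α) (𝓝[>] 0) (𝓝 0) := by
      have h2 := (Real.continuousAt_rpow_const 0 (1 - α) (Or.inr (by linarith))).tendsto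
      rw [Real.zero_rpow (by linarith)] at h2
      simpa using (h2.div_const α).mono_left nhdsWithin_le_nhds
    refine squeeze_zero_norm' ?_ h
    filter_upwards [self_mem_nhdsWithin] with τ hτ
    have hτ0 : (0 : ℝ) < τ := hτ
    have h2 := Real.add_one_le_exp (-τ)
    have h3 : Real.exp (-τ) ≤ 1 := Real.exp_le_one_iff.2 (by linarith)
    rw [Pi.mul_apply, norm_mul, norm_neg, Real.norm_of_nonneg (by linarith),
      Real.norm_of_nonneg (by positivity), show (1 : ℝ) - α = 1 + -α by ring, Real.rpow_add hτ0,
      Real.rpow_one, mul_div_assoc]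
    gcongr
    linarith
  have hlim1 : Tendsto ((fun τ : ℝ => 1 - Real.exp (-τ)) * fun τ => -(τ ^ (-α) / α))
      atTop (𝓝 0) := by
    have h := ((tendsto_const_nhds (x := (1 : ℝ))).sub Real.tendsto_exp_neg_atTop_nhds_zero).mul
      (((tendsto_rpow_neg_atTop h0).div_const α).neg)
    rw [zero_div, neg_zero, mul_zero] at h
    exact h
  have h := integral_Ioi_mul_deriv_eq_deriv_mul hu hv (integrableOn_rpow_mul_one_sub_exp h0 h1 |>.congr
    (Eventually.of_forall fun τ => mul_comm _ _)) ?_ hlim0 hlim1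
  · simp_rw [mul_comm _ (1 - Real.exp _), h]
    have e : ∀ τ : ℝ, Real.exp (-τ) * -(τ ^ (-α) / α) =
        (-α⁻¹) * (Real.exp (-τ) * τ ^ (-α)) := fun τ => by ring
    simp_rw [e]
    rw [integral_const_mul, hΓ']
    field_simp
    ring
  · refine (hΓ.const_mul (-α⁻¹)).congr (Eventually.of_forall fun τ => ?_)
    simp only [Pi.mul_apply]
    ring

/-- The constant in `integral_rpow_smul_sub`, found by testing with a decaying exponential. -/
lemma integral_rpow_mul_log_one_add {α : ℝ} (h0 : 0 < α) (h1 : α < 1) :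
    ∫ r in Ioi (0 : ℝ), r ^ (-1 - α) * Real.log (1 + r) = -(Real.Gamma α * Real.Gamma (-α)) := by
  have hΓ : IntegrableOn (fun σ : ℝ => σ ^ (α - 1) * Real.exp (-σ)) (Ioi 0) := by
    simpa [mul_comm] using Real.GammaIntegral_convergent h0
  have hprod := Integrable.mul_prod hΓ (integrableOn_rpow_mul_one_sub_exp h0 h1)
  have e : ∀ u : ℝ × ℝ, (u.1 ^ (α - 1) * u.2 ^ (-1 - α)) •
      (Real.exp (-(u.1 + u.2)) - Real.exp (-u.1)) =
      -((u.1 ^ (α - 1) * Real.exp (-u.1)) * (u.2 ^ (-1 - α) * (1 - Real.exp (-u.2)))) := by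
    intro u
    rw [neg_add, Real.exp_add, smul_eq_mul]
    ring
  have h := integral_rpow_smul_sub (α := α) (Q := fun σ => Real.exp (-σ)) (L := 1) (R := 0) (M := 1)
    (by fun_prop) (fun σ hσ => by
      rw [Real.norm_of_nonneg (Real.exp_pos _).le]
      exact Real.exp_le_one_iff.2 (by linarith))
    (by
      have : Tendsto (fun σ : ℝ => Real.exp (-σ)) (𝓝 0) (𝓝 (Real.exp (-0))) :=
        (by fun_prop : Continuous fun σ : ℝ => Real.exp (-σ)).tendsto 0
      rw [neg_zero, Real.exp_zero] at this
      exact this.mono_left nhdsWithin_le_nhds)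
    (Real.tendsto_exp_neg_atTop_nhds_zero)
    (by simp_rw [e]; exact hprod.neg)
  simp_rw [e] at h
  rw [integral_neg, integral_prod_mul (fun σ : ℝ => σ ^ (α - 1) * Real.exp (-σ))
    (fun τ : ℝ => τ ^ (-1 - α) * (1 - Real.exp (-τ))), integral_rpow_mul_one_sub_exp h0 h1] at h
  have hΓ' : ∫ σ in Ioi (0 : ℝ), σ ^ (α - 1) * Real.exp (-σ) = Real.Gamma α := by
    rw [Real.Gamma_eq_integral h0]
    simp_rw [mul_comm]
  rw [hΓ', zero_sub, smul_eq_mul] at h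
  linarith

end TimeIntegrals

/-! ### The heat kernel -/

section HeatKernel

/-- The heat kernel `(4 π σ) ^ (-n / 2) exp (-|x|² / (4 σ))` at time `σ`. -/
noncomputable def heatKernel (σ : ℝ) (x : E) : ℝ :=
  (4 * Real.pi * σ) ^ (-(n : ℝ) / 2) * Real.exp (-(1 / (4 * σ)) * ‖x‖ ^ 2)

lemma heatKernel_nonneg {σ : ℝ} (hσ : 0 ≤ σ) (x : E) : 0 ≤ heatKernel σ x := by
  unfold heatKernel; positivity

lemma heatKernel_neg (σ : ℝ) (x : E) : heatKernel σ (-x) = heatKernel σ x := by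
  unfold heatKernel; rw [norm_neg]

lemma heatKernel_sub_comm (σ : ℝ) (x y : E) : heatKernel σ (x - y) = heatKernel σ (y - x) := by
  rw [← heatKernel_neg, neg_sub]

lemma measurable_heatKernel : Measurable fun u : ℝ × E => heatKernel u.1 u.2 := by
  unfold heatKernel; fun_prop

lemma integrable_exp_neg_mul_sq_norm {b : ℝ} (hb : 0 < b) :
    Integrable fun x : E => Real.exp (-b * ‖x‖ ^ 2) := by
  apply Integrable.of_integral_ne_zero
  rw [GaussianFourier.integral_rexp_neg_mul_sq_norm hb]
  positivity

lemma integral_exp_neg_mul_sq_norm {b : ℝ} (hb : 0 < b) :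
    ∫ x : E, Real.exp (-b * ‖x‖ ^ 2) = (Real.pi / b) ^ ((n : ℝ) / 2) := by
  rw [GaussianFourier.integral_rexp_neg_mul_sq_norm hb, finrank_euclideanSpace_fin]

lemma integrable_heatKernel {σ : ℝ} (hσ : 0 < σ) : Integrable (heatKernel (n := n) σ) :=
  (integrable_exp_neg_mul_sq_norm (by positivity)).const_mul _

lemma integral_heatKernel {σ : ℝ} (hσ : 0 < σ) : ∫ x : E, heatKernel σ x = 1 := by
  unfold heatKernel
  rw [integral_const_mul, integral_exp_neg_mul_sq_norm (by positivity),
    show Real.pi / (1 / (4 * σ)) = 4 * Real.pi * σ by field_simp, ← Real.rpow_add (by positivity)]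
  rw [show -(n : ℝ) / 2 + n / 2 = 0 by ring, Real.rpow_zero]

/-- The semigroup property of the heat kernel, by completing the square. -/
lemma heatKernel_mul_heatKernel {σ τ : ℝ} (hσ : 0 < σ) (hτ : 0 < τ) (x z : E) :
    heatKernel σ z * heatKernel τ (z - x) =
      heatKernel (σ + τ) x * heatKernel (σ * τ / (σ + τ)) (z - (σ / (σ + τ)) • x) := by
  unfold heatKernel
  rw [mul_mul_mul_comm, ← Real.exp_add, mul_mul_mul_comm, ← Real.exp_add,
    ← Real.mul_rpow (by positivity) (by positivity), ← Real.mul_rpow (by positivity) (by positivity)]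
  congr 2
  · field_simp
  · rw [norm_sub_sq_real, norm_sub_sq_real, norm_smul, real_inner_smul_right, mul_pow,
      Real.norm_of_nonneg (by positivity)]
    field_simp
    ring

lemma integrable_heatKernel_mul {σ τ : ℝ} (hσ : 0 < σ) (hτ : 0 < τ) (x v : E) :
    Integrable fun z => heatKernel σ (x - z) * heatKernel τ (z - v) := by
  have h := ((integrable_heatKernel (n := n) (σ := σ * τ / (σ + τ)) (by positivity)).comp_sub_right
    ((σ / (σ + τ)) • (v - x))).const_mul (heatKernel (σ + τ) (v - x))
  refine (h.comp_sub_right x).congr (Eventually.of_forall fun z => ?_)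
  simp only
  rw [← heatKernel_mul_heatKernel hσ hτ, heatKernel_sub_comm σ x z, sub_sub_sub_cancel_right]

lemma integral_heatKernel_mul {σ τ : ℝ} (hσ : 0 < σ) (hτ : 0 < τ) (x v : E) :
    ∫ z, heatKernel σ (x - z) * heatKernel τ (z - v) = heatKernel (σ + τ) (x - v) := by
  have e : ∀ z : E, heatKernel σ (x - z) * heatKernel τ (z - v) = heatKernel (σ + τ) (v - x) *
      heatKernel (σ * τ / (σ + τ)) (z - x - (σ / (σ + τ)) • (v - x)) := fun z => by
    rw [← heatKernel_mul_heatKernel hσ hτ, heatKernel_sub_comm σ x z, sub_sub_sub_cancel_right]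
  simp_rw [e, integral_const_mul, sub_sub]
  rw [integral_sub_right_eq_self (fun z => heatKernel (σ * τ / (σ + τ)) z),
    integral_heatKernel (by positivity), mul_one, heatKernel_sub_comm]

/-- The Riesz kernels are superpositions of heat kernels. -/
lemma integral_rpow_mul_heatKernel {β : ℝ} (hβ : β < (n : ℝ) / 2) {x : E} (hx : x ≠ 0) :
    ∫ σ in Ioi (0 : ℝ), σ ^ (β - 1) * heatKernel σ x =
      Real.Gamma (n / 2 - β) / (4 ^ β * Real.pi ^ ((n : ℝ) / 2)) * ‖x‖ ^ (2 * β - n) := by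
  have hx0 : 0 < ‖x‖ := norm_pos_iff.2 hx
  have hr : 0 < ‖x‖ ^ 2 / 4 := by positivity
  have h := integral_comp_rpow_Ioi
    (fun y : ℝ => y ^ (n / 2 - β - 1) * Real.exp (-(‖x‖ ^ 2 / 4 * y))) (p := -1) (by norm_num)
  rw [Real.integral_rpow_mul_exp_neg_mul_Ioi (by linarith) hr] at h
  have e : ∀ σ ∈ Ioi (0 : ℝ), σ ^ (β - 1) * heatKernel σ x =
      (4 * Real.pi) ^ (-(n : ℝ) / 2) * ((|(-1 : ℝ)| * σ ^ ((-1 : ℝ) - 1)) •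
        ((σ ^ (-1 : ℝ)) ^ ((n : ℝ) / 2 - β - 1) * Real.exp (-(‖x‖ ^ 2 / 4 * σ ^ (-1 : ℝ))))) := by
    intro σ hσ
    have hσ0 : (0 : ℝ) < σ := hσ
    unfold heatKernel
    rw [Real.mul_rpow (by positivity) hσ0.le, ← Real.rpow_mul hσ0.le, smul_eq_mul,
      show -(1 / (4 * σ)) * ‖x‖ ^ 2 = -(‖x‖ ^ 2 / 4 * σ ^ (-1 : ℝ)) by
        rw [Real.rpow_neg_one]; field_simp]
    have e2 : σ ^ (β - 1) * σ ^ (-(n : ℝ) / 2) =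
        σ ^ ((-1 : ℝ) - 1) * σ ^ (-1 * ((n : ℝ) / 2 - β - 1)) := by
      rw [← Real.rpow_add hσ0, ← Real.rpow_add hσ0]; congr 1; ring
    rw [abs_neg, abs_one, one_mul]
    calc _ = (4 * Real.pi) ^ (-(n : ℝ) / 2) * ((σ ^ (β - 1) * σ ^ (-(n : ℝ) / 2)) *
          Real.exp (-(‖x‖ ^ 2 / 4 * σ ^ (-1 : ℝ)))) := by ring
      _ = _ := by rw [e2]; ring
  rw [setIntegral_congr_fun measurableSet_Ioi e, integral_const_mul, h]
  have e3 : (1 / (‖x‖ ^ 2 / 4)) ^ ((n : ℝ) / 2 - β) =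
      4 ^ ((n : ℝ) / 2) / 4 ^ β * ‖x‖ ^ (2 * β - n) := by
    rw [one_div_div, Real.div_rpow (by norm_num) (by positivity), Real.rpow_sub (by norm_num),
      ← Real.rpow_natCast ‖x‖ 2, ← Real.rpow_mul hx0.le, div_eq_mul_inv, ← Real.rpow_neg hx0.le]
    congr 2
    push_cast
    ring
  rw [e3, neg_div, Real.rpow_neg (by positivity), Real.mul_rpow (by norm_num) Real.pi_pos.le]
  have h4 : (4 : ℝ) ^ ((n : ℝ) / 2) ≠ 0 := by positivity
  field_simp

lemma integrableOn_rpow_mul_heatKernel {β : ℝ} (hβ : β < (n : ℝ) / 2) {x : E} (hx : x ≠ 0) :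
    IntegrableOn (fun σ : ℝ => σ ^ (β - 1) * heatKernel σ x) (Ioi 0) := by
  apply Integrable.of_integral_ne_zero
  rw [integral_rpow_mul_heatKernel hβ hx]
  have : 0 < Real.Gamma (n / 2 - β) := Real.Gamma_pos_of_pos (by linarith)
  have hx0 : 0 < ‖x‖ := norm_pos_iff.2 hx
  positivity

/-- The weight which dominates the heat kernels for bounded times and their differences for large
times. -/
noncomputable def heatWeight (x : E) : ℝ := min (‖x‖ ^ (-(n : ℝ))) (‖x‖ ^ (-((n : ℝ) + 1)))

lemma exp_neg_le_rpow {m u : ℝ} (hm : 0 < m) (hu : 0 < u) :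
    Real.exp (-u) ≤ m ^ m * u ^ (-m) := by
  have h : u / m ≤ Real.exp (u / m) := by linarith [Real.add_one_le_exp (u / m)]
  have h2 : (u / m) ^ m ≤ Real.exp u := by
    calc (u / m) ^ m ≤ Real.exp (u / m) ^ m := Real.rpow_le_rpow (by positivity) h hm.le
      _ = Real.exp u := by rw [← Real.exp_mul]; congr 1; field_simp
  rw [Real.div_rpow hu.le hm.le, div_le_iff₀ (by positivity)] at h2
  rw [Real.exp_neg, Real.rpow_neg hu.le, ← div_eq_mul_inv, le_div_iff₀ (by positivity),
    inv_mul_le_iff₀ (Real.exp_pos u)]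
  exact h2

lemma exp_neg_mul_sq_le {k c : ℝ} (hk : 0 < k) (hc : 0 < c) : ∃ C : ℝ, 0 ≤ C ∧
    ∀ (σ r : ℝ), 0 < σ → 0 < r →
      Real.exp (-(1 / (c * σ)) * r ^ 2) ≤ C * (σ ^ (k / 2) * r ^ (-k)) := by
  refine ⟨(k / 2) ^ (k / 2) * c ^ (k / 2), by positivity, fun σ r hσ hr => ?_⟩
  have h := exp_neg_le_rpow (m := k / 2) (u := 1 / (c * σ) * r ^ 2) (by positivity) (by positivity)
  rw [← neg_mul] at h
  refine h.trans (le_of_eq ?_)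
  rw [Real.mul_rpow (by positivity) (by positivity), one_div, Real.inv_rpow (by positivity),
    ← Real.rpow_neg (by positivity), neg_neg, Real.mul_rpow hc.le hσ.le, ← Real.rpow_natCast r 2,
    ← Real.rpow_mul hr.le]
  have : ((2 : ℕ) : ℝ) * -(k / 2) = -k := by push_cast; ring
  rw [this]
  ring

lemma heatKernel_le_heatWeight (hn : 0 < (n : ℝ)) : ∃ C : ℝ, 0 ≤ C ∧ ∀ (σ : ℝ) (x : E), 0 < σ →
    x ≠ 0 → heatKernel σ x ≤ C * max 1 (σ ^ (1 / 2 : ℝ)) * heatWeight x := by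
  obtain ⟨C₁, hC₁0, hC₁⟩ := exp_neg_mul_sq_le (k := n) (c := 4) hn (by norm_num)
  obtain ⟨C₂, hC₂0, hC₂⟩ := exp_neg_mul_sq_le (k := n + 1) (c := 4) (by linarith) (by norm_num)
  have hpi : 0 ≤ (4 * Real.pi) ^ (-(n : ℝ) / 2) := by positivity
  refine ⟨(4 * Real.pi) ^ (-(n : ℝ) / 2) * (C₁ + C₂), by positivity, fun σ x hσ hx => ?_⟩
  have hx0 : 0 < ‖x‖ := norm_pos_iff.2 hx
  have e : heatKernel σ x = (4 * Real.pi) ^ (-(n : ℝ) / 2) * (σ ^ (-(n : ℝ) / 2) *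
      Real.exp (-(1 / (4 * σ)) * ‖x‖ ^ 2)) := by
    unfold heatKernel
    rw [Real.mul_rpow (by positivity) hσ.le, mul_assoc]
  have h1 : σ ^ (-(n : ℝ) / 2) * Real.exp (-(1 / (4 * σ)) * ‖x‖ ^ 2) ≤ C₁ * ‖x‖ ^ (-(n : ℝ)) := by
    calc _ ≤ σ ^ (-(n : ℝ) / 2) * (C₁ * (σ ^ ((n : ℝ) / 2) * ‖x‖ ^ (-(n : ℝ)))) := by
          gcongr; exact hC₁ σ _ hσ hx0
      _ = C₁ * (σ ^ (-(n : ℝ) / 2) * σ ^ ((n : ℝ) / 2)) * ‖x‖ ^ (-(n : ℝ)) := by ring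
      _ = _ := by
          rw [← Real.rpow_add hσ, show -(n : ℝ) / 2 + n / 2 = 0 by ring, Real.rpow_zero, mul_one]
  have h2 : σ ^ (-(n : ℝ) / 2) * Real.exp (-(1 / (4 * σ)) * ‖x‖ ^ 2) ≤
      C₂ * σ ^ (1 / 2 : ℝ) * ‖x‖ ^ (-((n : ℝ) + 1)) := by
    calc _ ≤ σ ^ (-(n : ℝ) / 2) * (C₂ * (σ ^ (((n : ℝ) + 1) / 2) * ‖x‖ ^ (-((n : ℝ) + 1)))) := by
          gcongr; exact hC₂ σ _ hσ hx0
      _ = C₂ * (σ ^ (-(n : ℝ) / 2) * σ ^ (((n : ℝ) + 1) / 2)) * ‖x‖ ^ (-((n : ℝ) + 1)) := by ring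
      _ = _ := by
          rw [← Real.rpow_add hσ, show -(n : ℝ) / 2 + (n + 1) / 2 = 1 / 2 by ring]
  have hm1 : 1 ≤ max 1 (σ ^ (1 / 2 : ℝ)) := le_max_left _ _
  rw [e, mul_assoc, mul_assoc]
  refine mul_le_mul_of_nonneg_left ?_ hpi
  unfold heatWeight
  rw [← mul_assoc]
  rcases le_total (‖x‖ ^ (-(n : ℝ))) (‖x‖ ^ (-((n : ℝ) + 1))) with h | h
  · rw [min_eq_left h]
    refine h1.trans ?_
    gcongr
    calc C₁ ≤ (C₁ + C₂) * 1 := by linarith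
      _ ≤ _ := by gcongr
  · rw [min_eq_right h]
    refine h2.trans ?_
    gcongr
    · linarith
    · exact le_max_right _ _

lemma abs_exp_neg_sub_le {a b c : ℝ} (ha : c ≤ a) (hb : c ≤ b) :
    |Real.exp (-a) - Real.exp (-b)| ≤ |a - b| * Real.exp (-c) := by
  wlog hab : a ≤ b generalizing a b
  · rw [abs_sub_comm, abs_sub_comm a]
    exact this hb ha (le_of_not_ge hab)
  have h1 : Real.exp (-b) = Real.exp (-a) * Real.exp (-(b - a)) := by
    rw [← Real.exp_add]; congr 1; ring
  have h2 := Real.add_one_le_exp (-(b - a))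
  have h3 : Real.exp (-a) ≤ Real.exp (-c) := Real.exp_le_exp.2 (by linarith)
  have h4 : Real.exp (-b) ≤ Real.exp (-a) := Real.exp_le_exp.2 (by linarith)
  rw [abs_of_nonneg (by linarith), abs_of_nonpos (by linarith), h1]
  nlinarith [Real.exp_pos (-a), Real.exp_pos (-c)]

/-- Differences of heat kernels decay one order faster, uniformly for large times. -/
lemma abs_heatKernel_sub_le (hn : 0 < (n : ℝ)) (x y : E) (hxy : x ≠ y) : ∃ C : ℝ, 0 ≤ C ∧
    ∀ (σ : ℝ) (v : E), 1 ≤ σ → v ≠ x →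
      |heatKernel σ (x - v) - heatKernel σ (y - v)| ≤ C * heatWeight (x - v) := by
  obtain ⟨C₁, hC₁0, hC₁⟩ := exp_neg_mul_sq_le (k := n + 2) (c := 16) (by linarith) (by norm_num)
  obtain ⟨r, hr⟩ : ∃ r, r = ‖x - y‖ := ⟨_, rfl⟩
  have hr0 : 0 < r := by rw [hr]; exact norm_pos_iff.2 (sub_ne_zero.2 hxy)
  obtain ⟨m, hm⟩ : ∃ m, m = min ((2 * r) ^ (-(n : ℝ))) ((2 * r) ^ (-((n : ℝ) + 1))) := ⟨_, rfl⟩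
  have hm0 : 0 < m := by rw [hm]; positivity
  refine ⟨m⁻¹ + r * C₁ * (1 + (2 * r)⁻¹), by positivity, fun σ v hσ hv => ?_⟩
  have hσ0 : 0 < σ := by linarith
  obtain ⟨q, hq⟩ : ∃ q, q = ‖x - v‖ := ⟨_, rfl⟩
  obtain ⟨b, hb⟩ : ∃ b, b = ‖y - v‖ := ⟨_, rfl⟩
  have hq0 : 0 < q := by rw [hq]; exact norm_pos_iff.2 (sub_ne_zero.2 hv.symm)
  have hb0 : 0 ≤ b := by rw [hb]; exact norm_nonneg _
  have hqb : |q - b| ≤ r := by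
    rw [hq, hb, hr]
    refine (abs_norm_sub_norm_le _ _).trans (le_of_eq ?_)
    congr 1; abel
  have hw : heatWeight (x - v) = min (q ^ (-(n : ℝ))) (q ^ (-((n : ℝ) + 1))) := by
    rw [hq]; rfl
  have hw0 : 0 ≤ heatWeight (x - v) := by rw [hw]; positivity
  have hpi : 1 ≤ 4 * Real.pi := by linarith [Real.pi_gt_three]
  have hpre : (4 * Real.pi * σ) ^ (-(n : ℝ) / 2) ≤ σ ^ (-(n : ℝ) / 2) :=
    Real.rpow_le_rpow_of_nonpos hσ0 (by nlinarith) (by linarith)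
  have hpre0 : 0 ≤ (4 * Real.pi * σ) ^ (-(n : ℝ) / 2) := by positivity
  have hdiff : |heatKernel σ (x - v) - heatKernel σ (y - v)| =
      (4 * Real.pi * σ) ^ (-(n : ℝ) / 2) *
        |Real.exp (-(q ^ 2 / (4 * σ))) - Real.exp (-(b ^ 2 / (4 * σ)))| := by
    unfold heatKernel
    rw [← hq, ← hb, ← mul_sub, abs_mul, abs_of_nonneg hpre0]
    congr 4 <;> ring
  rw [hdiff, add_mul]
  rcases lt_or_ge q (2 * r) with h | h
  · have h1 : (4 * Real.pi * σ) ^ (-(n : ℝ) / 2) ≤ 1 :=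
      hpre.trans (Real.rpow_le_one_of_one_le_of_nonpos hσ (by linarith))
    have e1 := Real.exp_pos (-(q ^ 2 / (4 * σ)))
    have e2 := Real.exp_pos (-(b ^ 2 / (4 * σ)))
    have e3 : Real.exp (-(q ^ 2 / (4 * σ))) ≤ 1 :=
      Real.exp_le_one_iff.2 (neg_nonpos.2 (by positivity))
    have e4 : Real.exp (-(b ^ 2 / (4 * σ))) ≤ 1 :=
      Real.exp_le_one_iff.2 (neg_nonpos.2 (by positivity))
    have h2 : |Real.exp (-(q ^ 2 / (4 * σ))) - Real.exp (-(b ^ 2 / (4 * σ)))| ≤ 1 := by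
      rw [abs_le]; constructor <;> linarith
    have h3 : m ≤ heatWeight (x - v) := by
      rw [hw, hm]
      refine min_le_min ?_ ?_ <;> exact Real.rpow_le_rpow_of_nonpos hq0 h.le (by linarith)
    calc _ ≤ (1 : ℝ) * 1 := by gcongr
      _ = m⁻¹ * m := by rw [one_mul, inv_mul_cancel₀ hm0.ne']
      _ ≤ m⁻¹ * heatWeight (x - v) := by gcongr
      _ ≤ _ := le_add_of_nonneg_right (by positivity)
  · have hb1 : q / 2 ≤ b := by linarith [(abs_le.1 hqb).2]
    have hb2 : b ≤ 3 / 2 * q := by linarith [(abs_le.1 hqb).1]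
    have h1 := abs_exp_neg_sub_le (a := q ^ 2 / (4 * σ)) (b := b ^ 2 / (4 * σ))
      (c := 1 / (16 * σ) * q ^ 2) (by
        rw [div_eq_mul_one_div (q ^ 2), mul_comm (q ^ 2)]
        refine mul_le_mul_of_nonneg_right ?_ (by positivity)
        exact one_div_le_one_div_of_le (by positivity) (by linarith)) (by
        have : (q / 2) ^ 2 ≤ b ^ 2 := by gcongr
        calc 1 / (16 * σ) * q ^ 2 = (q / 2) ^ 2 / (4 * σ) := by field_simp; norm_num
          _ ≤ _ := by gcongr)
    have h2 : |q ^ 2 / (4 * σ) - b ^ 2 / (4 * σ)| ≤ r * q / σ := by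
      rw [← sub_div, abs_div, abs_of_pos (by positivity : 0 < 4 * σ),
        show q ^ 2 - b ^ 2 = (q - b) * (q + b) by ring, abs_mul,
        abs_of_nonneg (by positivity : 0 ≤ q + b), div_le_div_iff₀ (by positivity) hσ0]
      have : |q - b| * (q + b) ≤ r * (4 * q) := by gcongr; linarith
      nlinarith
    have h3 := hC₁ σ q hσ0 hq0
    rw [← neg_mul] at h1
    have h4 : q ^ (-((n : ℝ) + 1)) ≤ (1 + (2 * r)⁻¹) * heatWeight (x - v) := by
      rw [hw, add_mul, one_mul]
      rcases le_total (q ^ (-(n : ℝ))) (q ^ (-((n : ℝ) + 1))) with h5 | h5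
      · rw [min_eq_left h5]
        have : q ^ (-((n : ℝ) + 1)) ≤ (2 * r)⁻¹ * q ^ (-(n : ℝ)) := by
          rw [neg_add, Real.rpow_add hq0, mul_comm, Real.rpow_neg_one]
          gcongr
        refine this.trans (le_add_of_nonneg_left (by positivity))
      · rw [min_eq_right h5]
        exact le_add_of_nonneg_right (by positivity)
    calc _ ≤ σ ^ (-(n : ℝ) / 2) * ((r * q / σ) * (C₁ * (σ ^ (((n : ℝ) + 2) / 2) *
          q ^ (-((n : ℝ) + 2))))) := by
          gcongr
          refine h1.trans ?_
          gcongr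
      _ = r * C₁ * (σ ^ (-(n : ℝ) / 2) * σ ^ (((n : ℝ) + 2) / 2) * σ ^ (-1 : ℝ)) *
          (q ^ (1 : ℝ) * q ^ (-((n : ℝ) + 2))) := by
          rw [Real.rpow_neg_one, Real.rpow_one]; ring
      _ = r * C₁ * q ^ (-((n : ℝ) + 1)) := by
          rw [← Real.rpow_add hσ0, ← Real.rpow_add hσ0, ← Real.rpow_add hq0,
            show -(n : ℝ) / 2 + (n + 2) / 2 + -1 = 0 by ring, Real.rpow_zero, mul_one]
          congr 2; ring
      _ ≤ r * C₁ * ((1 + (2 * r)⁻¹) * heatWeight (x - v)) := by gcongr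
      _ = r * C₁ * (1 + (2 * r)⁻¹) * heatWeight (x - v) := by ring
      _ ≤ _ := le_add_of_nonneg_left (by positivity)

lemma measurable_heatWeight : Measurable (heatWeight (n := n)) := by
  unfold heatWeight; fun_prop

lemma heatWeight_nonneg (x : E) : 0 ≤ heatWeight x := by
  unfold heatWeight; positivity

variable [NormedSpace ℝ F]

/-- The heat extension of `h` at time `σ`. -/
noncomputable def heatAverage (h : E → F) (σ : ℝ) (x : E) : F :=
  ∫ v, heatKernel σ (x - v) • h v

/-- The condition on `x` under which the heat extensions of `h` converge to `h x`. -/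
def HeatRegular (h : E → F) (x : E) : Prop :=
  Integrable fun v => heatWeight (x - v) * ‖h v - h x‖

lemma measurable_heatKernel_sub (x : E) : Measurable fun u : ℝ × E => heatKernel u.1 (x - u.2) :=
  measurable_heatKernel.comp (measurable_fst.prodMk (measurable_const.sub measurable_snd))

lemma integrable_heatKernel_sub {σ : ℝ} (hσ : 0 < σ) (x : E) :
    Integrable fun v => heatKernel σ (x - v) := (integrable_heatKernel hσ).comp_sub_left x

lemma integral_heatKernel_sub {σ : ℝ} (hσ : 0 < σ) (x : E) : ∫ v, heatKernel σ (x - v) = 1 := by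
  rw [integral_sub_left_eq_self (fun v => heatKernel σ v), integral_heatKernel hσ]

lemma stronglyMeasurable_heatKernel_smul {h : E → F} (hh : StronglyMeasurable h) (x : E) :
    StronglyMeasurable fun u : ℝ × E => heatKernel u.1 (x - u.2) • h u.2 :=
  (measurable_heatKernel_sub x).stronglyMeasurable.smul (hh.comp_measurable measurable_snd)

lemma stronglyMeasurable_heatAverage {h : E → F} (hh : StronglyMeasurable h) (x : E) :
    StronglyMeasurable fun σ => heatAverage h σ x :=
  (stronglyMeasurable_heatKernel_smul hh x).integral_prod_right'

lemma norm_heatKernel_smul_le (hn : 0 < (n : ℝ)) : ∃ C : ℝ, 0 ≤ C ∧ ∀ (h : E → F) (σ : ℝ)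
    (x : E), 0 < σ → ∀ v, ‖heatKernel σ (x - v) • (h v - h x)‖ ≤
      C * max 1 (σ ^ (1 / 2 : ℝ)) * (heatWeight (x - v) * ‖h v - h x‖) := by
  obtain ⟨C, hC0, hC⟩ := heatKernel_le_heatWeight (n := n) hn
  refine ⟨C, hC0, fun h σ x hσ v => ?_⟩
  rw [norm_smul, Real.norm_of_nonneg (heatKernel_nonneg hσ.le _), ← mul_assoc]
  rcases eq_or_ne v x with rfl | hv
  · simp
  · gcongr
    exact hC σ _ hσ (sub_ne_zero.2 hv.symm)

lemma integrable_heatKernel_smul_sub (hn : 0 < (n : ℝ)) {h : E → F} (hh : StronglyMeasurable h)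
    {x : E} (hx : HeatRegular h x) {σ : ℝ} (hσ : 0 < σ) :
    Integrable fun v => heatKernel σ (x - v) • (h v - h x) := by
  obtain ⟨C, -, hC⟩ := norm_heatKernel_smul_le (n := n) (F := F) hn
  refine (hx.const_mul (C * max 1 (σ ^ (1 / 2 : ℝ)))).mono' ?_ (Eventually.of_forall (hC h σ x hσ))
  exact (((integrable_heatKernel_sub hσ x).aestronglyMeasurable).smul
    (hh.aestronglyMeasurable.sub aestronglyMeasurable_const))

lemma integrable_heatKernel_smul (hn : 0 < (n : ℝ)) {h : E → F} (hh : StronglyMeasurable h)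
    {x : E} (hx : HeatRegular h x) {σ : ℝ} (hσ : 0 < σ) :
    Integrable fun v => heatKernel σ (x - v) • h v := by
  refine ((integrable_heatKernel_smul_sub hn hh hx hσ).add
    ((integrable_heatKernel_sub hσ x).smul_const (h x))).congr (Eventually.of_forall fun v => ?_)
  simp only [Pi.add_apply]
  rw [← smul_add, sub_add_cancel]

lemma norm_heatKernel_sub_smul_le (hn : 0 < (n : ℝ)) (h : E → F) {x y : E} (hxy : x ≠ y) :
    ∃ C : ℝ, ∀ σ v, 1 ≤ σ → ‖(heatKernel σ (x - v) - heatKernel σ (y - v)) • (h v - h x)‖ ≤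
      C * (heatWeight (x - v) * ‖h v - h x‖) := by
  obtain ⟨C, -, hC⟩ := abs_heatKernel_sub_le hn x y hxy
  refine ⟨C, fun σ v hσ => ?_⟩
  rw [norm_smul, ← mul_assoc, Real.norm_eq_abs]
  rcases eq_or_ne v x with rfl | hv
  · simp
  · gcongr
    exact hC σ v hσ hv

variable [CompleteSpace F]

lemma heatAverage_sub (hn : 0 < (n : ℝ)) {h : E → F} (hh : StronglyMeasurable h)
    {x : E} (hx : HeatRegular h x) {σ : ℝ} (hσ : 0 < σ) (c : F) :
    heatAverage h σ x - c = ∫ v, heatKernel σ (x - v) • (h v - c) := by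
  unfold heatAverage
  simp_rw [smul_sub]
  rw [integral_sub (integrable_heatKernel_smul hn hh hx hσ)
    ((integrable_heatKernel_sub hσ x).smul_const c), integral_smul_const,
    integral_heatKernel_sub hσ, one_smul]

lemma norm_heatAverage_sub_le (hn : 0 < (n : ℝ)) {h : E → F} (hh : StronglyMeasurable h)
    {x : E} (hx : HeatRegular h x) : ∃ M : ℝ, ∀ σ, 0 < σ → σ ≤ 1 → ‖heatAverage h σ x - h x‖ ≤ M := by
  obtain ⟨C, -, hC⟩ := norm_heatKernel_smul_le (n := n) (F := F) hn
  refine ⟨∫ v, C * (heatWeight (x - v) * ‖h v - h x‖), fun σ hσ hσ1 => ?_⟩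
  rw [heatAverage_sub hn hh hx hσ]
  refine norm_integral_le_of_norm_le (hx.const_mul C) (Eventually.of_forall fun v => ?_)
  have := hC h σ x hσ v
  rwa [max_eq_left (Real.rpow_le_one hσ.le hσ1 (by norm_num)), mul_one] at this

lemma tendsto_heatKernel_zero {x : E} (hn : 0 < (n : ℝ)) (hx : x ≠ 0) :
    Tendsto (fun σ => heatKernel σ x) (𝓝[>] 0) (𝓝 0) := by
  obtain ⟨C₁, hC₁0, hC₁⟩ := exp_neg_mul_sq_le (k := n + 1) (c := 4) (by linarith) (by norm_num)
  have hx0 : 0 < ‖x‖ := norm_pos_iff.2 hx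
  have hlim : Tendsto (fun σ : ℝ => (4 * Real.pi) ^ (-(n : ℝ) / 2) * (C₁ * (σ ^ (1 / 2 : ℝ) *
      ‖x‖ ^ (-((n : ℝ) + 1))))) (𝓝[>] 0) (𝓝 0) := by
    have h2 := (Real.continuousAt_rpow_const 0 (1 / 2) (Or.inr (by norm_num))).tendsto
    rw [Real.zero_rpow (by norm_num)] at h2
    have h3 := ((h2.mul_const (‖x‖ ^ (-((n : ℝ) + 1)))).const_mul C₁).const_mul
      ((4 * Real.pi) ^ (-(n : ℝ) / 2))
    rw [zero_mul, mul_zero, mul_zero] at h3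
    exact h3.mono_left nhdsWithin_le_nhds
  refine squeeze_zero' ?_ ?_ hlim
  · filter_upwards [self_mem_nhdsWithin] with σ hσ
    exact heatKernel_nonneg (mem_Ioi.1 hσ).le x
  · filter_upwards [self_mem_nhdsWithin] with σ hσ
    have hσ0 : (0 : ℝ) < σ := hσ
    unfold heatKernel
    rw [Real.mul_rpow (by positivity) hσ0.le, mul_assoc]
    refine mul_le_mul_of_nonneg_left ?_ (by positivity)
    calc _ ≤ σ ^ (-(n : ℝ) / 2) * (C₁ * (σ ^ (((n : ℝ) + 1) / 2) * ‖x‖ ^ (-((n : ℝ) + 1)))) := by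
          gcongr; exact hC₁ σ _ hσ0 hx0
      _ = C₁ * (σ ^ (-(n : ℝ) / 2) * σ ^ (((n : ℝ) + 1) / 2) * ‖x‖ ^ (-((n : ℝ) + 1))) := by ring
      _ = _ := by
          rw [← Real.rpow_add hσ0, show -(n : ℝ) / 2 + (n + 1) / 2 = 1 / 2 by ring]

lemma tendsto_heatAverage_zero [NeZero n] {h : E → F} (hh : StronglyMeasurable h)
    {x : E} (hx : HeatRegular h x) :
    Tendsto (fun σ => heatAverage h σ x) (𝓝[>] 0) (𝓝 (h x)) := by
  have hn : 0 < (n : ℝ) := mod_cast NeZero.pos n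
  obtain ⟨C, -, hC⟩ := norm_heatKernel_smul_le (n := n) (F := F) hn
  have hlim : Tendsto (fun σ => ∫ v, heatKernel σ (x - v) • (h v - h x)) (𝓝[>] 0)
      (𝓝 (∫ _ : E, (0 : F))) := by
    refine tendsto_integral_filter_of_dominated_convergence
      (fun v => C * (heatWeight (x - v) * ‖h v - h x‖)) ?_ ?_ (hx.const_mul C) ?_
    · filter_upwards [self_mem_nhdsWithin] with σ hσ
      exact (integrable_heatKernel_smul_sub hn hh hx hσ).aestronglyMeasurable
    · filter_upwards [Ioc_mem_nhdsGT (zero_lt_one (α := ℝ))] with σ hσ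
      refine Eventually.of_forall fun v => ?_
      have := hC h σ x hσ.1 v
      rwa [max_eq_left (Real.rpow_le_one hσ.1.le hσ.2 (by norm_num)), mul_one] at this
    · filter_upwards [Measure.ae_ne volume x] with v hv
      have := (tendsto_heatKernel_zero hn (sub_ne_zero.2 hv.symm)).smul_const (h v - h x)
      rwa [zero_smul] at this
  rw [integral_zero] at hlim
  have h2 := hlim.add_const (h x)
  rw [zero_add] at h2
  refine h2.congr' ?_
  filter_upwards [self_mem_nhdsWithin] with σ hσ
  rw [← heatAverage_sub hn hh hx hσ, sub_add_cancel]

lemma tendsto_heatKernel_atTop (hn : 0 < (n : ℝ)) (x : E) :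
    Tendsto (fun σ => heatKernel σ x) atTop (𝓝 0) := by
  have hlim : Tendsto (fun σ : ℝ => (4 * Real.pi * σ) ^ (-(n : ℝ) / 2)) atTop (𝓝 0) := by
    rw [neg_div]
    refine (tendsto_rpow_neg_atTop (by positivity)).comp ?_
    exact tendsto_id.const_mul_atTop (by positivity)
  refine squeeze_zero' ?_ ?_ hlim
  · filter_upwards [eventually_gt_atTop 0] with σ hσ
    exact heatKernel_nonneg hσ.le x
  · filter_upwards [eventually_gt_atTop 0] with σ hσ
    unfold heatKernel
    refine mul_le_of_le_one_right (by positivity) (Real.exp_le_one_iff.2 ?_)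
    rw [neg_mul]
    exact neg_nonpos.2 (by positivity)

lemma heatAverage_sub_heatAverage (hn : 0 < (n : ℝ)) {h : E → F} (hh : StronglyMeasurable h)
    {x y : E} (hx : HeatRegular h x) (hy : HeatRegular h y) {σ : ℝ} (hσ : 0 < σ) :
    heatAverage h σ x - heatAverage h σ y =
      ∫ v, (heatKernel σ (x - v) - heatKernel σ (y - v)) • (h v - h x) := by
  rw [← sub_sub_sub_cancel_right _ _ (h x), heatAverage_sub hn hh hx hσ, heatAverage_sub hn hh hy hσ,
    ← integral_sub]
  · simp_rw [sub_smul]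
  · exact integrable_heatKernel_smul_sub hn hh hx hσ
  · simp_rw [smul_sub]
    exact (integrable_heatKernel_smul hn hh hy hσ).sub
      ((integrable_heatKernel_sub hσ y).smul_const _)

lemma tendsto_heatAverage_sub_atTop [NeZero n] {h : E → F} (hh : StronglyMeasurable h)
    {x y : E} (hxy : x ≠ y) (hx : HeatRegular h x) (hy : HeatRegular h y) :
    Tendsto (fun σ => heatAverage h σ x - heatAverage h σ y) atTop (𝓝 0) := by
  have hn : 0 < (n : ℝ) := mod_cast NeZero.pos n
  obtain ⟨C, hC⟩ := norm_heatKernel_sub_smul_le hn h hxy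
  have hlim : Tendsto (fun σ => ∫ v, (heatKernel σ (x - v) - heatKernel σ (y - v)) • (h v - h x))
      atTop (𝓝 (∫ _ : E, (0 : F))) := by
    refine tendsto_integral_filter_of_dominated_convergence
      (fun v => C * (heatWeight (x - v) * ‖h v - h x‖)) ?_ ?_ (hx.const_mul C) ?_
    · filter_upwards [eventually_gt_atTop 0] with σ hσ
      exact (((integrable_heatKernel_sub hσ x).sub
        (integrable_heatKernel_sub hσ y)).aestronglyMeasurable).smul
        (hh.aestronglyMeasurable.sub aestronglyMeasurable_const)
    · filter_upwards [eventually_ge_atTop 1] with σ hσ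
      exact Eventually.of_forall fun v => hC σ v hσ
    · refine Eventually.of_forall fun v => ?_
      have := ((tendsto_heatKernel_atTop hn (x - v)).sub
        (tendsto_heatKernel_atTop hn (y - v))).smul_const (h v - h x)
      rwa [sub_zero, zero_smul] at this
  rw [integral_zero] at hlim
  refine hlim.congr' ?_
  filter_upwards [eventually_gt_atTop 0] with σ hσ
  rw [heatAverage_sub_heatAverage hn hh hx hy hσ]

lemma norm_heatAverage_sub_heatAverage_le [NeZero n] {h : E → F} (hh : StronglyMeasurable h)
    {x y : E} (hxy : x ≠ y) (hx : HeatRegular h x) (hy : HeatRegular h y) :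
    ∃ M : ℝ, ∀ σ, 0 < σ → ‖heatAverage h σ x - heatAverage h σ y‖ ≤ M := by
  have hn : 0 < (n : ℝ) := mod_cast NeZero.pos n
  obtain ⟨C, hC⟩ := norm_heatKernel_sub_smul_le hn h hxy
  obtain ⟨M₁, hM₁⟩ := norm_heatAverage_sub_le hn hh hx
  obtain ⟨M₂, hM₂⟩ := norm_heatAverage_sub_le hn hh hy
  refine ⟨max (M₁ + ‖h x - h y‖ + M₂) (∫ v, C * (heatWeight (x - v) * ‖h v - h x‖)),
    fun σ hσ => ?_⟩
  rcases le_total σ 1 with h1 | h1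
  · refine le_max_of_le_left ?_
    calc ‖heatAverage h σ x - heatAverage h σ y‖
        = ‖(heatAverage h σ x - h x) + (h x - h y) - (heatAverage h σ y - h y)‖ := by
          congr 1; abel
      _ ≤ ‖heatAverage h σ x - h x‖ + ‖h x - h y‖ + ‖heatAverage h σ y - h y‖ :=
          (norm_sub_le _ _).trans (by gcongr; exact norm_add_le _ _)
      _ ≤ _ := by
          gcongr
          · exact hM₁ σ hσ h1
          · exact hM₂ σ hσ h1
  · refine le_max_of_le_right ?_
    rw [heatAverage_sub_heatAverage hn hh hx hy hσ]
    exact norm_integral_le_of_norm_le (hx.const_mul C) (Eventually.of_forall fun v => hC σ v h1)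

end HeatKernel

/-! ### Inversion of the fractional Laplacian -/

section RieszIdentity

lemma heatKernel_le_of_norm_le {σ : ℝ} (hσ : 0 ≤ σ) {u v : E} (h : ‖u‖ ≤ ‖v‖) :
    heatKernel σ v ≤ heatKernel σ u := by
  unfold heatKernel
  refine mul_le_mul_of_nonneg_left (Real.exp_le_exp.2 ?_) (by positivity)
  have : 0 ≤ 1 / (4 * σ) := by positivity
  have h2 : ‖u‖ ^ 2 ≤ ‖v‖ ^ 2 := by gcongr
  nlinarith

/-- The difference of two Riesz kernels is a superposition of differences of heat kernels, which
have the same sign for all times. -/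
lemma integral_rpow_mul_abs_heatKernel_sub (β : ℝ) (u v : E) :
    ∫ σ in Ioi (0 : ℝ), |σ ^ (β - 1) * (heatKernel σ u - heatKernel σ v)| =
      |∫ σ in Ioi (0 : ℝ), σ ^ (β - 1) * (heatKernel σ u - heatKernel σ v)| := by
  have key : ∀ {u v : E}, ‖u‖ ≤ ‖v‖ →
      ∫ σ in Ioi (0 : ℝ), |σ ^ (β - 1) * (heatKernel σ u - heatKernel σ v)| =
      |∫ σ in Ioi (0 : ℝ), σ ^ (β - 1) * (heatKernel σ u - heatKernel σ v)| := by
    intro u v h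
    have hnn : ∀ σ ∈ Ioi (0 : ℝ), 0 ≤ σ ^ (β - 1) * (heatKernel σ u - heatKernel σ v) :=
      fun σ hσ => mul_nonneg (Real.rpow_nonneg (mem_Ioi.1 hσ).le _)
        (sub_nonneg.2 (heatKernel_le_of_norm_le (mem_Ioi.1 hσ).le h))
    rw [abs_of_nonneg (setIntegral_nonneg measurableSet_Ioi hnn)]
    exact setIntegral_congr_fun measurableSet_Ioi fun σ hσ => abs_of_nonneg (hnn σ hσ)
  rcases le_total ‖u‖ ‖v‖ with h | h
  · exact key h
  · have := key h
    have e : ∀ σ, σ ^ (β - 1) * (heatKernel σ u - heatKernel σ v) =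
        -(σ ^ (β - 1) * (heatKernel σ v - heatKernel σ u)) := fun σ => by ring
    simp_rw [e, integral_neg, abs_neg]
    exact this

lemma integral_rpow_mul_heatKernel_sub {β : ℝ} (hβ : β < (n : ℝ) / 2) {u v : E} (hu : u ≠ 0)
    (hv : v ≠ 0) :
    ∫ σ in Ioi (0 : ℝ), σ ^ (β - 1) * (heatKernel σ u - heatKernel σ v) =
      Real.Gamma (n / 2 - β) / (4 ^ β * Real.pi ^ ((n : ℝ) / 2)) *
        (‖u‖ ^ (2 * β - n) - ‖v‖ ^ (2 * β - n)) := by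
  simp_rw [mul_sub]
  rw [integral_sub (integrableOn_rpow_mul_heatKernel hβ hu) (integrableOn_rpow_mul_heatKernel hβ hv),
    integral_rpow_mul_heatKernel hβ hu, integral_rpow_mul_heatKernel hβ hv]

lemma integrableOn_rpow_mul_heatKernel_sub {β : ℝ} (hβ : β < (n : ℝ) / 2) {u v : E} (hu : u ≠ 0)
    (hv : v ≠ 0) :
    IntegrableOn (fun σ : ℝ => σ ^ (β - 1) * (heatKernel σ u - heatKernel σ v)) (Ioi 0) := by
  simp_rw [mul_sub]
  exact (integrableOn_rpow_mul_heatKernel hβ hu).sub (integrableOn_rpow_mul_heatKernel hβ hv)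

variable [NormedSpace ℝ F]

lemma integrable_heatKernel_mul_smul_left (hn : 0 < (n : ℝ)) {h : E → F} (hh : StronglyMeasurable h)
    {x : E} (hx : HeatRegular h x) {σ τ : ℝ} (hσ : 0 < σ) (hτ : 0 < τ) :
    Integrable (fun w : E × E => (heatKernel σ (x - w.1) * heatKernel τ (w.1 - w.2)) • (h w.1 - h x))
      (volume.prod volume) := by
  have hm : Measurable fun w : E × E => heatKernel σ (x - w.1) * heatKernel τ (w.1 - w.2) := by
    unfold heatKernel; fun_prop
  have hM : AEStronglyMeasurable (fun w : E × E => (heatKernel σ (x - w.1) *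
      heatKernel τ (w.1 - w.2)) • (h w.1 - h x)) (volume.prod volume) := (hm.stronglyMeasurable.smul
    ((hh.comp_measurable measurable_fst).sub stronglyMeasurable_const)).aestronglyMeasurable
  rw [integrable_prod_iff hM]
  constructor
  · refine Eventually.of_forall fun z => ?_
    exact (((integrable_heatKernel_sub hτ z).const_mul (heatKernel σ (x - z))).smul_const (h z - h x))
  · refine (integrable_heatKernel_smul_sub hn hh hx hσ).norm.congr (Eventually.of_forall fun z => ?_)
    simp only [norm_smul, norm_mul]
    rw [integral_mul_const, integral_const_mul]
    have : ∫ v, ‖heatKernel τ (z - v)‖ = 1 := by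
      rw [← integral_heatKernel_sub hτ z]
      exact integral_congr_ae (Eventually.of_forall fun v =>
        Real.norm_of_nonneg (heatKernel_nonneg hτ.le _))
    rw [this, mul_one]

lemma integrable_heatKernel_mul_smul_right (hn : 0 < (n : ℝ)) {h : E → F}
    (hh : StronglyMeasurable h) {x : E} (hx : HeatRegular h x) {σ τ : ℝ} (hσ : 0 < σ) (hτ : 0 < τ) :
    Integrable (fun w : E × E => (heatKernel σ (x - w.1) * heatKernel τ (w.1 - w.2)) • (h w.2 - h x))
      (volume.prod volume) := by
  have hm : Measurable fun w : E × E => heatKernel σ (x - w.1) * heatKernel τ (w.1 - w.2) := by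
    unfold heatKernel; fun_prop
  have hM : AEStronglyMeasurable (fun w : E × E => (heatKernel σ (x - w.1) *
      heatKernel τ (w.1 - w.2)) • (h w.2 - h x)) (volume.prod volume) := (hm.stronglyMeasurable.smul
    ((hh.comp_measurable measurable_snd).sub stronglyMeasurable_const)).aestronglyMeasurable
  rw [integrable_prod_iff' hM]
  constructor
  · exact Eventually.of_forall fun v => (integrable_heatKernel_mul hσ hτ x v).smul_const (h v - h x)
  · refine (integrable_heatKernel_smul_sub hn hh hx (add_pos hσ hτ)).norm.congr
      (Eventually.of_forall fun v => ?_)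
    simp only [norm_smul]
    rw [integral_mul_const]
    congr 1
    rw [Real.norm_of_nonneg (heatKernel_nonneg (add_pos hσ hτ).le _),
      ← integral_heatKernel_mul hσ hτ x v]
    exact integral_congr_ae (Eventually.of_forall fun z =>
      (Real.norm_of_nonneg (mul_nonneg (heatKernel_nonneg hσ.le _) (heatKernel_nonneg hτ.le _))).symm)

lemma integrable_heatKernel_mul_smul_sub (hn : 0 < (n : ℝ)) {h : E → F}
    (hh : StronglyMeasurable h) {x : E} (hx : HeatRegular h x) {σ τ : ℝ} (hσ : 0 < σ) (hτ : 0 < τ) :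
    Integrable (fun w : E × E => (heatKernel σ (x - w.1) * heatKernel τ (w.1 - w.2)) •
      (h w.2 - h w.1)) (volume.prod volume) := by
  refine ((integrable_heatKernel_mul_smul_right hn hh hx hσ hτ).sub
    (integrable_heatKernel_mul_smul_left hn hh hx hσ hτ)).congr (Eventually.of_forall fun w => ?_)
  simp only [Pi.sub_apply]
  rw [← smul_sub, sub_sub_sub_cancel_right]

variable [CompleteSpace F]

/-- Averaging the increments of `h` over a further heat step gives the increment in time of its
heat extension. -/
lemma integral_heatKernel_mul_smul_sub (hn : 0 < (n : ℝ)) {h : E → F}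
    (hh : StronglyMeasurable h) {x : E} (hx : HeatRegular h x) {σ τ : ℝ} (hσ : 0 < σ) (hτ : 0 < τ) :
    ∫ w : E × E, (heatKernel σ (x - w.1) * heatKernel τ (w.1 - w.2)) • (h w.2 - h w.1)
      ∂(volume.prod volume) = heatAverage h (σ + τ) x - heatAverage h σ x := by
  have hl := integrable_heatKernel_mul_smul_left hn hh hx hσ hτ
  have hr := integrable_heatKernel_mul_smul_right hn hh hx hσ hτ
  have e : ∀ w : E × E, (heatKernel σ (x - w.1) * heatKernel τ (w.1 - w.2)) • (h w.2 - h w.1) =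
      (heatKernel σ (x - w.1) * heatKernel τ (w.1 - w.2)) • (h w.2 - h x) -
      (heatKernel σ (x - w.1) * heatKernel τ (w.1 - w.2)) • (h w.1 - h x) := fun w => by
    rw [← smul_sub, sub_sub_sub_cancel_right]
  simp_rw [e]
  rw [integral_sub hr hl, integral_prod_symm _ hr, integral_prod _ hl]
  simp only [integral_smul_const, integral_heatKernel_mul hσ hτ, integral_const_mul,
    integral_heatKernel_sub hτ, mul_one]
  rw [← heatAverage_sub hn hh hx (add_pos hσ hτ), ← heatAverage_sub hn hh hx hσ,
    sub_sub_sub_cancel_right]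

/-- `I_t (-Δ)^{t/2} h` differs from `h` by a constant: the increments of both functions agree.
Both kernels are superpositions of heat kernels, and the resulting double integral in time
telescopes. -/
theorem sub_eq_integral_smul_fracLaplacian [NeZero n] {t : ℝ} (ht0 : 0 < t) (ht1 : t < 1) {h : E → F}
    (hh : StronglyMeasurable h) {x y : E} (hxy : x ≠ y) (hx : HeatRegular h x)
    (hy : HeatRegular h y)
    (hR : Integrable (fun w : E × E => ((‖x - w.1‖ ^ (t - (n : ℝ)) - ‖y - w.1‖ ^ (t - (n : ℝ))) *
      (‖w.1 - w.2‖ ^ ((n : ℝ) + t))⁻¹) • (h w.2 - h w.1)) (volume.prod volume)) :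
    h x - h y = (Real.Gamma (((n : ℝ) - t) / 2) /
      ((2 : ℝ) ^ t * Real.pi ^ ((n : ℝ) / 2) * Real.Gamma (t / 2))) •
      ∫ z, (‖x - z‖ ^ (t - (n : ℝ)) - ‖y - z‖ ^ (t - (n : ℝ))) • fracLaplacian t h z := by
  have hn1 : (1 : ℝ) ≤ n := mod_cast NeZero.one_le
  have hn : 0 < (n : ℝ) := by linarith
  obtain ⟨α, hα⟩ : ∃ α, α = t / 2 := ⟨_, rfl⟩
  have hα0 : 0 < α := by rw [hα]; linarith
  have hα1 : α < 1 := by rw [hα]; linarith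
  have hαn : α < (n : ℝ) / 2 := by rw [hα]; linarith
  have htα : t = 2 * α := by rw [hα]; ring
  subst htα
  obtain ⟨ν, hν⟩ : ∃ ν : Measure ℝ, ν = volume.restrict (Ioi 0) := ⟨_, rfl⟩
  have : SFinite ν := by rw [hν]; infer_instance
  obtain ⟨a, ha⟩ : ∃ a : E → ℝ → ℝ,
    a = fun z σ => σ ^ (α - 1) * (heatKernel σ (x - z) - heatKernel σ (y - z)) := ⟨_, rfl⟩
  obtain ⟨b, hb⟩ : ∃ b : E × E → ℝ → ℝ,
    b = fun w τ => τ ^ (-α - 1) * heatKernel τ (w.1 - w.2) := ⟨_, rfl⟩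
  obtain ⟨c₁, hc₁⟩ : ∃ c₁, c₁ = Real.Gamma (n / 2 - α) / (4 ^ α * Real.pi ^ ((n : ℝ) / 2)) :=
    ⟨_, rfl⟩
  obtain ⟨c₂, hc₂⟩ : ∃ c₂, c₂ = Real.Gamma (n / 2 - -α) / (4 ^ (-α) * Real.pi ^ ((n : ℝ) / 2)) :=
    ⟨_, rfl⟩
  have hc₁0 : 0 < c₁ := by
    rw [hc₁]; have := Real.Gamma_pos_of_pos (s := n / 2 - α) (by linarith); positivity
  have hc₂0 : 0 < c₂ := by
    rw [hc₂]; have := Real.Gamma_pos_of_pos (s := n / 2 - -α) (by linarith); positivity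
  have ha1 : ∀ z, z ≠ x → z ≠ y → Integrable (a z) ν := fun z hzx hzy => by
    rw [ha, hν]
    exact integrableOn_rpow_mul_heatKernel_sub hαn (sub_ne_zero.2 hzx.symm) (sub_ne_zero.2 hzy.symm)
  have ha2 : ∀ z, z ≠ x → z ≠ y → ∫ σ, a z σ ∂ν =
      c₁ * (‖x - z‖ ^ (2 * α - (n : ℝ)) - ‖y - z‖ ^ (2 * α - (n : ℝ))) := fun z hzx hzy => by
    rw [ha, hν, hc₁]
    exact integral_rpow_mul_heatKernel_sub hαn (sub_ne_zero.2 hzx.symm) (sub_ne_zero.2 hzy.symm)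
  have ha3 : ∀ z, ∫ σ, ‖a z σ‖ ∂ν = ‖∫ σ, a z σ ∂ν‖ := fun z => by
    rw [ha, hν]
    exact integral_rpow_mul_abs_heatKernel_sub α (x - z) (y - z)
  have hb1 : ∀ w : E × E, w.1 ≠ w.2 → Integrable (b w) ν := fun w hw => by
    rw [hb, hν]
    exact integrableOn_rpow_mul_heatKernel (by linarith) (sub_ne_zero.2 hw)
  have hb2 : ∀ w : E × E, w.1 ≠ w.2 → ∫ τ, b w τ ∂ν = c₂ * (‖w.1 - w.2‖ ^ ((n : ℝ) + 2 * α))⁻¹ :=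
    fun w hw => by
    rw [hb, hν, hc₂, ← Real.rpow_neg (norm_nonneg _)]
    simp only
    rw [integral_rpow_mul_heatKernel (by linarith) (sub_ne_zero.2 hw)]
    congr 2; ring
  have hb3 : ∀ w : E × E, ∫ τ, ‖b w τ‖ ∂ν = ∫ τ, b w τ ∂ν := fun w => by
    rw [hb, hν]
    exact setIntegral_congr_fun measurableSet_Ioi fun τ hτ => Real.norm_of_nonneg
      (mul_nonneg (Real.rpow_nonneg (mem_Ioi.1 hτ).le _) (heatKernel_nonneg (mem_Ioi.1 hτ).le _))
  obtain ⟨Φ, hΦ⟩ : ∃ Φ : (E × E) × (ℝ × ℝ) → F,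
    Φ = fun u => (a u.1.1 u.2.1 * b u.1 u.2.2) • (h u.1.2 - h u.1.1) := ⟨_, rfl⟩
  have hΦm : StronglyMeasurable Φ := by
    rw [hΦ]
    refine StronglyMeasurable.smul (Measurable.stronglyMeasurable ?_)
      ((hh.comp_measurable (by fun_prop)).sub (hh.comp_measurable (by fun_prop)))
    rw [ha, hb]
    unfold heatKernel
    fun_prop
  have hae : ∀ᵐ w : E × E ∂(volume.prod volume), w.1 ≠ x ∧ w.1 ≠ y :=
    Measure.quasiMeasurePreserving_fst.ae ((Measure.ae_ne volume x).and (Measure.ae_ne volume y))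
  have hin : ∀ w : E × E, w.1 ≠ x → w.1 ≠ y →
      Integrable (fun u => Φ (w, u)) (ν.prod ν) ∧
      ∫ u, Φ (w, u) ∂(ν.prod ν) = (c₁ * c₂) •
        ((‖x - w.1‖ ^ (2 * α - (n : ℝ)) - ‖y - w.1‖ ^ (2 * α - (n : ℝ))) *
        (‖w.1 - w.2‖ ^ ((n : ℝ) + 2 * α))⁻¹) • (h w.2 - h w.1) ∧
      ∫ u, ‖Φ (w, u)‖ ∂(ν.prod ν) = (c₁ * c₂) *
        ‖((‖x - w.1‖ ^ (2 * α - (n : ℝ)) - ‖y - w.1‖ ^ (2 * α - (n : ℝ))) *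
        (‖w.1 - w.2‖ ^ ((n : ℝ) + 2 * α))⁻¹) • (h w.2 - h w.1)‖ := by
    intro w hwx hwy
    rcases eq_or_ne w.1 w.2 with hw | hw
    · rw [hΦ]
      simp [hw]
    · rw [hΦ]
      simp only
      refine ⟨((ha1 _ hwx hwy).mul_prod (hb1 w hw)).smul_const _, ?_, ?_⟩
      · rw [integral_smul_const, integral_prod_mul (a w.1) (b w), ha2 _ hwx hwy, hb2 w hw, smul_smul]
        congr 1; ring
      · simp_rw [norm_smul, norm_mul]
        rw [integral_mul_const, integral_prod_mul (fun σ => ‖a w.1 σ‖) (fun τ => ‖b w τ‖),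
          ha3, hb3, ha2 _ hwx hwy, hb2 w hw, norm_mul, Real.norm_of_nonneg hc₁0.le,
          Real.norm_of_nonneg (inv_nonneg.2 (Real.rpow_nonneg (norm_nonneg _) _))]
        ring
  have hΦi : Integrable Φ ((volume.prod volume).prod (ν.prod ν)) := by
    rw [integrable_prod_iff hΦm.aestronglyMeasurable]
    refine ⟨?_, (hR.norm.const_mul (c₁ * c₂)).congr ?_⟩
    · filter_upwards [hae] with w hw using (hin w hw.1 hw.2).1
    · filter_upwards [hae] with w hw using (hin w hw.1 hw.2).2.2.symm
  have hpos : ∀ᵐ u : ℝ × ℝ ∂(ν.prod ν), 0 < u.1 ∧ 0 < u.2 := by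
    have h0 : ∀ᵐ σ ∂ν, 0 < σ := by rw [hν]; exact ae_restrict_mem measurableSet_Ioi
    exact (Measure.quasiMeasurePreserving_fst.ae h0).and (Measure.quasiMeasurePreserving_snd.ae h0)
  obtain ⟨Q, hQ⟩ : ∃ Q : ℝ → F, Q = fun σ => heatAverage h σ x - heatAverage h σ y := ⟨_, rfl⟩
  have htime : ∀ u : ℝ × ℝ, 0 < u.1 → 0 < u.2 → ∫ w, Φ (w, u) ∂(volume.prod volume) =
      (u.1 ^ (α - 1) * u.2 ^ (-1 - α)) • (Q (u.1 + u.2) - Q u.1) := by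
    intro u h1 h2
    have e : ∀ w : E × E, Φ (w, u) = (u.1 ^ (α - 1) * u.2 ^ (-1 - α)) •
        ((heatKernel u.1 (x - w.1) * heatKernel u.2 (w.1 - w.2)) • (h w.2 - h w.1) -
        (heatKernel u.1 (y - w.1) * heatKernel u.2 (w.1 - w.2)) • (h w.2 - h w.1)) := fun w => by
      rw [hΦ, ha, hb, ← sub_smul, smul_smul]
      simp only
      rw [show -α - 1 = -1 - α by ring]
      congr 1; ring
    simp_rw [e]
    rw [integral_smul, integral_sub (integrable_heatKernel_mul_smul_sub hn hh hx h1 h2)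
      (integrable_heatKernel_mul_smul_sub hn hh hy h1 h2),
      integral_heatKernel_mul_smul_sub hn hh hx h1 h2,
      integral_heatKernel_mul_smul_sub hn hh hy h1 h2, hQ]
    simp only
    congr 1; abel
  obtain ⟨M, hM⟩ := norm_heatAverage_sub_heatAverage_le hh hxy hx hy
  have hfin := integral_rpow_smul_sub (α := α) (Q := Q) (L := h x - h y) (R := 0) (M := M)
    (by rw [hQ]; exact (stronglyMeasurable_heatAverage hh x).sub (stronglyMeasurable_heatAverage hh y))
    (by rw [hQ]; exact hM)
    (by rw [hQ]; exact (tendsto_heatAverage_zero hh hx).sub (tendsto_heatAverage_zero hh hy))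
    (by rw [hQ]; exact tendsto_heatAverage_sub_atTop hh hxy hx hy) (by
      rw [← hν]
      refine hΦi.integral_prod_right.congr ?_
      filter_upwards [hpos] with u hu using htime u hu.1 hu.2)
  rw [integral_rpow_mul_log_one_add hα0 hα1, ← hν] at hfin
  have hA : ∫ u, (u.1 ^ (α - 1) * u.2 ^ (-1 - α)) • (Q (u.1 + u.2) - Q u.1) ∂(ν.prod ν) =
      (c₁ * c₂) • ∫ z, (‖x - z‖ ^ (2 * α - (n : ℝ)) - ‖y - z‖ ^ (2 * α - (n : ℝ))) •
        ∫ v, (‖z - v‖ ^ ((n : ℝ) + 2 * α))⁻¹ • (h v - h z) := by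
    calc _ = ∫ u, ∫ w, Φ (w, u) ∂(volume.prod volume) ∂(ν.prod ν) := by
          refine integral_congr_ae ?_
          filter_upwards [hpos] with u hu using (htime u hu.1 hu.2).symm
      _ = ∫ w, ∫ u, Φ (w, u) ∂(ν.prod ν) ∂(volume.prod volume) :=
          (integral_integral_swap (f := fun w u => Φ (w, u)) hΦi).symm
      _ = ∫ w : E × E, (c₁ * c₂) •
        ((‖x - w.1‖ ^ (2 * α - (n : ℝ)) - ‖y - w.1‖ ^ (2 * α - (n : ℝ))) *
        (‖w.1 - w.2‖ ^ ((n : ℝ) + 2 * α))⁻¹) • (h w.2 - h w.1) ∂(volume.prod volume) := by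
          refine integral_congr_ae ?_
          filter_upwards [hae] with w hw using (hin w hw.1 hw.2).2.1
      _ = _ := by
          rw [integral_smul, integral_prod _ hR]
          simp_rw [mul_smul, integral_smul]
  rw [hA] at hfin
  have hG1 : 0 < Real.Gamma α := Real.Gamma_pos_of_pos hα0
  have hG2 : Real.Gamma (-α) ≠ 0 := by
    refine Real.Gamma_ne_zero fun m hm => ?_
    have : α = m := by linarith
    rcases Nat.eq_zero_or_pos m with h0 | h0
    · rw [h0, Nat.cast_zero] at this; linarith
    · have : (1 : ℝ) ≤ m := mod_cast h0
      linarith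
  have hp4 : (4 : ℝ) ^ (-α) = (4 ^ α)⁻¹ := Real.rpow_neg (by norm_num) _
  have h40 : (0 : ℝ) < 4 ^ α := by positivity
  have h20 : (0 : ℝ) < 2 ^ (2 * α) := by positivity
  have hpi : 0 < Real.pi ^ ((n : ℝ) / 2) := by positivity
  have hconst : c₁ * c₂ = (Real.Gamma α * Real.Gamma (-α)) *
      ((Real.Gamma (((n : ℝ) - 2 * α) / 2) /
        ((2 : ℝ) ^ (2 * α) * Real.pi ^ ((n : ℝ) / 2) * Real.Gamma (2 * α / 2))) *
      ((2 : ℝ) ^ (2 * α) * Real.Gamma (((n : ℝ) + 2 * α) / 2) /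
        (Real.pi ^ ((n : ℝ) / 2) * Real.Gamma (-(2 * α) / 2)))) := by
    rw [hc₁, hc₂, hp4, show (n : ℝ) / 2 - α = (n - 2 * α) / 2 by ring,
      show (n : ℝ) / 2 - -α = (n + 2 * α) / 2 by ring, show 2 * α / 2 = α by ring,
      show -(2 * α) / 2 = -α by ring]
    field_simp
  unfold fracLaplacian
  have hsm : ∀ z, (‖x - z‖ ^ (2 * α - (n : ℝ)) - ‖y - z‖ ^ (2 * α - (n : ℝ))) •
      (((2 : ℝ) ^ (2 * α) * Real.Gamma (((n : ℝ) + 2 * α) / 2) /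
        (Real.pi ^ ((n : ℝ) / 2) * Real.Gamma (-(2 * α) / 2))) •
        ∫ v, (‖z - v‖ ^ ((n : ℝ) + 2 * α))⁻¹ • (h v - h z)) =
      ((2 : ℝ) ^ (2 * α) * Real.Gamma (((n : ℝ) + 2 * α) / 2) /
        (Real.pi ^ ((n : ℝ) / 2) * Real.Gamma (-(2 * α) / 2))) •
      ((‖x - z‖ ^ (2 * α - (n : ℝ)) - ‖y - z‖ ^ (2 * α - (n : ℝ))) •
        ∫ v, (‖z - v‖ ^ ((n : ℝ) + 2 * α))⁻¹ • (h v - h z)) := fun z => smul_comm _ _ _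
  simp_rw [hsm]
  rw [integral_smul, smul_smul]
  have hne : Real.Gamma α * Real.Gamma (-α) ≠ 0 := mul_ne_zero hG1.ne' hG2
  rw [hconst, mul_smul, zero_sub, smul_neg, neg_smul, neg_neg] at hfin
  exact (smul_right_injective F hne hfin).symm

end RieszIdentity

/-! ### The absolute value of the fractional Laplacian -/

section IncrementIntegral

lemma growthBound_indicator_ball [NeZero n] {κ : ℝ} (hκ0 : 0 ≤ κ) (hκn : κ ≤ n) (z₀ : E) (R : ℝ) :
    GrowthBound ((ball z₀ R).indicator fun _ => (1 : ℝ≥0∞))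
      (volume (ball (0 : E) 1) * ofReal R ^ κ) (n - κ) := by
  intro u r hr
  have hvol : ∀ (u : E) (r : ℝ), volume (ball u r) =
      volume (ball (0 : E) 1) * ofReal r ^ (n : ℝ) := fun u r => by
    rw [EuclideanSpace.volume_ball, EuclideanSpace.volume_ball, rpow_natCast]
    simp [mul_comm]
  rw [lintegral_indicator_const isOpen_ball.measurableSet, one_mul, Measure.restrict_apply
    isOpen_ball.measurableSet, mul_assoc]
  have hr0 : ofReal r ≠ 0 := by simpa using hr
  rcases le_total R r with h | h
  · refine (measure_mono inter_subset_left).trans ?_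
    rw [hvol]
    refine mul_le_mul_right ?_ _
    rcases le_or_gt R 0 with hR | hR
    · have hn : (0 : ℝ) < n := mod_cast NeZero.pos n
      rw [ENNReal.ofReal_of_nonpos hR, zero_rpow_of_pos hn]; exact zero_le
    · have hR0 : ofReal R ≠ 0 := by simpa using hR
      calc ofReal R ^ (n : ℝ) = ofReal R ^ κ * ofReal R ^ (n - κ) := by
            rw [← rpow_add _ _ hR0 ofReal_ne_top]; congr 1; ring
        _ ≤ _ := by
            refine mul_le_mul_right (rpow_le_rpow (ofReal_le_ofReal h) ?_) _
            linarith
  · refine (measure_mono inter_subset_right).trans ?_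
    rw [hvol]
    refine mul_le_mul_right ?_ _
    calc ofReal r ^ (n : ℝ) = ofReal r ^ κ * ofReal r ^ (n - κ) := by
            rw [← rpow_add _ _ hr0 ofReal_ne_top]; congr 1; ring
        _ ≤ _ := by
            refine mul_le_mul_left (rpow_le_rpow (ofReal_le_ofReal h) hκ0) _

/-- The absolutely convergent majorant `∫ |h z - h v| / |z - v|^{n + t} dv` of `(-Δ)^{t/2} h`. -/
noncomputable def incrementIntegral (t : ℝ) (h : E → F) (z : E) : ℝ≥0∞ :=
  ∫⁻ v, edist (h z) (h v) * edist z v ^ (-(n + t) : ℝ)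

lemma measurable_incrementIntegral {t : ℝ} {h : E → F} (hh : StronglyMeasurable h) :
    Measurable (incrementIntegral t h) := by
  have hd := measurable_edist_comp hh
  refine Measurable.lintegral_prod_right'
    (f := fun q : E × E => edist (h q.1) (h q.2) * edist q.1 q.2 ^ (-(n + t) : ℝ)) ?_
  exact hd.mul (by fun_prop)

lemma lintegral_ind_increment_le [NeZero n] {s t κ : ℝ} (hs0 : 0 < s) (hs1 : s < 1) (hκ0 : 0 < κ)
    (hκn : κ < n) {e : ℝ} (he : e * (1 - s / n) = -(n + t) + 2 * s - κ * (s / n)) :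
    ∃ C : ℝ≥0, ∀ h : E → F, StronglyMeasurable h → ∀ (z₀ : E) (R : ℝ), 0 < R →
    ∀ (P : E → E → Prop) (K : ℝ≥0), (Measurable fun u : E × E => ind (P u.1 u.2)) →
    (∀ z, ∫⁻ v, ind (P z v) * edist z v ^ e ≤ K * ofReal R ^ (e + n)) →
      ∫⁻ z in ball z₀ R, ∫⁻ v, ind (P z v) * (edist (h z) (h v) * edist z v ^ (-(n + t) : ℝ))
        ≤ C * K ^ (1 - s / n) * gagliardoEnergy univ (n / s) h ^ (s / n) *
          ofReal R ^ (n - t) := by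
  have hn : (1 : ℝ) ≤ n := mod_cast NeZero.one_le
  have hn0 : (n : ℝ) ≠ 0 := by positivity
  have hp : 1 ≤ (n : ℝ) / s := by rw [le_div_iff₀ hs0]; linarith
  have hθ : s / n ≤ 1 := by rw [div_le_one (by linarith)]; linarith
  have hθ0 : 0 ≤ s / n := by positivity
  obtain ⟨C₁, hC₁⟩ := lintegral_trace_le (n := n) (F := F) hp hκ0 hκn
  obtain ⟨b, hb⟩ : ∃ b : ℝ≥0, (b : ℝ≥0∞) = volume (ball (0 : E) 1) :=
    ⟨_, coe_toNNReal measure_ball_lt_top.ne⟩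
  refine ⟨b ^ (1 - s / n) * (C₁ * b) ^ (s / n), fun h hh z₀ R hR P K hP hK => ?_⟩
  have hdh := measurable_edist_comp hh
  have hvol : volume (ball z₀ R) = b * ofReal R ^ (n : ℝ) := by
    rw [hb, EuclideanSpace.volume_ball, EuclideanSpace.volume_ball, rpow_natCast]
    simp [mul_comm]
  have hR0 : ofReal R ≠ 0 := by simpa using hR
  have hol := lintegral_three_holder (volume.restrict (ball z₀ R)) volume
    (Measure.dirac ()) (θ := 1 - s / n) (by linarith) (by linarith)
    (J := fun z v _ => ind (P z v) * (edist (h z) (h v) * edist z v ^ (-(n + t) : ℝ)))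
    (U := fun z v _ => ind (P z v) * edist z v ^ e)
    (V := fun z v _ => edist (h z) (h v) ^ ((n : ℝ) / s) * edist z v ^ (κ - 2 * n))
    ((hP.comp (measurable_fst.prodMk (measurable_fst.comp measurable_snd))).mul (by fun_prop))
    (((hdh.comp (measurable_fst.prodMk (measurable_fst.comp measurable_snd))).pow_const _).mul
      (by fun_prop)) (fun z => by
      filter_upwards [Measure.ae_ne volume z] with v hv
      refine Eventually.of_forall fun _ => ?_
      refine ind_mul_le_of_imp fun hPv => ?_
      have h0 := (edist_pos.2 hv.symm).ne'
      have htop := edist_ne_top z v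
      rw [ind_of_true hPv, one_mul, sub_sub_cancel, mul_rpow_of_nonneg _ _ hθ0,
        ← rpow_mul, ← rpow_mul, ← rpow_mul, mul_left_comm,
        ← rpow_add _ _ h0 htop, show (n : ℝ) / s * (s / n) = 1 by field_simp,
        rpow_one, he]
      refine le_of_eq ?_
      congr 2
      field_simp
      ring)
  simp only [lintegral_dirac] at hol
  refine hol.trans ?_
  have hU : ∫⁻ z in ball z₀ R, ∫⁻ v, ind (P z v) * edist z v ^ e ≤
      b * K * ofReal R ^ (e + 2 * n) := by
    calc _ ≤ ∫⁻ z in ball z₀ R, K * ofReal R ^ (e + n) := lintegral_mono hK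
      _ = K * ofReal R ^ (e + n) * (b * ofReal R ^ (n : ℝ)) := by
          rw [setLIntegral_const, hvol]
      _ = b * K * (ofReal R ^ (e + n) * ofReal R ^ (n : ℝ)) := by ring
      _ = _ := by
          rw [← rpow_add _ _ hR0 ofReal_ne_top]
          congr 2; ring
  have hV : ∫⁻ z in ball z₀ R, ∫⁻ v, edist (h z) (h v) ^ ((n : ℝ) / s) *
      edist z v ^ (κ - 2 * n) ≤ C₁ * b * ofReal R ^ κ * gagliardoEnergy univ (n / s) h := by
    obtain ⟨ψ, hψ⟩ : ∃ ψ, ψ = (ball z₀ R).indicator fun _ => (1 : ℝ≥0∞) := ⟨_, rfl⟩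
    have hψm : Measurable ψ := by
      rw [hψ]; exact measurable_const.indicator isOpen_ball.measurableSet
    have hg := growthBound_indicator_ball hκ0.le hκn.le z₀ R
    rw [← hψ] at hg
    have hm : Measurable fun u : E × E => edist (h u.1) (h u.2) ^ ((n : ℝ) / s) *
        edist u.1 u.2 ^ (κ - 2 * n) * ψ u.1 :=
      ((hdh.pow_const _).mul (by fun_prop)).mul (hψm.comp measurable_fst)
    calc _ = ∫⁻ z, ∫⁻ v, edist (h z) (h v) ^ ((n : ℝ) / s) * edist z v ^ (κ - 2 * n) * ψ z := by
          rw [← lintegral_indicator isOpen_ball.measurableSet]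
          refine lintegral_congr fun z => ?_
          by_cases hz : z ∈ ball z₀ R
          · simp [hψ, hz]
          · simp [hψ, hz]
      _ ≤ _ := by
          refine lintegral_lintegral_le_of_balls hm fun ρ hρ => ?_
          refine (hC₁ h hh ψ _ hψm hg 0 ρ).trans ?_
          rw [← hb]
          calc _ = C₁ * b * ofReal R ^ κ * gagliardoEnergy (ball 0 ρ) (n / s) h := by
                ring
            _ ≤ _ := by gcongr; exact gagliardoEnergy_mono (subset_univ _) _ _
  rw [sub_sub_cancel]
  refine (mul_le_mul' (rpow_le_rpow hU (by linarith))
    (rpow_le_rpow hV hθ0)).trans (le_of_eq ?_)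
  have h1θ : 0 ≤ 1 - s / n := by linarith
  rw [mul_rpow_of_nonneg _ _ h1θ, mul_rpow_of_nonneg _ _ h1θ,
    mul_rpow_of_nonneg _ _ hθ0, mul_rpow_of_nonneg _ _ hθ0, ← rpow_mul,
    ← rpow_mul, coe_mul, coe_rpow_of_nonneg _ h1θ,
    coe_rpow_of_nonneg _ hθ0, coe_mul]
  have hexp : ofReal R ^ ((e + 2 * n) * (1 - s / n)) * ofReal R ^ (κ * (s / n)) =
      ofReal R ^ (n - t) := by
    rw [← rpow_add _ _ hR0 ofReal_ne_top, add_mul, he]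
    congr 1; field_simp; ring
  rw [← hexp]
  ring

lemma lintegral_lintegral_le_near_add_far {J : E → E → ℝ≥0∞}
    (hJ : Measurable fun u : E × E => J u.1 u.2) (B : Set E) (R : ℝ≥0∞) :
    ∫⁻ z in B, ∫⁻ v, J z v ≤ (∫⁻ z in B, ∫⁻ v, ind (edist z v ≤ R) * J z v) +
      ∫⁻ z in B, ∫⁻ v, ind (R ≤ edist z v) * J z v := by
  have hm : Measurable fun u : E × E => ind (edist u.1 u.2 ≤ R) * J u.1 u.2 :=
    (measurable_ind_le (by fun_prop) measurable_const).mul hJ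
  have hJz : ∀ z, Measurable fun v => J z v := fun z => hJ.comp measurable_prodMk_left
  have hmz : ∀ z, Measurable fun v => ind (edist z v ≤ R) * J z v := fun z =>
    (measurable_ind_le (by fun_prop) measurable_const).mul (hJz z)
  have hmi : Measurable fun z => ∫⁻ v, ind (edist z v ≤ R) * J z v := hm.lintegral_prod_right'
  rw [← lintegral_add_left hmi]
  refine lintegral_mono fun z => ?_
  rw [← lintegral_add_left (hmz z)]
  refine lintegral_mono fun v => ?_
  rcases le_total (edist z v) R with hle | hle
  · simp only [ind_of_true hle, one_mul]; exact le_self_add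
  · simp only [ind_of_true hle, one_mul]; exact le_add_self

/-- The majorant of `(-Δ)^{t/2} h` satisfies the same growth bound as a function in `L^{n/t}`. -/
lemma growthBound_incrementIntegral [NeZero n] {s t : ℝ} (hs0 : 0 < s) (hs1 : s < 1) (ht0 : 0 < t)
    (hts : t < s) : ∃ C : ℝ≥0, ∀ h : E → F, StronglyMeasurable h →
      GrowthBound (incrementIntegral t h) (C * gagliardoEnergy univ (n / s) h ^ (s / n)) (n - t) := by
  have hn : (1 : ℝ) ≤ n := mod_cast NeZero.one_le
  have hn0 : (0 : ℝ) < n := by positivity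
  have hsn : s / n < 1 := by rw [div_lt_one hn0]; linarith
  have hθ : 0 < 1 - s / n := by linarith
  obtain ⟨κ₁, hκ₁⟩ : ∃ κ₁, κ₁ = n * (s - t) / (2 * s) := ⟨_, rfl⟩
  obtain ⟨κ₂, hκ₂⟩ : ∃ κ₂, κ₂ = n * (1 - t / (2 * s)) := ⟨_, rfl⟩
  have hκ₁' : κ₁ * (s / n) = (s - t) / 2 := by rw [hκ₁]; field_simp
  have hκ₂' : κ₂ * (s / n) = s - t / 2 := by rw [hκ₂]; field_simp
  have hsn0 : 0 < s / n := by positivity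
  have h1 : 0 < κ₁ := by rw [hκ₁]; have := sub_pos.2 hts; positivity
  have h1' : κ₁ < n := by
    have : κ₁ * (s / n) < n * (s / n) := by rw [hκ₁']; field_simp; linarith
    exact lt_of_mul_lt_mul_right this hsn0.le
  have h2 : 0 < κ₂ := by
    have : 0 * (s / n) < κ₂ * (s / n) := by rw [hκ₂']; linarith
    exact lt_of_mul_lt_mul_right this hsn0.le
  have h2' : κ₂ < n := by
    have : κ₂ * (s / n) < n * (s / n) := by rw [hκ₂']; field_simp; linarith
    exact lt_of_mul_lt_mul_right this hsn0.le
  obtain ⟨e₁, he₁⟩ : ∃ e₁, e₁ = (-(n + t) + 2 * s - κ₁ * (s / n)) / (1 - s / n) := ⟨_, rfl⟩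
  obtain ⟨e₂, he₂⟩ : ∃ e₂, e₂ = (-(n + t) + 2 * s - κ₂ * (s / n)) / (1 - s / n) := ⟨_, rfl⟩
  have he₁' : e₁ * (1 - s / n) = -(n + t) + 2 * s - κ₁ * (s / n) := by
    rw [he₁, div_mul_cancel₀ _ hθ.ne']
  have he₂' : e₂ * (1 - s / n) = -(n + t) + 2 * s - κ₂ * (s / n) := by
    rw [he₂, div_mul_cancel₀ _ hθ.ne']
  have hnθ : (n : ℝ) * (1 - s / n) = n - s := by field_simp
  have h3 : 0 < e₁ + n := by
    have : 0 * (1 - s / n) < (e₁ + n) * (1 - s / n) := by rw [add_mul, he₁', hκ₁', hnθ]; linarith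
    exact lt_of_mul_lt_mul_right this hθ.le
  have h4 : e₂ + n < 0 := by
    have : (e₂ + n) * (1 - s / n) < 0 * (1 - s / n) := by rw [add_mul, he₂', hκ₂', hnθ]; linarith
    exact lt_of_mul_lt_mul_right this hθ.le
  obtain ⟨C₁, hC₁⟩ := lintegral_ind_increment_le (n := n) (F := F) hs0 hs1 h1 h1' he₁'
  obtain ⟨C₂, hC₂⟩ := lintegral_ind_increment_le (n := n) (F := F) hs0 hs1 h2 h2' he₂'
  obtain ⟨K₁, hK₁⟩ := lintegral_ind_near_le_volume (n := n) h3
  obtain ⟨K₂, hK₂⟩ := lintegral_ind_far_le_volume (n := n) h4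
  refine ⟨C₁ * K₁ ^ (1 - s / n) + C₂ * K₂ ^ (1 - s / n), fun h hh z₀ R hR => ?_⟩
  have hR0 : ofReal R ≠ 0 := by simpa using hR
  have hdh := measurable_edist_comp hh
  have hm1 : Measurable fun u : E × E => ind (edist u.1 u.2 ≤ ofReal R) :=
    measurable_ind_le (by fun_prop) measurable_const
  have hm2 : Measurable fun u : E × E => ind (ofReal R ≤ edist u.1 u.2) :=
    measurable_ind_le measurable_const (by fun_prop)
  have hn1 := hC₁ h hh z₀ R hR _ K₁ hm1 (fun z => hK₁ z _ hR0 ofReal_ne_top)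
  have hn2 := hC₂ h hh z₀ R hR _ K₂ hm2 (fun z => hK₂ z _ hR0 ofReal_ne_top)
  refine (lintegral_lintegral_le_near_add_far (hdh.mul (by fun_prop)) _ _).trans
    ((add_le_add hn1 hn2).trans (le_of_eq ?_))
  rw [coe_add, coe_mul, coe_mul,
    coe_rpow_of_nonneg _ hθ.le, coe_rpow_of_nonneg _ hθ.le]
  ring

lemma ae_lt_top_of_lintegral_ball_ne_top {φ : E → ℝ≥0∞} (hφ : Measurable φ)
    (h : ∀ k : ℕ, ∫⁻ x in ball (0 : E) (k + 1), φ x ≠ ∞) : ∀ᵐ x, φ x < ∞ := by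
  have hk : ∀ᵐ x, ∀ k : ℕ, x ∈ ball (0 : E) (k + 1) → φ x < ∞ := by
    rw [ae_all_iff]
    intro k
    exact (ae_restrict_iff' isOpen_ball.measurableSet).1 (ae_lt_top hφ (h k))
  filter_upwards [hk] with x hx
  obtain ⟨k, hk⟩ := exists_nat_gt ‖x‖
  refine hx k ?_
  rw [mem_ball_zero_iff]
  linarith

/-- The points at which the increments of `h` are represented by a Riesz potential of its
fractional Laplacian. -/
def RieszRegular (t : ℝ) (h : E → F) (x : E) : Prop :=
  incrementIntegral t h x < ∞ ∧ ∀ k : ℕ,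
    ∫⁻ z in ball 0 (k + 1), edist x z ^ (t - n) * incrementIntegral t h z < ∞

lemma ae_rieszRegular [NeZero n] {t : ℝ} (ht0 : 0 < t) (htn : t < n) {h : E → F}
    (hh : StronglyMeasurable h) {A : ℝ≥0∞} (hA : A ≠ ∞)
    (hg : GrowthBound (incrementIntegral t h) A (n - t)) : ∀ᵐ x, RieszRegular t h x := by
  have hm := measurable_incrementIntegral (t := t) hh
  have hball : ∀ k : ℕ, ∫⁻ z in ball (0 : E) (k + 1), incrementIntegral t h z ≠ ∞ := fun k =>
    ne_top_of_le_ne_top (mul_ne_top hA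
      (rpow_ne_top_of_nonneg (by linarith) ofReal_ne_top)) (hg 0 (k + 1) (by positivity))
  have h1 : ∀ᵐ x, incrementIntegral t h x < ∞ := ae_lt_top_of_lintegral_ball_ne_top hm hball
  have h2 : ∀ᵐ x, ∀ k : ℕ,
      ∫⁻ z in ball 0 (k + 1), edist x z ^ (t - n) * incrementIntegral t h z < ∞ := by
    rw [ae_all_iff]
    intro k
    have hmJ : Measurable fun u : E × E => edist u.1 u.2 ^ (t - n) * incrementIntegral t h u.2 :=
      (by fun_prop : Measurable fun u : E × E => edist u.1 u.2 ^ (t - n)).mul (hm.comp measurable_snd)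
    refine ae_lt_top_of_lintegral_ball_ne_top hmJ.lintegral_prod_right' fun m => ?_
    obtain ⟨C, hC⟩ := setLIntegral_ball_edist_rpow_le_max (n := n) (a := t - n) (by linarith)
      (by linarith)
    have hm0 : ofReal ((m : ℝ) + 1) ≠ 0 := by simp; positivity
    have hsw : ∫⁻ x in ball (0 : E) (m + 1), ∫⁻ z in ball (0 : E) (k + 1),
        edist x z ^ (t - n) * incrementIntegral t h z =
        ∫⁻ z in ball (0 : E) (k + 1), ∫⁻ x in ball (0 : E) (m + 1),
        edist x z ^ (t - n) * incrementIntegral t h z := lintegral_lintegral_swap hmJ.aemeasurable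
    rw [hsw]
    refine ne_top_of_le_ne_top (mul_ne_top (a := C * ofReal ((m : ℝ) + 1) ^ (n : ℝ) *
      ofReal ((m : ℝ) + 1) ^ (t - n)) ?_ (hball k)) ?_
    · refine mul_ne_top (mul_ne_top coe_ne_top
        (rpow_ne_top_of_nonneg (by positivity) ofReal_ne_top)) ?_
      exact rpow_ne_top_of_ne_zero hm0 ofReal_ne_top
    · rw [← lintegral_const_mul _ hm]
      refine lintegral_mono fun z => ?_
      rw [lintegral_mul_const _ (by fun_prop)]
      refine mul_le_mul_left ((hC 0 z (m + 1) (by positivity)).trans ?_) _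
      refine mul_le_mul_right ?_ _
      exact ennreal_rpow_anti (by linarith) (le_max_left _ _)
  filter_upwards [h1, h2] with x hx1 hx2 using ⟨hx1, hx2⟩

lemma rieszDiff_le_add (t : ℝ) {x y z : E} (hxz : x ≠ z) (hyz : y ≠ z) :
    rieszDiff t x y z ≤ edist x z ^ (t - n) + edist y z ^ (t - n) := by
  unfold rieszDiff
  rw [← dist_eq_norm, ← dist_eq_norm, ← ofReal_dist_rpow hxz, ← ofReal_dist_rpow hyz,
    ← ofReal_add (by positivity) (by positivity)]
  refine ofReal_le_ofReal ?_
  have h1 : 0 ≤ dist x z ^ (t - n) := by positivity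
  have h2 : 0 ≤ dist y z ^ (t - n) := by positivity
  rw [abs_le]; constructor <;> linarith

lemma RieszRegular.lintegral_rieszDiff_lt_top [NeZero n] {t : ℝ} (htn : t < n) {h : E → F}
    (hh : StronglyMeasurable h) {A : ℝ≥0∞} (hA : A ≠ ∞)
    (hg : GrowthBound (incrementIntegral t h) A (n - t)) {x y : E} (hxy : x ≠ y)
    (hx : RieszRegular t h x) (hy : RieszRegular t h y) :
    ∫⁻ z, rieszDiff t x y z * incrementIntegral t h z < ∞ := by
  have hm := measurable_incrementIntegral (t := t) hh
  obtain ⟨r, hr⟩ : ∃ r, r = dist x y := ⟨_, rfl⟩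
  have hr0 : 0 < r := by rw [hr]; exact dist_pos.2 hxy
  obtain ⟨k, hk⟩ := exists_nat_gt (‖x‖ + ‖y‖ + r)
  have hne : ∀ᵐ z : E, z ≠ x ∧ z ≠ y := (Measure.ae_ne volume x).and (Measure.ae_ne volume y)
  have hsub : ∀ w : E, ‖w‖ ≤ ‖x‖ + ‖y‖ → (ball (0 : E) (k + 1))ᶜ ⊆ (ball w r)ᶜ := by
    intro w hw
    refine compl_subset_compl.2 fun z hz => ?_
    rw [mem_ball_zero_iff]
    rw [mem_ball, dist_eq_norm] at hz
    have := norm_sub_norm_le z w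
    linarith
  obtain ⟨C, hC⟩ := lintegral_compl_ball_edist_rpow_le (n := n) (a := t - n - 1) (e := n - t)
    (by linarith)
  have hfar : ∀ w : E, ‖w‖ ≤ ‖x‖ + ‖y‖ → ∫⁻ z in (ball (0 : E) (k + 1))ᶜ,
      edist w z ^ (t - n - 1) * incrementIntegral t h z < ∞ := by
    intro w hw
    refine lt_of_le_of_lt ((lintegral_mono_set (hsub w hw)).trans (hC _ A hg w r hr0)) ?_
    refine mul_lt_top (mul_lt_top ENNReal.coe_lt_top hA.lt_top) ?_
    refine (rpow_ne_top_of_ne_zero ?_ ofReal_ne_top).lt_top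
    simpa using hr0
  have hmw : ∀ (w : E) (a : ℝ), Measurable fun z => edist w z ^ a * incrementIntegral t h z :=
    fun w a => (by fun_prop : Measurable fun z : E => edist w z ^ a).mul hm
  rw [← lintegral_add_compl _ (isOpen_ball (x := (0 : E)) (ε := (k : ℝ) + 1)).measurableSet]
  refine ENNReal.add_lt_top.2 ⟨?_, ?_⟩
  · refine lt_of_le_of_lt ?_ (ENNReal.add_lt_top.2 ⟨hx.2 k, hy.2 k⟩)
    rw [← lintegral_add_left (hmw x _)]
    refine lintegral_mono_ae (ae_restrict_of_ae ?_)
    filter_upwards [hne] with z hz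
    rw [← add_mul]
    exact mul_le_mul_left (rieszDiff_le_add t hz.1.symm hz.2.symm) _
  · have hfin := ENNReal.add_lt_top.2 ⟨hfar x (by linarith [norm_nonneg y]),
      hfar y (by linarith [norm_nonneg x])⟩
    refine lt_of_le_of_lt ?_ (mul_lt_top (a := ofReal (max 1 (n - t)) *
      edist x y ^ (1 : ℝ)) ?_ hfin)
    · rw [← lintegral_add_left (hmw x _), ← lintegral_const_mul' _ _ (mul_ne_top
        ofReal_ne_top (by rw [rpow_one]; exact edist_ne_top x y))]
      refine lintegral_mono_ae (ae_restrict_of_ae ?_)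
      filter_upwards [hne] with z hz
      calc _ ≤ ofReal (max 1 (n - t)) * (edist x y ^ (1 : ℝ) *
            (edist x z ^ (t - n - 1) + edist y z ^ (t - n - 1))) * incrementIntegral t h z :=
            mul_le_mul_left (rieszDiff_le htn.le zero_le_one le_rfl hz.1.symm hz.2.symm) _
        _ = _ := by ring
    · exact mul_lt_top ENNReal.ofReal_lt_top (by
        rw [rpow_one]; exact edist_lt_top x y)

lemma RieszRegular.heatRegular {t : ℝ} (ht0 : 0 < t) (ht1 : t < 1) {h : E → F}
    (hh : StronglyMeasurable h) {x : E} (hx : RieszRegular t h x) : HeatRegular h x := by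
  refine ⟨((measurable_heatWeight.comp (by fun_prop)).aestronglyMeasurable.mul
    (hh.sub stronglyMeasurable_const).norm.aestronglyMeasurable), ?_⟩
  refine lt_of_le_of_lt (lintegral_mono fun v => ?_) hx.1
  rcases eq_or_ne x v with rfl | hv
  · simp
  rw [enorm_mul, enorm_norm, ← edist_eq_enorm_sub, edist_comm, mul_comm]
  refine mul_le_mul_right ?_ _
  have hd := dist_pos.2 hv
  rw [← ofReal_dist_rpow hv, Real.enorm_of_nonneg (heatWeight_nonneg _)]
  refine ofReal_le_ofReal ?_
  unfold heatWeight
  rw [← dist_eq_norm]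
  rcases le_total (dist x v) 1 with h1 | h1
  · refine (min_le_left _ _).trans ?_
    exact Real.rpow_le_rpow_of_exponent_ge hd h1 (by linarith)
  · refine (min_le_right _ _).trans ?_
    exact Real.rpow_le_rpow_of_exponent_le h1 (by linarith)

variable [NormedSpace ℝ F]

lemma enorm_fracLaplacian_le (t : ℝ) (h : E → F) (z : E) :
    ‖fracLaplacian t h z‖ₑ ≤ ‖(2 : ℝ) ^ t * Real.Gamma (((n : ℝ) + t) / 2) /
      (Real.pi ^ ((n : ℝ) / 2) * Real.Gamma (-t / 2))‖ₑ * incrementIntegral t h z := by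
  unfold fracLaplacian
  rw [enorm_smul]
  refine mul_le_mul_right ((enorm_integral_le_lintegral_enorm _).trans (lintegral_mono fun v => ?_)) _
  rcases eq_or_ne z v with rfl | hv
  · simp
  rw [enorm_smul, ← edist_eq_enorm_sub, edist_comm, mul_comm, ← ofReal_dist_rpow hv,
    Real.enorm_of_nonneg (by positivity), Real.rpow_neg dist_nonneg, dist_eq_norm z v]

lemma stronglyMeasurable_fracLaplacian {t : ℝ} {h : E → F} (hh : StronglyMeasurable h) :
    StronglyMeasurable (fracLaplacian t h) := by
  refine StronglyMeasurable.fun_const_smul (StronglyMeasurable.integral_prod_right'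
    (f := fun u : E × E => (‖u.1 - u.2‖ ^ ((n : ℝ) + t))⁻¹ • (h u.2 - h u.1)) ?_) _
  exact StronglyMeasurable.smul (Measurable.stronglyMeasurable (by fun_prop))
    ((hh.comp_measurable measurable_snd).sub (hh.comp_measurable measurable_fst))

lemma integrable_rieszDiff_smul_increment {t : ℝ} {h : E → F}
    (hh : StronglyMeasurable h) {x y : E}
    (hfin : ∫⁻ z, rieszDiff t x y z * incrementIntegral t h z < ∞) :
    Integrable (fun w : E × E => ((‖x - w.1‖ ^ (t - (n : ℝ)) - ‖y - w.1‖ ^ (t - (n : ℝ))) *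
      (‖w.1 - w.2‖ ^ ((n : ℝ) + t))⁻¹) • (h w.2 - h w.1)) (volume.prod volume) := by
  have hm : StronglyMeasurable fun w : E × E =>
      ((‖x - w.1‖ ^ (t - (n : ℝ)) - ‖y - w.1‖ ^ (t - (n : ℝ))) *
      (‖w.1 - w.2‖ ^ ((n : ℝ) + t))⁻¹) • (h w.2 - h w.1) :=
    StronglyMeasurable.smul (Measurable.stronglyMeasurable (by fun_prop))
      ((hh.comp_measurable measurable_snd).sub (hh.comp_measurable measurable_fst))
  refine ⟨hm.aestronglyMeasurable, ?_⟩
  unfold HasFiniteIntegral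
  rw [lintegral_prod _ hm.enorm.aemeasurable]
  refine lt_of_le_of_lt (lintegral_mono fun z => ?_) hfin
  have hd := measurable_edist_comp hh
  have hdz : Measurable fun v => edist (h z) (h v) * edist z v ^ (-(n + t) : ℝ) :=
    (hd.comp measurable_prodMk_left).mul (by fun_prop)
  unfold incrementIntegral
  rw [← lintegral_const_mul _ hdz]
  refine lintegral_mono fun v => ?_
  rcases eq_or_ne z v with rfl | hv
  · simp
  simp only
  rw [enorm_smul, enorm_mul, ← edist_eq_enorm_sub (h v), edist_comm (h v), ← ofReal_dist_rpow hv,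
    Real.enorm_of_nonneg (r := (‖z - v‖ ^ ((n : ℝ) + t))⁻¹) (by positivity),
    Real.rpow_neg dist_nonneg, dist_eq_norm z v, Real.enorm_eq_ofReal_abs]
  unfold rieszDiff
  refine le_of_eq ?_
  ring

lemma integrable_sub_smul_fracLaplacian {t : ℝ} {h : E → F}
    (hh : StronglyMeasurable h) {x y : E}
    (hfin : ∫⁻ z, rieszDiff t x y z * incrementIntegral t h z < ∞) :
    Integrable fun z => (‖x - z‖ ^ (t - (n : ℝ)) - ‖y - z‖ ^ (t - (n : ℝ))) • fracLaplacian t h z := by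
  have h1 := ((integrable_rieszDiff_smul_increment hh hfin).integral_prod_left).smul
    ((2 : ℝ) ^ t * Real.Gamma (((n : ℝ) + t) / 2) /
      (Real.pi ^ ((n : ℝ) / 2) * Real.Gamma (-t / 2)))
  refine h1.congr (Eventually.of_forall fun z => ?_)
  simp only [Pi.smul_apply, fracLaplacian]
  simp_rw [mul_smul]
  rw [integral_smul, smul_comm]

end IncrementIntegral

/-! ### Pointwise estimate of the second commutator -/

lemma Measurable.rieszDiff {α : Type*} [MeasurableSpace α] {a b c : α → E} (ha : Measurable a)
    (hb : Measurable b) (hc : Measurable c) (t : ℝ) :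
    Measurable fun u => rieszDiff t (a u) (b u) (c u) := by
  unfold _root_.rieszDiff; fun_prop

section Identity

variable [NormedSpace ℝ F] [CompleteSpace F]

/-- The increments of `h` are those of the Riesz potential of `(-Δ)^{t/2} h`. -/
lemma RieszRegular.sub_eq [NeZero n] {t : ℝ} (ht0 : 0 < t) (ht1 : t < 1) {h : E → F}
    (hh : StronglyMeasurable h) {x y : E} (hxy : x ≠ y) (hx : RieszRegular t h x)
    (hy : RieszRegular t h y) (hfin : ∫⁻ z, rieszDiff t x y z * incrementIntegral t h z < ∞) :
    h x - h y = (Real.Gamma (((n : ℝ) - t) / 2) /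
      ((2 : ℝ) ^ t * Real.pi ^ ((n : ℝ) / 2) * Real.Gamma (t / 2))) •
      ∫ z, (‖x - z‖ ^ (t - (n : ℝ)) - ‖y - z‖ ^ (t - (n : ℝ))) • fracLaplacian t h z :=
  sub_eq_integral_smul_fracLaplacian ht0 ht1 hh hxy (hx.heatRegular ht0 ht1 hh)
    (hy.heatRegular ht0 ht1 hh) (integrable_rieszDiff_smul_increment hh hfin)

/-- The increments of `g` are controlled pointwise by a Riesz potential of `(-Δ)^{t/2} g`. -/
lemma exists_edist_le_potential [NeZero n] {t t' : ℝ} (ht0 : 0 < t) (ht1 : t < 1) (ht'0 : 0 ≤ t')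
    (ht'1 : t' ≤ 1) : ∃ C : ℝ≥0, ∀ g : E → F, StronglyMeasurable g → ∀ x z : E, x ≠ z →
      RieszRegular t g x → RieszRegular t g z →
      ∫⁻ w, rieszDiff t x z w * incrementIntegral t g w < ∞ →
      edist (g x) (g z) ≤ C * (edist x z ^ t' *
        (potential (t - t') (fun w => ‖fracLaplacian t g w‖ₑ) x +
          potential (t - t') (fun w => ‖fracLaplacian t g w‖ₑ) z)) := by
  have hn : (1 : ℝ) ≤ n := mod_cast NeZero.one_le
  obtain ⟨c, hc⟩ : ∃ c, c = Real.Gamma (((n : ℝ) - t) / 2) /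
      ((2 : ℝ) ^ t * Real.pi ^ ((n : ℝ) / 2) * Real.Gamma (t / 2)) := ⟨_, rfl⟩
  refine ⟨‖c‖₊ * (max 1 (n - t)).toNNReal,
    fun g hg x z hxz hx hz hfin => ?_⟩
  have hm : Measurable fun w => ‖fracLaplacian t g w‖ₑ :=
    (stronglyMeasurable_fracLaplacian hg).enorm
  have hmx : ∀ u : E, Measurable fun w => edist u w ^ (t - t' - n) * ‖fracLaplacian t g w‖ₑ :=
    fun u => Measurable.mul (by fun_prop) hm
  rw [edist_eq_enorm_sub, hx.sub_eq ht0 ht1 hg hxz hz hfin, ← hc, enorm_smul, coe_mul, mul_assoc]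
  refine mul_le_mul_right ?_ _
  refine (enorm_integral_le_lintegral_enorm _).trans ?_
  unfold potential
  rw [← lintegral_add_left (hmx x), ← lintegral_const_mul' _ _ (rpow_ne_top_of_nonneg ht'0
    (edist_ne_top x z)), ← lintegral_const_mul' _ _ coe_ne_top]
  refine lintegral_mono_ae ?_
  filter_upwards [Measure.ae_ne volume x, Measure.ae_ne volume z] with w hwx hwz
  have h := rieszDiff_le (t := t) (by linarith) ht'0 ht'1 hwx.symm hwz.symm
  rw [enorm_smul, Real.enorm_eq_ofReal_abs]
  unfold rieszDiff at h
  refine (mul_le_mul_left h _).trans (le_of_eq ?_)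
  rw [show t - t' - n = t - n - t' by ring]
  unfold ofReal
  ring

lemma exists_enorm_commTheta_le [NeZero n] {t : ℝ} (ht0 : 0 < t) (ht1 : t < 1) : ∃ C : ℝ≥0,
    ∀ (g : E → ℝ) (h : E → F), StronglyMeasurable h → ∀ x y : E, x ≠ y →
      RieszRegular t h x → RieszRegular t h y →
      ∫⁻ z, rieszDiff t x y z * incrementIntegral t h z < ∞ →
      Integrable (fun z => ‖x - z‖ ^ (t - (n : ℝ)) • (g z • fracLaplacian t h z)) →
      Integrable (fun z => ‖y - z‖ ^ (t - (n : ℝ)) • (g z • fracLaplacian t h z)) →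
      ‖commTheta t g h x y‖ₑ ≤ C * ∫⁻ z, rieszDiff t x y z *
        ((edist (g x) (g z) + edist (g y) (g z)) * incrementIntegral t h z) := by
  obtain ⟨c, hc⟩ : ∃ c, c = Real.Gamma (((n : ℝ) - t) / 2) /
      ((2 : ℝ) ^ t * Real.pi ^ ((n : ℝ) / 2) * Real.Gamma (t / 2)) := ⟨_, rfl⟩
  obtain ⟨c', hc'⟩ : ∃ c', c' = (2 : ℝ) ^ t * Real.Gamma (((n : ℝ) + t) / 2) /
      (Real.pi ^ ((n : ℝ) / 2) * Real.Gamma (-t / 2)) := ⟨_, rfl⟩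
  refine ⟨‖c‖₊ * ‖c'‖₊, fun g h hh x y hxy hx hy hfin hix hiy => ?_⟩
  have hi := integrable_sub_smul_fracLaplacian hh hfin
  have hid := hx.sub_eq ht0 ht1 hh hxy hy hfin
  have e : commTheta t g h x y = c • ∫ z, (‖x - z‖ ^ (t - (n : ℝ)) - ‖y - z‖ ^ (t - (n : ℝ))) •
      ((g z - 1 / 2 * (g x + g y)) • fracLaplacian t h z) := by
    have e1 : ∀ z, (‖x - z‖ ^ (t - (n : ℝ)) - ‖y - z‖ ^ (t - (n : ℝ))) •
        ((g z - 1 / 2 * (g x + g y)) • fracLaplacian t h z) =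
        ‖x - z‖ ^ (t - (n : ℝ)) • (g z • fracLaplacian t h z) -
        ‖y - z‖ ^ (t - (n : ℝ)) • (g z • fracLaplacian t h z) -
        (1 / 2 * (g x + g y)) • ((‖x - z‖ ^ (t - (n : ℝ)) - ‖y - z‖ ^ (t - (n : ℝ))) •
          fracLaplacian t h z) := fun z => by module
    simp_rw [e1]
    have hixy : Integrable fun z => ‖x - z‖ ^ (t - (n : ℝ)) • (g z • fracLaplacian t h z) -
        ‖y - z‖ ^ (t - (n : ℝ)) • (g z • fracLaplacian t h z) := hix.sub hiy
    rw [integral_sub hixy (hi.fun_smul _), integral_sub hix hiy, integral_smul, smul_sub,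
      smul_sub, smul_comm c, hc, ← hid]
    rfl
  rw [e, enorm_smul, coe_mul, mul_assoc]
  refine mul_le_mul_right ((enorm_integral_le_lintegral_enorm _).trans ?_) _
  rw [← lintegral_const_mul' _ _ coe_ne_top]
  refine lintegral_mono fun z => ?_
  have hb := enorm_fracLaplacian_le t h z
  rw [← hc'] at hb
  have hg : ‖g z - 1 / 2 * (g x + g y)‖ₑ ≤ edist (g x) (g z) + edist (g y) (g z) := by
    rw [edist_dist, edist_dist, ← ofReal_add dist_nonneg dist_nonneg,
      Real.enorm_eq_ofReal_abs, Real.dist_eq, Real.dist_eq]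
    refine ofReal_le_ofReal ?_
    rw [show g z - 1 / 2 * (g x + g y) = -(1 / 2) * ((g x - g z) + (g y - g z)) by ring, abs_mul]
    have h1 := abs_add_le (g x - g z) (g y - g z)
    have h2 := abs_nonneg ((g x - g z) + (g y - g z))
    norm_num
    linarith
  rw [enorm_smul, enorm_smul, Real.enorm_eq_ofReal_abs]
  calc _ ≤ rieszDiff t x y z * ((edist (g x) (g z) + edist (g y) (g z)) *
      (‖c'‖ₑ * incrementIntegral t h z)) := by
        unfold rieszDiff
        exact mul_le_mul_right (mul_le_mul' hg hb) _
    _ = _ := by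
        rw [← enorm_eq_nnnorm]
        ring

end Identity

/-- The quadrilinear form which controls the second commutator: `V` stands for the Riesz potential
of `(-Δ)^{t/2} g` which bounds the increments of `g`, and `w = (z, v)` carries the increment of
`h` in the integral that defines `(-Δ)^{t/2} h (z)`. -/
noncomputable def quadrilinear (s t t' : ℝ) (f : E → F) (h : E → G) (V : E → ℝ≥0∞)
    (x y : E) (w : E × E) : ℝ≥0∞ :=
  edist (f x) (f y) ^ ((n : ℝ) / s - 1) * edist (h w.1) (h w.2) *
    (edist x y ^ (-(2 * n) : ℝ) * (rieszDiff t x y w.1 * (edist x w.1 ^ t' *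
      ((V x + V w.1) * edist w.1 w.2 ^ (-(n + t) : ℝ)))))

lemma measurable_quadrilinear {s t t' : ℝ} {f : E → F} {h : E → G} (hf : StronglyMeasurable f)
    (hh : StronglyMeasurable h) {V : E → ℝ≥0∞} (hV : Measurable V) :
    Measurable fun u : E × E × (E × E) => quadrilinear s t t' f h V u.1 u.2.1 u.2.2 := by
  unfold quadrilinear
  refine Measurable.mul (Measurable.mul (Measurable.pow_const ?_ _) ?_) (Measurable.mul
    (by fun_prop) (Measurable.mul ?_ (Measurable.mul (by fun_prop) (Measurable.mul
      (Measurable.add ?_ ?_) (by fun_prop)))))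
  · exact measurable_edist_map hf (by fun_prop) (by fun_prop)
  · exact measurable_edist_map hh (by fun_prop) (by fun_prop)
  · exact Measurable.rieszDiff (by fun_prop) (by fun_prop) (by fun_prop) t
  · exact hV.comp measurable_fst
  · exact hV.comp (measurable_fst.comp (measurable_snd.comp measurable_snd))

lemma lintegral_iterated_symm_add_swap {γ : Type*} [MeasurableSpace γ] (μ : Measure γ) [SFinite μ]
    {J : E → E → γ → ℝ≥0∞} (hJ : Measurable fun u : E × E × γ => J u.1 u.2.1 u.2.2) (B : Set E) :
    ∫⁻ x in B, ∫⁻ y in B, ∫⁻ w, J x y w + J y x w ∂μ =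
      2 * ∫⁻ x in B, ∫⁻ y in B, ∫⁻ w, J x y w ∂μ := by
  obtain ⟨I, hI⟩ : ∃ I : E → E → ℝ≥0∞, I = fun x y => ∫⁻ w, J x y w ∂μ := ⟨_, rfl⟩
  have hIm : Measurable fun u : E × E => I u.1 u.2 := by
    rw [hI]
    exact Measurable.lintegral_prod_right' (f := fun q : (E × E) × γ => J q.1.1 q.1.2 q.2)
      (hJ.comp (show Measurable fun q : (E × E) × γ => (q.1.1, q.1.2, q.2) by fun_prop))
  have hJxy : ∀ x y, Measurable fun w => J x y w := fun x y =>
    hJ.comp (measurable_const.prodMk measurable_prodMk_left)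
  have h2 := lintegral_iterated_add_swap (J := fun x y _ => I x y)
    (hIm.comp (show Measurable fun u : E × E × E => (u.1, u.2.1) by fun_prop)) B 0
  rw [hI] at h2
  rw [← h2]
  refine lintegral_congr fun x => lintegral_congr fun y => ?_
  rw [lintegral_add_left (hJxy x y)]

lemma lintegral_mul_incrementIntegral {t : ℝ} {h : E → G} (hh : StronglyMeasurable h)
    {φ : E → ℝ≥0∞} (hφ : Measurable φ) :
    ∫⁻ z, φ z * incrementIntegral t h z =
      ∫⁻ w : E × E, φ w.1 * (edist (h w.1) (h w.2) * edist w.1 w.2 ^ (-(n + t) : ℝ)) := by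
  have hd := measurable_edist_comp hh
  have hm : Measurable fun w : E × E =>
      φ w.1 * (edist (h w.1) (h w.2) * edist w.1 w.2 ^ (-(n + t) : ℝ)) :=
    (hφ.comp measurable_fst).mul (hd.mul (by fun_prop))
  rw [Measure.volume_eq_prod, lintegral_prod _ hm.aemeasurable]
  refine lintegral_congr fun z => ?_
  have hdz : Measurable fun v => edist (h z) (h v) * edist z v ^ (-(n + t) : ℝ) :=
    (hd.comp measurable_prodMk_left).mul (by fun_prop)
  unfold incrementIntegral
  rw [← lintegral_const_mul _ hdz]

/-- The second commutator is dominated by the quadrilinear form. -/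
lemma exists_commT₂_le [NeZero n] [NormedSpace ℝ G] [CompleteSpace G] {s t t' : ℝ} (hs0 : 0 < s)
    (hs1 : s < 1) (ht0 : 0 < t) (hts : t < s) (ht'0 : 0 ≤ t') (ht'1 : t' ≤ 1) : ∃ C : ℝ≥0,
    ∀ (f : E → F) (g : E → ℝ) (h : E → G), StronglyMeasurable f → StronglyMeasurable g →
    StronglyMeasurable h → gagliardoEnergy univ (n / s) g ≠ ∞ →
    gagliardoEnergy univ (n / s) h ≠ ∞ →
    (∀ᵐ x : E, Integrable fun z => ‖x - z‖ ^ (t - (n : ℝ)) • (g z • fracLaplacian t h z)) →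
    ∀ B : Set E, commT₂ B s t f g h ≤ C * ∫⁻ x in B, ∫⁻ y in B, ∫⁻ w : E × E,
      quadrilinear s t t' f h (potential (t - t') fun w => ‖fracLaplacian t g w‖ₑ) x y w := by
  have hn : (1 : ℝ) ≤ n := mod_cast NeZero.one_le
  have hsn : 0 ≤ s / n := by positivity
  obtain ⟨Cg, hCg⟩ := growthBound_incrementIntegral (n := n) (F := ℝ) hs0 hs1 ht0 hts
  obtain ⟨Ch, hCh⟩ := growthBound_incrementIntegral (n := n) (F := G) hs0 hs1 ht0 hts
  obtain ⟨C₁, hC₁⟩ := exists_edist_le_potential (n := n) (F := ℝ) ht0 (by linarith : t < 1) ht'0 ht'1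
  obtain ⟨C₂, hC₂⟩ := exists_enorm_commTheta_le (n := n) (F := G) ht0 (by linarith : t < 1)
  refine ⟨2 * (C₂ * C₁), fun f g h hf hg hh hEg hEh hint B => ?_⟩
  obtain ⟨V, hV⟩ : ∃ V, V = potential (t - t') fun w => ‖fracLaplacian t g w‖ₑ := ⟨_, rfl⟩
  have hVm : Measurable V := by
    rw [hV]; exact measurable_potential (stronglyMeasurable_fracLaplacian hg).enorm
  have hAg : Cg * gagliardoEnergy univ (n / s) g ^ (s / n) ≠ ∞ :=
    mul_ne_top coe_ne_top (rpow_ne_top_of_nonneg hsn hEg)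
  have hAh : Ch * gagliardoEnergy univ (n / s) h ^ (s / n) ≠ ∞ :=
    mul_ne_top coe_ne_top (rpow_ne_top_of_nonneg hsn hEh)
  have hrg := ae_rieszRegular ht0 (by linarith : t < n) hg hAg (hCg g hg)
  have hrh := ae_rieszRegular ht0 (by linarith : t < n) hh hAh (hCh h hh)
  have hmi := measurable_incrementIntegral (t := t) hh
  have hQ := measurable_quadrilinear (s := s) (t := t) (t' := t') hf hh hVm
  have hpt : commT₂ B s t f g h ≤ ∫⁻ x in B, ∫⁻ y in B, (C₂ * C₁ : ℝ≥0) * ∫⁻ w : E × E,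
      quadrilinear s t t' f h V x y w + quadrilinear s t t' f h V y x w := by
    refine lintegral_mono_ae (ae_restrict_of_ae ?_)
    filter_upwards [hrg, hrh, hint] with x hxg hxh hxi
    refine lintegral_mono_ae (ae_restrict_of_ae ?_)
    filter_upwards [hrg, hrh, hint, Measure.ae_ne volume x] with y hyg hyh hyi hyx
    rw [ofReal_integrand_le hs0 (by linarith) f hyx.symm, ofReal_norm]
    have hΘ := hC₂ g h hh x y hyx.symm hxh hyh
      (hxh.lintegral_rieszDiff_lt_top (by linarith) hh hAh (hCh h hh) hyx.symm hyh) hxi hyi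
    obtain ⟨φ, hφ⟩ : ∃ φ : E → ℝ≥0∞, φ = fun z => rieszDiff t x y z *
        (edist x z ^ t' * (V x + V z) + edist y z ^ t' * (V y + V z)) := ⟨_, rfl⟩
    have hφm : Measurable φ := by
      rw [hφ]
      refine Measurable.mul (Measurable.rieszDiff measurable_const measurable_const measurable_id t) (Measurable.add (Measurable.mul (by fun_prop) (measurable_const.add hVm))
          (Measurable.mul (by fun_prop) (measurable_const.add hVm)))
    have hΘ' : ‖commTheta t g h x y‖ₑ ≤ (C₂ * C₁ : ℝ≥0) * ∫⁻ z, φ z * incrementIntegral t h z := by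
      refine hΘ.trans ?_
      rw [coe_mul, mul_assoc]
      refine mul_le_mul_right ?_ _
      rw [← lintegral_const_mul' _ _ coe_ne_top]
      refine lintegral_mono_ae ?_
      filter_upwards [hrg, Measure.ae_ne volume x, Measure.ae_ne volume y] with z hzg hzx hzy
      have h1 := hC₁ g hg x z hzx.symm hxg hzg
        (hxg.lintegral_rieszDiff_lt_top (by linarith) hg hAg (hCg g hg) hzx.symm hzg)
      have h2 := hC₁ g hg y z hzy.symm hyg hzg
        (hyg.lintegral_rieszDiff_lt_top (by linarith) hg hAg (hCg g hg) hzy.symm hzg)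
      rw [← hV] at h1 h2
      calc _ ≤ rieszDiff t x y z * ((C₁ * (edist x z ^ t' * (V x + V z)) +
          C₁ * (edist y z ^ t' * (V y + V z))) * incrementIntegral t h z) := by gcongr
        _ = _ := by rw [hφ]; ring
    rw [lintegral_mul_incrementIntegral hh hφm] at hΘ'
    have hd := measurable_edist_comp hh
    have hmw : Measurable fun w : E × E =>
        φ w.1 * (edist (h w.1) (h w.2) * edist w.1 w.2 ^ (-(n + t) : ℝ)) :=
      (hφm.comp measurable_fst).mul (hd.mul (by fun_prop))
    calc _ ≤ edist (f x) (f y) ^ ((n : ℝ) / s - 1) * ((C₂ * C₁ : ℝ≥0) * ∫⁻ w : E × E, φ w.1 *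
          (edist (h w.1) (h w.2) * edist w.1 w.2 ^ (-(n + t) : ℝ))) * edist x y ^ (-(2 * n) : ℝ) :=
          mul_le_mul_left (mul_le_mul_right hΘ' _) _
      _ = (C₂ * C₁ : ℝ≥0) * ((edist (f x) (f y) ^ ((n : ℝ) / s - 1) *
          edist x y ^ (-(2 * n) : ℝ)) * ∫⁻ w : E × E, φ w.1 *
          (edist (h w.1) (h w.2) * edist w.1 w.2 ^ (-(n + t) : ℝ))) := by ring
      _ = _ := by
          rw [← lintegral_const_mul _ hmw]
          congr 1
          refine lintegral_congr fun w => ?_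
          rw [hφ]
          unfold quadrilinear
          rw [edist_comm (f y), edist_comm y x, rieszDiff_comm t y x]
          ring
  refine hpt.trans (le_of_eq ?_)
  rw [← hV]
  simp_rw [lintegral_const_mul' _ _ (coe_ne_top (r := C₂ * C₁))]
  rw [lintegral_iterated_symm_add_swap volume hQ]
  push_cast
  ring

/-! ### Hölder's inequality for quadrilinear kernels -/

lemma ae_prod_edist_ne [NeZero n] (x : E) (Z : Set (E × E)) :
    ∀ᵐ w ∂((volume : Measure (E × E)).restrict Z), x ≠ w.1 ∧ w.1 ≠ w.2 := by
  refine ae_restrict_of_ae ?_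
  have h1 : ∀ᵐ w : E × E, w.1 ≠ x :=
    Measure.quasiMeasurePreserving_fst.ae (Measure.ae_ne volume x)
  have h2 : ∀ᵐ w : E × E, w.1 ≠ w.2 := by
    have hms : MeasurableSet {w : E × E | w.1 ≠ w.2} :=
      (measurableSet_eq_fun measurable_fst measurable_snd).compl
    rw [Measure.volume_eq_prod, Measure.ae_prod_iff_ae_ae hms]
    refine Filter.Eventually.of_forall fun z => ?_
    filter_upwards [Measure.ae_ne volume z] with v hv using hv.symm
  filter_upwards [h1, h2] with w hw1 hw2 using ⟨hw1.symm, hw2⟩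

/-- Hölder's inequality distributes a quadrilinear kernel between the energies of `f` and `h`: it
suffices to integrate one factor over `(z, v)` and the other one over `(x, y)`. -/
lemma lintegral_quadrilinear_le [NeZero n] {s : ℝ} (hs0 : 0 < s) (hs1 : s < 1) {f : E → F}
    {h : E → G} (hf : StronglyMeasurable f) (hh : StronglyMeasurable h)
    {P : E → E → E → E → Prop}
    (hP : Measurable fun u : E × E × (E × E) => ind (P u.1 u.2.1 u.2.2.1 u.2.2.2))
    {w w₁ w₂ : E → E → E → ℝ≥0∞} (hw₁ : Measurable fun u : E × E × E => w₁ u.1 u.2.1 u.2.2)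
    (hw₂ : Measurable fun u : E × E × E => w₂ u.1 u.2.1 u.2.2)
    (hw : ∀ x y z, w x y z = w₁ x y z ^ (1 - s / n) * w₂ x y z ^ (s / n))
    {er er₁ er₂ eq eq₁ eq₂ ed ed₁ ed₂ : ℝ} (her : er = er₁ * (1 - s / n) + er₂ * (s / n))
    (heq : eq = eq₁ * (1 - s / n) + eq₂ * (s / n)) (hed : ed = ed₁ * (1 - s / n) + ed₂ * (s / n))
    {K₁ K₂ : ℝ≥0∞} {W : E → E → ℝ≥0∞} (hW : Measurable fun u : E × E => W u.1 u.2)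
    (hU : ∀ x y, x ≠ y → ∫⁻ z, ∫⁻ v, ind (P x y z v) *
      (edist x z ^ eq₁ * edist z v ^ ed₁ * w₁ x y z) ≤ K₁ * edist x y ^ (-(2 * n) - er₁))
    (hV : ∀ z v, z ≠ v → ∫⁻ x, ∫⁻ y, ind (P x y z v) *
      (edist x y ^ er₂ * edist x z ^ eq₂ * w₂ x y z) ≤ W z v)
    (B : Set E) {Z : Set (E × E)} {D : Set E} (hZ : Z ⊆ D ×ˢ D)
    (hE : ∫⁻ z in D, ∫⁻ v in D, edist (h z) (h v) ^ ((n : ℝ) / s) * edist z v ^ ed₂ * W z v ≤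
      K₂ * gagliardoEnergy D (n / s) h) :
    ∫⁻ x in B, ∫⁻ y in B, ∫⁻ u in Z, ind (P x y u.1 u.2) *
        (edist (f x) (f y) ^ ((n : ℝ) / s - 1) * edist (h u.1) (h u.2) *
          (edist x y ^ er * edist x u.1 ^ eq * edist u.1 u.2 ^ ed * w x y u.1))
      ≤ K₁ ^ (1 - s / n) * K₂ ^ (s / n) *
        (gagliardoEnergy B (n / s) f ^ (1 - s / n) * gagliardoEnergy D (n / s) h ^ (s / n)) := by
  have hn : (1 : ℝ) ≤ n := mod_cast NeZero.one_le
  have hn0 : (n : ℝ) ≠ 0 := by positivity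
  have hθ : s / n ≤ 1 := by rw [div_le_one (by linarith)]; linarith
  have hθ0 : 0 ≤ s / n := by positivity
  have hw' : ∀ (w' : E → E → E → ℝ≥0∞), (Measurable fun u : E × E × E => w' u.1 u.2.1 u.2.2) →
      Measurable fun u : E × E × (E × E) => w' u.1 u.2.1 u.2.2.1 := fun w' hm =>
    hm.comp (show Measurable fun u : E × E × (E × E) => (u.1, u.2.1, u.2.2.1) by fun_prop)
  have ha : Measurable fun u : E × E × (E × E) => edist (f u.1) (f u.2.1) :=
    measurable_edist_map hf (by fun_prop) (by fun_prop)
  have hb : Measurable fun u : E × E × (E × E) => edist (h u.2.2.1) (h u.2.2.2) :=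
    measurable_edist_map hh (by fun_prop) (by fun_prop)
  have hol := lintegral_holder_kernel (volume.restrict B) (volume.restrict B)
    ((volume : Measure (E × E)).restrict Z)
    (p := n / s) (θ := 1 - s / n) (by linarith) (by linarith) (by field_simp)
    (P := fun x y u => P x y u.1 u.2) (a := fun x y _ => edist (f x) (f y))
    (b := fun _ _ u => edist (h u.1) (h u.2)) (r := fun x y _ => edist x y)
    (q := fun x _ u => edist x u.1) (d := fun _ _ u => edist u.1 u.2) (w := fun x y u => w x y u.1)
    (w₁ := fun x y u => w₁ x y u.1) (w₂ := fun x y u => w₂ x y u.1) hP ha hb (by fun_prop)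
    (by fun_prop) (by fun_prop) (hw' _ hw₁) (hw' _ hw₂)
    (fun x => by
      filter_upwards [ae_edist_ne x B] with y hy
      filter_upwards [ae_prod_edist_ne x Z] with u hu
      exact ⟨hy, ⟨(edist_pos.2 hu.1).ne', edist_ne_top _ _⟩,
        ⟨(edist_pos.2 hu.2).ne', edist_ne_top _ _⟩⟩)
    (er := er) (er₁ := er₁) (er₂ := er₂) (eq := eq) (eq₁ := eq₁) (eq₂ := eq₂)
    (ed := ed) (ed₁ := ed₁) (ed₂ := ed₂) (by rw [sub_sub_cancel]; exact her)
    (by rw [sub_sub_cancel]; exact heq) (by rw [sub_sub_cancel]; exact hed)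
    (fun x y u => by rw [sub_sub_cancel]; exact hw x y u.1)
  rw [sub_sub_cancel] at hol
  refine hol.trans ?_
  have hI : ∫⁻ x in B, ∫⁻ y in B, ∫⁻ u in Z, ind (P x y u.1 u.2) *
      (edist (f x) (f y) ^ ((n : ℝ) / s) *
        (edist x y ^ er₁ * edist x u.1 ^ eq₁ * edist u.1 u.2 ^ ed₁ * w₁ x y u.1))
      ≤ K₁ * gagliardoEnergy B (n / s) f := by
    refine lintegral_le_mul_gagliardoEnergy (e := er₁) (e' := -(2 * n) - er₁) (by ring) hf B _
      fun x y hxy => ?_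
    have hm : Measurable fun u : E × E => ind (P x y u.1 u.2) *
        (edist x u.1 ^ eq₁ * edist u.1 u.2 ^ ed₁ * w₁ x y u.1) :=
      (hP.comp (show Measurable fun u : E × E => (x, y, u) by fun_prop)).mul
        (Measurable.mul (by fun_prop) (hw₁.comp
          (show Measurable fun u : E × E => (x, y, u.1) by fun_prop)))
    calc ∫⁻ u in Z, ind (P x y u.1 u.2) * (edist (f x) (f y) ^ ((n : ℝ) / s) *
          (edist x y ^ er₁ * edist x u.1 ^ eq₁ * edist u.1 u.2 ^ ed₁ * w₁ x y u.1))
        ≤ ∫⁻ u : E × E, edist (f x) (f y) ^ ((n : ℝ) / s) * edist x y ^ er₁ *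
            (ind (P x y u.1 u.2) * (edist x u.1 ^ eq₁ * edist u.1 u.2 ^ ed₁ * w₁ x y u.1)) := by
          refine (setLIntegral_le_lintegral _ _).trans (lintegral_mono fun u => le_of_eq ?_)
          ring
      _ = edist (f x) (f y) ^ ((n : ℝ) / s) * edist x y ^ er₁ * ∫⁻ z, ∫⁻ v, ind (P x y z v) *
            (edist x z ^ eq₁ * edist z v ^ ed₁ * w₁ x y z) := by
          rw [lintegral_const_mul _ hm, Measure.volume_eq_prod, lintegral_prod _ hm.aemeasurable]
      _ ≤ _ := mul_le_mul_right (hU x y hxy) _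
  have hJ : ∫⁻ x in B, ∫⁻ y in B, ∫⁻ u in Z, ind (P x y u.1 u.2) *
      (edist (h u.1) (h u.2) ^ ((n : ℝ) / s) *
        (edist x y ^ er₂ * edist x u.1 ^ eq₂ * edist u.1 u.2 ^ ed₂ * w₂ x y u.1))
      ≤ K₂ * gagliardoEnergy D (n / s) h := by
    refine le_trans ?_ hE
    obtain ⟨J, hJ⟩ : ∃ J : E → E → E × E → ℝ≥0∞, J = fun x y u => ind (P x y u.1 u.2) *
      (edist (h u.1) (h u.2) ^ ((n : ℝ) / s) *
        (edist x y ^ er₂ * edist x u.1 ^ eq₂ * edist u.1 u.2 ^ ed₂ * w₂ x y u.1)) := ⟨_, rfl⟩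
    have hJm : Measurable fun u : E × E × (E × E) => J u.1 u.2.1 u.2.2 := by
      rw [hJ]
      exact hP.mul ((hb.pow_const _).mul (Measurable.mul (by fun_prop) (hw' _ hw₂)))
    have hWm : Measurable fun u : E × E => edist (h u.1) (h u.2) ^ ((n : ℝ) / s) *
        edist u.1 u.2 ^ ed₂ * W u.1 u.2 :=
      ((measurable_edist_comp hh).pow_const _ |>.mul (by fun_prop)).mul hW
    have hPx : ∀ u : E × E, Measurable fun q : E × E => ind (P q.1 q.2 u.1 u.2) *
        (edist q.1 q.2 ^ er₂ * edist q.1 u.1 ^ eq₂ * w₂ q.1 q.2 u.1) := fun u =>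
      (hP.comp (show Measurable fun q : E × E => (q.1, q.2, u) by fun_prop)).mul
        (Measurable.mul (by fun_prop) (hw₂.comp
          (show Measurable fun q : E × E => (q.1, q.2, u.1) by fun_prop)))
    calc _ = ∫⁻ x in B, ∫⁻ y in B, ∫⁻ u in Z, J x y u := by rw [hJ]
      _ ≤ ∫⁻ x, ∫⁻ y, ∫⁻ u in Z, J x y u :=
          (setLIntegral_le_lintegral _ _).trans
            (lintegral_mono fun x => setLIntegral_le_lintegral _ _)
      _ = ∫⁻ u in Z, ∫⁻ x, ∫⁻ y, J x y u := by
          have e : ∀ x, ∫⁻ y, ∫⁻ u in Z, J x y u = ∫⁻ u in Z, ∫⁻ y, J x y u := fun x =>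
            lintegral_lintegral_swap
              (hJm.comp (show Measurable fun q : E × (E × E) => (x, q.1, q.2) by
                fun_prop)).aemeasurable
          simp_rw [e]
          refine lintegral_lintegral_swap (Measurable.aemeasurable ?_)
          exact Measurable.lintegral_prod_right'
            (f := fun q : (E × (E × E)) × E => J q.1.1 q.2 q.1.2)
            (hJm.comp (show Measurable fun q : (E × (E × E)) × E => (q.1.1, q.2, q.1.2) by fun_prop))
      _ ≤ ∫⁻ u in Z, edist (h u.1) (h u.2) ^ ((n : ℝ) / s) * edist u.1 u.2 ^ ed₂ * W u.1 u.2 := by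
          refine lintegral_mono_ae ?_
          filter_upwards [ae_prod_edist_ne 0 Z] with u hu
          have e : ∀ x y, J x y u = edist (h u.1) (h u.2) ^ ((n : ℝ) / s) * edist u.1 u.2 ^ ed₂ *
              (ind (P x y u.1 u.2) * (edist x y ^ er₂ * edist x u.1 ^ eq₂ * w₂ x y u.1)) :=
            fun x y => by rw [hJ]; ring
          simp_rw [e]
          have hy : ∀ x, Measurable fun y => ind (P x y u.1 u.2) *
              (edist x y ^ er₂ * edist x u.1 ^ eq₂ * w₂ x y u.1) := fun x =>
            (hPx u).comp (show Measurable fun y : E => (x, y) by fun_prop)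
          have ey : ∀ x, _ = _ := fun x => lintegral_const_mul (μ := volume)
            (edist (h u.1) (h u.2) ^ ((n : ℝ) / s) * edist u.1 u.2 ^ ed₂) (hy x)
          rw [lintegral_congr ey, lintegral_const_mul _ (Measurable.lintegral_prod_right' (hPx u))]
          exact mul_le_mul_right (hV u.1 u.2 hu.2) _
      _ ≤ ∫⁻ u in D ×ˢ D, edist (h u.1) (h u.2) ^ ((n : ℝ) / s) * edist u.1 u.2 ^ ed₂ * W u.1 u.2 :=
          lintegral_mono_set hZ
      _ = _ := by
          rw [Measure.volume_eq_prod, ← Measure.prod_restrict, lintegral_prod _ hWm.aemeasurable]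
  calc _ ≤ (K₁ * gagliardoEnergy B (n / s) f) ^ (1 - s / n) *
        (K₂ * gagliardoEnergy D (n / s) h) ^ (s / n) := by
        refine mul_le_mul' (rpow_le_rpow hI (by linarith)) ?_
        exact rpow_le_rpow hJ hθ0
    _ = _ := by
        rw [mul_rpow_of_nonneg _ _ (by linarith), mul_rpow_of_nonneg _ _ hθ0]
        ring

/-! ### Iterated integrals of products of Riesz kernels -/

lemma ind_mul_mul_ind (P Q : Prop) (a : ℝ≥0∞) : ind (P ∧ Q) * a = ind P * (ind Q * a) := by
  by_cases hP : P <;> by_cases hQ : Q <;> simp [ind, hP, hQ]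

lemma ind_mono {P Q : Prop} (h : P → Q) : ind P ≤ ind Q := by
  by_cases hP : P
  · rw [ind_of_true hP, ind_of_true (h hP)]
  · rw [ind_of_false hP]; exact zero_le

lemma measurable_ind_and {α : Type*} [MeasurableSpace α] {P Q : α → Prop}
    (hP : Measurable fun a => ind (P a)) (hQ : Measurable fun a => ind (Q a)) :
    Measurable fun a => ind (P a ∧ Q a) := by
  have e : (fun a => ind (P a ∧ Q a)) = fun a => ind (P a) * ind (Q a) := by
    funext a
    simpa using ind_mul_mul_ind (P a) (Q a) 1
  rw [e]
  exact hP.mul hQ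

lemma inv_mul_rpow_neg {l r : ℝ≥0∞} (hl0 : l ≠ 0) (hr : r ≠ ∞) (e : ℝ) :
    (l⁻¹ * r) ^ (-e) = l ^ e * r ^ (-e) := by
  rw [mul_rpow_of_ne_top (inv_ne_top.2 hl0) hr, inv_rpow,
    ← rpow_neg, neg_neg]

lemma ennreal_inv_mul_le {l a b : ℝ≥0∞} (h : a ≤ l * b) : l⁻¹ * a ≤ b := by
  rw [mul_comm, ← div_eq_mul_inv]
  exact ENNReal.div_le_of_le_mul' h

lemma lintegral_far_max_le [NeZero n] {e : ℝ} (he : 0 < e) {c : ℝ≥0∞} (hc0 : c ≠ 0) (hc : c ≠ ∞) :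
    ∃ C : ℝ≥0, ∀ (z : E) (M : ℝ≥0∞), M ≠ 0 → M ≠ ∞ → ∀ P : E → Prop,
      (∀ v, P v → M ≤ c * edist z v) →
      ∫⁻ v, ind (P v) * edist z v ^ (-n - e) ≤ C * M ^ (-e) := by
  obtain ⟨C, hC⟩ := lintegral_ind_far_le_volume (n := n) (a := -n - e) (by linarith)
  refine ⟨C * (c ^ e).toNNReal, fun z M hM0 hM P hP => ?_⟩
  calc ∫⁻ v, ind (P v) * edist z v ^ (-n - e)
      ≤ ∫⁻ v, ind (c⁻¹ * M ≤ edist z v) * edist z v ^ (-n - e) :=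
        lintegral_mono fun v => mul_le_mul_left
          (ind_mono fun h => ennreal_inv_mul_le (hP v h)) _
    _ ≤ C * (c⁻¹ * M) ^ (-n - e + n) := hC z _ (mul_ne_zero (inv_ne_zero.2 hc) hM0)
        (mul_ne_top (inv_ne_top.2 hc0) hM)
    _ = _ := by
        rw [show -n - e + n = -e by ring, inv_mul_rpow_neg hc0 hM, coe_mul,
          coe_toNNReal (rpow_ne_top_of_nonneg he.le hc), mul_assoc]

/-! The distances are `r = |x - y|`, `q = |x - z|` and `d = |z - v|`; first the region where `d` is
the largest one. -/

lemma lintegral_increment_dominant_left [NeZero n] {τ : ℝ} (hτ : 0 < τ) : ∃ C : ℝ≥0,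
    ∀ l : ℝ≥0∞, l ≠ 0 → l ≠ ∞ → ∀ x y : E, x ≠ y →
      ∫⁻ z, ∫⁻ v, ind (edist x y ≤ l * edist z v ∧ edist x z ≤ 2 * edist z v) *
        (edist x z ^ (τ - n) * edist z v ^ (-n - 2 * τ) * 1) ≤
        C * (l ^ τ * edist x y ^ (-τ)) := by
  have hn : (1 : ℝ) ≤ n := mod_cast NeZero.one_le
  obtain ⟨C₁, hC₁⟩ := lintegral_far_max_le (n := n) (e := 2 * τ) (by linarith)
    (c := 2) (by simp) (by simp)
  obtain ⟨C₂, hC₂⟩ := lintegral_edist_rpow_max_le_volume (n := n) (a := τ - n) (b := -(2 * τ))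
    (by linarith) (by linarith)
  refine ⟨C₁ * C₂, fun l hl0 hl x y hxy => ?_⟩
  have hR0 : l⁻¹ * edist x y ≠ 0 := mul_ne_zero (inv_ne_zero.2 hl) (edist_pos.2 hxy).ne'
  have hR : l⁻¹ * edist x y ≠ ∞ := mul_ne_top (inv_ne_top.2 hl0) (edist_ne_top x y)
  calc _ ≤ ∫⁻ z, C₁ * (edist x z ^ (τ - n) * max (l⁻¹ * edist x y) (edist x z) ^ (-(2 * τ))) := by
        refine lintegral_mono_ae ?_
        filter_upwards [Measure.ae_ne volume x] with z hz
        have htop : edist x z ^ (τ - n) ≠ ∞ := edist_rpow_ne_top hz.symm _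
        have e : ∀ v, ind (edist x y ≤ l * edist z v ∧ edist x z ≤ 2 * edist z v) *
            (edist x z ^ (τ - n) * edist z v ^ (-n - 2 * τ) * 1) = edist x z ^ (τ - n) *
            (ind (edist x y ≤ l * edist z v ∧ edist x z ≤ 2 * edist z v) *
              edist z v ^ (-n - 2 * τ)) := fun v => by ring
        simp_rw [e]
        rw [lintegral_const_mul' _ _ htop, mul_left_comm]
        refine mul_le_mul_right (hC₁ z _ (ne_bot_of_le_ne_bot hR0 (le_max_left _ _))
          (max_ne_top hR (edist_ne_top _ _)) _ fun v hv => max_le ?_ hv.2) _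
        exact (ennreal_inv_mul_le hv.1).trans (le_mul_of_one_le_left zero_le one_le_two)
    _ ≤ _ := by
        rw [lintegral_const_mul' _ _ coe_ne_top, coe_mul, mul_assoc]
        refine mul_le_mul_right ((hC₂ x _ hR0 hR).trans (le_of_eq ?_)) _
        rw [show τ - n + -(2 * τ) + n = -τ by ring, inv_mul_rpow_neg hl0 (edist_ne_top x y)]

lemma lintegral_increment_dominant_right [NeZero n] {τ : ℝ} (hτ : 0 < τ) : ∃ C : ℝ≥0,
    ∀ (l : ℝ≥0∞), l ≤ 1 → ∀ (ψ : E → ℝ≥0∞) (z v : E), z ≠ v →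
      ∫⁻ x, ∫⁻ y, ind (edist x y ≤ l * edist z v ∧ edist x z ≤ 2 * edist z v) *
        (edist x y ^ (τ - n) * edist x z ^ (τ - n) * ψ x) ≤
        C * (edist z v ^ τ * ∫⁻ x, ind (edist z x ≤ 2 * edist z v) * (edist z x ^ (τ - n) * ψ x)) := by
  obtain ⟨C, hC⟩ := lintegral_ind_near_le_volume (n := n) (a := τ - n) (by linarith)
  refine ⟨C, fun l hl ψ z v hzv => ?_⟩
  have hd0 := (edist_pos.2 hzv).ne'
  have hd := edist_ne_top z v
  rw [← mul_assoc, ← lintegral_const_mul' _ _ (mul_ne_top coe_ne_top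
    (rpow_ne_top_of_nonneg hτ.le hd))]
  refine lintegral_mono fun x => ?_
  have hCx := hC x (edist z v) hd0 hd
  rw [show τ - n + n = τ by ring] at hCx
  obtain ⟨X, hX⟩ : ∃ X, X = ind (edist z x ≤ 2 * edist z v) * (edist z x ^ (τ - n) * ψ x) :=
    ⟨_, rfl⟩
  have hm : Measurable fun y : E => ind (edist x y ≤ edist z v) * edist x y ^ (τ - n) :=
    (measurable_ind_le (by fun_prop) measurable_const).mul (by fun_prop)
  calc _ ≤ ∫⁻ y, ind (edist x y ≤ edist z v) * edist x y ^ (τ - n) * X := by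
        refine lintegral_mono fun y => ?_
        rw [ind_mul_mul_ind, hX, edist_comm z x]
        calc _ ≤ ind (edist x y ≤ edist z v) * (ind (edist x z ≤ 2 * edist z v) *
              (edist x y ^ (τ - n) * edist x z ^ (τ - n) * ψ x)) :=
              mul_le_mul_left (ind_mono fun h => h.trans (mul_le_of_le_one_left zero_le hl)) _
          _ = _ := by ring
    _ = (∫⁻ y, ind (edist x y ≤ edist z v) * edist x y ^ (τ - n)) * X := lintegral_mul_const _ hm
    _ ≤ C * edist z v ^ τ * X := mul_le_mul_left hCx _
    _ = _ := by rw [hX]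

/-! The region where `q` is the largest one. -/

lemma lintegral_pole_dominant_left [NeZero n] {ε β m : ℝ} (hε : 0 < ε) (hβ : 0 < β) :
    ∃ C : ℝ≥0, ∀ (ψ : E → ℝ≥0∞) (A : ℝ≥0∞), GrowthBound ψ A (n - m) → ∀ l : ℝ≥0∞, l ≠ 0 → l ≠ ∞ →
    ∀ x y : E, x ≠ y →
      ∫⁻ z, ∫⁻ v, ind (edist x y ≤ l * edist x z ∧ edist z v ≤ edist x z) *
        (edist x z ^ (-n - ε + m - β) * edist z v ^ (β - n) * ψ z) ≤
        C * A * (l ^ ε * edist x y ^ (-ε)) := by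
  obtain ⟨C₁, hC₁⟩ := lintegral_ind_near_le_volume (n := n) (a := β - n) (by linarith)
  obtain ⟨C₂, hC₂⟩ := lintegral_ind_far_le (n := n) (a := -n - ε + m) (e := n - m) (by linarith)
  refine ⟨C₁ * C₂, fun ψ A hA l hl0 hl x y hxy => ?_⟩
  have hR0 : l⁻¹ * edist x y ≠ 0 := mul_ne_zero (inv_ne_zero.2 hl) (edist_pos.2 hxy).ne'
  have hR : l⁻¹ * edist x y ≠ ∞ := mul_ne_top (inv_ne_top.2 hl0) (edist_ne_top x y)
  calc _ ≤ ∫⁻ z, C₁ * (ind (l⁻¹ * edist x y ≤ edist x z) *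
          (edist x z ^ (-n - ε + m) * ψ z)) := by
        refine lintegral_mono_ae ?_
        filter_upwards [Measure.ae_ne volume x] with z hz
        have hq0 := (edist_pos.2 hz.symm).ne'
        have hq := edist_ne_top x z
        have hCz := hC₁ z (edist x z) hq0 hq
        rw [show β - n + n = β by ring] at hCz
        obtain ⟨X, hX⟩ : ∃ X, X = ind (l⁻¹ * edist x y ≤ edist x z) *
          (edist x z ^ (-n - ε + m - β) * ψ z) := ⟨_, rfl⟩
        have hm : Measurable fun v : E => ind (edist z v ≤ edist x z) * edist z v ^ (β - n) :=
          (measurable_ind_le (by fun_prop) measurable_const).mul (by fun_prop)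
        calc _ ≤ ∫⁻ v, ind (edist z v ≤ edist x z) * edist z v ^ (β - n) * X := by
              refine lintegral_mono fun v => ?_
              rw [ind_mul_mul_ind, hX]
              calc _ ≤ ind (l⁻¹ * edist x y ≤ edist x z) * (ind (edist z v ≤ edist x z) *
                    (edist x z ^ (-n - ε + m - β) * edist z v ^ (β - n) * ψ z)) :=
                    mul_le_mul_left (ind_mono ennreal_inv_mul_le) _
                _ = _ := by ring
          _ = (∫⁻ v, ind (edist z v ≤ edist x z) * edist z v ^ (β - n)) * X :=
              lintegral_mul_const _ hm
          _ ≤ C₁ * edist x z ^ β * X := mul_le_mul_left hCz _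
          _ = C₁ * (ind (l⁻¹ * edist x y ≤ edist x z) *
              ((edist x z ^ β * edist x z ^ (-n - ε + m - β)) * ψ z)) := by rw [hX]; ring
          _ = _ := by
              rw [← rpow_add _ _ hq0 hq, show β + (-n - ε + m - β) = -n - ε + m by ring]
    _ ≤ _ := by
        rw [lintegral_const_mul' _ _ coe_ne_top, coe_mul, mul_assoc (C₁ : ℝ≥0∞),
          mul_assoc (C₁ : ℝ≥0∞)]
        refine mul_le_mul_right ((hC₂ ψ A hA x _ hR0 hR).trans (le_of_eq ?_)) _
        rw [show -n - ε + m + (n - m) = -ε by ring, inv_mul_rpow_neg hl0 (edist_ne_top x y)]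

lemma lintegral_pole_dominant_right [NeZero n] {α β m : ℝ} (hα : 0 < α) (hβ : 0 < β) :
    ∃ C : ℝ≥0, ∀ (ψ : E → ℝ≥0∞) (A : ℝ≥0∞), GrowthBound ψ A (n - m) → ∀ l : ℝ≥0∞, l ≤ 1 →
    ∀ z v : E, z ≠ v →
      ∫⁻ x, ∫⁻ y, ind (edist x y ≤ l * edist x z ∧ edist z v ≤ edist x z) *
        (edist x y ^ (α - n) * edist x z ^ (-n - α - β + m) * ψ x) ≤
        C * A * edist z v ^ (-β) := by
  obtain ⟨C₁, hC₁⟩ := lintegral_ind_near_le_volume (n := n) (a := α - n) (by linarith)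
  obtain ⟨C₂, hC₂⟩ := lintegral_ind_far_le (n := n) (a := -n - β + m) (e := n - m) (by linarith)
  refine ⟨C₁ * C₂, fun ψ A hA l hl z v hzv => ?_⟩
  calc _ ≤ ∫⁻ x, C₁ * (ind (edist z v ≤ edist z x) * (edist z x ^ (-n - β + m) * ψ x)) := by
        refine lintegral_mono_ae ?_
        filter_upwards [Measure.ae_ne volume z] with x hx
        have hq0 := (edist_pos.2 hx).ne'
        have hq := edist_ne_top x z
        have hCx := hC₁ x (edist x z) hq0 hq
        rw [show α - n + n = α by ring] at hCx
        obtain ⟨X, hX⟩ : ∃ X, X = ind (edist z v ≤ edist x z) *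
          (edist x z ^ (-n - α - β + m) * ψ x) := ⟨_, rfl⟩
        have hm : Measurable fun y : E => ind (edist x y ≤ edist x z) * edist x y ^ (α - n) :=
          (measurable_ind_le (by fun_prop) measurable_const).mul (by fun_prop)
        calc _ ≤ ∫⁻ y, ind (edist x y ≤ edist x z) * edist x y ^ (α - n) * X := by
              refine lintegral_mono fun y => ?_
              rw [ind_mul_mul_ind, hX]
              calc _ ≤ ind (edist x y ≤ edist x z) * (ind (edist z v ≤ edist x z) *
                    (edist x y ^ (α - n) * edist x z ^ (-n - α - β + m) * ψ x)) :=
                    mul_le_mul_left (ind_mono fun h => h.trans (mul_le_of_le_one_left zero_le hl)) _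
                _ = _ := by ring
          _ = (∫⁻ y, ind (edist x y ≤ edist x z) * edist x y ^ (α - n)) * X :=
              lintegral_mul_const _ hm
          _ ≤ C₁ * edist x z ^ α * X := mul_le_mul_left hCx _
          _ = C₁ * (ind (edist z v ≤ edist x z) *
              ((edist x z ^ α * edist x z ^ (-n - α - β + m)) * ψ x)) := by rw [hX]; ring
          _ = _ := by
              rw [← rpow_add _ _ hq0 hq, show α + (-n - α - β + m) = -n - β + m by ring,
                edist_comm x z]
    _ ≤ _ := by
        rw [lintegral_const_mul' _ _ coe_ne_top, coe_mul, mul_assoc (C₁ : ℝ≥0∞),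
          mul_assoc (C₁ : ℝ≥0∞)]
        refine mul_le_mul_right ((hC₂ ψ A hA z _ (edist_pos.2 hzv).ne' (edist_ne_top z v)).trans
          (le_of_eq ?_)) _
        rw [show -n - β + m + (n - m) = -β by ring]

/-! The region where `r` is the largest one. -/

lemma lintegral_base_dominant_left [NeZero n] {t β m : ℝ} (hβ : 0 < β) (hm : m < t) :
    ∃ C : ℝ≥0, ∀ (ψ : E → ℝ≥0∞) (A : ℝ≥0∞), GrowthBound ψ A (n - m) → ∀ x y : E, x ≠ y →
      ∫⁻ z, ∫⁻ v, ind (edist x z ≤ 2 * edist x y ∧ edist z v ≤ edist x y) *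
        (edist x z ^ (t - n) * edist z v ^ (β - n) * ψ z) ≤
        C * A * edist x y ^ (β + t - m) := by
  obtain ⟨C₁, hC₁⟩ := lintegral_ind_near_le_volume (n := n) (a := β - n) (by linarith)
  obtain ⟨C₂, hC₂⟩ := lintegral_ind_near_le (n := n) (a := t - n) (e := n - m) (by linarith)
  refine ⟨C₁ * (C₂ * 2 ^ (t - m)), fun ψ A hA x y hxy => ?_⟩
  have hr0 := (edist_pos.2 hxy).ne'
  have hr := edist_ne_top x y
  calc _ ≤ ∫⁻ z, C₁ * edist x y ^ β * (ind (edist x z ≤ 2 * edist x y) *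
          (edist x z ^ (t - n) * ψ z)) := by
        refine lintegral_mono fun z => ?_
        have hCz := hC₁ z (edist x y) hr0 hr
        rw [show β - n + n = β by ring] at hCz
        obtain ⟨X, hX⟩ : ∃ X, X = ind (edist x z ≤ 2 * edist x y) *
          (edist x z ^ (t - n) * ψ z) := ⟨_, rfl⟩
        have hm : Measurable fun v : E => ind (edist z v ≤ edist x y) * edist z v ^ (β - n) :=
          (measurable_ind_le (by fun_prop) measurable_const).mul (by fun_prop)
        calc _ = ∫⁻ v, ind (edist z v ≤ edist x y) * edist z v ^ (β - n) * X := by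
              refine lintegral_congr fun v => ?_
              rw [ind_mul_mul_ind, hX]
              ring
          _ = (∫⁻ v, ind (edist z v ≤ edist x y) * edist z v ^ (β - n)) * X :=
              lintegral_mul_const _ hm
          _ ≤ C₁ * edist x y ^ β * X := mul_le_mul_left hCz _
          _ = _ := by rw [hX]
    _ ≤ C₁ * edist x y ^ β * (C₂ * A * (2 * edist x y) ^ (t - n + (n - m))) := by
        rw [lintegral_const_mul' _ _ (mul_ne_top coe_ne_top
          (rpow_ne_top_of_nonneg hβ.le hr))]
        exact mul_le_mul_right (hC₂ ψ A hA x _ (mul_ne_zero (by simp) hr0)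
          (mul_ne_top (by simp) hr)) _
    _ = C₁ * (C₂ * 2 ^ (t - m)) * A * (edist x y ^ β * edist x y ^ (t - m)) := by
        rw [show t - n + (n - m) = t - m by ring, mul_rpow_of_nonneg _ _ (by linarith)]
        ring
    _ = _ := by
        rw [← rpow_add _ _ hr0 hr, coe_mul, coe_mul,
          coe_rpow_of_nonneg _ (by linarith), coe_ofNat, add_sub_assoc]

lemma lintegral_base_dominant_right [NeZero n] {t β m : ℝ} (hβ : 0 < β) (hm : m < t) :
    ∃ C : ℝ≥0, ∀ (ψ : E → ℝ≥0∞) (A : ℝ≥0∞), GrowthBound ψ A (n - m) → ∀ z v : E, z ≠ v →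
      ∫⁻ x, ∫⁻ y, ind (edist x z ≤ 2 * edist x y ∧ edist z v ≤ edist x y) *
        (edist x y ^ (-n - (t + β - m)) * edist x z ^ (t - n) * ψ x) ≤
        C * A * edist z v ^ (-β) := by
  obtain ⟨C₁, hC₁⟩ := lintegral_far_max_le (n := n) (e := t + β - m) (by linarith)
    (c := 2) (by simp) (by simp)
  obtain ⟨C₂, hC₂⟩ := lintegral_edist_rpow_max_le (n := n) (a := t - n) (b := -(t + β - m))
    (e := n - m) (by linarith) (by linarith)
  refine ⟨C₁ * C₂, fun ψ A hA z v hzv => ?_⟩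
  have hd0 := (edist_pos.2 hzv).ne'
  have hd := edist_ne_top z v
  calc _ ≤ ∫⁻ x, C₁ * (edist z x ^ (t - n) * max (edist z v) (edist z x) ^ (-(t + β - m)) *
          ψ x) := by
        refine lintegral_mono fun x => ?_
        have hCx := hC₁ x (max (edist z v) (edist z x)) (ne_bot_of_le_ne_bot hd0 (le_max_left _ _))
          (max_ne_top hd (edist_ne_top _ _))
          (fun y => edist x z ≤ 2 * edist x y ∧ edist z v ≤ edist x y) fun y hy => max_le
            (hy.2.trans (le_mul_of_one_le_left zero_le one_le_two)) (by rw [edist_comm]; exact hy.1)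
        have hm : Measurable fun y : E => ind (edist x z ≤ 2 * edist x y ∧ edist z v ≤ edist x y) *
            edist x y ^ (-n - (t + β - m)) := by
          refine Measurable.mul ?_ (by fun_prop)
          exact measurable_ind_and (measurable_ind_le measurable_const (by fun_prop))
            (measurable_ind_le measurable_const (by fun_prop))
        calc _ = ∫⁻ y, ind (edist x z ≤ 2 * edist x y ∧ edist z v ≤ edist x y) *
              edist x y ^ (-n - (t + β - m)) * (edist x z ^ (t - n) * ψ x) :=
              lintegral_congr fun y => by ring
          _ = (∫⁻ y, ind (edist x z ≤ 2 * edist x y ∧ edist z v ≤ edist x y) *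
              edist x y ^ (-n - (t + β - m))) * (edist x z ^ (t - n) * ψ x) :=
              lintegral_mul_const _ hm
          _ ≤ C₁ * max (edist z v) (edist z x) ^ (-(t + β - m)) * (edist x z ^ (t - n) * ψ x) :=
              mul_le_mul_left hCx _
          _ = _ := by rw [edist_comm x z]; ring
    _ ≤ _ := by
        rw [lintegral_const_mul' _ _ coe_ne_top, coe_mul, mul_assoc (C₁ : ℝ≥0∞),
          mul_assoc (C₁ : ℝ≥0∞)]
        refine mul_le_mul_right ((hC₂ ψ A hA z _ hd0 hd).trans (le_of_eq ?_)) _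
        rw [show t - n + -(t + β - m) + (n - m) = -β by ring]

lemma lintegral_base_dominant_right' [NeZero n] {t β m : ℝ} (ht : 0 < t) (hβ : 0 < β) (hmn : m < n) :
    ∃ C : ℝ≥0, ∀ (ψ : E → ℝ≥0∞) (A : ℝ≥0∞), Measurable ψ → GrowthBound ψ A (n - m) →
    ∀ z v : E, z ≠ v →
      ∫⁻ x, ∫⁻ y, ind (edist x z ≤ 2 * edist x y ∧ edist z v ≤ edist x y) *
        (edist x y ^ (-n - (t + β - m)) * edist x z ^ (t - n) * ψ y) ≤
        C * A * edist z v ^ (-β) := by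
  obtain ⟨C₁, hC₁⟩ := lintegral_edist_rpow_max_le_volume (n := n) (a := t - n)
    (b := -n - (t + β - m)) (by linarith) (by linarith)
  obtain ⟨C₂, hC₂⟩ := lintegral_edist_rpow_max_le (n := n) (a := 0) (b := -n - (β - m))
    (e := n - m) (by linarith) (by linarith)
  have h3 : (3 : ℝ≥0∞) ^ (n + (t + β - m)) ≠ ∞ :=
    rpow_ne_top_of_nonneg (by linarith) (by simp)
  refine ⟨((3 : ℝ≥0∞) ^ (n + (t + β - m))).toNNReal * C₁ * C₂, fun ψ A hψ hA z v hzv => ?_⟩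
  have hd0 := (edist_pos.2 hzv).ne'
  have hd := edist_ne_top z v
  have hm1 : Measurable fun u : E × E => ind (edist u.1 z ≤ 2 * edist u.1 u.2 ∧
      edist z v ≤ edist u.1 u.2) *
      (edist u.1 u.2 ^ (-n - (t + β - m)) * edist u.1 z ^ (t - n) * ψ u.2) := by
    exact Measurable.mul (measurable_ind_and (measurable_ind_le (by fun_prop) (by fun_prop))
      (measurable_ind_le measurable_const (by fun_prop)))
      (Measurable.mul (by fun_prop) (hψ.comp measurable_snd))
  rw [lintegral_lintegral_swap hm1.aemeasurable]
  calc _ ≤ ∫⁻ y, (3 ^ (n + (t + β - m)) * C₁) * (edist z y ^ (0 : ℝ) *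
          max (edist z v) (edist z y) ^ (-n - (β - m)) * ψ y) := by
        refine lintegral_mono fun y => ?_
        obtain ⟨M, hM⟩ : ∃ M, M = max (edist z v) (edist z y) := ⟨_, rfl⟩
        have hM0 : M ≠ 0 := by rw [hM]; exact ne_bot_of_le_ne_bot hd0 (le_max_left _ _)
        have hMt : M ≠ ∞ := by rw [hM]; exact max_ne_top hd (edist_ne_top _ _)
        have hCz := hC₁ z M hM0 hMt
        -- in the region of integration `|y - z| ≤ |x - y| + |x - z| ≤ 3 |x - y|`
        have hpt : ∀ x, ind (edist x z ≤ 2 * edist x y ∧ edist z v ≤ edist x y) *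
            (edist x y ^ (-n - (t + β - m)) * edist x z ^ (t - n) * ψ y) ≤
            (edist z x ^ (t - n) * max M (edist z x) ^ (-n - (t + β - m))) *
              (3 ^ (n + (t + β - m)) * ψ y) := fun x => by
          refine ind_mul_le_of_imp fun h => ?_
          have h1 : max M (edist z x) ≤ 3 * edist x y := by
            rw [hM]
            refine max_le (max_le ?_ ?_) ?_
            · exact h.2.trans (le_mul_of_one_le_left zero_le (by norm_num))
            · calc edist z y ≤ edist x z + edist x y := by
                    rw [edist_comm x z]; exact edist_triangle _ _ _
                _ ≤ 2 * edist x y + edist x y := by gcongr; exact h.1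
                _ = 3 * edist x y := by ring
            · rw [edist_comm]
              exact h.1.trans (by gcongr; norm_num)
          have h2 := rpow_le_mul_rpow_of_nonpos (c := 3) (by simp) (by simp)
            (e := -n - (t + β - m)) (by linarith) h1
          rw [show -(-n - (t + β - m)) = n + (t + β - m) by ring] at h2
          calc _ ≤ (3 ^ (n + (t + β - m)) * max M (edist z x) ^ (-n - (t + β - m))) *
                edist x z ^ (t - n) * ψ y := by gcongr
            _ = _ := by rw [edist_comm x z]; ring
        refine (lintegral_mono hpt).trans ?_
        have hm2 : Measurable fun x : E => edist z x ^ (t - n) *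
            max M (edist z x) ^ (-n - (t + β - m)) := by fun_prop
        rw [lintegral_mul_const _ hm2, rpow_zero, one_mul, ← hM]
        refine (mul_le_mul_left hCz _).trans (le_of_eq ?_)
        rw [show t - n + (-n - (t + β - m)) + n = -n - (β - m) by ring]
        ring
    _ ≤ _ := by
        rw [lintegral_const_mul' _ _ (mul_ne_top h3 coe_ne_top), coe_mul,
          coe_mul, coe_toNNReal h3, mul_assoc (_ * _), mul_assoc (_ * _)]
        refine mul_le_mul_right ((hC₂ ψ A hA z _ hd0 hd).trans (le_of_eq ?_)) _
        rw [show 0 + (-n - (β - m)) + (n - m) = -β by ring, mul_assoc]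

/-! ### Summation over the scales -/

/-- A decomposition of the pairs of points according to the dyadic size of the smallest ball around
`x₀` which contains both of them. -/
def pairShell (x₀ : E) (ρ : ℝ) : ℕ → Set (E × E)
  | 0 => ball x₀ (2 ^ 4 * ρ) ×ˢ ball x₀ (2 ^ 4 * ρ)
  | j + 1 => ball x₀ (2 ^ (j + 1 + 4) * ρ) ×ˢ ball x₀ (2 ^ (j + 1 + 4) * ρ) \
      ball x₀ (2 ^ (j + 4) * ρ) ×ˢ ball x₀ (2 ^ (j + 4) * ρ)

lemma pairShell_subset (x₀ : E) (ρ : ℝ) (j : ℕ) : pairShell x₀ ρ j ⊆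
    ball x₀ (2 ^ (j + 4) * ρ) ×ˢ ball x₀ (2 ^ (j + 4) * ρ) := by
  cases j with
  | zero => exact le_of_eq (by simp [pairShell])
  | succ j => exact sdiff_subset

lemma measurableSet_pairShell (x₀ : E) (ρ : ℝ) (j : ℕ) : MeasurableSet (pairShell x₀ ρ j) := by
  cases j with
  | zero => exact measurableSet_ball.prod measurableSet_ball
  | succ j =>
    exact MeasurableSet.diff (measurableSet_ball.prod measurableSet_ball)
      (measurableSet_ball.prod measurableSet_ball)

lemma iUnion_pairShell (x₀ : E) {ρ : ℝ} (hρ : 0 < ρ) : ⋃ j, pairShell x₀ ρ j = univ := by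
  classical
  refine eq_univ_of_forall fun u => ?_
  have hex : ∃ j, u ∈ ball x₀ (2 ^ (j + 4) * ρ) ×ˢ ball x₀ (2 ^ (j + 4) * ρ) := by
    obtain ⟨i, hi⟩ := exists_mem_ball_dyadic x₀ hρ u.1
    obtain ⟨j, hj⟩ := exists_mem_ball_dyadic x₀ hρ u.2
    refine ⟨max i j, ball_subset_ball ?_ hi, ball_subset_ball ?_ hj⟩
    · exact mul_le_mul_of_nonneg_right (pow_le_pow_right₀ one_le_two (by omega)) hρ.le
    · exact mul_le_mul_of_nonneg_right (pow_le_pow_right₀ one_le_two (by omega)) hρ.le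
  rw [mem_iUnion]
  refine ⟨Nat.find hex, ?_⟩
  have h1 := Nat.find_spec hex
  have h2 := fun m => Nat.find_min hex (m := m)
  generalize Nat.find hex = k at h1 h2
  cases k with
  | zero => simpa [pairShell] using h1
  | succ k => exact ⟨h1, h2 k (Nat.lt_succ_self k)⟩

/-- For a pair in a far shell, one of the two points is much farther from the points of the ball
than these are from each other. -/
lemma edist_le_of_mem_pairShell {x₀ : E} {ρ : ℝ} {j : ℕ} {x y : E} {u : E × E}
    (hx : x ∈ ball x₀ ρ) (hy : y ∈ ball x₀ ρ) (hu : u ∈ pairShell x₀ ρ (j + 1)) :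
    3 * edist x y ≤ 2⁻¹ ^ (j + 1) * (edist x u.1 + edist u.1 u.2) := by
  rw [mem_ball] at hx hy
  have hxy : dist x y ≤ 2 * ρ := by linarith [dist_triangle_right x y x₀]
  have hρ : 0 < ρ := dist_nonneg.trans_lt hx
  have h1 : 1 ≤ (2 : ℝ) ^ j := one_le_pow₀ one_le_two
  have hfar : ∀ z, 2 ^ (j + 4) * ρ ≤ dist z x₀ → 15 * 2 ^ j * ρ ≤ dist x z := by
    intro z hz
    rw [pow_add] at hz
    nlinarith [dist_triangle z x x₀, dist_comm z x]
  have h2 : 15 * 2 ^ j * ρ ≤ dist x u.1 + dist u.1 u.2 := by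
    have h3 : ¬(u.1 ∈ ball x₀ (2 ^ (j + 4) * ρ) ∧ u.2 ∈ ball x₀ (2 ^ (j + 4) * ρ)) :=
      hu.2
    rw [not_and_or, mem_ball, mem_ball, not_lt, not_lt] at h3
    rcases h3 with h3 | h3
    · linarith [hfar _ h3, dist_nonneg (x := u.1) (y := u.2)]
    · linarith [hfar _ h3, dist_triangle x u.1 u.2]
  have h4 : 3 * dist x y ≤ 2⁻¹ ^ (j + 1) * (dist x u.1 + dist u.1 u.2) := by
    calc 3 * dist x y ≤ 15 / 2 * ρ := by linarith
      _ = 2⁻¹ ^ (j + 1) * (15 * 2 ^ j * ρ) := by rw [pow_succ, inv_pow]; field_simp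
      _ ≤ _ := by gcongr
  have h5 := ofReal_le_ofReal h4
  rwa [ofReal_mul (by norm_num), ofReal_mul (by positivity),
    ofReal_add dist_nonneg dist_nonneg, ofReal_pow (by norm_num),
    ENNReal.ofReal_inv_of_pos (by norm_num), ofReal_ofNat, ofReal_ofNat,
    ← edist_dist, ← edist_dist, ← edist_dist] at h5

lemma setLIntegral_iterated_mono {α β γ : Type*} [MeasurableSpace α] [MeasurableSpace β]
    [MeasurableSpace γ] {μ₁ : Measure α} {μ₂ : Measure β} {μ₃ : Measure γ} {A : Set α} {B : Set β}
    {Z : Set γ} (hA : MeasurableSet A) (hB : MeasurableSet B) (hZ : MeasurableSet Z)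
    {J K : α → β → γ → ℝ≥0∞} (h : ∀ x ∈ A, ∀ y ∈ B, ∀ z ∈ Z, J x y z ≤ K x y z) :
    ∫⁻ x in A, ∫⁻ y in B, ∫⁻ z in Z, J x y z ∂μ₃ ∂μ₂ ∂μ₁ ≤
      ∫⁻ x in A, ∫⁻ y in B, ∫⁻ z in Z, K x y z ∂μ₃ ∂μ₂ ∂μ₁ :=
  setLIntegral_mono' hA fun x hx => setLIntegral_mono' hB fun y hy =>
    setLIntegral_mono' hZ fun z hz => h x hx y hy z hz

lemma lintegral_iterated_le_scaleSum {J : E → E → E × E → ℝ≥0∞}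
    (hJ : Measurable fun u : E × E × (E × E) => J u.1 u.2.1 u.2.2) (x₀ : E) {ρ : ℝ}
    (hρ : 0 < ρ) {K w : ℝ≥0∞} {s : ℝ} {f : E → F} {h : E → G}
    (hK : ∀ j, ∫⁻ x in ball x₀ ρ, ∫⁻ y in ball x₀ ρ, ∫⁻ u in pairShell x₀ ρ j,
      J x y u ≤ K * (w ^ j * (gagliardoEnergy (ball x₀ ρ) (n / s) f ^ (1 - s / n) *
        gagliardoEnergy (ball x₀ (2 ^ (j + 4) * ρ)) (n / s) h ^ (s / n)))) :
    ∫⁻ x in ball x₀ ρ, ∫⁻ y in ball x₀ ρ, ∫⁻ u, J x y u ≤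
      K * scaleSum w s x₀ ρ f h := by
  have hm3 : Measurable fun u : (E × E) × (E × E) => J u.1.1 u.1.2 u.2 :=
    hJ.comp (show Measurable fun u : (E × E) × (E × E) => (u.1.1, u.1.2, u.2) by fun_prop)
  have hm2 : ∀ j, Measurable fun u : E × E => ∫⁻ z in pairShell x₀ ρ j, J u.1 u.2 z :=
    fun j => hm3.lintegral_prod_right'
  have hm1 : ∀ j, Measurable fun x : E =>
      ∫⁻ y in ball x₀ ρ, ∫⁻ z in pairShell x₀ ρ j, J x y z :=
    fun j => (hm2 j).lintegral_prod_right'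
  calc _ ≤ ∫⁻ x in ball x₀ ρ, ∫⁻ y in ball x₀ ρ,
        ∑' j, ∫⁻ u in pairShell x₀ ρ j, J x y u := by
        refine lintegral_mono fun x => lintegral_mono fun y => ?_
        rw [← setLIntegral_univ, ← iUnion_pairShell x₀ hρ]
        exact lintegral_iUnion_le _ _
    _ = ∑' j, ∫⁻ x in ball x₀ ρ, ∫⁻ y in ball x₀ ρ,
        ∫⁻ u in pairShell x₀ ρ j, J x y u := by
        rw [← lintegral_tsum fun j => (hm1 j).aemeasurable]
        refine lintegral_congr fun x => ?_
        have hx : ∀ j, Measurable fun y : E => ∫⁻ z in pairShell x₀ ρ j, J x y z :=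
          fun j => (hm2 j).comp measurable_prodMk_left
        rw [← lintegral_tsum fun j => (hx j).aemeasurable]
    _ ≤ _ := by
        unfold scaleSum
        rw [← tsum_mul_left]
        exact tsum_le_tsum hK

/-- The part in a region `P` of a quadrilinear form with a kernel which is a product of powers of
`|x - y|`, `|x - z|`, `|z - v|` and of a weight `w x y z`, at `u = (z, v)`. -/
noncomputable def regionForm (P : E → E → E → E → Prop) (s t a b : ℝ) (f : E → F) (h : E → G)
    (w : E → E → E → ℝ≥0∞) (x y : E) (u : E × E) : ℝ≥0∞ :=
  ind (P x y u.1 u.2) * (edist (f x) (f y) ^ ((n : ℝ) / s - 1) * edist (h u.1) (h u.2) *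
    (edist x y ^ a * edist x u.1 ^ b * edist u.1 u.2 ^ (-(n + t) : ℝ) * w x y u.1))

lemma measurable_regionForm {P : E → E → E → E → Prop}
    (hP : Measurable fun u : E × E × (E × E) => ind (P u.1 u.2.1 u.2.2.1 u.2.2.2)) (s t a b : ℝ)
    {f : E → F} {h : E → G} (hf : StronglyMeasurable f) (hh : StronglyMeasurable h)
    {w : E → E → E → ℝ≥0∞} (hw : Measurable fun u : E × E × E => w u.1 u.2.1 u.2.2) :
    Measurable fun u : E × E × (E × E) => regionForm P s t a b f h w u.1 u.2.1 u.2.2 := by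
  have hw' : Measurable fun u : E × E × (E × E) => w u.1 u.2.1 u.2.2.1 :=
    hw.comp (show Measurable fun u : E × E × (E × E) => (u.1, u.2.1, u.2.2.1) by fun_prop)
  unfold regionForm
  refine hP.mul (Measurable.mul (Measurable.mul (Measurable.pow_const ?_ _) ?_)
    (Measurable.mul (by fun_prop) hw'))
  · exact measurable_edist_map hf (by fun_prop) (by fun_prop)
  · exact measurable_edist_map hh (by fun_prop) (by fun_prop)

lemma regionForm_mono {P Q : E → E → E → E → Prop} {s t a b : ℝ} {f : E → F} {h : E → G}
    {w : E → E → E → ℝ≥0∞} {x y : E} {u : E × E} (hPQ : P x y u.1 u.2 → Q x y u.1 u.2) :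
    regionForm P s t a b f h w x y u ≤ regionForm Q s t a b f h w x y u :=
  mul_le_mul_left (ind_mono hPQ) _

/-- The region where `|z - v|` dominates, with the ratio `l` of `|x - y|` and `|z - v|`. -/
def incrementRegion (l : ℝ≥0∞) (x y z v : E) : Prop :=
  edist x y ≤ l * edist z v ∧ edist x z ≤ 2 * edist z v

/-- The region where `|x - z|` dominates, with the ratio `l` of `|x - y|` and `|x - z|`. -/
def poleRegion (l : ℝ≥0∞) (x y z v : E) : Prop :=
  edist x y ≤ l * edist x z ∧ edist z v ≤ edist x z

/-- The region where `|x - y|` dominates. -/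
def baseRegion (x y z v : E) : Prop :=
  edist x z ≤ 2 * edist x y ∧ edist z v ≤ edist x y

lemma measurable_ind_incrementRegion (l : ℝ≥0∞) : Measurable fun u : E × E × (E × E) =>
    ind (incrementRegion l u.1 u.2.1 u.2.2.1 u.2.2.2) :=
  measurable_ind_and (measurable_ind_le (by fun_prop) (by fun_prop))
      (measurable_ind_le (by fun_prop) (by fun_prop))

lemma measurable_ind_poleRegion (l : ℝ≥0∞) : Measurable fun u : E × E × (E × E) =>
    ind (poleRegion l u.1 u.2.1 u.2.2.1 u.2.2.2) :=
  measurable_ind_and (measurable_ind_le (by fun_prop) (by fun_prop))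
      (measurable_ind_le (by fun_prop) (by fun_prop))

lemma measurable_ind_baseRegion : Measurable fun u : E × E × (E × E) =>
    ind (baseRegion u.1 u.2.1 u.2.2.1 u.2.2.2) :=
  measurable_ind_and (measurable_ind_le (by fun_prop) (by fun_prop))
      (measurable_ind_le (by fun_prop) (by fun_prop))

lemma incrementRegion_of_mem_pairShell {x₀ : E} {ρ : ℝ} {j : ℕ} {x y : E} {u : E × E}
    (hx : x ∈ ball x₀ ρ) (hy : y ∈ ball x₀ ρ) (hu : u ∈ pairShell x₀ ρ j) (h : incrementRegion 1 x y u.1 u.2) :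
    incrementRegion (2⁻¹ ^ j) x y u.1 u.2 := by
  refine ⟨?_, h.2⟩
  cases j with
  | zero => simpa using h.1
  | succ j =>
    have h1 := edist_le_of_mem_pairShell hx hy hu
    have h3 : (3 : ℝ≥0∞) ≠ 0 := by norm_num
    refine (ENNReal.mul_le_mul_iff_right h3 ofNat_ne_top).1 ?_
    calc _ ≤ _ := h1
      _ ≤ 2⁻¹ ^ (j + 1) * (2 * edist u.1 u.2 + edist u.1 u.2) := by gcongr; exact h.2
      _ = _ := by ring

lemma poleRegion_of_mem_pairShell {x₀ : E} {ρ : ℝ} {j : ℕ} {x y : E} {u : E × E}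
    (hx : x ∈ ball x₀ ρ) (hy : y ∈ ball x₀ ρ) (hu : u ∈ pairShell x₀ ρ j) (h : poleRegion 1 x y u.1 u.2) :
    poleRegion (2⁻¹ ^ j) x y u.1 u.2 := by
  refine ⟨?_, h.2⟩
  cases j with
  | zero => simpa using h.1
  | succ j =>
    have h1 := edist_le_of_mem_pairShell hx hy hu
    have h3 : (3 : ℝ≥0∞) ≠ 0 := by norm_num
    refine (ENNReal.mul_le_mul_iff_right h3 ofNat_ne_top).1 ?_
    calc _ ≤ _ := h1
      _ ≤ 2⁻¹ ^ (j + 1) * (edist x u.1 + edist x u.1) := by gcongr; exact h.2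
      _ = 2 * (2⁻¹ ^ (j + 1) * edist x u.1) := by ring
      _ ≤ _ := by gcongr; norm_num

lemma not_baseRegion_of_mem_pairShell {x₀ : E} {ρ : ℝ} {j : ℕ} {x y : E} {u : E × E}
    (hx : x ∈ ball x₀ ρ) (hy : y ∈ ball x₀ ρ)
    (hxy : x ≠ y) (hu : u ∈ pairShell x₀ ρ (j + 1)) : ¬baseRegion x y u.1 u.2 := by
  intro h
  have h1 := edist_le_of_mem_pairShell hx hy hu
  have h2 : 3 * edist x y ≤ 3 * (2⁻¹ * edist x y) := by
    calc _ ≤ _ := h1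
      _ ≤ 2⁻¹ ^ (j + 1) * (2 * edist x y + edist x y) := by gcongr; exacts [h.1, h.2]
      _ = 2⁻¹ ^ j * (3 * (2⁻¹ * edist x y)) := by ring
      _ ≤ 1 * _ := by gcongr; exact pow_le_one' (by simp) j
      _ = _ := one_mul _
  have h3 : (3 : ℝ≥0∞) ≠ 0 := by norm_num
  rw [ENNReal.mul_le_mul_iff_right h3 ofNat_ne_top] at h2
  have h4 : 2⁻¹ * edist x y < edist x y := by
    rw [mul_comm, ← div_eq_mul_inv]
    exact ENNReal.half_lt_self (edist_pos.2 hxy).ne' (edist_ne_top x y)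
  exact absurd h2 (not_le.2 h4)

/-! ### Quadrilinear estimates in the three regions -/

/-- The trace inequality in the form in which it bounds the energy factor of `h`. -/
lemma lintegral_trace_mul_le [NeZero n] {p κ : ℝ} (hp : 1 ≤ p) (hκ : 0 < κ) (hκn : κ < n) :
    ∃ C : ℝ≥0, ∀ h : E → G, StronglyMeasurable h → ∀ (Ψ : E → ℝ≥0∞) (A : ℝ≥0∞), Measurable Ψ →
    GrowthBound Ψ A (n - κ) → ∀ (e i : ℝ), e + i = κ - 2 * n → ∀ (c : ℝ≥0) (x₀ : E) (M : ℝ),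
      ∫⁻ z in ball x₀ M, ∫⁻ v in ball x₀ M,
          edist (h z) (h v) ^ p * edist z v ^ e * (c * (edist z v ^ i * Ψ z))
        ≤ C * (c * A) * gagliardoEnergy (ball x₀ M) p h := by
  obtain ⟨C, hC⟩ := lintegral_trace_le (n := n) (F := G) hp hκ hκn
  refine ⟨C, fun h hh Ψ A hΨ hA e i hei c x₀ M => ?_⟩
  calc _ = ∫⁻ z in ball x₀ M, c * ∫⁻ v in ball x₀ M,
          edist (h z) (h v) ^ p * edist z v ^ (κ - 2 * n) * Ψ z := by
        refine lintegral_congr fun z => ?_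
        rw [← lintegral_const_mul' _ _ coe_ne_top]
        refine lintegral_congr_ae ?_
        filter_upwards [ae_edist_ne z (ball x₀ M)] with v hv
        rw [← hei, rpow_add _ _ hv.1 hv.2]
        ring
    _ = c * ∫⁻ z in ball x₀ M, ∫⁻ v in ball x₀ M,
          edist (h z) (h v) ^ p * edist z v ^ (κ - 2 * n) * Ψ z :=
        lintegral_const_mul' _ _ coe_ne_top
    _ ≤ c * (C * A * gagliardoEnergy (ball x₀ M) p h) :=
        mul_le_mul_right (hC h hh Ψ A hΨ hA x₀ M) _
    _ = _ := by ring

lemma inv_two_pow_rpow_rpow (j : ℕ) (a b : ℝ) :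
    (((2⁻¹ : ℝ≥0∞) ^ j) ^ a) ^ b = (2⁻¹ ^ (b * a)) ^ j := by
  rw [← rpow_natCast, ← rpow_natCast, ← rpow_mul, ← rpow_mul,
    ← rpow_mul]
  congr 1
  ring

/-- The quadrilinear estimate in the region where `|z - v|` dominates. -/
lemma lintegral_incrementRegion_le [NeZero n] {s t t' τ i : ℝ} (hs0 : 0 < s) (hs1 : s < 1)
    (hτ : 0 < τ) (hτe : 2 * τ = t + t' - s) (hi0 : 0 < n / s * t' - 2 * τ + i)
    (hin : n / s * t' - 2 * τ + i < n) : ∃ C : ℝ≥0, ∀ (f : E → F) (h : E → G),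
    StronglyMeasurable f → StronglyMeasurable h →
    ∀ (w : E → E → E → ℝ≥0∞), (Measurable fun u : E × E × E => w u.1 u.2.1 u.2.2) →
    ∀ (Ψ : E → ℝ≥0∞) (A : ℝ≥0∞) (c : ℝ≥0), Measurable Ψ →
    GrowthBound Ψ A (n - (n / s * t' - 2 * τ + i)) →
    (∀ l : ℝ≥0∞, l ≤ 1 → ∀ z v, z ≠ v →
      ∫⁻ x, ∫⁻ y, ind (edist x y ≤ l * edist z v ∧ edist x z ≤ 2 * edist z v) *
        (edist x y ^ (τ - n) * edist x z ^ (τ - n) * w x y z ^ ((n : ℝ) / s)) ≤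
        c * (edist z v ^ i * Ψ z)) →
    ∀ (x₀ : E) (ρ : ℝ), 0 < ρ →
      ∫⁻ x in ball x₀ ρ, ∫⁻ y in ball x₀ ρ, ∫⁻ u,
        regionForm (incrementRegion 1) s t (-(2 * n) + t + t' - τ) (τ - n) f h w x y u
      ≤ C * (c * A) ^ (s / n) * scaleSum (2⁻¹ ^ ((1 - s / n) * τ)) s x₀ ρ f h := by
  have hn : (1 : ℝ) ≤ n := mod_cast NeZero.one_le
  have hn0 : (n : ℝ) ≠ 0 := by positivity
  have hp : 1 ≤ (n : ℝ) / s := by rw [le_div_iff₀ hs0]; linarith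
  have hθ : 0 ≤ 1 - s / n := by rw [sub_nonneg, div_le_one (by linarith)]; linarith
  have hθ0 : 0 ≤ s / n := by positivity
  obtain ⟨C₁, hC₁⟩ := lintegral_increment_dominant_left (n := n) hτ
  obtain ⟨C₂, hC₂⟩ := lintegral_trace_mul_le (n := n) (G := G) hp hi0 hin
  refine ⟨C₁ ^ (1 - s / n) * C₂ ^ (s / n), fun f h hf hh w hw Ψ A c hΨ hA hV x₀ ρ hρ =>
    lintegral_iterated_le_scaleSum
      (measurable_regionForm (measurable_ind_incrementRegion 1) _ _ _ _ hf hh hw) x₀ hρ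
      fun j => ?_⟩
  obtain ⟨l, hl⟩ : ∃ l : ℝ≥0∞, l = 2⁻¹ ^ j := ⟨_, rfl⟩
  have hl0 : l ≠ 0 := hl ▸ pow_ne_zero _ (by simp)
  have hl1 : l ≤ 1 := hl ▸ pow_le_one' (by simp) j
  refine (setLIntegral_iterated_mono measurableSet_ball measurableSet_ball
    (measurableSet_pairShell x₀ ρ j) fun x hx y hy u hu => regionForm_mono
      fun hu' => hl ▸ incrementRegion_of_mem_pairShell hx hy hu hu').trans ?_
  refine (lintegral_quadrilinear_le hs0 hs1 hf hh
    (P := incrementRegion l) (measurable_ind_incrementRegion l)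
    (w := w) (w₁ := fun _ _ _ => 1) (w₂ := fun x y z => w x y z ^ ((n : ℝ) / s)) measurable_const
    (hw.pow_const _) (fun x y z => by
      rw [one_rpow, one_mul, ← rpow_mul, show (n : ℝ) / s * (s / n) = 1 by field_simp,
        rpow_one])
    (er₁ := -(2 * n) + τ) (er₂ := τ - n) (eq₁ := τ - n) (eq₂ := τ - n) (ed₁ := -n - 2 * τ)
    (ed₂ := -2 * n + n / s * t' - 2 * τ) (K₁ := C₁ * l ^ τ) (K₂ := C₂ * (c * A))
    (W := fun z v => c * (edist z v ^ i * Ψ z)) ?_ ?_ ?_ ?_ ?_ (hV l hl1) _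
    (pairShell_subset x₀ ρ j) ?_).trans (le_of_eq ?_)
  · have ht : t' = 2 * τ + s - t := by linarith
    subst ht
    field_simp
    ring
  · field_simp; ring
  · have ht : t' = 2 * τ + s - t := by linarith
    subst ht
    field_simp
    ring
  · exact measurable_const.mul (Measurable.mul (by fun_prop) (hΨ.comp measurable_fst))
  · intro x y hxy
    rw [show -(2 * n) - (-(2 * n) + τ) = -τ by ring, mul_assoc]
    exact hC₁ l hl0 (ne_top_of_le_ne_top one_ne_top hl1) x y hxy
  · exact hC₂ h hh Ψ A hΨ hA _ i (by ring) c x₀ _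
  · rw [mul_rpow_of_nonneg _ _ hθ, mul_rpow_of_nonneg _ _ hθ0, coe_mul,
      coe_rpow_of_nonneg _ hθ, coe_rpow_of_nonneg _ hθ0]
    rw [← inv_two_pow_rpow_rpow, ← hl]
    ring

/-- The quadrilinear estimate in the region where `|x - z|` dominates. -/
lemma lintegral_poleRegion_le [NeZero n] {s t m₁ m₂ e τ : ℝ} (hs0 : 0 < s) (hs1 : s < 1)
    (hts : t < s) (he : e = -n - 1 + t + m₁ * (1 - s / n) + m₂ * (s / n)) (hτ : τ ≤ 1 - s) :
    ∃ C : ℝ≥0, ∀ (f : E → F) (h : E → G), StronglyMeasurable f → StronglyMeasurable h →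
    ∀ (ψ₁ ψ₂ : E → ℝ≥0∞) (A₁ A₂ : ℝ≥0∞), Measurable ψ₁ →
    Measurable ψ₂ → GrowthBound ψ₁ A₁ (n - m₁) → GrowthBound ψ₂ A₂ (n - m₂) →
    ∀ (x₀ : E) (ρ : ℝ), 0 < ρ →
      ∫⁻ x in ball x₀ ρ, ∫⁻ y in ball x₀ ρ, ∫⁻ u,
        regionForm (poleRegion 1) s t (1 - 2 * n) e f h
          (fun x _ z => ψ₁ z ^ (1 - s / n) * ψ₂ x ^ (s / n)) x y u
      ≤ C * (A₁ ^ (1 - s / n) * A₂ ^ (s / n)) *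
        scaleSum (2⁻¹ ^ ((1 - s / n) * τ)) s x₀ ρ f h := by
  have hn : (1 : ℝ) ≤ n := mod_cast NeZero.one_le
  have hn0 : (n : ℝ) ≠ 0 := by positivity
  have hθ : 0 ≤ 1 - s / n := by rw [sub_nonneg, div_le_one (by linarith)]; linarith
  have hθ0 : 0 ≤ s / n := by positivity
  obtain ⟨C₁, hC₁⟩ := lintegral_pole_dominant_left (n := n) (ε := 1 - s) (β := s - t) (m := m₁)
    (by linarith) (by linarith)
  obtain ⟨C₂, hC₂⟩ := lintegral_pole_dominant_right (n := n) (α := 1 - s) (β := s - t) (m := m₂)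
    (by linarith) (by linarith)
  refine ⟨C₁ ^ (1 - s / n) * C₂ ^ (s / n), fun f h hf hh ψ₁ ψ₂ A₁ A₂ hm₁ hm₂ hA₁ hA₂ x₀ ρ hρ =>
    lintegral_iterated_le_scaleSum
      (measurable_regionForm (measurable_ind_poleRegion 1) _ _ _ _ hf hh (by fun_prop)) x₀ hρ
      fun j => ?_⟩
  obtain ⟨l, hl⟩ : ∃ l : ℝ≥0∞, l = 2⁻¹ ^ j := ⟨_, rfl⟩
  have hl0 : l ≠ 0 := hl ▸ pow_ne_zero _ (by simp)
  have hl1 : l ≤ 1 := hl ▸ pow_le_one' (by simp) j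
  refine (setLIntegral_iterated_mono measurableSet_ball measurableSet_ball
    (measurableSet_pairShell x₀ ρ j) fun x hx y hy u hu => regionForm_mono
      fun hu' => hl ▸ poleRegion_of_mem_pairShell hx hy hu hu').trans ?_
  refine (lintegral_quadrilinear_le hs0 hs1 hf hh
    (P := poleRegion l) (measurable_ind_poleRegion l)
    (w := fun x _ z => ψ₁ z ^ (1 - s / n) * ψ₂ x ^ (s / n)) (w₁ := fun _ _ z => ψ₁ z)
    (w₂ := fun x _ _ => ψ₂ x) (hm₁.comp (measurable_snd.comp measurable_snd))
    (hm₂.comp measurable_fst) (fun x y z => rfl)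
    (er₁ := -(2 * n) + (1 - s)) (er₂ := (1 - s) - n) (eq₁ := -n - (1 - s) + m₁ - (s - t))
    (eq₂ := -n - (1 - s) - (s - t) + m₂) (ed₁ := (s - t) - n) (ed₂ := -2 * n + (s - t))
    (K₁ := C₁ * A₁ * l ^ (1 - s)) (K₂ := C₂ * A₂)
    (W := fun z v => C₂ * A₂ * edist z v ^ (-(s - t))) ?_ ?_ ?_ ?_ ?_
    (hC₂ ψ₂ A₂ hA₂ l hl1) _ (pairShell_subset x₀ ρ j) ?_).trans ?_
  · field_simp; ring
  · rw [he]; field_simp; ring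
  · field_simp; ring
  · exact measurable_const.mul (by fun_prop)
  · intro x y hxy
    rw [show -(2 * n) - (-(2 * n) + (1 - s)) = -(1 - s) by ring, mul_assoc]
    exact hC₁ ψ₁ A₁ hA₁ l hl0 (ne_top_of_le_ne_top one_ne_top hl1) x y hxy
  · exact lintegral_le_mul_gagliardoEnergy (e := -2 * n + (s - t)) (e' := -(s - t)) (by ring) hh _ _
      fun z v _ => le_rfl
  · rw [mul_rpow_of_nonneg _ _ hθ, mul_rpow_of_nonneg _ _ hθ,
      mul_rpow_of_nonneg _ _ hθ0, coe_mul, coe_rpow_of_nonneg _ hθ,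
      coe_rpow_of_nonneg _ hθ0, ← inv_two_pow_rpow_rpow, ← hl]
    have hg : (l ^ (1 - s)) ^ (1 - s / n) ≤ (l ^ τ) ^ (1 - s / n) :=
      rpow_le_rpow (ENNReal.rpow_le_rpow_of_exponent_ge hl1 hτ) hθ
    refine (mul_le_mul_left (mul_le_mul_left (mul_le_mul_right hg _) _) _).trans (le_of_eq ?_)
    ring

/-- The quadrilinear estimate in the region where `|x - y|` dominates. -/
lemma lintegral_baseRegion_le [NeZero n] {s t m₁ m₂ e : ℝ} (hs0 : 0 < s) (hs1 : s < 1)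
    (ht0 : 0 < t) (hts : t < s) (hm₁ : m₁ < t) (hm₂ : m₂ < t)
    (he : e = -(2 * n) + m₁ * (1 - s / n) + m₂ * (s / n)) (σ : ℝ) : ∃ C : ℝ≥0,
    ∀ (f : E → F) (h : E → G), StronglyMeasurable f → StronglyMeasurable h →
    ∀ (ψ₁ ψ₂ : E → ℝ≥0∞) (A₁ A₂ : ℝ≥0∞), Measurable ψ₁ →
    Measurable ψ₂ → GrowthBound ψ₁ A₁ (n - m₁) → GrowthBound ψ₂ A₂ (n - m₂) →
    ∀ (k : E → E → E), (k = fun x _ => x) ∨ (k = fun _ y => y) →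
    ∀ (x₀ : E) (ρ : ℝ), 0 < ρ →
      ∫⁻ x in ball x₀ ρ, ∫⁻ y in ball x₀ ρ, ∫⁻ u,
        regionForm baseRegion s t e (t - n) f h
          (fun x y z => ψ₁ z ^ (1 - s / n) * ψ₂ (k x y) ^ (s / n)) x y u
      ≤ C * (A₁ ^ (1 - s / n) * A₂ ^ (s / n)) * scaleSum (2⁻¹ ^ σ) s x₀ ρ f h := by
  have hn : (1 : ℝ) ≤ n := mod_cast NeZero.one_le
  have hn0 : (n : ℝ) ≠ 0 := by positivity
  have hθ : 0 ≤ 1 - s / n := by rw [sub_nonneg, div_le_one (by linarith)]; linarith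
  have hθ0 : 0 ≤ s / n := by positivity
  obtain ⟨C₁, hC₁⟩ := lintegral_base_dominant_left (n := n) (t := t) (β := s - t) (m := m₁)
    (by linarith) hm₁
  obtain ⟨C₂, hC₂⟩ := lintegral_base_dominant_right (n := n) (t := t) (β := s - t) (m := m₂)
    (by linarith) hm₂
  obtain ⟨C₃, hC₃⟩ := lintegral_base_dominant_right' (n := n) (t := t) (β := s - t) (m := m₂)
    ht0 (by linarith) (by linarith)
  refine ⟨C₁ ^ (1 - s / n) * (C₂ + C₃) ^ (s / n),
    fun f h hf hh ψ₁ ψ₂ A₁ A₂ hψ₁ hψ₂ hA₁ hA₂ k hk x₀ ρ hρ => ?_⟩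
  have hkm : Measurable fun u : E × E × E => ψ₂ (k u.1 u.2.1) := by
    rcases hk with rfl | rfl
    · exact hψ₂.comp measurable_fst
    · exact hψ₂.comp (measurable_fst.comp measurable_snd)
  refine lintegral_iterated_le_scaleSum (measurable_regionForm measurable_ind_baseRegion _ _ _ _ hf
    hh (Measurable.mul (by fun_prop) (hkm.pow_const _))) x₀ hρ fun j => ?_
  cases j with
  | zero =>
    refine (lintegral_quadrilinear_le hs0 hs1 hf hh
      (P := baseRegion) measurable_ind_baseRegion
      (w := fun x y z => ψ₁ z ^ (1 - s / n) * ψ₂ (k x y) ^ (s / n)) (w₁ := fun _ _ z => ψ₁ z)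
      (w₂ := fun x y _ => ψ₂ (k x y)) (hψ₁.comp (measurable_snd.comp measurable_snd))
      hkm (fun x y z => rfl)
      (er₁ := -(2 * n) - ((s - t) + t - m₁)) (er₂ := -n - (t + (s - t) - m₂)) (eq₁ := t - n)
      (eq₂ := t - n) (ed₁ := (s - t) - n) (ed₂ := -2 * n + (s - t))
      (K₁ := C₁ * A₁) (K₂ := (C₂ + C₃) * A₂)
      (W := fun z v => (C₂ + C₃) * A₂ * edist z v ^ (-(s - t))) ?_ ?_ ?_ ?_ ?_
      ?_ _ (pairShell_subset x₀ ρ 0) ?_).trans (le_of_eq ?_)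
    · rw [he]; field_simp; ring
    · field_simp; ring
    · field_simp; ring
    · exact measurable_const.mul (by fun_prop)
    · intro x y hxy
      rw [sub_sub_cancel]
      exact hC₁ ψ₁ A₁ hA₁ x y hxy
    · intro z v hzv
      rcases hk with rfl | rfl
      · refine (hC₂ ψ₂ A₂ hA₂ z v hzv).trans ?_
        gcongr
        exact le_self_add
      · refine (hC₃ ψ₂ A₂ hψ₂ hA₂ z v hzv).trans ?_
        gcongr
        exact le_add_self
    · exact lintegral_le_mul_gagliardoEnergy (e := -2 * n + (s - t)) (e' := -(s - t)) (by ring) hh _ _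
        fun z v _ => le_rfl
    · rw [mul_rpow_of_nonneg _ _ hθ, mul_rpow_of_nonneg _ _ hθ0, coe_mul,
        coe_rpow_of_nonneg _ hθ, coe_rpow_of_nonneg _ hθ0, coe_add, pow_zero]
      ring
  | succ j =>
    refine le_of_eq_of_le (b := 0) ?_ zero_le
    refine le_antisymm ?_ zero_le
    calc _ ≤ ∫⁻ x in ball x₀ ρ, ∫⁻ y in ball x₀ ρ, ∫⁻ u in pairShell x₀ ρ (j + 1),
          (0 : ℝ≥0∞) := by
          refine setLIntegral_mono' measurableSet_ball fun x hx => ?_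
          refine lintegral_mono_ae ?_
          filter_upwards [ae_restrict_mem measurableSet_ball,
            ae_restrict_of_ae (Measure.ae_ne volume x)] with y hy hyx
          refine setLIntegral_mono' (measurableSet_pairShell x₀ ρ _) fun u hu => ?_
          unfold regionForm
          rw [ind_of_false (not_baseRegion_of_mem_pairShell hx hy hyx.symm hu), zero_mul]
      _ = 0 := by simp

/-- The majorant of the quadrilinear form: the weights `V x`, `V y` and `V z` in the three
regions. -/
noncomputable def quadMajorant (s t t' τ : ℝ) (f : E → F) (h : E → G) (V : E → ℝ≥0∞)
    (x y : E) (u : E × E) : ℝ≥0∞ :=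
  (regionForm (incrementRegion 1) s t (-(2 * n) + t + t' - τ) (τ - n) f h (fun x _ _ => V x) x y u +
    (regionForm (incrementRegion 1) s t (-(2 * n) + t + t' - τ) (τ - n) f h (fun _ y _ => V y) x y u +
    regionForm (incrementRegion 1) s t (-(2 * n) + t + t' - τ) (τ - n) f h (fun _ _ z => V z) x y u)) +
  ((regionForm (poleRegion 1) s t (1 - 2 * n) (t + t' - 1 - n) f h (fun x _ _ => V x) x y u +
    regionForm (poleRegion 1) s t (1 - 2 * n) (t + t' - 1 - n) f h (fun _ _ z => V z) x y u) +
  (regionForm baseRegion s t (t' - 2 * n) (t - n) f h (fun x _ _ => V x) x y u +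
    (regionForm baseRegion s t (t' - 2 * n) (t - n) f h (fun _ y _ => V y) x y u +
    regionForm baseRegion s t (t' - 2 * n) (t - n) f h (fun _ _ z => V z) x y u)))

lemma le_regionForm {P : E → E → E → E → Prop} {s t a b : ℝ} {f : E → F} {h : E → G}
    {w : E → E → E → ℝ≥0∞} {x y : E} {u : E × E} (hP : P x y u.1 u.2) :
    edist (f x) (f y) ^ ((n : ℝ) / s - 1) * edist (h u.1) (h u.2) *
    (edist x y ^ a * edist x u.1 ^ b * edist u.1 u.2 ^ (-(n + t) : ℝ) * w x y u.1) ≤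
      regionForm P s t a b f h w x y u := by
  unfold regionForm
  rw [ind_of_true hP, one_mul]

/-- The part of the form with the kernel of the region `|x - z| ≤ 2 |x - y|` is bounded by the
majorant. -/
lemma le_quadMajorant_of_le_two_mul {s t t' τ : ℝ} (hτt : τ ≤ t) (ht1 : t ≤ 1 + τ) (f : E → F)
    (h : E → G) (V : E → ℝ≥0∞) {x y : E} {u : E × E} (hxy : x ≠ y) (hxu : x ≠ u.1)
    (hq : edist x u.1 ≤ 2 * edist x y) :
    edist (f x) (f y) ^ ((n : ℝ) / s - 1) * edist (h u.1) (h u.2) *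
      (edist x y ^ (t' - 2 * n) * edist x u.1 ^ (t - n) * edist u.1 u.2 ^ (-(n + t) : ℝ) *
        (V x + V y + V u.1)) ≤ 2 * quadMajorant s t t' τ f h V x y u := by
  have hr0 : edist x y ≠ 0 := (edist_pos.2 hxy).ne'
  have hq0 : edist x u.1 ≠ 0 := (edist_pos.2 hxu).ne'
  rcases le_total (edist u.1 u.2) (edist x y) with hd | hd
  · have hP : baseRegion x y u.1 u.2 := ⟨hq, hd⟩
    calc _ = edist (f x) (f y) ^ ((n : ℝ) / s - 1) * edist (h u.1) (h u.2) *
          (edist x y ^ (t' - 2 * n) * edist x u.1 ^ (t - n) * edist u.1 u.2 ^ (-(n + t) : ℝ) * V x) +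
          (edist (f x) (f y) ^ ((n : ℝ) / s - 1) * edist (h u.1) (h u.2) *
          (edist x y ^ (t' - 2 * n) * edist x u.1 ^ (t - n) * edist u.1 u.2 ^ (-(n + t) : ℝ) * V y) +
          edist (f x) (f y) ^ ((n : ℝ) / s - 1) * edist (h u.1) (h u.2) *
          (edist x y ^ (t' - 2 * n) * edist x u.1 ^ (t - n) * edist u.1 u.2 ^ (-(n + t) : ℝ) *
            V u.1)) := by ring
      _ ≤ regionForm baseRegion s t (t' - 2 * n) (t - n) f h (fun x _ _ => V x) x y u +
          (regionForm baseRegion s t (t' - 2 * n) (t - n) f h (fun _ y _ => V y) x y u +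
          regionForm baseRegion s t (t' - 2 * n) (t - n) f h (fun _ _ z => V z) x y u) :=
        add_le_add (le_regionForm hP) (add_le_add (le_regionForm hP) (le_regionForm hP))
      _ ≤ quadMajorant s t t' τ f h V x y u := le_add_self.trans le_add_self
      _ ≤ _ := le_mul_of_one_le_left zero_le one_le_two
  · have hP : incrementRegion 1 x y u.1 u.2 := by
      refine ⟨by rwa [one_mul], hq.trans (mul_le_mul_right hd _)⟩
    have hk : edist x y ^ (t' - 2 * n) * edist x u.1 ^ (t - n) ≤
        2 * (edist x y ^ (-(2 * n) + t + t' - τ) * edist x u.1 ^ (τ - n)) := by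
      calc _ = edist x y ^ (t' - 2 * n) * (edist x u.1 ^ (t - τ) * edist x u.1 ^ (τ - n)) := by
            rw [← rpow_add _ _ hq0 (edist_ne_top _ _), show t - τ + (τ - n) = t - n by ring]
        _ ≤ edist x y ^ (t' - 2 * n) * ((2 * edist x y) ^ (t - τ) * edist x u.1 ^ (τ - n)) := by
            gcongr
        _ = 2 ^ (t - τ) * (edist x y ^ (t' - 2 * n) * edist x y ^ (t - τ) *
            edist x u.1 ^ (τ - n)) := by
            rw [mul_rpow_of_nonneg _ _ (by linarith)]
            ring
        _ ≤ 2 ^ (1 : ℝ) * (edist x y ^ (t' - 2 * n) * edist x y ^ (t - τ) *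
            edist x u.1 ^ (τ - n)) := by
            gcongr
            · exact one_le_two
            · linarith
        _ = _ := by
            rw [← rpow_add _ _ hr0 (edist_ne_top _ _), rpow_one,
              show t' - 2 * n + (t - τ) = -(2 * n) + t + t' - τ by ring]
    calc _ ≤ edist (f x) (f y) ^ ((n : ℝ) / s - 1) * edist (h u.1) (h u.2) *
          (2 * (edist x y ^ (-(2 * n) + t + t' - τ) * edist x u.1 ^ (τ - n)) *
            edist u.1 u.2 ^ (-(n + t) : ℝ) * (V x + V y + V u.1)) := by gcongr
      _ = 2 * (edist (f x) (f y) ^ ((n : ℝ) / s - 1) * edist (h u.1) (h u.2) *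
          (edist x y ^ (-(2 * n) + t + t' - τ) * edist x u.1 ^ (τ - n) *
            edist u.1 u.2 ^ (-(n + t) : ℝ) * V x) +
          (edist (f x) (f y) ^ ((n : ℝ) / s - 1) * edist (h u.1) (h u.2) *
          (edist x y ^ (-(2 * n) + t + t' - τ) * edist x u.1 ^ (τ - n) *
            edist u.1 u.2 ^ (-(n + t) : ℝ) * V y) +
          edist (f x) (f y) ^ ((n : ℝ) / s - 1) * edist (h u.1) (h u.2) *
          (edist x y ^ (-(2 * n) + t + t' - τ) * edist x u.1 ^ (τ - n) *
            edist u.1 u.2 ^ (-(n + t) : ℝ) * V u.1))) := by ring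
      _ ≤ 2 * (regionForm (incrementRegion 1) s t (-(2 * n) + t + t' - τ) (τ - n) f h
            (fun x _ _ => V x) x y u +
          (regionForm (incrementRegion 1) s t (-(2 * n) + t + t' - τ) (τ - n) f h
            (fun _ y _ => V y) x y u +
          regionForm (incrementRegion 1) s t (-(2 * n) + t + t' - τ) (τ - n) f h
            (fun _ _ z => V z) x y u)) := mul_le_mul_right
        (add_le_add (le_regionForm hP) (add_le_add (le_regionForm hP) (le_regionForm hP))) _
      _ ≤ _ := mul_le_mul_right le_self_add _

/-- The part of the form with the kernel of the region `|x - y| ≤ |x - z|` is bounded by the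
majorant. -/
lemma le_quadMajorant_of_le {s t t' τ : ℝ} (hτ : t + t' - τ ≤ 1) (f : E → F)
    (h : E → G) (V : E → ℝ≥0∞) {x y : E} {u : E × E} (hxy : x ≠ y) (hxu : x ≠ u.1)
    (hq : edist x y ≤ edist x u.1) :
    edist (f x) (f y) ^ ((n : ℝ) / s - 1) * edist (h u.1) (h u.2) *
      (edist x y ^ (1 - 2 * n : ℝ) * edist x u.1 ^ (t + t' - 1 - n) *
        edist u.1 u.2 ^ (-(n + t) : ℝ) * (V x + V u.1)) ≤ quadMajorant s t t' τ f h V x y u := by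
  have hr0 : edist x y ≠ 0 := (edist_pos.2 hxy).ne'
  have hq0 : edist x u.1 ≠ 0 := (edist_pos.2 hxu).ne'
  rcases le_total (edist u.1 u.2) (edist x u.1) with hd | hd
  · have hP : poleRegion 1 x y u.1 u.2 := ⟨by rwa [one_mul], hd⟩
    calc _ = edist (f x) (f y) ^ ((n : ℝ) / s - 1) * edist (h u.1) (h u.2) *
          (edist x y ^ (1 - 2 * n : ℝ) * edist x u.1 ^ (t + t' - 1 - n) *
            edist u.1 u.2 ^ (-(n + t) : ℝ) * V x) +
          edist (f x) (f y) ^ ((n : ℝ) / s - 1) * edist (h u.1) (h u.2) *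
          (edist x y ^ (1 - 2 * n : ℝ) * edist x u.1 ^ (t + t' - 1 - n) *
            edist u.1 u.2 ^ (-(n + t) : ℝ) * V u.1) := by ring
      _ ≤ regionForm (poleRegion 1) s t (1 - 2 * n) (t + t' - 1 - n) f h (fun x _ _ => V x) x y u +
          regionForm (poleRegion 1) s t (1 - 2 * n) (t + t' - 1 - n) f h (fun _ _ z => V z) x y u :=
        add_le_add (le_regionForm hP) (le_regionForm hP)
      _ ≤ _ := le_self_add.trans le_add_self
  · have hP : incrementRegion 1 x y u.1 u.2 := by
      refine ⟨by rw [one_mul]; exact hq.trans hd, hd.trans ?_⟩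
      exact le_mul_of_one_le_left zero_le one_le_two
    have hk : edist x y ^ (1 - 2 * n : ℝ) * edist x u.1 ^ (t + t' - 1 - n) ≤
        edist x y ^ (-(2 * n) + t + t' - τ) * edist x u.1 ^ (τ - n) := by
      calc _ = edist x y ^ (-(2 * n) + t + t' - τ) * edist x y ^ (1 - (t + t' - τ)) *
            edist x u.1 ^ (t + t' - 1 - n) := by
            rw [← rpow_add _ _ hr0 (edist_ne_top _ _),
              show -(2 * n) + t + t' - τ + (1 - (t + t' - τ)) = 1 - 2 * n by ring]
        _ ≤ edist x y ^ (-(2 * n) + t + t' - τ) * edist x u.1 ^ (1 - (t + t' - τ)) *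
            edist x u.1 ^ (t + t' - 1 - n) := by
            gcongr
        _ = _ := by
            rw [mul_assoc, ← rpow_add _ _ hq0 (edist_ne_top _ _),
              show 1 - (t + t' - τ) + (t + t' - 1 - n) = τ - n by ring]
    calc _ ≤ edist (f x) (f y) ^ ((n : ℝ) / s - 1) * edist (h u.1) (h u.2) *
          (edist x y ^ (-(2 * n) + t + t' - τ) * edist x u.1 ^ (τ - n) *
            edist u.1 u.2 ^ (-(n + t) : ℝ) * (V x + V u.1)) := by gcongr
      _ = edist (f x) (f y) ^ ((n : ℝ) / s - 1) * edist (h u.1) (h u.2) *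
          (edist x y ^ (-(2 * n) + t + t' - τ) * edist x u.1 ^ (τ - n) *
            edist u.1 u.2 ^ (-(n + t) : ℝ) * V x) +
          edist (f x) (f y) ^ ((n : ℝ) / s - 1) * edist (h u.1) (h u.2) *
          (edist x y ^ (-(2 * n) + t + t' - τ) * edist x u.1 ^ (τ - n) *
            edist u.1 u.2 ^ (-(n + t) : ℝ) * V u.1) := by ring
      _ ≤ regionForm (incrementRegion 1) s t (-(2 * n) + t + t' - τ) (τ - n) f h
            (fun x _ _ => V x) x y u +
          (regionForm (incrementRegion 1) s t (-(2 * n) + t + t' - τ) (τ - n) f h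
            (fun _ y _ => V y) x y u +
          regionForm (incrementRegion 1) s t (-(2 * n) + t + t' - τ) (τ - n) f h
            (fun _ _ z => V z) x y u) :=
        add_le_add (le_regionForm hP) ((le_regionForm hP).trans le_add_self)
      _ ≤ _ := le_self_add

/-! ### The estimate of the quadrilinear form -/

/-- The integrand of the quadrilinear form, split according to the regimes of the difference of
Riesz kernels and symmetrized in `x` and `y`. -/
lemma exists_quadrilinear_le_quadMajorant {s t t' τ : ℝ} (htn : t ≤ n) (ht'0 : 0 ≤ t')
    (ht'1 : t' ≤ 1) (hτt : τ ≤ t) (ht1 : t ≤ 1 + τ) (hτ : t + t' - τ ≤ 1) : ∃ C : ℝ≥0,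
    ∀ (f : E → F) (h : E → G) (V : E → ℝ≥0∞) (x y : E) (u : E × E), x ≠ y → x ≠ u.1 → y ≠ u.1 →
      quadrilinear s t t' f h V x y u ≤
        C * (quadMajorant s t t' τ f h V x y u + quadMajorant s t t' τ f h V y x u) := by
  obtain ⟨c, hc⟩ : ∃ c, c = ofReal (max 1 (n - t)) := ⟨_, rfl⟩
  obtain ⟨c', hc'⟩ : ∃ c' : ℝ≥0∞, c' = 1 + 2 ^ (n + 1 - t) := ⟨_, rfl⟩
  have hct : 4 * (c * c') ≠ ∞ := by
    rw [hc, hc']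
    refine mul_ne_top (by norm_num) (mul_ne_top ofReal_ne_top
      (add_ne_top.2 ⟨one_ne_top, ?_⟩))
    exact rpow_ne_top_of_nonneg (by linarith) ofNat_ne_top
  have hc1 : 1 ≤ c' := by rw [hc']; exact le_self_add
  refine ⟨(4 * (c * c')).toNNReal, fun f h V x y u hxy hxu hyu => ?_⟩
  rw [coe_toNNReal hct]
  have hr0 : edist x y ≠ 0 := (edist_pos.2 hxy).ne'
  have hq0 : edist x u.1 ≠ 0 := (edist_pos.2 hxu).ne'
  have hrt := edist_ne_top x y
  have hqt := edist_ne_top x u.1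
  obtain ⟨a, ha⟩ : ∃ a, a = edist (f x) (f y) ^ ((n : ℝ) / s - 1) * edist (h u.1) (h u.2) :=
    ⟨_, rfl⟩
  obtain ⟨D, hD⟩ : ∃ D, D = edist u.1 u.2 ^ (-(n + t) : ℝ) := ⟨_, rfl⟩
  have hquad : quadrilinear s t t' f h V x y u = a * (edist x y ^ (-(2 * n) : ℝ) *
      (rieszDiff t x y u.1 * (edist x u.1 ^ t' * ((V x + V u.1) * D)))) := by
    rw [ha, hD]; rfl
  rw [hquad]
  rcases rieszDiff_cases htn hxu hyu with ⟨hq, hK⟩ | ⟨hq, hq', hK⟩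
  · have h1 := le_quadMajorant_of_le (s := s) hτ f h V hxy hxu hq
    rw [← ha, ← hD] at h1
    rw [← hc, ← hc'] at hK
    calc _ ≤ a * (edist x y ^ (-(2 * n) : ℝ) * ((c * c' * (edist x y * edist x u.1 ^ (t - n - 1))) *
          (edist x u.1 ^ t' * ((V x + V u.1) * D)))) := by gcongr
      _ = c * c' * (a * ((edist x y ^ (-(2 * n) : ℝ) * edist x y ^ (1 : ℝ)) *
          (edist x u.1 ^ (t - n - 1) * edist x u.1 ^ t') * D * (V x + V u.1))) := by
          rw [rpow_one]; ring
      _ = c * c' * (a * (edist x y ^ (1 - 2 * n : ℝ) * edist x u.1 ^ (t + t' - 1 - n) * D *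
          (V x + V u.1))) := by
          rw [← rpow_add _ _ hr0 hrt, ← rpow_add _ _ hq0 hqt,
            show -(2 * n) + 1 = (1 - 2 * n : ℝ) by ring,
            show t - n - 1 + t' = t + t' - 1 - n by ring]
      _ ≤ 4 * (c * c') * quadMajorant s t t' τ f h V x y u := by
          rw [mul_assoc 4]
          refine le_mul_of_one_le_of_le (by norm_num) (mul_le_mul_right h1 _)
      _ ≤ _ := mul_le_mul_right le_self_add _
  · have h1 := le_quadMajorant_of_le_two_mul (s := s) (t' := t') hτt ht1 f h V hxy hxu hq
    have h2 := le_quadMajorant_of_le_two_mul (s := s) (t' := t') hτt ht1 f h V hxy.symm hyu hq'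
    rw [edist_comm (f y), edist_comm y x, ← ha, ← hD] at h2
    rw [← ha, ← hD] at h1
    rw [← hc] at hK
    have hq2 : edist x u.1 ^ t' ≤ 2 * edist x y ^ t' := by
      calc _ ≤ (2 * edist x y) ^ t' := rpow_le_rpow hq ht'0
        _ = 2 ^ t' * edist x y ^ t' := mul_rpow_of_nonneg _ _ ht'0
        _ ≤ 2 ^ (1 : ℝ) * edist x y ^ t' := by gcongr; exact one_le_two
        _ = _ := by rw [rpow_one]
    calc _ ≤ a * (edist x y ^ (-(2 * n) : ℝ) * ((c * (edist x u.1 ^ (t - n) +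
          edist y u.1 ^ (t - n))) * ((2 * edist x y ^ t') * ((V x + V u.1) * D)))) := by gcongr
      _ = 2 * c * (a * ((edist x y ^ t' * edist x y ^ (-(2 * n) : ℝ)) * edist x u.1 ^ (t - n) * D *
            (V x + V u.1)) + a * ((edist x y ^ t' * edist x y ^ (-(2 * n) : ℝ)) *
            edist y u.1 ^ (t - n) * D * (V x + V u.1))) := by ring
      _ = 2 * c * (a * (edist x y ^ (t' - 2 * n) * edist x u.1 ^ (t - n) * D *
            (V x + V u.1)) + a * (edist x y ^ (t' - 2 * n) * edist y u.1 ^ (t - n) * D *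
            (V x + V u.1))) := by
          rw [← rpow_add _ _ hr0 hrt, show t' + -(2 * n) = t' - 2 * n by ring]
      _ ≤ 2 * c * (a * (edist x y ^ (t' - 2 * n) * edist x u.1 ^ (t - n) * D *
            (V x + V y + V u.1)) + a * (edist x y ^ (t' - 2 * n) * edist y u.1 ^ (t - n) * D *
            (V y + V x + V u.1))) := by
          gcongr
          · exact le_self_add
          · exact le_add_self
      _ ≤ 2 * c * (2 * quadMajorant s t t' τ f h V x y u +
            2 * quadMajorant s t t' τ f h V y x u) := by gcongr
      _ = 4 * (c * 1) * (quadMajorant s t t' τ f h V x y u +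
            quadMajorant s t t' τ f h V y x u) := by ring
      _ ≤ _ := by gcongr

lemma coe_mul_rpow_rpow (c : ℝ≥0) (A : ℝ≥0∞) {m e : ℝ} (he : 0 ≤ e) (hme : m * e = 1) :
    ((c : ℝ≥0∞) * A ^ m) ^ e = (c ^ e : ℝ≥0) * A := by
  rw [mul_rpow_of_nonneg _ _ he, ← rpow_mul, hme, rpow_one,
    coe_rpow_of_nonneg _ he]

/-- The weight `V z` in the region where `|z - v|` dominates. -/
lemma lintegral_incrementRegion_trd_le [NeZero n] {s t t' τ : ℝ} (hs0 : 0 < s) (hs1 : s < 1)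
    (hτ : 0 < τ) (hτe : 2 * τ = t + t' - s) (ht' : 0 < t') (hpt : n / s * t' < n) :
    ∃ C : ℝ≥0, ∀ (f : E → F) (h : E → G), StronglyMeasurable f → StronglyMeasurable h →
    ∀ (V : E → ℝ≥0∞) (A : ℝ≥0∞), Measurable V →
    GrowthBound (fun x => V x ^ ((n : ℝ) / s)) (A ^ ((n : ℝ) / s)) (n - n / s * t') →
    ∀ (x₀ : E) (ρ : ℝ), 0 < ρ →
      ∫⁻ x in ball x₀ ρ, ∫⁻ y in ball x₀ ρ, ∫⁻ u,
        regionForm (incrementRegion 1) s t (-(2 * n) + t + t' - τ) (τ - n) f h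
          (fun _ _ z => V z) x y u
      ≤ C * A * scaleSum (2⁻¹ ^ ((1 - s / n) * τ)) s x₀ ρ f h := by
  have hn : (1 : ℝ) ≤ n := mod_cast NeZero.one_le
  have hpt0 : 0 < n / s * t' := by positivity
  obtain ⟨C, hC⟩ := lintegral_incrementRegion_le (n := n) (F := F) (G := G) (i := 2 * τ) hs0 hs1 hτ
    hτe (by linarith) (by linarith)
  obtain ⟨C₁, hC₁⟩ := lintegral_increment_dominant_right (n := n) hτ
  obtain ⟨C₂, hC₂⟩ := lintegral_ind_near_le_volume (n := n) (a := τ - n) (by linarith)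
  obtain ⟨c, hc⟩ : ∃ c : ℝ≥0, c = (C₁ * C₂) * (2 ^ τ : ℝ≥0) := ⟨_, rfl⟩
  refine ⟨C * c ^ (s / n), fun f h hf hh V A hV hA x₀ ρ hρ => ?_⟩
  refine (hC f h hf hh (fun _ _ z => V z) (hV.comp (measurable_snd.comp measurable_snd))
    (fun x => V x ^ ((n : ℝ) / s)) _ c (hV.pow_const _)
    (by rwa [sub_add_cancel]) (fun l hl z v hzv => ?_) x₀ ρ hρ).trans (le_of_eq ?_)
  · have hd0 : edist z v ≠ 0 := (edist_pos.2 hzv).ne'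
    have hdt := edist_ne_top z v
    refine (hC₁ l hl (fun _ => V z ^ ((n : ℝ) / s)) z v hzv).trans ?_
    have e : ∀ x, ind (edist z x ≤ 2 * edist z v) * (edist z x ^ (τ - n) * V z ^ ((n : ℝ) / s)) =
        ind (edist z x ≤ 2 * edist z v) * edist z x ^ (τ - n) * V z ^ ((n : ℝ) / s) :=
      fun x => by ring
    simp_rw [e]
    have hm : Measurable fun x => ind (edist z x ≤ 2 * edist z v) * edist z x ^ (τ - n) :=
      Measurable.mul (measurable_ind_le (by fun_prop) (by fun_prop)) (by fun_prop)
    rw [lintegral_mul_const _ hm]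
    have h2 := hC₂ z (2 * edist z v) (mul_ne_zero two_ne_zero hd0)
      (mul_ne_top ofNat_ne_top hdt)
    rw [sub_add_cancel, mul_rpow_of_nonneg _ _ hτ.le] at h2
    calc _ ≤ C₁ * (edist z v ^ τ * (C₂ * (2 ^ τ * edist z v ^ τ) * V z ^ ((n : ℝ) / s))) := by
          gcongr
      _ = C₁ * C₂ * 2 ^ τ * ((edist z v ^ τ * edist z v ^ τ) * V z ^ ((n : ℝ) / s)) := by ring
      _ = _ := by
          rw [← rpow_add _ _ hd0 hdt, ← two_mul, hc, coe_mul, coe_mul,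
            coe_rpow_of_nonneg _ hτ.le]
          rfl
  · rw [coe_mul_rpow_rpow _ _ (by positivity) (by field_simp), coe_mul]
    ring

/-- The weight `V x` in the region where `|z - v|` dominates. -/
lemma lintegral_incrementRegion_fst_le [NeZero n] {s t t' τ : ℝ} (hs0 : 0 < s) (hs1 : s < 1)
    (hτ : 0 < τ) (hτe : 2 * τ = t + t' - s) (hτp : τ < n / s * t') (hpt : n / s * t' < n) :
    ∃ C : ℝ≥0, ∀ (f : E → F) (h : E → G), StronglyMeasurable f → StronglyMeasurable h →
    ∀ (V : E → ℝ≥0∞) (A : ℝ≥0∞), Measurable V →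
    GrowthBound (fun x => V x ^ ((n : ℝ) / s)) (A ^ ((n : ℝ) / s)) (n - n / s * t') →
    ∀ (x₀ : E) (ρ : ℝ), 0 < ρ →
      ∫⁻ x in ball x₀ ρ, ∫⁻ y in ball x₀ ρ, ∫⁻ u,
        regionForm (incrementRegion 1) s t (-(2 * n) + t + t' - τ) (τ - n) f h
          (fun x _ _ => V x) x y u
      ≤ C * A * scaleSum (2⁻¹ ^ ((1 - s / n) * τ)) s x₀ ρ f h := by
  have hn : (1 : ℝ) ≤ n := mod_cast NeZero.one_le
  obtain ⟨C, hC⟩ := lintegral_incrementRegion_le (n := n) (F := F) (G := G) (i := τ) hs0 hs1 hτ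
    hτe (by linarith) (by linarith)
  obtain ⟨C₁, hC₁⟩ := lintegral_increment_dominant_right (n := n) hτ
  obtain ⟨C₂, hC₂⟩ := growthBound_potential (n := n) (e := n - n / s * t') hτ (by linarith)
    (by linarith)
  refine ⟨C * (C₁ * C₂) ^ (s / n), fun f h hf hh V A hV hA x₀ ρ hρ => ?_⟩
  refine (hC f h hf hh (fun x _ _ => V x) (hV.comp measurable_fst)
    (potential τ fun x => V x ^ ((n : ℝ) / s)) (C₂ * A ^ ((n : ℝ) / s)) C₁
    (measurable_potential (hV.pow_const _))
    (by
      convert hC₂ _ _ (hV.pow_const _) hA using 1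
      ring) (fun l hl z v hzv => ?_) x₀ ρ hρ).trans (le_of_eq ?_)
  · refine (hC₁ l hl (fun x => V x ^ ((n : ℝ) / s)) z v hzv).trans ?_
    refine mul_le_mul_right (mul_le_mul_right (lintegral_mono fun x => ?_) _) _
    exact mul_le_of_le_one_left zero_le (ind_le_one _)
  · rw [← mul_assoc (C₁ : ℝ≥0∞), ← coe_mul, coe_mul_rpow_rpow _ _ (by positivity)
      (by field_simp), coe_mul C]
    ring

/-- The weight `V y` in the region where `|z - v|` dominates. -/
lemma lintegral_incrementRegion_snd_le [NeZero n] {s t t' τ : ℝ} (hs0 : 0 < s) (hs1 : s < 1)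
    (hτ : 0 < τ) (hτe : 2 * τ = t + t' - s) (hτp : 2 * τ < n / s * t') (hpt : n / s * t' < n) :
    ∃ C : ℝ≥0, ∀ (f : E → F) (h : E → G), StronglyMeasurable f → StronglyMeasurable h →
    ∀ (V : E → ℝ≥0∞) (A : ℝ≥0∞), Measurable V →
    GrowthBound (fun x => V x ^ ((n : ℝ) / s)) (A ^ ((n : ℝ) / s)) (n - n / s * t') →
    ∀ (x₀ : E) (ρ : ℝ), 0 < ρ →
      ∫⁻ x in ball x₀ ρ, ∫⁻ y in ball x₀ ρ, ∫⁻ u,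
        regionForm (incrementRegion 1) s t (-(2 * n) + t + t' - τ) (τ - n) f h
          (fun _ y _ => V y) x y u
      ≤ C * A * scaleSum (2⁻¹ ^ ((1 - s / n) * τ)) s x₀ ρ f h := by
  have hn : (1 : ℝ) ≤ n := mod_cast NeZero.one_le
  obtain ⟨C, hC⟩ := lintegral_incrementRegion_le (n := n) (F := F) (G := G) (i := 0) hs0 hs1 hτ
    hτe (by linarith) (by linarith)
  obtain ⟨C₁, hC₁⟩ := growthBound_potential (n := n) (e := n - n / s * t') hτ (by linarith)
    (by linarith)
  obtain ⟨C₂, hC₂⟩ := growthBound_potential (n := n) (e := τ + (n - n / s * t')) hτ (by linarith)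
    (by linarith)
  refine ⟨C * (1 * (C₂ * C₁)) ^ (s / n), fun f h hf hh V A hV hA x₀ ρ hρ => ?_⟩
  have hVp : Measurable fun x => V x ^ ((n : ℝ) / s) := hV.pow_const _
  refine (hC f h hf hh (fun _ y _ => V y) (hV.comp (measurable_fst.comp measurable_snd))
    (potential τ (potential τ fun x => V x ^ ((n : ℝ) / s))) (C₂ * (C₁ * A ^ ((n : ℝ) / s))) 1
    (measurable_potential (measurable_potential hVp))
    (by
      convert hC₂ _ _ (measurable_potential hVp) (hC₁ _ _ hVp hA) using 1
      ring) (fun l hl z v hzv => ?_) x₀ ρ hρ).trans (le_of_eq ?_)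
  · rw [rpow_zero, one_mul, ENNReal.coe_one, one_mul]
    refine lintegral_mono_ae ?_
    filter_upwards [Measure.ae_ne volume z] with x hxz
    calc _ ≤ ∫⁻ y, edist z x ^ (τ - n) * (edist x y ^ (τ - n) * V y ^ ((n : ℝ) / s)) := by
          refine lintegral_mono fun y => ?_
          refine (mul_le_of_le_one_left zero_le (ind_le_one _)).trans (le_of_eq ?_)
          rw [edist_comm z x]
          ring
      _ = _ := by
          rw [lintegral_const_mul' _ _ (edist_rpow_ne_top hxz.symm _)]
          rfl
  · rw [← mul_assoc (C₂ : ℝ≥0∞), ← mul_assoc (_ : ℝ≥0∞) _ (A ^ _), ← coe_mul,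
      ← coe_mul, coe_mul_rpow_rpow _ _ (by positivity) (by field_simp), coe_mul C]
    ring

lemma lintegral_quadMajorant_eq {s t t' τ : ℝ} {f : E → F} {h : E → G} (hf : StronglyMeasurable f)
    (hh : StronglyMeasurable h) {V : E → ℝ≥0∞} (hV : Measurable V) (B : Set E)
    {I : (E → E → E × E → ℝ≥0∞) → ℝ≥0∞}
    (hI : I = fun J => ∫⁻ x in B, ∫⁻ y in B, ∫⁻ u, J x y u) :
    I (quadMajorant s t t' τ f h V) =
      (I (regionForm (incrementRegion 1) s t (-(2 * n) + t + t' - τ) (τ - n) f h fun x _ _ => V x) +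
      (I (regionForm (incrementRegion 1) s t (-(2 * n) + t + t' - τ) (τ - n) f h fun _ y _ => V y) +
      I (regionForm (incrementRegion 1) s t (-(2 * n) + t + t' - τ) (τ - n) f h fun _ _ z => V z))) +
      ((I (regionForm (poleRegion 1) s t (1 - 2 * n) (t + t' - 1 - n) f h fun x _ _ => V x) +
      I (regionForm (poleRegion 1) s t (1 - 2 * n) (t + t' - 1 - n) f h fun _ _ z => V z)) +
      (I (regionForm baseRegion s t (t' - 2 * n) (t - n) f h fun x _ _ => V x) +
      (I (regionForm baseRegion s t (t' - 2 * n) (t - n) f h fun _ y _ => V y) +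
      I (regionForm baseRegion s t (t' - 2 * n) (t - n) f h fun _ _ z => V z)))) := by
  have hx : Measurable fun u : E × E × E => V u.1 := by fun_prop
  have hy : Measurable fun u : E × E × E => V u.2.1 := by fun_prop
  have hz : Measurable fun u : E × E × E => V u.2.2 := by fun_prop
  have hadd : ∀ J K : E → E → E × E → ℝ≥0∞,
      (Measurable fun u : E × E × (E × E) => J u.1 u.2.1 u.2.2) →
      I (fun x y u => J x y u + K x y u) = I J + I K := by
    intro J K hJ
    rw [hI]
    exact lintegral_iterated_add _ _ _ hJ
  have hA := fun w => measurable_regionForm (w := w) (measurable_ind_incrementRegion (n := n) 1) s t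
    (-(2 * n) + t + t' - τ) (τ - n) hf hh
  have hP := fun w => measurable_regionForm (w := w) (measurable_ind_poleRegion (n := n) 1) s t
    (1 - 2 * n) (t + t' - 1 - n) hf hh
  have hB := fun w => measurable_regionForm (w := w) (measurable_ind_baseRegion (n := n)) s t
    (t' - 2 * n) (t - n) hf hh
  have hAx := hA (fun x _ _ => V x) hx
  have hAy := hA (fun _ y _ => V y) hy
  have hAz := hA (fun _ _ z => V z) hz
  have hPx := hP (fun x _ _ => V x) hx
  have hPz := hP (fun _ _ z => V z) hz
  rw [← hadd _ _ hAy, ← hadd _ _ hAx, ← hadd _ _ hPx, ← hadd _ _ (hB (fun _ y _ => V y) hy),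
    ← hadd _ _ (hB (fun x _ _ => V x) hx), ← hadd _ _ (hPx.add hPz),
    ← hadd _ _ (hAx.add (hAy.add hAz))]
  rfl

lemma measurable_quadMajorant {s t t' τ : ℝ} {f : E → F} {h : E → G} (hf : StronglyMeasurable f)
    (hh : StronglyMeasurable h) {V : E → ℝ≥0∞} (hV : Measurable V) :
    Measurable fun u : E × E × (E × E) => quadMajorant s t t' τ f h V u.1 u.2.1 u.2.2 := by
  have hx : Measurable fun u : E × E × E => V u.1 := by fun_prop
  have hy : Measurable fun u : E × E × E => V u.2.1 := by fun_prop
  have hz : Measurable fun u : E × E × E => V u.2.2 := by fun_prop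
  have hA := fun w => measurable_regionForm (w := w) (measurable_ind_incrementRegion (n := n) 1) s t
    (-(2 * n) + t + t' - τ) (τ - n) hf hh
  have hP := fun w => measurable_regionForm (w := w) (measurable_ind_poleRegion (n := n) 1) s t
    (1 - 2 * n) (t + t' - 1 - n) hf hh
  have hB := fun w => measurable_regionForm (w := w) (measurable_ind_baseRegion (n := n)) s t
    (t' - 2 * n) (t - n) hf hh
  exact ((hA (fun x _ _ => V x) hx).add ((hA (fun _ y _ => V y) hy).add (hA (fun _ _ z => V z)
    hz))).add (((hP (fun x _ _ => V x) hx).add (hP (fun _ _ z => V z) hz)).add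
    ((hB (fun x _ _ => V x) hx).add ((hB (fun _ y _ => V y) hy).add (hB (fun _ _ z => V z) hz))))

/-- The estimate of the quadrilinear form for a weight `V` whose powers with the exponents `n / s`
and `n / (n - s)` have the growth of a Riesz potential. -/
lemma lintegral_quadrilinear_le_scaleSum [NeZero n] {s t t' τ : ℝ} (hs0 : 0 < s) (hs1 : s < 1)
    (ht0 : 0 < t) (hts : t < s) (hτ : 0 < τ) (hτe : 2 * τ = t + t' - s) (ht'1 : t' ≤ 1 - s)
    (hp : n / s * t' < t) (hq : (1 - s / n)⁻¹ * t' < t) : ∃ C : ℝ≥0, ∀ (f : E → F) (h : E → G),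
    StronglyMeasurable f → StronglyMeasurable h → ∀ (V : E → ℝ≥0∞) (A : ℝ≥0∞), Measurable V →
    GrowthBound (fun x => V x ^ ((n : ℝ) / s)) (A ^ ((n : ℝ) / s)) (n - n / s * t') →
    GrowthBound (fun x => V x ^ (1 - s / n)⁻¹) (A ^ (1 - s / n)⁻¹) (n - (1 - s / n)⁻¹ * t') →
    ∀ (x₀ : E) (ρ : ℝ), 0 < ρ →
      ∫⁻ x in ball x₀ ρ, ∫⁻ y in ball x₀ ρ, ∫⁻ u, quadrilinear s t t' f h V x y u
      ≤ C * A * scaleSum (2⁻¹ ^ ((1 - s / n) * τ)) s x₀ ρ f h := by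
  have hn : (1 : ℝ) ≤ n := mod_cast NeZero.one_le
  have hn0 : (n : ℝ) ≠ 0 := by positivity
  have hs : s ≠ 0 := hs0.ne'
  have ht' : 0 < t' := by linarith
  have hp1 : 1 ≤ (n : ℝ) / s := by rw [le_div_iff₀ hs0]; linarith
  have hp' : t' ≤ n / s * t' := le_mul_of_one_le_left ht'.le hp1
  have hθ0 : 0 < 1 - s / n := by rw [sub_pos, div_lt_one (by linarith)]; linarith
  have hθ : (1 - s / n)⁻¹ * (1 - s / n) = 1 := inv_mul_cancel₀ hθ0.ne'
  have hsn : (n : ℝ) / s * (s / n) = 1 := by field_simp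
  obtain ⟨C₀, hC₀⟩ := exists_quadrilinear_le_quadMajorant (n := n) (F := F) (G := G) (s := s)
    (t := t) (t' := t') (τ := τ) (by linarith) ht'.le (by linarith) (by linarith) (by linarith)
    (by linarith)
  obtain ⟨C₁, hC₁⟩ := lintegral_incrementRegion_fst_le (n := n) (F := F) (G := G) hs0 hs1 hτ hτe
    (by linarith) (by linarith)
  obtain ⟨C₂, hC₂⟩ := lintegral_incrementRegion_snd_le (n := n) (F := F) (G := G) hs0 hs1 hτ hτe
    (by linarith) (by linarith)
  obtain ⟨C₃, hC₃⟩ := lintegral_incrementRegion_trd_le (n := n) (F := F) (G := G) hs0 hs1 hτ hτe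
    ht' (by linarith)
  obtain ⟨C₄, hC₄⟩ := lintegral_poleRegion_le (n := n) (F := F) (G := G) (m₁ := 0)
    (m₂ := n / s * t') (e := t + t' - 1 - n) (τ := τ) hs0 hs1 hts
    (by linear_combination (-t') * hsn) (by linarith)
  obtain ⟨C₅, hC₅⟩ := lintegral_poleRegion_le (n := n) (F := F) (G := G) (m₁ := (1 - s / n)⁻¹ * t')
    (m₂ := 0) (e := t + t' - 1 - n) (τ := τ) hs0 hs1 hts
    (by linear_combination (-t') * hθ) (by linarith)
  obtain ⟨C₆, hC₆⟩ := lintegral_baseRegion_le (n := n) (F := F) (G := G) (m₁ := 0)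
    (m₂ := n / s * t') (e := t' - 2 * n) hs0 hs1 ht0 hts ht0 hp
    (by linear_combination (-t') * hsn) ((1 - s / n) * τ)
  obtain ⟨C₇, hC₇⟩ := lintegral_baseRegion_le (n := n) (F := F) (G := G) (m₁ := (1 - s / n)⁻¹ * t')
    (m₂ := 0) (e := t' - 2 * n) hs0 hs1 ht0 hts hq ht0
    (by linear_combination (-t') * hθ) ((1 - s / n) * τ)
  obtain ⟨ω, hω⟩ : ∃ ω : ℝ≥0, (ω : ℝ≥0∞) = volume (ball (0 : E) 1) :=
    ⟨_, coe_toNNReal measure_ball_lt_top.ne⟩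
  have hone : GrowthBound (fun _ : E => 1) ω (n - 0) := by
    rw [hω, sub_zero]
    exact growthBound_one
  refine ⟨2 * C₀ * ((C₁ + (C₂ + C₃)) + ((C₄ * ω ^ (1 - s / n) + C₅ * ω ^ (s / n)) +
    (C₆ * ω ^ (1 - s / n) + (C₆ * ω ^ (1 - s / n) + C₇ * ω ^ (s / n))))),
    fun f h hf hh V A hV hV₁ hV₂ x₀ ρ hρ => ?_⟩
  have hM := measurable_quadMajorant (s := s) (t := t) (t' := t') (τ := τ) hf hh hV
  have hVp : Measurable fun x => V x ^ ((n : ℝ) / s) := hV.pow_const _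
  have hVq : Measurable fun x => V x ^ (1 - s / n)⁻¹ := hV.pow_const _
  have eVp : ∀ a : ℝ≥0∞, (1 : ℝ≥0∞) ^ (1 - s / n) * (a ^ ((n : ℝ) / s)) ^ (s / n) = a := by
    intro a
    rw [one_rpow, one_mul, ← rpow_mul, hsn, rpow_one]
  have eVq : ∀ a : ℝ≥0∞, (a ^ (1 - s / n)⁻¹) ^ (1 - s / n) * (1 : ℝ≥0∞) ^ (s / n) = a := by
    intro a
    rw [one_rpow, mul_one, ← rpow_mul, hθ, rpow_one]
  obtain ⟨I, hI⟩ : ∃ I : (E → E → E × E → ℝ≥0∞) → ℝ≥0∞, I = fun J =>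
    ∫⁻ x in ball x₀ ρ, ∫⁻ y in ball x₀ ρ, ∫⁻ u, J x y u := ⟨_, rfl⟩
  obtain ⟨S, hS⟩ : ∃ S, S = scaleSum (2⁻¹ ^ ((1 - s / n) * τ)) s x₀ ρ f h := ⟨_, rfl⟩
  have b₁ := hC₁ f h hf hh V A hV hV₁ x₀ ρ hρ
  have b₂ := hC₂ f h hf hh V A hV hV₁ x₀ ρ hρ
  have b₃ := hC₃ f h hf hh V A hV hV₁ x₀ ρ hρ
  have b₄ := hC₄ f h hf hh (fun _ => 1) _ _ _ measurable_const hVp hone hV₁ x₀ ρ hρ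
  have b₅ := hC₅ f h hf hh _ (fun _ => 1) _ _ hVq measurable_const hV₂ hone x₀ ρ hρ
  have b₆ := hC₆ f h hf hh (fun _ => 1) _ _ _ measurable_const hVp hone hV₁ _ (Or.inl rfl) x₀ ρ hρ
  have b₆' := hC₆ f h hf hh (fun _ => 1) _ _ _ measurable_const hVp hone hV₁ _ (Or.inr rfl) x₀ ρ hρ
  have b₇ := hC₇ f h hf hh _ (fun _ => 1) _ _ hVq measurable_const hV₂ hone _ (Or.inl rfl) x₀ ρ hρ
  have eA : (A ^ ((n : ℝ) / s)) ^ (s / n) = A := by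
    rw [← rpow_mul, hsn, rpow_one]
  have eA' : (A ^ (1 - s / n)⁻¹) ^ (1 - s / n) = A := by
    rw [← rpow_mul, hθ, rpow_one]
  simp only [eVp, eVq, eA, eA'] at b₄ b₅ b₆ b₆' b₇
  rw [← coe_rpow_of_nonneg _ hθ0.le, ← hS] at b₄ b₆ b₆'
  rw [← coe_rpow_of_nonneg _ (by positivity), ← hS] at b₅ b₇
  rw [← hS] at b₁ b₂ b₃
  have htot : I (quadMajorant s t t' τ f h V) ≤ (C₁ * A * S + (C₂ * A * S + C₃ * A * S)) +
      ((C₄ * ((ω ^ (1 - s / n) : ℝ≥0) * A) * S + C₅ * (A * (ω ^ (s / n) : ℝ≥0)) * S) +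
      (C₆ * ((ω ^ (1 - s / n) : ℝ≥0) * A) * S + (C₆ * ((ω ^ (1 - s / n) : ℝ≥0) * A) * S +
      C₇ * (A * (ω ^ (s / n) : ℝ≥0)) * S))) := by
    rw [lintegral_quadMajorant_eq hf hh hV _ hI, hI]
    exact add_le_add (add_le_add b₁ (add_le_add b₂ b₃)) (add_le_add (add_le_add b₄ b₅)
      (add_le_add b₆ (add_le_add b₆' b₇)))
  calc _ ≤ ∫⁻ x in ball x₀ ρ, ∫⁻ y in ball x₀ ρ, ∫⁻ u, C₀ *
        (quadMajorant s t t' τ f h V x y u + quadMajorant s t t' τ f h V y x u) := by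
        refine lintegral_iterated_mono_ae _ _ _ fun x => ?_
        filter_upwards [ae_restrict_of_ae (Measure.ae_ne volume x)] with y hyx
        have hx := ae_prod_edist_ne x univ
        have hy := ae_prod_edist_ne y univ
        rw [Measure.restrict_univ] at hx hy
        filter_upwards [hx, hy] with u hxu hyu
        exact hC₀ f h V x y u hyx.symm hxu.1 hyu.1
    _ = C₀ * (2 * I (quadMajorant s t t' τ f h V)) := by
        simp_rw [lintegral_const_mul' _ _ (coe_ne_top (r := C₀))]
        rw [lintegral_iterated_symm_add_swap volume hM, hI]
    _ ≤ _ := mul_le_mul_right (mul_le_mul_right htot _) _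
    _ = _ := by
        rw [← hS]
        push_cast
        ring

/-! ### The second commutator estimate -/

/-- The powers of the Riesz potential of `φ ∈ L^{n/t}` with two exponents obey growth bounds with a
common constant. -/
lemma exists_growthBound_potential_rpow [NeZero n] {t t' p q : ℝ} (ht' : 0 < t') (hp : 1 ≤ p)
    (hq : 1 ≤ q) (hpt : p * t' < t) (hqt : q * t' < t) (htn : t < n) : ∃ K : ℝ≥0,
    ∀ φ : E → ℝ≥0∞, Measurable φ → ∀ m ∈ ({p, q} : Set ℝ),
      GrowthBound (fun x => potential (t - t') φ x ^ m)
        ((K * (∫⁻ z, φ z ^ ((n : ℝ) / t)) ^ (t / n)) ^ m) (n - m * t') := by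
  have ht0 : 0 < t := lt_of_le_of_lt (by positivity) hpt
  obtain ⟨C, hC⟩ := growthBound_of_lintegral_rpow (n := n) ht0 htn
  obtain ⟨C₁, hC₁⟩ := growthBound_potential_rpow (n := n) ht' hp hpt htn
  obtain ⟨C₂, hC₂⟩ := growthBound_potential_rpow (n := n) ht' hq hqt htn
  obtain ⟨c, hc⟩ : ∃ c : ℝ≥0, c = 1 + (C₁ + C₂) := ⟨_, rfl⟩
  have key : ∀ (D : ℝ≥0) (m : ℝ), 1 ≤ m → D ≤ c → ∀ N : ℝ≥0∞,
      D * (C * N) ^ m ≤ ((c * C : ℝ≥0) * N) ^ m := by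
    intro D m hm hD N
    rw [coe_mul, mul_assoc, mul_rpow_of_nonneg (c : ℝ≥0∞) _ (by linarith)]
    refine mul_le_mul_left ?_ _
    have hc1 : (1 : ℝ≥0∞) ≤ c := by rw [hc]; push_cast; exact le_self_add
    calc (D : ℝ≥0∞) ≤ c := ENNReal.coe_le_coe.2 hD
      _ = (c : ℝ≥0∞) ^ (1 : ℝ) := (rpow_one _).symm
      _ ≤ _ := ENNReal.rpow_le_rpow_of_exponent_le hc1 hm
  refine ⟨c * C, fun φ hφ m hm => ?_⟩
  rcases hm with rfl | rfl
  · exact fun u r hr => (hC₁ φ _ hφ (hC φ hφ.aemeasurable) u r hr).trans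
      (mul_le_mul_left (key _ _ hp (by rw [hc, add_left_comm]; exact le_self_add) _) _)
  · exact fun u r hr => (hC₂ φ _ hφ (hC φ hφ.aemeasurable) u r hr).trans
      (mul_le_mul_left (key _ _ hq (by rw [hc, ← add_assoc]; exact le_add_self) _) _)

lemma exists_commT₂_le_scaleSum [NeZero n] [NormedSpace ℝ G] [CompleteSpace G] {s t t' τ : ℝ}
    (hs0 : 0 < s) (hs1 : s < 1) (ht0 : 0 < t) (hts : t < s) (hτ : 0 < τ)
    (hτe : 2 * τ = t + t' - s) (ht'1 : t' ≤ 1 - s) (hp : n / s * t' < t)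
    (hq : (1 - s / n)⁻¹ * t' < t) : ∃ C : ℝ≥0,
    ∀ (f : E → F) (g : E → ℝ) (h : E → G), StronglyMeasurable f → StronglyMeasurable g →
    StronglyMeasurable h → gagliardoEnergy univ (n / s) g ≠ ∞ →
    gagliardoEnergy univ (n / s) h ≠ ∞ →
    (∀ᵐ x : E, Integrable fun z => ‖x - z‖ ^ (t - (n : ℝ)) • (g z • fracLaplacian t h z)) →
    ∀ (x₀ : E) (ρ : ℝ), 0 < ρ → commT₂ (ball x₀ ρ) s t f g h ≤
      C * eLpNorm (fracLaplacian t g) (ofReal ((n : ℝ) / t)) volume *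
        scaleSum (2⁻¹ ^ ((1 - s / n) * τ)) s x₀ ρ f h := by
  have hn : (1 : ℝ) ≤ n := mod_cast NeZero.one_le
  have hsn : s / n < 1 := by rw [div_lt_one (by linarith)]; linarith
  have hp1 : 1 ≤ (n : ℝ) / s := by rw [le_div_iff₀ hs0]; linarith
  have hsn0 : 0 < s / n := by positivity
  have hq1 : 1 ≤ (1 - s / n)⁻¹ := (one_le_inv₀ (by linarith)).2 (by linarith)
  have hnt : 0 < (n : ℝ) / t := by positivity
  obtain ⟨K, hK⟩ := exists_growthBound_potential_rpow (n := n) (t' := t') (by linarith) hp1 hq1 hp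
    hq (by linarith)
  obtain ⟨C₁, hC₁⟩ := exists_commT₂_le (n := n) (F := F) (G := G) (t' := t') hs0 hs1 ht0 hts
    (by linarith) (by linarith)
  obtain ⟨C₂, hC₂⟩ := lintegral_quadrilinear_le_scaleSum (n := n) (F := F) (G := G) hs0 hs1 ht0 hts
    hτ hτe ht'1 hp hq
  refine ⟨C₁ * (C₂ * K), fun f g h hf hg hh hEg hEh hint x₀ ρ hρ => ?_⟩
  have hφ := (stronglyMeasurable_fracLaplacian (t := t) hg).enorm
  have hnorm : eLpNorm (fracLaplacian t g) (ofReal ((n : ℝ) / t)) volume =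
      (∫⁻ z, ‖fracLaplacian t g z‖ₑ ^ ((n : ℝ) / t)) ^ (t / n) := by
    rw [eLpNorm_eq_lintegral_rpow_enorm_toReal (by simpa using hnt) ofReal_ne_top,
      ENNReal.toReal_ofReal hnt.le, one_div_div]
  rw [hnorm]
  refine (hC₁ f g h hf hg hh hEg hEh hint _).trans ?_
  refine (mul_le_mul_right (hC₂ f h hf hh _ _ (measurable_potential hφ) (hK _ hφ _ (Or.inl rfl))
    (hK _ hφ _ (Or.inr rfl)) x₀ ρ hρ) _).trans (le_of_eq ?_)
  rw [coe_mul, coe_mul]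
  ring

lemma fracLaplacian_congr_ae [NormedSpace ℝ G] {t : ℝ} {h h' : E → G} (hh : h =ᵐ[volume] h') :
    fracLaplacian t h =ᵐ[volume] fracLaplacian t h' := by
  filter_upwards [hh] with x hx
  unfold fracLaplacian
  congr 1
  refine integral_congr_ae ?_
  filter_upwards [hh] with y hy
  rw [hx, hy]

lemma smul_fracLaplacian_congr_ae [NormedSpace ℝ G] {t : ℝ} {g g' : E → ℝ} {h h' : E → G}
    (hg : g =ᵐ[volume] g') (hh : h =ᵐ[volume] h') (x : E) :
    (fun z => ‖x - z‖ ^ (t - (n : ℝ)) • (g z • fracLaplacian t h z)) =ᵐ[volume]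
      fun z => ‖x - z‖ ^ (t - (n : ℝ)) • (g' z • fracLaplacian t h' z) := by
  filter_upwards [hg, fracLaplacian_congr_ae (t := t) hh] with z h1 h2
  rw [h1, h2]

lemma commT₂_congr_ae [NormedSpace ℝ G] {s t : ℝ} {f f' : E → F} {g g' : E → ℝ} {h h' : E → G}
    (hf : f =ᵐ[volume] f') (hg : g =ᵐ[volume] g') (hh : h =ᵐ[volume] h') (B : Set E) :
    commT₂ B s t f g h = commT₂ B s t f' g' h' := by
  have hR : ∀ x, rieszPotential t (fun z => g z • fracLaplacian t h z) x =
      rieszPotential t (fun z => g' z • fracLaplacian t h' z) x := fun x => by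
    unfold rieszPotential
    rw [integral_congr_ae (smul_fracLaplacian_congr_ae hg hh x)]
  unfold commT₂ commTheta
  refine lintegral_congr_ae (ae_restrict_of_ae ?_)
  filter_upwards [hf, hg, hh] with x hfx hgx hhx
  refine lintegral_congr_ae (ae_restrict_of_ae ?_)
  filter_upwards [hf, hg, hh] with y hfy hgy hhy
  rw [hfx, hgx, hhx, hfy, hgy, hhy, hR x, hR y]

lemma localizedBound_anti {s σ σ' : ℝ} (hσ : σ ≤ σ') (L : ℕ) (x₀ : E) (ρ : ℝ) (f : E → F)
    (g : E → G) : localizedBound s σ' L x₀ ρ f g ≤ localizedBound s σ L x₀ ρ f g := by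
  unfold localizedBound
  gcongr with k
  exact one_le_two

/-- The second commutator estimate over a ball, in its global and in its localized form. -/
theorem commT₂_le [NeZero n] [NormedSpace ℝ G] [CompleteSpace G] {s t t' τ : ℝ}
    (hs0 : 0 < s) (hs1 : s < 1) (ht0 : 0 < t) (hts : t < s) (hτ : 0 < τ)
    (hτe : 2 * τ = t + t' - s) (ht'1 : t' ≤ 1 - s) (hp : n / s * t' < t)
    (hq : (1 - s / n)⁻¹ * t' < t) : ∃ C : ℝ≥0,
    ∀ (f : E → F) (g : E → ℝ) (h : E → G), AEStronglyMeasurable f volume →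
    AEStronglyMeasurable g volume → AEStronglyMeasurable h volume →
    gagliardoSeminorm univ s (n / s) g < ∞ → gagliardoSeminorm univ s (n / s) h < ∞ →
    (∀ᵐ x : E, Integrable fun z => ‖x - z‖ ^ (t - (n : ℝ)) • (g z • fracLaplacian t h z)) →
    ∀ (x₀ : E) (ρ : ℝ), 0 < ρ →
      commT₂ (ball x₀ ρ) s t f g h ≤
        C * eLpNorm (fracLaplacian t g) (ofReal ((n : ℝ) / t)) volume *
          gagliardoSeminorm univ s (n / s) f ^ ((n : ℝ) / s - 1) *
          gagliardoSeminorm univ s (n / s) h ∧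
      ∀ L : ℕ, commT₂ (ball x₀ ρ) s t f g h ≤
        C * eLpNorm (fracLaplacian t g) (ofReal ((n : ℝ) / t)) volume *
          localizedBound s ((1 - s / n) * τ) L x₀ ρ f h := by
  have hn : (1 : ℝ) ≤ n := mod_cast NeZero.one_le
  have hn0 : 0 < (n : ℝ) := by linarith
  have hsn : s / n < 1 := by rw [div_lt_one hn0]; linarith
  have hsn0 : 0 < s / n := by positivity
  have hσ : 0 < (1 - s / n) * τ := mul_pos (by linarith) hτ
  obtain ⟨C₁, hC₁⟩ := exists_commT₂_le_scaleSum (n := n) (F := F) (G := G) hs0 hs1 ht0 hts hτ hτe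
    ht'1 hp hq
  obtain ⟨C₂, hC₂⟩ := scaleSum_le_univ (n := n) (F := F) (G := G) hs0 (by linarith) hσ
  obtain ⟨C₃, hC₃⟩ := scaleSum_le_localizedBound (n := n) (F := F) (G := G) hs0 (by linarith) hσ
  refine ⟨C₁ * (C₂ + C₃), fun f g h hf hg hh hEg hEh hint x₀ ρ hρ => ?_⟩
  obtain ⟨f', hf', hff'⟩ := hf
  obtain ⟨g', hg', hgg'⟩ := hg
  obtain ⟨h', hh', hhh'⟩ := hh
  rw [gagliardoSeminorm_eq hs0 hn0, ENNReal.rpow_lt_top_iff_of_pos hsn0,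
    gagliardoEnergy_congr_ae hgg'] at hEg
  have hEh' := hEh
  rw [gagliardoSeminorm_eq hs0 hn0, ENNReal.rpow_lt_top_iff_of_pos hsn0,
    gagliardoEnergy_congr_ae hhh'] at hEh'
  have hint' : ∀ᵐ x : E, Integrable
      fun z => ‖x - z‖ ^ (t - (n : ℝ)) • (g' z • fracLaplacian t h' z) := by
    filter_upwards [hint] with x hx
    exact hx.congr (smul_fracLaplacian_congr_ae hgg' hhh' x)
  have key := hC₁ f' g' h' hf' hg' hh' hEg.ne hEh'.ne hint' x₀ ρ hρ
  rw [← commT₂_congr_ae hff' hgg' hhh', ← scaleSum_congr_ae hff' hhh',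
    ← eLpNorm_congr_ae (fracLaplacian_congr_ae hgg')] at key
  obtain ⟨N, hN⟩ : ∃ N, N = eLpNorm (fracLaplacian t g) (ofReal ((n : ℝ) / t)) volume :=
    ⟨_, rfl⟩
  rw [← hN] at key ⊢
  refine ⟨?_, fun L => ?_⟩
  · rw [gagliardoSeminorm_rpow hs0 hn0, gagliardoSeminorm_eq hs0 hn0, mul_assoc (_ * N)]
    refine key.trans ((mul_le_mul_right (hC₂ x₀ ρ f h) _).trans ?_)
    generalize gagliardoEnergy univ (n / s) f ^ (1 - s / n) *
        gagliardoEnergy univ (n / s) h ^ (s / n) = S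
    calc C₁ * N * (C₂ * S) = (C₁ * C₂ : ℝ≥0) * N * S := by push_cast; ring
      _ ≤ _ := by
        gcongr
        exact le_self_add
  · refine key.trans ((mul_le_mul_right (hC₃ L x₀ ρ f h hρ) _).trans ?_)
    generalize localizedBound s ((1 - s / n) * τ) L x₀ ρ f h = S
    calc C₁ * N * (C₃ * S) = (C₁ * C₃ : ℝ≥0) * N * S := by push_cast; ring
      _ ≤ _ := by
        gcongr
        exact le_add_self

end

theorem theorem1p4 (n : ℕ) (hn : 1 ≤ n) (s : ℝ) (hs : s ∈ Set.Ioo (0 : ℝ) 1) :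
    ∃ t₀ ∈ Set.Ioo (0 : ℝ) s, ∀ t ∈ Set.Ioo t₀ s, ∀ N : ℕ,
      ∃ C : ℝ≥0, ∃ σ : ℝ, 0 < σ ∧
        -- the estimate of `T₁` on the whole space, and its localized version
        (∀ f g : EuclideanSpace ℝ (Fin n) → EuclideanSpace ℝ (Fin N),
          AEStronglyMeasurable f volume → AEStronglyMeasurable g volume →
          eLpNorm (commT₁ Set.univ s t f g) (ENNReal.ofReal ((n : ℝ) / ((n : ℝ) - t))) volume
              ≤ C * gagliardoSeminorm Set.univ s (n / s) f ^ ((n : ℝ) / s - 1)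
                * gagliardoSeminorm Set.univ s (n / s) g ∧
          ∀ (x₀ : EuclideanSpace ℝ (Fin n)) (ρ : ℝ), 0 < ρ → ∀ L : ℕ,
            eLpNorm (commT₁ (Metric.ball x₀ ρ) s t f g)
                (ENNReal.ofReal ((n : ℝ) / ((n : ℝ) - t))) volume
              ≤ C * localizedBound s σ L x₀ ρ f g) ∧
        -- the estimate of `T₂` over a ball, and its localized version
        (∀ (f h : EuclideanSpace ℝ (Fin n) → EuclideanSpace ℝ (Fin N))
          (g : EuclideanSpace ℝ (Fin n) → ℝ),
          AEStronglyMeasurable f volume → AEStronglyMeasurable g volume →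
          AEStronglyMeasurable h volume →
          gagliardoSeminorm Set.univ s (n / s) g < ∞ →
          gagliardoSeminorm Set.univ s (n / s) h < ∞ →
          (∀ᵐ x : EuclideanSpace ℝ (Fin n), Integrable
            (fun z => ‖x - z‖ ^ (t - (n : ℝ)) • (g z • fracLaplacian t h z)) volume) →
          ∀ (x₀ : EuclideanSpace ℝ (Fin n)) (ρ : ℝ), 0 < ρ →
            commT₂ (Metric.ball x₀ ρ) s t f g h
                ≤ C * eLpNorm (fracLaplacian t g) (ENNReal.ofReal ((n : ℝ) / t)) volume
                  * gagliardoSeminorm Set.univ s (n / s) f ^ ((n : ℝ) / s - 1)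
                  * gagliardoSeminorm Set.univ s (n / s) h ∧
            ∀ L : ℕ,
              commT₂ (Metric.ball x₀ ρ) s t f g h
                ≤ C * eLpNorm (fracLaplacian t g) (ENNReal.ofReal ((n : ℝ) / t)) volume
                  * localizedBound s σ L x₀ ρ f h) := by
  have hs0 := hs.1
  have hs1 := hs.2
  have : NeZero n := ⟨by omega⟩
  have hn1 : (1 : ℝ) ≤ n := by exact_mod_cast hn
  have hn0 : (0 : ℝ) < n := by linarith
  have hsn : s / n < 1 := by rw [div_lt_one hn0]; linarith
  have hsn0 : 0 < s / n := by positivity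
  have hp0 : 0 < (n : ℝ) / s := by positivity
  have hq0 : 0 < (1 - s / n)⁻¹ := inv_pos.2 (by linarith)
  -- `t'` is the Hölder exponent in the pointwise estimate of `g`; it has to exceed `s - t`, while
  -- `t' n / s`, `t' n / (n - s)` stay below `t`.
  obtain ⟨t', ht'⟩ : ∃ t', t' = min (1 - s) (s / (n / s + (1 - s / n)⁻¹ + 1)) := ⟨_, rfl⟩
  have ht'0 : 0 < t' := by
    rw [ht']
    exact lt_min (by linarith) (by positivity)
  have ht'1 : t' ≤ 1 - s := by rw [ht']; exact min_le_left _ _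
  have ht's : n / s * t' + (1 - s / n)⁻¹ * t' + t' ≤ s := by
    have h1 : t' ≤ s / (n / s + (1 - s / n)⁻¹ + 1) := by rw [ht']; exact min_le_right _ _
    rw [le_div_iff₀ (by positivity)] at h1
    linarith
  have h1 : 0 < n / s * t' := mul_pos hp0 ht'0
  have h2 : 0 < (1 - s / n)⁻¹ * t' := mul_pos hq0 ht'0
  refine ⟨s - t', ⟨by linarith, by linarith⟩, fun t ht N => ?_⟩
  have hts := ht.2
  have ht1 := ht.1
  have ht0 : 0 < t := by linarith
  obtain ⟨C₁, hC₁⟩ := eLpNorm_commT₁_le (n := n) (F := EuclideanSpace ℝ (Fin N))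
    (G := EuclideanSpace ℝ (Fin N)) hs0 hs1 ht0 hts
  obtain ⟨C₂, hC₂⟩ := commT₂_le (n := n) (F := EuclideanSpace ℝ (Fin N))
    (G := EuclideanSpace ℝ (Fin N)) (τ := (t + t' - s) / 2) hs0 hs1 ht0 hts (by linarith)
    (by ring) ht'1 (by linarith) (by linarith)
  have hτ : 0 < (1 - s / n) * ((t + t' - s) / 2) := mul_pos (by linarith) (by linarith)
  have hle₁ : (C₁ : ℝ≥0∞) ≤ (C₁ + C₂ : ℝ≥0) := ENNReal.coe_le_coe.2 le_self_add
  have hle₂ : (C₂ : ℝ≥0∞) ≤ (C₁ + C₂ : ℝ≥0) := ENNReal.coe_le_coe.2 le_add_self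
  refine ⟨C₁ + C₂, min (1 - s) ((1 - s / n) * ((t + t' - s) / 2)), lt_min (by linarith) hτ,
    fun f g hf hg => ⟨?_, fun x₀ ρ hρ L => ?_⟩,
    fun f h g hf hg hh hEg hEh hint x₀ ρ hρ => ⟨?_, fun L => ?_⟩⟩
  · refine (hC₁ f g hf hg).1.trans ?_
    gcongr
  · refine ((hC₁ f g hf hg).2 x₀ ρ hρ L).trans ?_
    exact mul_le_mul' hle₁ (localizedBound_anti (min_le_left _ _) L x₀ ρ f g)
  · refine (hC₂ f g h hf hg hh hEg hEh hint x₀ ρ hρ).1.trans ?_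
    gcongr
  · refine ((hC₂ f g h hf hg hh hEg hEh hint x₀ ρ hρ).2 L).trans ?_
    exact mul_le_mul' (mul_le_mul_left hle₂ _) (localizedBound_anti (min_le_right _ _) L x₀ ρ f h)
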